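/- **Setting.** All manifolds are smooth, Hausdorff, second countable and without boundary. A $T^n$-action on $M^{2n}$ is *standard* if every orbit has an invariant neighbourhood equivariantly diffeomorphic to $T^{n-l}\times\mathbb{C}^l\times\mathbb{R}^{n-l}$ with the standard rotations of $T^{n-l}\times\mathbb{C}^l$, up to an automorphism of $T^n$. Its orbit space $B=M/T^n$ is a manifold with corners (a function on $B$ is smooth iff its pullback to $M$ is), and $I_{|D|}=\pi^*I_{\partial B}$, locally generated by $|z_1|^2\cdots|z_l|^2$, is its canonical elliptic divisor. The elliptic tangent bundle $\mathcal{A}_{|D|}$ is the Lie algebroid of vector fields preserving $I_{|D|}$. If $\pi:M\to B$, $\hat\pi:\hat M\to B$ are standard with the same smooth base, then $\mathcal{A}_{|D|}\times_B\mathcal{A}_{|\hat D|}$ is the Lie algebroid over $M\times_B\hat M$ of the restrictions of those sections of $\mathcal{A}_{|D|}\boxtimes\mathcal{A}_{|\hat D|}$ that are tangent to $M\times_B\hat M$. Given closed invariant $H\in\Omega^3(\mathcal{A}_{|D|})$ and $\hat H\in\Omega^3(\mathcal{A}_{|\hat D|})$, a *$T$-duality* between $(M,H)$ and $(\hat M,\hat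 H)$ is a $T^{2n}$-invariant $F\in\Omega^2(\mathcal{A}_{|D|}\times_B\mathcal{A}_{|\hat D|})$ with $dF=p^*H-\hat p^*\hat H$ that at every point pairs the kernels of the two projections to $\mathcal{A}_{|D|}$ and $\mathcal{A}_{|\hat D|}$ nondegenerately. The map $\tau:\Omega^\bullet_{T^n}(\mathcal{A}_{|D|})\to\Omega^\bullet_{T^n}(\mathcal{A}_{|\hat D|})$ is determined by $\hat p^*\tau(\rho)=\iota_{X_1\wedge\cdots\wedge X_n}(e^F\wedge p^*\rho)$, with $X_1,\dots,X_n$ the generators of the torus action on $M$. For a fixed point $x\in M$ choose a standard chart $(z_1,\dots,z_n)$ centred at $x$ (any $z_i$ may be replaced by its conjugate). The *blow-up* $q:\tilde M\to M$ of $M$ at $x$ with respect to the ideal $\langle z_1,\dots,z_n\rangle$ is the complex blow-up in these coordinates, extended by the identity away from $x$; it carries the unique continuous lift of the torus action. Depending on the choice, $\tilde M$ is $M\#\mathbb{C}P^n$ or $M\#\overline{\mathbb{C}P^n}$. **Proposition.** Let $M^{2n}$ and $\hat M^{2n}$ be manifolds with standard $T^n$-actions over the same base $B$, and let $F$ be a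 $T$-duality between $(M,H)$ and $(\hat M,\hat H)$. Let $x\in M$ and $\hat x\in\hat M$ be fixed points with $\pi(x)=\hat\pi(\hat x)$, and let $q:\tilde M\to M$, $\hat q:\tilde{\hat M}\to\hat M$ be blow-ups at $x$ and $\hat x$ as above (the choices for $x$ and for $\hat x$ are independent). Then: 1. The actions on $\tilde M$ and $\tilde{\hat M}$ are standard, and the identity of $B$ lifts to a unique identification of the orbit spaces of $\tilde M$ and $\tilde{\hat M}$, as smooth spaces, with a common base $\tilde B$. Hence $q$ and $\hat q$ induce $Q:\tilde M\times_{\tilde B}\tilde{\hat M}\to M\times_B\hat M$. 2. Forms on $\mathcal{A}_{|D|}$, on $\mathcal{A}_{|\hat D|}$ and on $\mathcal{A}_{|D|}\times_B\mathcal{A}_{|\hat D|}$ have unique pullbacks by $q$, $\hat q$ and $Q$ to forms on the corresponding Lie algebroids of the blow-ups, and $Q^*F$ is a $T$-duality between $(\tilde M,q^*H)$ and $(\tilde{\hat M},\hat q^*\hat H)$. 3. The maps $\tau$ for $F$ and $\tilde\tau$ for $Q^*F$ are well defined on invariant forms, $q^*$ and $\hat q^*$ preserve invariance, and $\tilde\tau\circ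 q^*=\hat q^*\circ\tau$. -/

import Mathlib

open scoped Manifold ContDiff

noncomputable section

namespace TDual

/-! ## Lie algebroids given by vector fields, their forms and pullbacks

A space `P` carries an `ℝ`-algebra `S` of functions `P → ℝ`, its smooth functions.  Vector fields
are derivations of `S`.  A Lie algebroid whose anchor is injective on sections (such as the elliptic
tangent bundle, whose anchor is an isomorphism on a dense set) is given by its module of sections,
a Lie-Rinehart subalgebra of the derivations, and its forms of degree `k` are the alternating
`S`-multilinear maps from sections to functions. -/

section Algebroid

-- shortcuts for instances of the library
instance {P : Type*} (S : Subalgebra ℝ (P → ℝ)) : SMulCommClass ℝ S S :=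
  Algebra.to_smulCommClass

instance {P : Type*} (S : Subalgebra ℝ (P → ℝ)) : SMulCommClass S ℝ S :=
  IsScalarTower.to_smulCommClass'

instance {P : Type*} (S : Subalgebra ℝ (P → ℝ)) : LieRing (Derivation ℝ S S) :=
  Derivation.instLieRing

instance {P : Type*} (S : Subalgebra ℝ (P → ℝ)) : Module S (Derivation ℝ S S) :=
  Derivation.instModule

instance {P : Type*} (S : Subalgebra ℝ (P → ℝ)) : SMul S (Derivation ℝ S S) :=
  Derivation.instModule.toSMul

/-- Lie algebroids over `(P, S)` given by their sections, which are vector fields. -/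
abbrev Algebroid {P : Type*} (S : Subalgebra ℝ (P → ℝ)) :=
  LieRinehartSubalgebra S (Derivation ℝ S S)

instance {P : Type*} {S : Subalgebra ℝ (P → ℝ)} (A : Algebroid S) : AddCommGroup A :=
  (LieRinehartSubalgebra.lieRing S _ A).toAddCommGroup

instance {P : Type*} {S : Subalgebra ℝ (P → ℝ)} (A : Algebroid S) : Module S A :=
  SubmoduleClass.module A

instance {P : Type*} {S : Subalgebra ℝ (P → ℝ)} (A : Algebroid S) : SMul S A :=
  (inferInstance : Module S A).toSMul

/-- `Ω^k` of a Lie algebroid. -/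
abbrev Form {P : Type*} {S : Subalgebra ℝ (P → ℝ)} (A : Algebroid S) (k : ℕ) :=
  A [⋀^Fin k]→ₗ[S] S

variable {P P' : Type*} {S : Subalgebra ℝ (P → ℝ)} {S' : Subalgebra ℝ (P' → ℝ)}

/-- The Lie algebroid differential of a form of positive degree, evaluated on sections (the Koszul
formula): the second sum runs over the pairs `(i, j + 1)` with `i < j + 1`. -/
def extD {A : Algebroid S} {k : ℕ} (α : Form A (k + 1)) (X : Fin (k + 2) → A) : S :=
  (∑ i : Fin (k + 2), (-1 : S) ^ (i : ℕ) * (X i : Derivation ℝ S S) (α (i.removeNth X))) -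
    ∑ i : Fin (k + 1), ∑ j ∈ Finset.Ici i, (-1 : S) ^ ((i : ℕ) + (j : ℕ)) *
      α (Matrix.vecCons ⁅X i.castSucc, X j.succ⁆ (j.removeNth (i.castSucc.removeNth X)))

/-- `X` on `P` and `X'` on `P'` are related by the smooth map `ψ : P → P'`:
`X (f' ∘ ψ) = (X' f') ∘ ψ` for all smooth `f'`. -/
def Related (ψ : P → P') (X : Derivation ℝ S S) (X' : Derivation ℝ S' S') : Prop :=
  ∀ (f : S) (f' : S'), (f : P → ℝ) = (f' : P' → ℝ) ∘ ψ → (X f : P → ℝ) = (X' f' : P' → ℝ) ∘ ψ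

/-- `η = ψ^* α`.  For all maps `ψ` below (projections of the correspondence space, blow-down maps,
diffeomorphisms) the sections of `A` that are `ψ`-related to a section of `A'` generate `A`, so that
the pullback is determined by its values on them. -/
def IsPullbackForm (ψ : P → P') {A : Algebroid S} {A' : Algebroid S'} {k : ℕ}
    (α : Form A' k) (η : Form A k) : Prop :=
  ∀ (X : Fin k → A) (X' : Fin k → A'),
    (∀ i, Related ψ (X i : Derivation ℝ S S) (X' i : Derivation ℝ S' S')) →
      (η X : P → ℝ) = (α X' : P' → ℝ) ∘ ψ

/-- The wedge product of forms (sum over shuffles). -/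
def wedge {A : Algebroid S} {k l : ℕ} (α : Form A k) (β : Form A l) : Form A (k + l) :=
  ((LinearMap.mul' S S).compAlternatingMap (α.domCoprod β)).domDomCongr finSumFinEquiv

/-- The inhomogeneous form `F ∧ ρ` for a two-form `F`, by degree. -/
def wedgeTwo {A : Algebroid S} (F : Form A 2) (ρ : ∀ k, Form A k) : ∀ k, Form A k
  | 0 => 0
  | 1 => 0
  | k + 2 => (wedge F (ρ k)).domDomCongr (finCongr (Nat.add_comm 2 k))

/-- The inhomogeneous form `e^F ∧ ρ`, by degree; in degree `k` the terms with `j > k` vanish. -/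
def expWedge {A : Algebroid S} (F : Form A 2) (ρ : ∀ k, Form A k) (k : ℕ) : Form A k :=
  ∑ j ∈ Finset.range (k + 1), ((j.factorial : ℝ)⁻¹) • ((wedgeTwo F)^[j] ρ k)

/-- The section `X` takes the value `0` in the fibre of the vector bundle `A` at `p`, that is, it
is a sum of sections `f Y` with `f` a smooth function that vanishes at `p`. -/
def VanishesAt {A : Algebroid S} (X : A) (p : P) : Prop :=
  X ∈ Submodule.span S {Z : A | ∃ (f : S) (Y : A), (f : P → ℝ) p = 0 ∧ Z = f • Y}

end Algebroid

/-! ## Standard torus actions and their elliptic tangent bundles -/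

/-- The torus `T^n`. -/
abbrev Torus (n : ℕ) := Fin n → Circle

/-- `ℂ^n` as a real vector space: the model space of smooth manifolds of dimension `2n`. -/
abbrev Model (n : ℕ) := Fin n → ℂ

/-- Smooth manifolds of dimension `2n`: Hausdorff, second countable, without boundary. -/
class SmoothManifold (n : ℕ) (M : Type*) [TopologicalSpace M] [ChartedSpace (Model n) M] : Prop
    extends IsManifold 𝓘(ℝ, Model n) ∞ M, T2Space M, SecondCountableTopology M

/-- The algebra of smooth real functions. -/
def smoothFun {E H : Type*} [NormedAddCommGroup E] [NormedSpace ℝ E] [TopologicalSpace H]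
    (I : ModelWithCorners ℝ E H) (M : Type*) [TopologicalSpace M] [ChartedSpace H M] :
    Subalgebra ℝ (M → ℝ) where
  carrier := {f | ContMDiff I 𝓘(ℝ, ℝ) ∞ f}
  mul_mem' hf hg := ContMDiff.mul hf hg
  add_mem' hf hg := ContMDiff.add hf hg
  algebraMap_mem' _ := contMDiff_const

section Action

variable {n : ℕ} (M : Type*) [TopologicalSpace M] [ChartedSpace (Model n) M]
  [MulAction (Torus n) M]

/-- Smooth functions on `M^{2n}`. -/
abbrev Smooth (n : ℕ) (M : Type*) [TopologicalSpace M] [ChartedSpace (Model n) M] :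
    Subalgebra ℝ (M → ℝ) := smoothFun 𝓘(ℝ, Model n) M

variable {M}

/-- A smooth chart `φ` on an invariant open set, which identifies it with
`ℂ^l × (ℂ \ 0)^{n-l} ≃ ℂ^l × T^{n-l} × ℝ^{n-l}` (polar coordinates on the last factors), where
`K` is the set of the `l` indices of the factors `ℂ`, and which
intertwines the action with the standard rotations, up to the change `a` of generators of `T^n`. -/
structure IsStdChart (φ : OpenPartialHomeomorph M (Model n)) (K : Finset (Fin n))
    (a : Torus n ≃ₜ* Torus n) : Prop where
  mem_atlas : φ ∈ IsManifold.maximalAtlas 𝓘(ℝ, Model n) ∞ M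
  target_eq : φ.target = {z | ∀ i, i ∉ K → z i ≠ 0}
  smul_mem : ∀ (t : Torus n), ∀ m ∈ φ.source, t • m ∈ φ.source
  map_smul : ∀ (t : Torus n), ∀ m ∈ φ.source, ∀ i, φ (t • m) i = (a t i : ℂ) * φ m i

variable (n M) in
/-- The `T^n`-action on `M^{2n}` is standard. -/
def IsStandard : Prop :=
  ∀ m : M, ∃ (φ : OpenPartialHomeomorph M (Model n)) (K : Finset (Fin n))
    (a : Torus n ≃ₜ* Torus n), IsStdChart φ K a ∧ m ∈ φ.source

variable (n M) in
/-- The canonical elliptic divisor `I_{|D|} = π^* I_{∂B}` of a standard action: the smooth functions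
that in each standard chart are smooth multiples of `|z_1|^2 ⋯ |z_n|^2`
(the factors `|z_i|^2`, `i ∉ K`, are invertible there). -/
def ellipticIdeal : Ideal (Smooth n M) where
  carrier := {f | ∀ (φ : OpenPartialHomeomorph M (Model n)) (K : Finset (Fin n))
    (a : Torus n ≃ₜ* Torus n), IsStdChart φ K a →
      ∃ g : Model n → ℝ, ContDiffOn ℝ ∞ g φ.target ∧
        ∀ z ∈ φ.target, (f : M → ℝ) (φ.symm z) = (∏ i, ‖z i‖ ^ 2) * g z}
  zero_mem' φ K a _ := ⟨fun _ => 0, contDiffOn_const, fun z _ => by simp⟩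
  add_mem' {f f'} hf hf' φ K a h := by
    obtain ⟨g, hg, e⟩ := hf φ K a h
    obtain ⟨g', hg', e'⟩ := hf' φ K a h
    refine ⟨fun z => g z + g' z, hg.add hg', fun z hz => ?_⟩
    have := e z hz
    have := e' z hz
    simp only [Subalgebra.coe_add, Pi.add_apply]
    simp only [*]
    ring
  smul_mem' c f hf φ K a h := by
    obtain ⟨g, hg, e⟩ := hf φ K a h
    have hc : ContDiffOn ℝ ∞ (fun z => (c : M → ℝ) (φ.symm z)) φ.target := by
      rw [← contMDiffOn_iff_contDiffOn]
      have h1 := contMDiffOn_symm_of_mem_maximalAtlas h.mem_atlas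
      have h2 : ContMDiff 𝓘(ℝ, Model n) 𝓘(ℝ, ℝ) ∞ (c : M → ℝ) := c.2
      exact h2.comp_contMDiffOn h1
    refine ⟨fun z => (c : M → ℝ) (φ.symm z) * g z, hc.mul hg, fun z hz => ?_⟩
    have := e z hz
    simp only [smul_eq_mul, Subalgebra.coe_mul, Pi.mul_apply]
    simp only [*]
    ring

/-- The Lie algebroid of the vector fields that preserve an ideal. -/
def preserving {P : Type*} {S : Subalgebra ℝ (P → ℝ)} (J : Ideal S) : Algebroid S where
  carrier := {X | ∀ f ∈ J, X f ∈ J}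
  zero_mem' f _ := by simp
  add_mem' hX hY f hf := by simpa using J.add_mem (hX f hf) (hY f hf)
  smul_mem' c X hX f hf := by simpa using J.mul_mem_left c (hX f hf)
  lie_mem' hX hY f hf := by
    rw [Derivation.commutator_apply]
    exact J.sub_mem (hX _ (hY f hf)) (hY _ (hX f hf))

variable (n M) in
/-- The elliptic tangent bundle `𝒜_{|D|}`. -/
def elliptic : Algebroid (Smooth n M) := preserving (ellipticIdeal n M)

/-- The one-parameter subgroup of the `i`-th circle of `T^n`. -/
def circleExp {n : ℕ} (i : Fin n) (s : ℝ) : Torus n := Pi.mulSingle i (Circle.exp s)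

/-- A form is invariant under the action. -/
def Invariant {k : ℕ} (α : Form (elliptic n M) k) : Prop :=
  ∀ t : Torus n, IsPullbackForm (fun m : M => t • m) α α

end Action

/-! ## Quotients, correspondence spaces, and T-duality -/

section Duality

variable {n : ℕ} {M N B : Type*}
  [TopologicalSpace M] [ChartedSpace (Model n) M] [MulAction (Torus n) M]
  [TopologicalSpace N] [ChartedSpace (Model n) N] [MulAction (Torus n) N]
  [TopologicalSpace B]

/-- `π : M → B` and `π' : N → B` are quotient maps of the torus actions which define the same
smooth structure on `B`, where a function on an open set of `B` is smooth if its pullback is. -/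
structure SameBase (π : M → B) (π' : N → B) : Prop where
  quot : Topology.IsQuotientMap π
  quot' : Topology.IsQuotientMap π'
  eq_iff : ∀ m₁ m₂, π m₁ = π m₂ ↔ ∃ t : Torus n, t • m₁ = m₂
  eq_iff' : ∀ m₁ m₂, π' m₁ = π' m₂ ↔ ∃ t : Torus n, t • m₁ = m₂
  smooth_iff : ∀ (U : Set B) (f : B → ℝ), IsOpen U →
    (ContMDiffOn 𝓘(ℝ, Model n) 𝓘(ℝ, ℝ) ∞ (f ∘ π) (π ⁻¹' U) ↔
      ContMDiffOn 𝓘(ℝ, Model n) 𝓘(ℝ, ℝ) ∞ (f ∘ π') (π' ⁻¹' U))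

/-- The correspondence space `M ×_B N`. -/
def Corr (π : M → B) (π' : N → B) := {p : M × N // π p.1 = π' p.2}

/-- The first projection of the correspondence space. -/
def Corr.fst {π : M → B} {π' : N → B} (c : Corr π π') : M := c.1.1

/-- The second projection of the correspondence space. -/
def Corr.snd {π : M → B} {π' : N → B} (c : Corr π π') : N := c.1.2

/-- The action of `T^n × T^n` on the correspondence space. -/
def SameBase.act {π : M → B} {π' : N → B} (h : SameBase (n := n) π π') (t s : Torus n)
    (c : Corr π π') : Corr π π' :=
  ⟨(t • c.1.1, s • c.1.2),
    ((h.eq_iff _ _).2 ⟨t, rfl⟩).symm.trans (c.2.trans ((h.eq_iff' _ _).2 ⟨s, rfl⟩))⟩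

/-- Smooth functions on `M × N`. -/
abbrev SmoothProd (n : ℕ) (M N : Type*) [TopologicalSpace M] [ChartedSpace (Model n) M]
    [TopologicalSpace N] [ChartedSpace (Model n) N] : Subalgebra ℝ (M × N → ℝ) :=
  smoothFun (𝓘(ℝ, Model n).prod 𝓘(ℝ, Model n)) (M × N)

/-- Restriction of functions from `M × N` to the correspondence space. -/
def Corr.restrict (π : M → B) (π' : N → B) : (M × N → ℝ) →ₐ[ℝ] (Corr π π' → ℝ) where
  toFun f c := f c.1
  map_one' := rfl
  map_mul' _ _ := rfl
  map_zero' := rfl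
  map_add' _ _ := rfl
  commutes' _ := rfl

/-- Smooth functions on the correspondence space: restrictions of smooth functions on `M × N`. -/
def SmoothCorr (π : M → B) (π' : N → B) : Subalgebra ℝ (Corr π π' → ℝ) :=
  (SmoothProd n M N).map (Corr.restrict π π')

variable (n M N) in
/-- `𝒜_{|D|} ⊠ 𝒜_{|D'|}` on `M × N`: the vector fields that preserve the pullbacks of the
elliptic divisors of `M` and of `N`. -/
def ellipticProd : Algebroid (SmoothProd n M N) :=
  let J : Ideal (SmoothProd n M N) := Ideal.span
    {h | ∃ f ∈ ellipticIdeal n M, (h : M × N → ℝ) = (f : M → ℝ) ∘ Prod.fst}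
  let J' : Ideal (SmoothProd n M N) := Ideal.span
    {h | ∃ f ∈ ellipticIdeal n N, (h : M × N → ℝ) = (f : N → ℝ) ∘ Prod.snd}
  { carrier := {X | X ∈ preserving J ∧ X ∈ preserving J'}
    zero_mem' := ⟨zero_mem _, zero_mem _⟩
    add_mem' := fun h h' => ⟨add_mem h.1 h'.1, add_mem h.2 h'.2⟩
    smul_mem' := fun c _ h =>
      ⟨(preserving J).smul_mem c h.1, (preserving J').smul_mem c h.2⟩
    lie_mem' := fun h h' =>
      ⟨(preserving J).lie_mem h.1 h'.1, (preserving J').lie_mem h.2 h'.2⟩ }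

theorem smoothCorr_restrict_mem {π : M → B} {π' : N → B} (f : SmoothProd n M N) :
    Corr.restrict π π' f ∈ SmoothCorr (n := n) π π' := ⟨f, f.2, rfl⟩

theorem related_restrict_iff {π : M → B} {π' : N → B}
    (Y : Derivation ℝ (SmoothCorr (n := n) π π') (SmoothCorr (n := n) π π'))
    (X : Derivation ℝ (SmoothProd n M N) (SmoothProd n M N)) :
    Related (fun c : Corr π π' => c.1) Y X ↔ ∀ f : SmoothProd n M N,
      Y ⟨_, smoothCorr_restrict_mem f⟩ = ⟨_, smoothCorr_restrict_mem (X f)⟩ := by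
  constructor
  · intro h f
    exact Subtype.ext (h ⟨_, smoothCorr_restrict_mem f⟩ f rfl)
  · intro h f f' e
    have : f = ⟨_, smoothCorr_restrict_mem f'⟩ := Subtype.ext e
    rw [this, h f']
    rfl

/-- The Lie algebroid `𝒜_{|D|} ×_B 𝒜_{|D'|}` on the correspondence space: the restrictions of
those sections of `𝒜_{|D|} ⊠ 𝒜_{|D'|}` that are tangent to it.  (If `X` on `M × N` is related by
the inclusion to some derivation of the smooth functions on `M ×_B N`, then it is tangent: it
preserves the ideal of the functions that vanish on `M ×_B N`.) -/
def ellipticCorr (π : M → B) (π' : N → B) : Algebroid (SmoothCorr (n := n) π π') where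
  carrier := {Y | ∃ X ∈ ellipticProd n M N, Related (fun c : Corr π π' => c.1) Y X}
  zero_mem' := ⟨0, zero_mem _, (related_restrict_iff _ _).2 fun f => Subtype.ext rfl⟩
  add_mem' := by
    rintro Y Y' ⟨X, hX, h⟩ ⟨X', hX', h'⟩
    rw [related_restrict_iff] at h h'
    refine ⟨X + X', add_mem hX hX', (related_restrict_iff _ _).2 fun f => ?_⟩
    rw [Derivation.add_apply, h, h']
    rfl
  smul_mem' := by
    rintro ⟨_, g, hg, rfl⟩ Y ⟨X, hX, h⟩
    rw [related_restrict_iff] at h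
    refine ⟨(⟨g, hg⟩ : SmoothProd n M N) • X, (ellipticProd n M N).smul_mem _ hX,
      (related_restrict_iff _ _).2 fun f => ?_⟩
    rw [Derivation.smul_apply, h]
    rfl
  lie_mem' := by
    rintro Y Y' ⟨X, hX, h⟩ ⟨X', hX', h'⟩
    rw [related_restrict_iff] at h h'
    refine ⟨⁅X, X'⁆, (ellipticProd n M N).lie_mem hX hX',
      (related_restrict_iff _ _).2 fun f => ?_⟩
    rw [Derivation.commutator_apply, h, h', h, h', Derivation.commutator_apply]
    rfl

/-- The two-form `F` on `𝒜_{|D|} ×_B 𝒜_{|D'|}` is a T-duality between `(M, H)` and `(N, H')`. -/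
structure IsTDual {π : M → B} {π' : N → B} (h : SameBase (n := n) π π')
    (H : Form (elliptic n M) 3) (H' : Form (elliptic n N) 3)
    (F : Form (ellipticCorr (n := n) π π') 2) : Prop where
  closed : ∀ X, extD H X = 0
  closed' : ∀ X, extD H' X = 0
  invariant : Invariant H
  invariant' : Invariant H'
  invariantF : ∀ t s : Torus n, IsPullbackForm (h.act t s) F F
  /-- `dF = p^* H - p'^* H'` -/
  extD_eq : ∃ G G' : Form (ellipticCorr (n := n) π π') 3,
    IsPullbackForm Corr.fst H G ∧ IsPullbackForm Corr.snd H' G' ∧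
      ∀ X, extD F X = G X - G' X
  /-- At each point `F` is a nondegenerate pairing of the kernels of the two projections
  of Lie algebroids to `𝒜_{|D|}` and `𝒜_{|D'|}`. -/
  nondeg : ∀ (c : Corr π π') (Y : ellipticCorr (n := n) π π'),
    Related Corr.fst Y.1 (0 : Derivation ℝ (Smooth n M) (Smooth n M)) →
    (∀ Z : ellipticCorr (n := n) π π',
      Related Corr.snd Z.1 (0 : Derivation ℝ (Smooth n N) (Smooth n N)) →
        (F ![Y, Z] : Corr π π' → ℝ) c = 0) → VanishesAt Y c
  nondeg' : ∀ (c : Corr π π') (Z : ellipticCorr (n := n) π π'),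
    Related Corr.snd Z.1 (0 : Derivation ℝ (Smooth n N) (Smooth n N)) →
    (∀ Y : ellipticCorr (n := n) π π',
      Related Corr.fst Y.1 (0 : Derivation ℝ (Smooth n M) (Smooth n M)) →
        (F ![Y, Z] : Corr π π' → ℝ) c = 0) → VanishesAt Z c

/-- `σ = τ(ρ)`, that is, the pullback of `σ` to the correspondence space is
`ι_{X_1 ∧ ⋯ ∧ X_n} (e^F ∧ p^* ρ)`, where `X_1, …, X_n` are the infinitesimal generators of the
torus action on `M`.  Inhomogeneous forms are given by their components in each degree. -/
def IsTau {π : M → B} {π' : N → B} (h : SameBase (n := n) π π')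
    (F : Form (ellipticCorr (n := n) π π') 2)
    (ρ : ∀ k, Form (elliptic n M) k) (σ : ∀ k, Form (elliptic n N) k) : Prop :=
  ∃ (R T : ∀ k, Form (ellipticCorr (n := n) π π') k) (X : Fin n → ellipticCorr (n := n) π π'),
    (∀ k, IsPullbackForm Corr.fst (ρ k) (R k)) ∧
    (∀ k, IsPullbackForm Corr.snd (σ k) (T k)) ∧
    (∀ (i : Fin n) (f : SmoothCorr (n := n) π π') (c : Corr π π'),
      ((X i).1 f : Corr π π' → ℝ) c =
        deriv (fun s : ℝ => (f : Corr π π' → ℝ) (h.act (circleExp i s) 1 c)) 0) ∧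
    ∀ k v, T k v = expWedge F R (n + k) (Fin.append X v)

end Duality

/-! ## Blow-ups at fixed points -/

section BlowUp

variable {n : ℕ} {M M' : Type*}
  [TopologicalSpace M] [ChartedSpace (Model n) M] [MulAction (Torus n) M]
  [TopologicalSpace M'] [ChartedSpace (Model n) M'] [MulAction (Torus n) M']

/-- `q : M' → M` is the blow-down map of a blow-up of `M` at the fixed point `x`, together with
the lifted torus action.

The blow-up is formed with respect to a holomorphic ideal `⟨z_1, …, z_n⟩`, where `z = φ` is a
standard chart centred at `x`.  Replacing some `z_i` by their conjugates gives
another standard chart, so all adapted ideals, and both `M # ℂP^n` and `M # \bar{ℂP^n}`, occur.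

Over the domain of `φ` the points of `M'` are the pairs of a point `z` of `ℂ^n` and a line `[u]`
that contains it, with the smooth structure given by the affine charts
`(z, [u]) ↦ (u_1 / u_i, …, z_i, …, u_n / u_i)` on `u_i ≠ 0`; their inverses compose with the
blow-down map to `w ↦ (w_i w_1, …, w_i, …, w_i w_n)`. -/
structure IsBlowUp (x : M) (q : M' → M) : Prop where
  /-- Away from `x` the blow-down map is a diffeomorphism. -/
  bijOn : Set.BijOn q (q ⁻¹' {x}ᶜ) {x}ᶜ
  localDiffeo : IsLocalDiffeomorphOn 𝓘(ℝ, Model n) 𝓘(ℝ, Model n) ∞ q (q ⁻¹' {x}ᶜ)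
  /-- Near `x` it is the complex blow-up in standard coordinates. -/
  local_model : ∃ (φ : OpenPartialHomeomorph M (Model n)) (a : Torus n ≃ₜ* Torus n)
    (u : M' → Fin n → ℂ),
    IsStdChart φ Finset.univ a ∧ x ∈ φ.source ∧ φ x = 0 ∧
    (∀ m, q m ∈ φ.source → u m ≠ 0 ∧ ∃ b : ℂ, φ (q m) = b • u m) ∧
    ∀ i, ∃ ψ ∈ IsManifold.maximalAtlas 𝓘(ℝ, Model n) ∞ M',
      ψ.source = {m | q m ∈ φ.source ∧ u m i ≠ 0} ∧
      ψ.target = {w | w i • Function.update w i 1 ∈ φ.target} ∧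
      ∀ m ∈ ψ.source, ψ m = Function.update ((u m i)⁻¹ • u m) i (φ (q m) i)
  /-- The torus acts continuously on the blow-up, and the blow-down map is equivariant. -/
  continuous_smul : ∀ t : Torus n, Continuous fun m : M' => t • m
  map_smul : ∀ (t : Torus n) (m : M'), q (t • m) = t • q m

/-- The map induced on correspondence spaces by maps that are compatible with the bases. -/
def Corr.map {M N B M' N' B' : Type*} {π : M → B} {ϖ : N → B} {π' : M' → B'} {ϖ' : N' → B'}
    (q : M' → M) (r : N' → N)
    (h : ∀ m n, π' m = ϖ' n → π (q m) = ϖ (r n)) (c : Corr π' ϖ') : Corr π ϖ :=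
  ⟨(q c.1.1, r c.1.2), h _ _ c.2⟩

/-- The projection to the orbit space. -/
abbrev orbitMap (n : ℕ) (M : Type*) [MulAction (Torus n) M] :
    M → MulAction.orbitRel.Quotient (Torus n) M :=
  Quotient.mk _

end BlowUp

end TDual

end

open scoped Manifold ContDiff

noncomputable section

namespace TDual

open Filter Topology Set

set_option linter.unusedSectionVars false

/-! ## Division of smooth functions -/

section Calculus

theorem hasFDerivAt_integral_param {E F : Type} [NormedAddCommGroup E] [NormedSpace ℝ E]
    [FiniteDimensional ℝ E] [NormedAddCommGroup F] [NormedSpace ℝ F]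
    {f : E × ℝ → F} (hf : ContDiff ℝ 1 f) (x : E) :
    HasFDerivAt (fun x => ∫ s in (0 : ℝ)..1, f (x, s))
      (∫ s in (0 : ℝ)..1, (fderiv ℝ f (x, s)).comp (ContinuousLinearMap.inl ℝ E ℝ)) x := by
  have hd : Continuous fun p : E × ℝ => (fderiv ℝ f p).comp (ContinuousLinearMap.inl ℝ E ℝ) :=
    (hf.continuous_fderiv one_ne_zero).clm_comp continuous_const
  obtain ⟨C, hC⟩ := ((isCompact_closedBall x 1).prod (isCompact_Icc (a := (0 : ℝ)) (b := 1))
    ).exists_bound_of_continuousOn hd.continuousOn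
  refine intervalIntegral.hasFDerivAt_integral_of_dominated_of_fderiv_le
    (F := fun x s => f (x, s)) (bound := fun _ => C) (s := Metric.closedBall x 1)
    (F' := fun x s => (fderiv ℝ f (x, s)).comp (ContinuousLinearMap.inl ℝ E ℝ))
    (Metric.closedBall_mem_nhds x one_pos) ?_ ?_ ?_ ?_ ?_ ?_
  · exact Eventually.of_forall fun y =>
      (hf.continuous.comp (by fun_prop)).aestronglyMeasurable
  · exact (hf.continuous.comp (by fun_prop)).intervalIntegrable _ _
  · exact (hd.comp (by fun_prop : Continuous fun s : ℝ => (x, s))).aestronglyMeasurable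
  · refine Eventually.of_forall fun t ht y hy => hC (y, t) ⟨hy, ?_⟩
    rw [uIoc_of_le zero_le_one] at ht
    exact Ioc_subset_Icc_self ht
  · exact intervalIntegrable_const
  · refine Eventually.of_forall fun t _ y _ => ?_
    have h1 : HasFDerivAt f (fderiv ℝ f (y, t)) (y, t) :=
      (hf.differentiable one_ne_zero _).hasFDerivAt
    exact h1.comp y (hasFDerivAt_prodMk_left y t)

theorem contDiff_integral_param {E F : Type} [NormedAddCommGroup E] [NormedSpace ℝ E]
    [FiniteDimensional ℝ E] [NormedAddCommGroup F] [NormedSpace ℝ F]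
    {f : E × ℝ → F} (hf : ContDiff ℝ ∞ f) :
    ContDiff ℝ ∞ fun x => ∫ s in (0 : ℝ)..1, f (x, s) := by
  rw [contDiff_infty]
  intro n
  induction n generalizing F with
  | zero =>
    rw [Nat.cast_zero, contDiff_zero]
    exact continuous_iff_continuousAt.2 fun x =>
      (hasFDerivAt_integral_param (hf.of_le (by exact_mod_cast le_top)) x).continuousAt
  | succ n ih =>
    have h1 : ContDiff ℝ 1 f := hf.of_le (by exact_mod_cast le_top)
    rw [Nat.cast_add, Nat.cast_one, contDiff_succ_iff_fderiv]
    refine ⟨fun x => (hasFDerivAt_integral_param h1 x).differentiableAt, by simp, ?_⟩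
    have : fderiv ℝ (fun x => ∫ s in (0 : ℝ)..1, f (x, s)) =
        fun x => ∫ s in (0 : ℝ)..1, (fderiv ℝ f (x, s)).comp (ContinuousLinearMap.inl ℝ E ℝ) :=
      funext fun x => (hasFDerivAt_integral_param h1 x).fderiv
    rw [this]
    exact ih (f := fun p => (fderiv ℝ f p).comp (ContinuousLinearMap.inl ℝ E ℝ))
      ((hf.fderiv_right (by simp)).clm_comp contDiff_const)

/-- Hadamard's lemma with parameters. -/
theorem exists_eq_smul_of_zero {E F : Type} [NormedAddCommGroup E] [NormedSpace ℝ E]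
    [FiniteDimensional ℝ E] [NormedAddCommGroup F] [NormedSpace ℝ F] [CompleteSpace F]
    {f : E × ℝ → F} (hf : ContDiff ℝ ∞ f) (h0 : ∀ x, f (x, 0) = 0) :
    ∃ g : E × ℝ → F, ContDiff ℝ ∞ g ∧ ∀ p, f p = p.2 • g p := by
  refine ⟨fun p => ∫ s in (0 : ℝ)..1, fderiv ℝ f (p.1, s * p.2) (0, 1), ?_, ?_⟩
  · refine contDiff_integral_param
      (f := fun q : (E × ℝ) × ℝ => fderiv ℝ f (q.1.1, q.2 * q.1.2) (0, 1)) ?_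
    have : ContDiff ℝ ∞ (fderiv ℝ f) := hf.fderiv_right (by simp)
    exact (this.comp (by fun_prop)).clm_apply contDiff_const
  · rintro ⟨x, t⟩
    have hd : ∀ s : ℝ, HasDerivAt (fun s => f (x, s * t)) (t • fderiv ℝ f (x, s * t) (0, 1)) s := by
      intro s
      have h1 : HasFDerivAt f (fderiv ℝ f (x, s * t)) (x, s * t) :=
        (hf.differentiable (by simp) _).hasFDerivAt
      have h2 : HasDerivAt (fun s : ℝ => (x, s * t)) (0, t) s := by
        simpa using (hasDerivAt_const s x).prodMk ((hasDerivAt_id s).mul_const t)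
      have := h1.comp_hasDerivAt s h2
      have e : fderiv ℝ f (x, s * t) (0, t) = t • fderiv ℝ f (x, s * t) (0, 1) := by
        rw [← map_smul]
        simp
      rwa [e] at this
    have hc : Continuous fun s : ℝ => t • fderiv ℝ f (x, s * t) (0, 1) := by
      have : Continuous (fderiv ℝ f) := hf.continuous_fderiv (by simp)
      exact ((this.comp (by fun_prop)).clm_apply continuous_const).const_smul t
    have := intervalIntegral.integral_eq_sub_of_hasDerivAt (fun s _ => hd s)
      (hc.intervalIntegrable 0 1)
    simp only [one_mul, zero_mul, h0, sub_zero] at this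
    rw [← this, intervalIntegral.integral_smul]

end Calculus

section Hartogs

variable {ι : Type} [Fintype ι] [DecidableEq ι]

theorem dense_ne_zero : Dense {z : ι → ℂ | ∀ i, z i ≠ 0} := by
  have := dense_pi (Set.univ : Set ι) (s := fun _ => ({0}ᶜ : Set ℂ))
    fun i _ => dense_compl_singleton (0 : ℂ)
  convert this using 1
  ext z
  simp

theorem dense_coord_ne_zero (i : ι) : Dense {z : ι → ℂ | z i ≠ 0} :=
  dense_ne_zero.mono fun z (h : ∀ i, z i ≠ 0) => h i

theorem contDiff_normSq (i : ι) : ContDiff ℝ ∞ fun z : ι → ℂ => ‖z i‖ ^ 2 :=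
  (contDiff_apply ℝ ℂ i).norm_sq ℝ

/-- `F` has at most poles along `z_i = z_j = 0`: its products with powers of `|z_i|^2` and of
`|z_j|^2` are smooth. -/
def Pole (i j : ι) {E : Type} [NormedAddCommGroup E] [NormedSpace ℝ E] (F : (ι → ℂ) → E) : Prop :=
  ∃ m : ℕ, ContDiff ℝ ∞ (fun z => (‖z i‖ ^ 2) ^ m • F z) ∧
    ContDiff ℝ ∞ (fun z => (‖z j‖ ^ 2) ^ m • F z)

variable {i j : ι} {E : Type} [NormedAddCommGroup E] [NormedSpace ℝ E] {F : (ι → ℂ) → E}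

theorem Pole.symm (h : Pole i j F) : Pole j i F := let ⟨m, a, b⟩ := h; ⟨m, b, a⟩

theorem contDiffAt_of_smul {m : ℕ} (h : ContDiff ℝ ∞ fun z => (‖z i‖ ^ 2) ^ m • F z) {z : ι → ℂ}
    (hz : z i ≠ 0) : ContDiffAt ℝ ∞ F z := by
  have h1 : ContDiffAt ℝ ∞ (fun z : ι → ℂ => ((‖z i‖ ^ 2) ^ m)⁻¹) z :=
    ((contDiff_normSq i).pow m).contDiffAt.inv (by simp [hz])
  refine (h1.smul h.contDiffAt).congr_of_eventuallyEq ?_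
  filter_upwards [(continuous_apply i).continuousAt.eventually_ne hz] with y hy
  rw [Pi.smul_apply', smul_smul, inv_mul_cancel₀ (by simp [hy]), one_smul]

theorem contDiff_smul_fderiv {m : ℕ} (h : ContDiff ℝ ∞ fun z => (‖z i‖ ^ 2) ^ m • F z) :
    ContDiff ℝ ∞ fun z => (‖z i‖ ^ 2) ^ (m + 1) • fderiv ℝ F z := by
  set A := fun z => (‖z i‖ ^ 2) ^ m • F z with hA
  set N := fun z : ι → ℂ => ‖z i‖ ^ 2 with hN
  have hNs : ContDiff ℝ ∞ N := contDiff_normSq i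
  have key : ∀ z, (‖z i‖ ^ 2) ^ (m + 1) • fderiv ℝ F z =
      N z • fderiv ℝ A z - (m : ℝ) • (fderiv ℝ N z).smulRight (A z) := by
    intro z
    by_cases hz : z i = 0
    · have h0 : fderiv ℝ N z = 0 := by
        refine IsLocalMin.fderiv_eq_zero (Eventually.of_forall fun y => ?_)
        change ‖z i‖ ^ 2 ≤ ‖y i‖ ^ 2
        simp [hz]
      rw [h0]
      simp [hN, hz]
    · have hF : DifferentiableAt ℝ F z := (contDiffAt_of_smul h hz).differentiableAt (by simp)
      have hNd : DifferentiableAt ℝ N z := hNs.differentiable (by simp) z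
      have e : fderiv ℝ A z = N z ^ m • fderiv ℝ F z +
          ((m * N z ^ (m - 1)) • fderiv ℝ N z).smulRight (F z) := by
        have h1 : HasFDerivAt (fun y => N y ^ m) ((m * N z ^ (m - 1)) • fderiv ℝ N z) z := by
          simpa using hNd.hasFDerivAt.pow m
        exact (h1.smul hF.hasFDerivAt).fderiv
      rw [e]
      ext v
      simp only [smul_apply, sub_apply,
        add_apply, ContinuousLinearMap.smulRight_apply, smul_add, smul_smul,
        hA, smul_eq_mul]
      have : N z * (m * N z ^ (m - 1) * (fderiv ℝ N z) v) = m * (fderiv ℝ N z v * (‖z i‖ ^ 2) ^ m) := by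
        rcases m with _ | m
        · simp
        · simp only [Nat.add_sub_cancel, hN]
          ring
      rw [this]
      simp only [hN, pow_succ']
      abel
  rw [show (fun z => (‖z i‖ ^ 2) ^ (m + 1) • fderiv ℝ F z) = _ from funext key]
  have hAd : ContDiff ℝ ∞ (fderiv ℝ A) := h.fderiv_right (by simp)
  have hNd : ContDiff ℝ ∞ (fderiv ℝ N) := hNs.fderiv_right (by simp)
  exact (hNs.smul hAd).sub (ContDiff.smul (f := fun _ => (m : ℝ)) contDiff_const (hNd.smulRight h))

theorem Pole.fderiv (h : Pole i j F) : Pole i j (fderiv ℝ F) :=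
  let ⟨m, a, b⟩ := h
  ⟨m + 1, contDiff_smul_fderiv a, contDiff_smul_fderiv b⟩

theorem Pole.contDiffAt (h : Pole i j F) {z : ι → ℂ} (hz : z i ≠ 0 ∨ z j ≠ 0) :
    ContDiffAt ℝ ∞ F z := by
  obtain ⟨m, a, b⟩ := h
  exact hz.elim (contDiffAt_of_smul a) (contDiffAt_of_smul b)

theorem Pole.exists_bound_aux [CompleteSpace E] (hij : i ≠ j) (h : Pole i j F) (p : ι → ℂ) :
    ∃ C, ∀ z ∈ Metric.ball p 1, z j ≠ 0 → ‖F z‖ ≤ C := by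
  have hF := h
  obtain ⟨m, -, hb⟩ := h
  set C := fun z : ι → ℂ => (‖z j‖ ^ 2) ^ m • F z with hC
  have hup : ContDiff ℝ ∞ fun q : (ι → ℂ) × ℝ => Function.update q.1 j (q.2 • q.1 j) := by
    rw [contDiff_pi]
    intro k
    by_cases hk : k = j
    · subst hk
      simp only [Function.update_self]
      fun_prop
    · simp only [Function.update_of_ne hk]
      fun_prop
  have step : ∀ k ≤ 2 * m, ∃ D : (ι → ℂ) × ℝ → E, ContDiff ℝ ∞ D ∧
      ∀ q, C (Function.update q.1 j (q.2 • q.1 j)) = q.2 ^ k • D q := by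
    intro k
    induction k with
    | zero => exact fun _ => ⟨_, hb.comp hup, fun q => by simp [hC]⟩
    | succ k ih =>
      intro hk
      obtain ⟨D, hD, e⟩ := ih (by omega)
      have h0 : ∀ x, D (x, 0) = 0 := by
        have hcl : IsClosed {x | D (x, 0) = 0} :=
          isClosed_eq (hD.continuous.comp (by fun_prop)) continuous_const
        have hd := (dense_coord_ne_zero i).closure_eq
        refine fun x => (hcl.closure_subset_iff.2 ?_ : closure {z : ι → ℂ | z i ≠ 0} ⊆ _)
          (hd ▸ mem_univ x)
        intro x hx
        have hc1 : ContinuousAt (fun t : ℝ => D (x, t)) 0 :=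
          (hD.continuous.comp (by fun_prop)).continuousAt
        have hc2 : ContinuousAt (fun t : ℝ => (t ^ (2 * m - k) * (‖x j‖ ^ 2) ^ m) •
            F (Function.update x j (t • x j))) 0 := by
          refine ContinuousAt.smul (by fun_prop) ?_
          have : ContinuousAt F (Function.update x j ((0 : ℝ) • x j)) :=
            (hF.contDiffAt (Or.inl (by rwa [Function.update_of_ne hij]))).continuousAt
          exact ContinuousAt.comp (f := fun t : ℝ => Function.update x j (t • x j)) this
            (hup.continuous.comp (by fun_prop : Continuous fun t : ℝ => (x, t))).continuousAt
        have hne : ∀ᶠ t in 𝓝[≠] (0 : ℝ), D (x, t) = (t ^ (2 * m - k) * (‖x j‖ ^ 2) ^ m) •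
            F (Function.update x j (t • x j)) := by
          filter_upwards [self_mem_nhdsWithin] with t ht
          have ht : t ≠ 0 := ht
          have e1 := e (x, t)
          simp only [hC, Function.update_self] at e1
          have e2 : t ^ k • D (x, t) = t ^ k • ((t ^ (2 * m - k) * (‖x j‖ ^ 2) ^ m) •
              F (Function.update x j (t • x j))) := by
            rw [← e1, smul_smul]
            congr 1
            rw [← mul_assoc, ← pow_add, show k + (2 * m - k) = 2 * m by omega, norm_smul, mul_pow,
              mul_pow, ← pow_mul, Real.norm_eq_abs, ← pow_mul, ← abs_pow,
              abs_of_nonneg (by rw [pow_mul]; positivity : (0 : ℝ) ≤ t ^ (2 * m)), pow_mul]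
          exact smul_right_injective _ (pow_ne_zero k ht) e2
        have l1 := hc1.tendsto.mono_left (nhdsWithin_le_nhds (s := {0}ᶜ))
        have l2 := (hc2.tendsto.mono_left (nhdsWithin_le_nhds (s := {0}ᶜ))).congr'
          (hne.mono fun _ h => h.symm)
        have := tendsto_nhds_unique l1 l2
        rw [mem_ofPred_eq, this, zero_pow (by omega), zero_mul, zero_smul]
      obtain ⟨g, hg, eg⟩ := exists_eq_smul_of_zero hD h0
      exact ⟨g, hg, fun q => by rw [e, eg, smul_smul, pow_succ]⟩
  obtain ⟨D, hD, e⟩ := step (2 * m) le_rfl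
  obtain ⟨K, hK⟩ := ((isCompact_closedBall (0 : ι → ℂ) (‖p‖ + 2)).prod
    (isCompact_Icc (a := (0 : ℝ)) (b := ‖p‖ + 1))).exists_bound_of_continuousOn
    hD.continuous.continuousOn
  refine ⟨K, fun z hz hzj => ?_⟩
  have hzn : ‖z‖ ≤ ‖p‖ + 1 := by
    have := norm_sub_norm_le z p
    rw [Metric.mem_ball, dist_eq_norm] at hz
    linarith
  have hj : ‖z j‖ ≠ 0 := norm_ne_zero_iff.2 hzj
  have e1 := e (Function.update z j (‖z j‖⁻¹ • z j), ‖z j‖)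
  simp only [Function.update_self, Function.update_idem, smul_smul, mul_inv_cancel₀ hj, one_smul,
    Function.update_eq_self, hC, ← pow_mul] at e1
  rw [smul_right_injective _ (pow_ne_zero (2 * m) hj) e1]
  refine hK _ ⟨?_, norm_nonneg _, (norm_le_pi_norm z j).trans hzn⟩
  rw [mem_closedBall_zero_iff, pi_norm_le_iff_of_nonneg (by positivity)]
  intro k
  dsimp only
  by_cases hk : k = j
  · subst hk
    rw [Function.update_self, norm_smul, norm_inv, norm_norm, inv_mul_cancel₀ hj]
    linarith [norm_nonneg p]
  · rw [Function.update_of_ne hk]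
    linarith [norm_le_pi_norm z k]

theorem Pole.exists_bound [CompleteSpace E] (hij : i ≠ j) (h : Pole i j F) (p : ι → ℂ) :
    ∃ C, ∀ z ∈ Metric.ball p 1, (z i ≠ 0 ∨ z j ≠ 0) → ‖F z‖ ≤ C := by
  obtain ⟨C, hC⟩ := h.exists_bound_aux hij p
  obtain ⟨C', hC'⟩ := h.symm.exists_bound_aux hij.symm p
  exact ⟨max C C', fun z hz hh => hh.elim (fun h => (hC' z hz h).trans (le_max_right _ _))
    fun h => (hC z hz h).trans (le_max_left _ _)⟩

variable {i j : ι} {E : Type} [NormedAddCommGroup E] [NormedSpace ℝ E] {F : (ι → ℂ) → E}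

theorem norm_sub_le_of_segment {H : (ι → ℂ) → E} {p : ι → ℂ} {r K : ℝ}
    (hd : ∀ z ∈ Metric.ball p r, (z i ≠ 0 ∨ z j ≠ 0) → DifferentiableAt ℝ H z ∧ ‖fderiv ℝ H z‖ ≤ K)
    {a b : ι → ℂ} (ha : a ∈ Metric.ball p r) (hb : b ∈ Metric.ball p r) (hai : a i ≠ 0)
    (hbi : b i ≠ 0 ∨ b j ≠ 0) : ‖H b - H a‖ ≤ K * ‖b - a‖ := by
  set b' : ℝ → ι → ℂ := fun ε => b + Pi.single i ((ε : ℂ) * (Complex.I * a i)) with hb'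
  have hc : Continuous b' := by
    refine continuous_const.add ((continuous_single i).comp ?_)
    fun_prop
  have hb0 : b' 0 = b := by simp [hb']
  have ht : Tendsto b' (𝓝[≠] 0) (𝓝 b) := by
    have := hc.tendsto 0
    rw [hb0] at this
    exact this.mono_left nhdsWithin_le_nhds
  have hcb : ContinuousAt H b := (hd b hb hbi).1.continuousAt
  have hev : ∀ᶠ ε in 𝓝[≠] (0 : ℝ), ‖H (b' ε) - H a‖ ≤ K * ‖b' ε - a‖ := by
    have h1 : ∀ᶠ ε in 𝓝[≠] (0 : ℝ), b' ε ∈ Metric.ball p r := ht (Metric.isOpen_ball.mem_nhds hb)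
    have h2 : ∀ᶠ ε in 𝓝[≠] (0 : ℝ), (b i / a i).im + ε ≠ 0 := by
      by_cases h0 : (b i / a i).im = 0
      · filter_upwards [self_mem_nhdsWithin] with ε hε
        simpa [h0] using hε
      · have : Continuous fun ε : ℝ => (b i / a i).im + ε := by fun_prop
        exact nhdsWithin_le_nhds (this.continuousAt.eventually_ne (by simpa using h0))
    filter_upwards [h1, h2] with ε h1 h2
    have hseg : ∀ z ∈ segment ℝ a (b' ε), z i ≠ 0 := by
      rintro z ⟨u, v, hu, hv, huv, rfl⟩ h
      simp only [hb', Pi.add_apply, Pi.smul_apply, Pi.single_eq_same, Complex.real_smul] at h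
      have h3 : (u : ℂ) + v * (b i / a i + ε * Complex.I) = 0 := by
        field_simp
        linear_combination h
      have h4 := congrArg Complex.im h3
      simp only [Complex.add_im, Complex.ofReal_im, Complex.mul_im, Complex.ofReal_re,
        Complex.add_re, Complex.I_im, Complex.I_re, Complex.zero_im] at h4
      have h5 : v * ((b i / a i).im + ε) = 0 := by linarith
      rcases mul_eq_zero.1 h5 with rfl | h6
      · simp only [Complex.ofReal_zero, zero_mul, add_zero, Complex.ofReal_eq_zero] at h3
        linarith
      · exact h2 h6
    have hsub : segment ℝ a (b' ε) ⊆ Metric.ball p r := (convex_ball p r).segment_subset ha h1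
    exact (convex_segment a (b' ε)).norm_image_sub_le_of_norm_fderiv_le
      (fun z hz => (hd z (hsub hz) (Or.inl (hseg z hz))).1)
      (fun z hz => (hd z (hsub hz) (Or.inl (hseg z hz))).2)
      (left_mem_segment _ _ _) (right_mem_segment _ _ _)
  refine le_of_tendsto_of_tendsto ?_ ?_ hev
  · exact ((hcb.tendsto.comp ht).sub_const _).norm
  · exact ((ht.sub_const a).norm).const_mul K

theorem norm_sub_le_of_fderiv_le {H : (ι → ℂ) → E} {p : ι → ℂ} {r K : ℝ}
    (hd : ∀ z ∈ Metric.ball p r, (z i ≠ 0 ∨ z j ≠ 0) → DifferentiableAt ℝ H z ∧ ‖fderiv ℝ H z‖ ≤ K)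
    {a b : ι → ℂ} (ha : a ∈ Metric.ball p r) (hb : b ∈ Metric.ball p r) (hai : a i ≠ 0 ∨ a j ≠ 0)
    (hbi : b i ≠ 0 ∨ b j ≠ 0) : ‖H b - H a‖ ≤ K * ‖b - a‖ := by
  rcases hai with h | h
  · exact norm_sub_le_of_segment hd ha hb h hbi
  · exact norm_sub_le_of_segment (i := j) (j := i) (fun z hz h => hd z hz h.symm) ha hb h hbi.symm

theorem dense_regular : Dense {z : ι → ℂ | z i ≠ 0 ∨ z j ≠ 0} :=
  (dense_coord_ne_zero i).mono fun _ => Or.inl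

theorem Pole.exists_tendsto [CompleteSpace E] (hij : i ≠ j) (h : Pole i j F) (p : ι → ℂ) :
    ∃ y, Tendsto F (𝓝[{z | z i ≠ 0 ∨ z j ≠ 0}] p) (𝓝 y) := by
  have : NeBot (𝓝[{z : ι → ℂ | z i ≠ 0 ∨ z j ≠ 0}] p) :=
    mem_closure_iff_nhdsWithin_neBot.1 (dense_regular p)
  obtain ⟨C, hC⟩ := h.fderiv.exists_bound hij p
  rw [← cauchy_map_iff_exists_tendsto, Metric.cauchy_iff]
  refine ⟨inferInstance, fun ε hε => ?_⟩
  set δ := min 1 (ε / (2 * (|C| + 1))) with hδ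
  have hδ0 : 0 < δ := by positivity
  refine ⟨F '' (Metric.ball p δ ∩ {z | z i ≠ 0 ∨ z j ≠ 0}), image_mem_map
    (inter_mem (nhdsWithin_le_nhds (Metric.ball_mem_nhds p hδ0)) self_mem_nhdsWithin), ?_⟩
  rintro _ ⟨a, ⟨ha, ha'⟩, rfl⟩ _ ⟨b, ⟨hb, hb'⟩, rfl⟩
  have hsub : Metric.ball p δ ⊆ Metric.ball p 1 := Metric.ball_subset_ball (min_le_left _ _)
  have h1 := norm_sub_le_of_fderiv_le (i := i) (j := j) (H := F) (p := p) (r := 1) (K := C)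
    (fun z hz hz' => ⟨(h.contDiffAt hz').differentiableAt (by simp), hC z hz hz'⟩)
    (hsub hb) (hsub ha) hb' ha'
  rw [dist_eq_norm]
  have h2 : ‖a - b‖ < 2 * δ := by
    rw [← dist_eq_norm]
    calc dist a b ≤ dist a p + dist b p := dist_triangle_right _ _ _
      _ < δ + δ := add_lt_add ha hb
      _ = 2 * δ := by ring
  have h3 : (|C| + 1) * (2 * δ) ≤ ε := by
    have : δ ≤ ε / (2 * (|C| + 1)) := min_le_right _ _
    rw [le_div_iff₀ (by positivity)] at this
    linarith
  have h4 : C * ‖a - b‖ ≤ (|C| + 1) * ‖a - b‖ :=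
    mul_le_mul_of_nonneg_right ((le_abs_self C).trans (by linarith)) (norm_nonneg _)
  have h5 : (|C| + 1) * ‖a - b‖ < (|C| + 1) * (2 * δ) :=
    mul_lt_mul_of_pos_left h2 (by positivity)
  linarith

theorem Pole.continuous_extendFrom [CompleteSpace E] (hij : i ≠ j) (h : Pole i j F) :
    Continuous (extendFrom {z | z i ≠ 0 ∨ z j ≠ 0} F) :=
  _root_.continuous_extendFrom dense_regular (h.exists_tendsto hij)

theorem Pole.extendFrom_eq [CompleteSpace E] (h : Pole i j F) {z : ι → ℂ}
    (hz : z i ≠ 0 ∨ z j ≠ 0) : extendFrom {z | z i ≠ 0 ∨ z j ≠ 0} F z = F z :=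
  _root_.extendFrom_eq (dense_regular z)
    ((h.contDiffAt hz).continuousAt.tendsto.mono_left nhdsWithin_le_nhds)

theorem Pole.hasFDerivAt_extendFrom [CompleteSpace E] (hij : i ≠ j) (h : Pole i j F)
    (p : ι → ℂ) : HasFDerivAt (extendFrom {z | z i ≠ 0 ∨ z j ≠ 0} F)
      (extendFrom {z | z i ≠ 0 ∨ z j ≠ 0} (_root_.fderiv ℝ F) p) p := by
  set G := extendFrom {z | z i ≠ 0 ∨ z j ≠ 0} F with hG
  set G' := extendFrom {z | z i ≠ 0 ∨ z j ≠ 0} (_root_.fderiv ℝ F) with hG'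
  have hGc : Continuous G := h.continuous_extendFrom hij
  have hG'c : Continuous G' := h.fderiv.continuous_extendFrom hij
  rw [hasFDerivAt_iff_isLittleO, Asymptotics.isLittleO_iff]
  intro ε hε
  obtain ⟨r, hr, hb⟩ := Metric.continuousAt_iff.1 hG'c.continuousAt ε hε
  have hH : ∀ z ∈ Metric.ball p r, (z i ≠ 0 ∨ z j ≠ 0) →
      DifferentiableAt ℝ (fun z => F z - G' p z) z ∧
        ‖_root_.fderiv ℝ (fun z => F z - G' p z) z‖ ≤ ε := by
    intro z hz hz'
    have h1 : HasFDerivAt F (_root_.fderiv ℝ F z) z :=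
      ((h.contDiffAt hz').differentiableAt (by simp)).hasFDerivAt
    have h2 := h1.sub (G' p).hasFDerivAt
    refine ⟨h2.differentiableAt, ?_⟩
    have h3 := hb hz
    rw [hG', h.fderiv.extendFrom_eq hz', dist_eq_norm] at h3
    rw [show _root_.fderiv ℝ (fun z => F z - G' p z) z = _ from h2.fderiv]
    exact h3.le
  have hcl : ∀ a ∈ Metric.ball p r, ∀ b ∈ Metric.ball p r,
      ‖(G b - G' p b) - (G a - G' p a)‖ ≤ ε * ‖b - a‖ := by
    have hS : IsClosed {q : (ι → ℂ) × (ι → ℂ) |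
        ‖(G q.2 - G' p q.2) - (G q.1 - G' p q.1)‖ ≤ ε * ‖q.2 - q.1‖} :=
      isClosed_le (by fun_prop) (by fun_prop)
    intro a ha b hb
    obtain ⟨R, hR⟩ : ∃ R : Set (ι → ℂ), R = {z | z i ≠ 0 ∨ z j ≠ 0} := ⟨_, rfl⟩
    have hd : Dense (R ×ˢ R) := by
      rw [hR]
      exact dense_regular.prod dense_regular
    have hop : IsOpen (Metric.ball p r ×ˢ Metric.ball p r) :=
      Metric.isOpen_ball.prod Metric.isOpen_ball
    have hm : (a, b) ∈ closure ((Metric.ball p r ×ˢ Metric.ball p r) ∩ (R ×ˢ R)) :=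
      hd.open_subset_closure_inter hop (mk_mem_prod ha hb)
    have hsub := closure_minimal (t := {q : (ι → ℂ) × (ι → ℂ) |
        ‖(G q.2 - G' p q.2) - (G q.1 - G' p q.1)‖ ≤ ε * ‖q.2 - q.1‖}) ?_ hS hm
    · exact hsub
    rw [hR]
    rintro ⟨u, v⟩ ⟨⟨hu, hv⟩, hu', hv'⟩
    have h1 := norm_sub_le_of_fderiv_le hH hu hv hu' hv'
    have e1 : G v = F v := h.extendFrom_eq hv'
    have e2 : G u = F u := h.extendFrom_eq hu'
    rw [mem_ofPred_eq, e1, e2]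
    exact h1
  filter_upwards [Metric.ball_mem_nhds p hr] with z hz
  have := hcl p (Metric.mem_ball_self hr) z hz
  rwa [show G z - G p - (G' p) (z - p) = G z - G' p z - (G p - G' p p) by rw [map_sub]; abel]

theorem Pole.contDiff_extendFrom [CompleteSpace E] (hij : i ≠ j) (h : Pole i j F) :
    ContDiff ℝ ∞ (extendFrom {z | z i ≠ 0 ∨ z j ≠ 0} F) := by
  rw [contDiff_infty]
  intro n
  induction n generalizing E with
  | zero =>
    rw [Nat.cast_zero, contDiff_zero]
    exact h.continuous_extendFrom hij
  | succ n ih =>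
    rw [Nat.cast_add, Nat.cast_one, contDiff_succ_iff_fderiv]
    refine ⟨fun x => (h.hasFDerivAt_extendFrom hij x).differentiableAt, by simp, ?_⟩
    rw [show _root_.fderiv ℝ (extendFrom {z | z i ≠ 0 ∨ z j ≠ 0} F) = _ from
      funext fun x => (h.hasFDerivAt_extendFrom hij x).fderiv]
    exact ih h.fderiv

/-- If `|z_i|^2` divides `|z_j|^2 A` in the smooth functions, then it divides `A`. -/
theorem exists_eq_normSq_mul_of_mul (hij : i ≠ j) {A C : (ι → ℂ) → ℝ} (hA : ContDiff ℝ ∞ A)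
    (hC : ContDiff ℝ ∞ C) (h : ∀ z, ‖z j‖ ^ 2 * A z = ‖z i‖ ^ 2 * C z) :
    ∃ G : (ι → ℂ) → ℝ, ContDiff ℝ ∞ G ∧ ∀ z, A z = ‖z i‖ ^ 2 * G z := by
  have zero_of : ∀ (k l : ι) (f g : (ι → ℂ) → ℝ), k ≠ l → Continuous f →
      (∀ z, ‖z l‖ ^ 2 * f z = ‖z k‖ ^ 2 * g z) → ∀ z : ι → ℂ, z k = 0 → f z = 0 := by
    intro k l f g hkl hf hfg z hz
    by_contra hne
    have hc : Continuous fun t : ℂ => f (Function.update z l t) :=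
      hf.comp (continuous_const.update l continuous_id)
    have h1 : ∀ᶠ t in 𝓝[≠] (z l), f (Function.update z l t) ≠ 0 :=
      nhdsWithin_le_nhds (hc.continuousAt.eventually_ne (by simpa using hne))
    have h2 : ∀ᶠ t in 𝓝[≠] (z l), t ≠ 0 := by
      by_cases h0 : z l = 0
      · rw [h0]
        exact self_mem_nhdsWithin
      · exact nhdsWithin_le_nhds (continuousAt_id.eventually_ne h0)
    obtain ⟨t, ht1, ht2⟩ := (h1.and h2).exists
    have := hfg (Function.update z l t)
    rw [Function.update_self, Function.update_of_ne hkl, hz, norm_zero] at this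
    simp [ht1, ht2] at this
  have hA0 := zero_of i j A C hij hA.continuous h
  have hC0 := zero_of j i C A hij.symm hC.continuous fun z => (h z).symm
  have hP : Pole i j fun z : ι → ℂ =>
      if z i ≠ 0 then (‖z i‖ ^ 2)⁻¹ * A z else (‖z j‖ ^ 2)⁻¹ * C z := by
    refine ⟨1, ?_, ?_⟩
    · convert hA using 2 with z
      by_cases hz : z i = 0
      · simp [hz, hA0 z hz]
      · have : ‖z i‖ ≠ 0 := norm_ne_zero_iff.2 hz
        simp only [pow_one, ne_eq, hz, not_false_eq_true, if_true, smul_eq_mul]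
        field_simp
    · convert hC using 2 with z
      by_cases hz : z i = 0
      · by_cases hz' : z j = 0
        · simp [hz', hC0 z hz']
        · have : ‖z j‖ ≠ 0 := norm_ne_zero_iff.2 hz'
          simp only [pow_one, ne_eq, hz, not_true_eq_false, if_false, smul_eq_mul]
          field_simp
      · have : ‖z i‖ ≠ 0 := norm_ne_zero_iff.2 hz
        simp only [pow_one, ne_eq, hz, not_false_eq_true, if_true, smul_eq_mul]
        field_simp
        exact h z
  refine ⟨_, hP.contDiff_extendFrom hij, fun z => ?_⟩
  by_cases hz : z i = 0
  · simp [hz, hA0 z hz]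
  · have : ‖z i‖ ≠ 0 := norm_ne_zero_iff.2 hz
    rw [hP.extendFrom_eq (Or.inl hz)]
    simp only [ne_eq, hz, not_false_eq_true, if_true]
    field_simp

end Hartogs

section Division

variable {ι : Type} [Fintype ι] [DecidableEq ι]

theorem exists_eq_clm_smul {E F : Type} [NormedAddCommGroup E] [NormedSpace ℝ E]
    [FiniteDimensional ℝ E] [NormedAddCommGroup F] [NormedSpace ℝ F] [CompleteSpace F]
    (l : E →L[ℝ] ℝ) {w : E} (hw : l w = 1) {f : E → F} (hf : ContDiff ℝ ∞ f)
    (h0 : ∀ z, l z = 0 → f z = 0) : ∃ g : E → F, ContDiff ℝ ∞ g ∧ ∀ z, f z = l z • g z := by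
  obtain ⟨g, hg, e⟩ := exists_eq_smul_of_zero
    (f := fun q : E × ℝ => f (q.1 - l q.1 • w + q.2 • w)) (hf.comp (by fun_prop))
    fun x => h0 _ (by simp [hw])
  refine ⟨fun z => g (z, l z), hg.comp (by fun_prop), fun z => ?_⟩
  rw [← e (z, l z)]
  simp

/-- The real and imaginary parts of a coordinate. -/
def coordRe (i : ι) : (ι → ℂ) →L[ℝ] ℝ := Complex.reCLM.comp (ContinuousLinearMap.proj i)

def coordIm (i : ι) : (ι → ℂ) →L[ℝ] ℝ := Complex.imCLM.comp (ContinuousLinearMap.proj i)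

theorem coordRe_apply (i : ι) (z : ι → ℂ) : coordRe i z = (z i).re := rfl

theorem coordIm_apply (i : ι) (z : ι → ℂ) : coordIm i z = (z i).im := rfl

theorem dense_clm_ne_zero {E : Type} [NormedAddCommGroup E] [NormedSpace ℝ E]
    (l : E →L[ℝ] ℝ) {w : E} (hw : l w = 1) : Dense {z : E | l z ≠ 0} := by
  intro z
  by_cases hz : l z = 0
  · have ht : Tendsto (fun t : ℝ => z + t • w) (𝓝[≠] 0) (𝓝 z) := by
      have : Continuous fun t : ℝ => z + t • w := by fun_prop
      simpa using (this.tendsto 0).mono_left (nhdsWithin_le_nhds (s := {0}ᶜ))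
    refine mem_closure_of_tendsto ht ?_
    filter_upwards [self_mem_nhdsWithin] with t ht
    have ht : t ≠ 0 := ht
    simp [hz, hw, ht]
  · exact subset_closure hz

theorem eq_of_clm_mul_eq {E : Type} [NormedAddCommGroup E] [NormedSpace ℝ E]
    (l : E →L[ℝ] ℝ) {w : E} (hw : l w = 1) {f g : E → ℝ} (hf : Continuous f) (hg : Continuous g)
    (h : ∀ z, l z * f z = l z * g z) : f = g :=
  Continuous.ext_on (dense_clm_ne_zero l hw) hf hg fun z hz => mul_left_cancel₀ hz (h z)

/-- If `x a + y b = 0` for smooth `a` and `b`, where `x` and `y` are the parts of a coordinate,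
then `(a, b)` is a smooth multiple of `(y, -x)`. -/
theorem exists_eq_of_re_mul_add_im_mul (i : ι) {a b : (ι → ℂ) → ℝ} (ha : ContDiff ℝ ∞ a)
    (hb : ContDiff ℝ ∞ b) (h : ∀ z, (z i).re * a z + (z i).im * b z = 0) :
    ∃ g : (ι → ℂ) → ℝ, ContDiff ℝ ∞ g ∧ (∀ z, a z = (z i).im * g z) ∧
      ∀ z, b z = -(z i).re * g z := by
  have hwi : coordIm i (Pi.single i Complex.I) = 1 := by simp [coordIm_apply]
  have hwr : coordRe i (Pi.single i 1) = 1 := by simp [coordRe_apply]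
  obtain ⟨g, hg, e⟩ := exists_eq_clm_smul (coordIm i) hwi ha (by
    intro z hz
    have hc : Continuous fun t : ℝ => a (z + t • (Pi.single i 1 : ι → ℂ)) :=
      ha.continuous.comp (by fun_prop)
    by_contra hne
    have h1 : ∀ᶠ t in 𝓝[≠] (0 : ℝ), a (z + t • (Pi.single i 1 : ι → ℂ)) ≠ 0 :=
      nhdsWithin_le_nhds (hc.continuousAt.eventually_ne (by simpa using hne))
    have h2 : ∀ᶠ t in 𝓝[≠] (0 : ℝ), (z i).re + t ≠ 0 := by
      by_cases h0 : (z i).re = 0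
      · filter_upwards [self_mem_nhdsWithin] with t ht
        simpa [h0] using ht
      · have : Continuous fun t : ℝ => (z i).re + t := by fun_prop
        exact nhdsWithin_le_nhds (this.continuousAt.eventually_ne (by simpa using h0))
    obtain ⟨t, ht1, ht2⟩ := (h1.and h2).exists
    have h3 := h (z + t • (Pi.single i 1 : ι → ℂ))
    rw [coordIm_apply] at hz
    simp [hz] at h3
    exact h3.elim ht2 ht1)
  simp only [coordIm_apply, smul_eq_mul] at e
  refine ⟨g, hg, e, fun z => ?_⟩
  refine congrFun (eq_of_clm_mul_eq (coordIm i) hwi hb.continuous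
    (g := fun z => -(z i).re * g z) ?_ fun z => ?_) z
  · exact ((Complex.continuous_re.comp (continuous_apply i)).neg).mul hg.continuous
  · have := h z
    rw [e] at this
    rw [coordIm_apply]
    linear_combination this

theorem exists_eq_normSq_mul_of_prod_mul {i : ι} (S : Finset ι) (hi : i ∉ S) {A G : (ι → ℂ) → ℝ}
    (hA : ContDiff ℝ ∞ A) (hG : ContDiff ℝ ∞ G)
    (h : ∀ z, (∏ j ∈ S, ‖z j‖ ^ 2) * A z = ‖z i‖ ^ 2 * G z) :
    ∃ G : (ι → ℂ) → ℝ, ContDiff ℝ ∞ G ∧ ∀ z, A z = ‖z i‖ ^ 2 * G z := by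
  induction S using Finset.induction_on generalizing G with
  | empty => exact ⟨G, hG, by simpa using h⟩
  | insert j S hj ih =>
    rw [Finset.mem_insert, not_or] at hi
    obtain ⟨G', hG', e⟩ := exists_eq_normSq_mul_of_mul hi.1
      (A := fun z => (∏ j ∈ S, ‖z j‖ ^ 2) * A z) (C := G)
      ((contDiff_prod fun j _ => contDiff_normSq j).mul hA) hG fun z => by
        rw [← h z, Finset.prod_insert hj, mul_assoc]
    exact ih hi.2 hG' e

/-- A smooth vector field that preserves the ideal of `∏_{i ∈ T} |z_i|^2` has components
`v_i = c_i z_i`, `i ∈ T`, with smooth `c_i`. -/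
theorem exists_log_components (T : Finset ι) {v : (ι → ℂ) → ι → ℂ} {h : (ι → ℂ) → ℝ}
    (hv : ContDiff ℝ ∞ v) (hh : ContDiff ℝ ∞ h)
    (hyp : ∀ z, ∑ i ∈ T, 2 * (starRingEnd ℂ (z i) * v z i).re * ∏ j ∈ T.erase i, ‖z j‖ ^ 2 =
      h z * ∏ j ∈ T, ‖z j‖ ^ 2) {i : ι} (hi : i ∈ T) :
    ∃ c : (ι → ℂ) → ℂ, ContDiff ℝ ∞ c ∧ ∀ z, v z i = c z * z i := by
  set A : ι → (ι → ℂ) → ℝ := fun i z => (starRingEnd ℂ (z i) * v z i).re with hA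
  have hvi : ∀ i, ContDiff ℝ ∞ fun z => v z i := fun i => (contDiff_pi.1 hv) i
  have hAs : ∀ i, ContDiff ℝ ∞ (A i) := fun i => by
    refine Complex.reCLM.contDiff.comp (ContDiff.mul ?_ (hvi i))
    exact Complex.conjCLE.contDiff.comp (contDiff_apply ℝ ℂ i)
  have hP : ∀ S : Finset ι, ContDiff ℝ ∞ fun z : ι → ℂ => ∏ j ∈ S, ‖z j‖ ^ 2 :=
    fun S => contDiff_prod fun j _ => contDiff_normSq j
  obtain ⟨f, hf, ef⟩ := exists_eq_normSq_mul_of_prod_mul (T.erase i) (Finset.notMem_erase i T)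
    (hAs i) (G := fun z => h z / 2 * ∏ j ∈ T.erase i, ‖z j‖ ^ 2 -
      ∑ j ∈ T.erase i, A j z * ∏ k ∈ (T.erase j).erase i, ‖z k‖ ^ 2)
    (((hh.div_const 2).mul (hP _)).sub (ContDiff.sum fun j _ => (hAs j).mul (hP _))) (by
      intro z
      have h1 := hyp z
      rw [← Finset.add_sum_erase T _ hi, ← Finset.mul_prod_erase T _ hi] at h1
      have h2 : ∑ j ∈ T.erase i, 2 * (starRingEnd ℂ (z j) * v z j).re *
          ∏ k ∈ T.erase j, ‖z k‖ ^ 2 =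
          2 * ‖z i‖ ^ 2 * ∑ j ∈ T.erase i, A j z * ∏ k ∈ (T.erase j).erase i, ‖z k‖ ^ 2 := by
        rw [Finset.mul_sum]
        refine Finset.sum_congr rfl fun j hj => ?_
        rw [← Finset.mul_prod_erase (T.erase j) _
          (Finset.mem_erase.2 ⟨(Finset.ne_of_mem_erase hj).symm, hi⟩)]
        simp only [hA]
        ring
      rw [h2] at h1
      linear_combination h1 / 2)
  obtain ⟨g, hg, e1, e2⟩ := exists_eq_of_re_mul_add_im_mul i
    (a := fun z => (v z i - f z * z i).re) (b := fun z => (v z i - f z * z i).im)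
    (Complex.reCLM.contDiff.comp ((hvi i).sub
      ((Complex.ofRealCLM.contDiff.comp hf).mul (contDiff_apply ℝ ℂ i))))
    (Complex.imCLM.contDiff.comp ((hvi i).sub
      ((Complex.ofRealCLM.contDiff.comp hf).mul (contDiff_apply ℝ ℂ i)))) (by
      intro z
      have h1 := ef z
      simp only [hA, Complex.mul_re, Complex.conj_re, Complex.conj_im, Complex.sq_norm,
        Complex.normSq_apply] at h1
      simp only [Complex.sub_re, Complex.sub_im, Complex.re_ofReal_mul, Complex.im_ofReal_mul]
      linear_combination h1)
  refine ⟨fun z => f z - Complex.I * g z, ?_, fun z => ?_⟩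
  · exact (Complex.ofRealCLM.contDiff.comp hf).sub
      (contDiff_const.mul (Complex.ofRealCLM.contDiff.comp hg))
  · have h1 := e1 z
    have h2 := e2 z
    apply Complex.ext
    · simp only [Complex.sub_re, Complex.re_ofReal_mul] at h1
      simp
      linarith
    · simp only [Complex.sub_im, Complex.im_ofReal_mul] at h2
      simp
      linarith

/-- The function depends only on the absolute values of the coordinates. -/
def ModInv {α : Type*} (f : (ι → ℂ) → α) : Prop :=
  ∀ z w : ι → ℂ, (∀ i, ‖z i‖ = ‖w i‖) → f z = f w

theorem ModInv.of_normSq_mul {i : ι} {f g : (ι → ℂ) → ℝ} (hf : ModInv f) (hg : Continuous g)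
    (h : ∀ z, f z = ‖z i‖ ^ 2 * g z) : ModInv g := by
  intro z w hzw
  have key : ∀ t : ι → ℂ, (∀ k, ‖t k‖ = 1) → (fun z => g (t * z)) = g := by
    intro t ht
    refine Continuous.ext_on (dense_coord_ne_zero i) (hg.comp (by fun_prop)) hg fun z hz => ?_
    have h1 : f (t * z) = f z := hf _ _ fun k => by simp [ht]
    rw [h, h] at h1
    have : ‖(t * z) i‖ = ‖z i‖ := by simp [ht]
    rw [this] at h1
    exact mul_left_cancel₀ (pow_ne_zero 2 (norm_ne_zero_iff.2 hz)) h1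
  set t : ι → ℂ := fun k => if z k = 0 then 1 else w k / z k with ht
  have h1 : t * z = w := by
    ext k
    by_cases hk : z k = 0
    · have := hzw k
      simp only [hk, norm_zero] at this
      simp [ht, hk, norm_eq_zero.1 this.symm]
    · simp [ht, hk]
  rw [← h1]
  refine (congrFun (key t fun k => ?_) z).symm
  by_cases hk : z k = 0
  · simp [ht, hk]
  · simp only [ht, hk, if_false, norm_div, ← hzw k]
    exact div_self (norm_ne_zero_iff.2 hk)

theorem contDiff_update (j : ι) : ContDiff ℝ ∞ fun q : (ι → ℂ) × ℂ => Function.update q.1 j q.2 := by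
  rw [contDiff_pi]
  intro k
  by_cases hk : k = j
  · subst hk
    simp only [Function.update_self]
    fun_prop
  · simp only [Function.update_of_ne hk]
    fun_prop

theorem fderiv_rotation_eq_zero {U : (ι → ℂ) → ℝ} (hU : ContDiff ℝ ∞ U) (hinv : ModInv U) (j : ι)
    (z : ι → ℂ) : fderiv ℝ U z (Pi.single j (Complex.I * z j)) = 0 := by
  have h1 : HasDerivAt (fun s : ℝ => Function.update z j (Complex.exp (s * Complex.I) * z j))
      (Pi.single j (Complex.I * z j)) 0 := by
    rw [hasDerivAt_pi]
    intro k
    by_cases hk : k = j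
    · subst hk
      simp only [Function.update_self, Pi.single_eq_same]
      have h2 : HasDerivAt (fun s : ℝ => Complex.exp (s * Complex.I)) Complex.I 0 := by
        have := ((Complex.ofRealCLM.hasDerivAt (x := (0 : ℝ))).mul_const Complex.I).cexp
        simpa using this
      exact h2.mul_const _
    · simp only [Function.update_of_ne hk, Pi.single_eq_of_ne hk]
      exact hasDerivAt_const _ _
  have h3 : HasFDerivAt U (fderiv ℝ U z)
      (Function.update z j (Complex.exp ((0 : ℝ) * Complex.I) * z j)) := by
    simpa using (hU.differentiable (by simp) z).hasFDerivAt
  have h4 := h3.comp_hasDerivAt (0 : ℝ) h1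
  have h5 : (U ∘ fun s : ℝ => Function.update z j (Complex.exp (s * Complex.I) * z j)) =
      fun _ => U z := by
    funext s
    refine hinv _ _ fun k => ?_
    by_cases hk : k = j
    · subst hk
      simp [Complex.norm_exp_ofReal_mul_I]
    · simp [Function.update_of_ne hk]
  rw [h5] at h4
  exact h4.unique (hasDerivAt_const _ _)

/-- A smooth function of the absolute values that vanishes on `z_j = 0` is divisible by
`|z_j|^2`. -/
theorem ModInv.exists_eq_normSq_mul {U : (ι → ℂ) → ℝ} (hU : ContDiff ℝ ∞ U) (hinv : ModInv U)
    (j : ι) (h0 : ∀ z, z j = 0 → U z = 0) :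
    ∃ G : (ι → ℂ) → ℝ, ContDiff ℝ ∞ G ∧ ModInv G ∧ ∀ z, U z = ‖z j‖ ^ 2 * G z := by
  have hfd : ContDiff ℝ ∞ (fderiv ℝ U) := hU.fderiv_right (by simp)
  obtain ⟨g, hg, e1, e2⟩ := exists_eq_of_re_mul_add_im_mul j
    (a := fun z => fderiv ℝ U z (Pi.single j Complex.I))
    (b := fun z => -fderiv ℝ U z (Pi.single j 1))
    (hfd.clm_apply contDiff_const) (hfd.clm_apply contDiff_const).neg (by
      intro z
      have h1 := fderiv_rotation_eq_zero hU hinv j z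
      have h2 : (Pi.single j (Complex.I * z j) : ι → ℂ) =
          (z j).re • (Pi.single j Complex.I : ι → ℂ) - (z j).im • (Pi.single j 1 : ι → ℂ) := by
        ext k
        by_cases hk : k = j
        · subst hk
          simp only [Pi.single_eq_same, Pi.sub_apply, Pi.smul_apply, Complex.real_smul, mul_one]
          apply Complex.ext <;> simp
        · simp [hk]
      rw [h2, map_sub, map_smul, map_smul, smul_eq_mul, smul_eq_mul] at h1
      linarith)
  set G : (ι → ℂ) → ℝ := fun z => ∫ s in (0 : ℝ)..1, s * g (Function.update z j (s * z j)) with hG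
  have hup : ContDiff ℝ ∞ fun q : (ι → ℂ) × ℝ => Function.update q.1 j ((q.2 : ℂ) * q.1 j) :=
    (contDiff_update j).comp (contDiff_fst.prodMk ((Complex.ofRealCLM.contDiff.comp
      contDiff_snd).mul ((contDiff_apply ℝ ℂ j).comp contDiff_fst)))
  have hGs : ContDiff ℝ ∞ G := by
    refine contDiff_integral_param
      (f := fun q : (ι → ℂ) × ℝ => q.2 * g (Function.update q.1 j (q.2 * q.1 j))) ?_
    exact contDiff_snd.mul (hg.comp hup)
  have hGe : ∀ z, U z = ‖z j‖ ^ 2 * G z := by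
    intro z
    have hd : ∀ s : ℝ, HasDerivAt (fun s : ℝ => U (Function.update z j ((s : ℂ) * z j)))
        (‖z j‖ ^ 2 * (s * g (Function.update z j (s * z j)))) s := by
      intro s
      have h1 : HasDerivAt (fun s : ℝ => Function.update z j ((s : ℂ) * z j))
          (Pi.single j (z j)) s := by
        rw [hasDerivAt_pi]
        intro k
        by_cases hk : k = j
        · subst hk
          simp only [Function.update_self, Pi.single_eq_same]
          simpa using (Complex.ofRealCLM.hasDerivAt (x := s)).mul_const (z k)
        · simp only [Function.update_of_ne hk, Pi.single_eq_of_ne hk]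
          exact hasDerivAt_const _ _
      have h2 := (hU.differentiable (by simp) (Function.update z j ((s : ℂ) * z j))
        ).hasFDerivAt.comp_hasDerivAt s h1
      have h3 : (Pi.single j (z j) : ι → ℂ) =
          (z j).re • (Pi.single j 1 : ι → ℂ) + (z j).im • (Pi.single j Complex.I : ι → ℂ) := by
        ext k
        by_cases hk : k = j
        · subst hk
          simp only [Pi.single_eq_same, Pi.add_apply, Pi.smul_apply, Complex.real_smul, mul_one]
          apply Complex.ext <;> simp
        · simp [hk]
      rw [h3, map_add, map_smul, map_smul, smul_eq_mul, smul_eq_mul, e1] at h2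
      have h4 := e2 (Function.update z j ((s : ℂ) * z j))
      rw [neg_eq_iff_eq_neg] at h4
      rw [h4] at h2
      refine h2.congr_deriv ?_
      simp only [Function.update_self, Complex.re_ofReal_mul, Complex.im_ofReal_mul,
        Complex.sq_norm, Complex.normSq_apply]
      ring
    have hc : Continuous fun s : ℝ => ‖z j‖ ^ 2 * (s * g (Function.update z j (s * z j))) := by
      refine continuous_const.mul (continuous_id.mul (hg.continuous.comp ?_))
      exact hup.continuous.comp (by fun_prop : Continuous fun s : ℝ => (z, s))
    have h1 := intervalIntegral.integral_eq_sub_of_hasDerivAt (fun s _ => hd s)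
      (hc.intervalIntegrable 0 1)
    rw [intervalIntegral.integral_const_mul] at h1
    simp only [Complex.ofReal_one, one_mul, Function.update_eq_self, Complex.ofReal_zero,
      zero_mul] at h1
    rw [h0 _ (Function.update_self _ _ _), sub_zero] at h1
    exact h1.symm
  exact ⟨G, hGs, hinv.of_normSq_mul hGs.continuous hGe, hGe⟩

/-- The coordinates in `Z` are replaced by zero. -/
def zeroOn (Z : Finset ι) : (ι → ℂ) →L[ℝ] (ι → ℂ) :=
  ContinuousLinearMap.pi fun i => if i ∈ Z then 0 else ContinuousLinearMap.proj i

theorem zeroOn_apply (Z : Finset ι) (z : ι → ℂ) (i : ι) :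
    zeroOn Z z i = if i ∈ Z then 0 else z i := by
  simp only [zeroOn, ContinuousLinearMap.pi_apply]
  split_ifs <;> rfl

theorem ModInv.exists_expansion {U : (ι → ℂ) → ℝ} (hU : ContDiff ℝ ∞ U) (hinv : ModInv U)
    (Z : Finset ι) : ∃ G : ι → (ι → ℂ) → ℝ, (∀ i, ContDiff ℝ ∞ (G i)) ∧
      ∀ z, U z = U (zeroOn Z z) + ∑ i ∈ Z, ‖z i‖ ^ 2 * G i z := by
  induction Z using Finset.induction_on with
  | empty =>
    refine ⟨fun _ _ => 0, fun _ => contDiff_const, fun z => ?_⟩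
    have : zeroOn ∅ z = z := by
      ext i
      simp [zeroOn_apply]
    simp [this]
  | insert j Z hj ih =>
    obtain ⟨G, hG, e⟩ := ih
    obtain ⟨g, hg, -, eg⟩ := ModInv.exists_eq_normSq_mul
      (U := fun z => U (zeroOn Z z) - U (zeroOn (insert j Z) z))
      ((hU.comp (zeroOn Z).contDiff).sub (hU.comp (zeroOn (insert j Z)).contDiff))
      (fun z w h => by
        refine congrArg₂ (· - ·) (hinv _ _ fun i => ?_) (hinv _ _ fun i => ?_) <;>
        · rw [zeroOn_apply, zeroOn_apply]
          split_ifs <;> simp [h]) j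
      (fun z hz => by
        rw [sub_eq_zero]
        congr 1
        ext i
        by_cases hi : i = j
        · subst hi
          simp [zeroOn_apply, hj, hz]
        · simp [zeroOn_apply, hi])
    refine ⟨Function.update G j g, fun i => ?_, fun z => ?_⟩
    · by_cases hi : i = j
      · subst hi
        simpa using hg
      · simpa [Function.update_of_ne hi] using hG i
    · rw [Finset.sum_insert hj, Function.update_self, ← eg, e z]
      have : ∑ i ∈ Z, ‖z i‖ ^ 2 * Function.update G j g i z = ∑ i ∈ Z, ‖z i‖ ^ 2 * G i z :=
        Finset.sum_congr rfl fun i hi => by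
          rw [Function.update_of_ne (ne_of_mem_of_not_mem hi hj)]
      rw [this]
      ring

/-- `|z_i|` times the phase of `z0_i`. -/
def alignTo (z0 z : ι → ℂ) : ι → ℂ :=
  fun i => if z0 i = 0 then (‖z i‖ : ℂ) else (‖z i‖ : ℂ) * (z0 i / ‖z0 i‖)

theorem norm_alignTo (z0 z : ι → ℂ) (i : ι) : ‖alignTo z0 z i‖ = ‖z i‖ := by
  unfold alignTo
  split_ifs with h
  · simp
  · have : ‖z0 i‖ ≠ 0 := norm_ne_zero_iff.2 h
    simp [this]

theorem norm_alignTo_sub (z0 z : ι → ℂ) (i : ι) :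
    ‖alignTo z0 z i - z0 i‖ = |‖z i‖ - ‖z0 i‖| := by
  unfold alignTo
  split_ifs with h
  · simp [h]
  · have h1 : (‖z0 i‖ : ℂ) ≠ 0 := by simpa using h
    have : (‖z i‖ : ℂ) * (z0 i / ‖z0 i‖) - z0 i = ((‖z i‖ - ‖z0 i‖ : ℝ) : ℂ) * (z0 i / ‖z0 i‖) := by
      push_cast
      field_simp
    rw [this, norm_mul, norm_div, Complex.norm_real, Complex.norm_real, norm_norm,
      div_self (norm_ne_zero_iff.2 h), mul_one, Real.norm_eq_abs]

theorem abs_sub_sq_le {a b : ℝ} (ha : 0 ≤ a) (hb : 0 ≤ b) : |a - b| ^ 2 ≤ |a ^ 2 - b ^ 2| := by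
  rw [show a ^ 2 - b ^ 2 = (a - b) * (a + b) by ring, abs_mul, sq, abs_of_nonneg (add_nonneg ha hb)]
  refine mul_le_mul_of_nonneg_left ?_ (abs_nonneg _)
  rw [abs_le]
  constructor <;> linarith

/-- An invariant bump function. -/
theorem exists_modInv_bump {Ω : Set (ι → ℂ)} (hΩ : IsOpen Ω) (hinv : ModInv (· ∈ Ω)) {z0 : ι → ℂ}
    (h0 : z0 ∈ Ω) : ∃ χ : (ι → ℂ) → ℝ, ContDiff ℝ ∞ χ ∧ ModInv χ ∧ (∀ᶠ z in 𝓝 z0, χ z = 1) ∧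
      HasCompactSupport χ ∧ tsupport χ ⊆ Ω := by
  obtain ⟨δ, hδ, hball⟩ := Metric.isOpen_iff.1 hΩ z0 h0
  set ε := (δ / 2) ^ 2 with hε
  have hε0 : 0 < ε := by positivity
  have hsub : ∀ z : ι → ℂ, (∀ i, |‖z i‖ ^ 2 - ‖z0 i‖ ^ 2| ≤ ε) → z ∈ Ω := by
    intro z hz
    have h1 : alignTo z0 z ∈ Ω := by
      refine hball ?_
      rw [Metric.mem_ball, dist_eq_norm]
      refine lt_of_le_of_lt ((pi_norm_le_iff_of_nonneg (by positivity : 0 ≤ δ / 2)).2 fun i => ?_)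
        (half_lt_self hδ)
      rw [Pi.sub_apply, norm_alignTo_sub]
      refine (abs_le_of_sq_le_sq' ?_ (by positivity)).2
      exact (abs_sub_sq_le (norm_nonneg _) (norm_nonneg _)).trans (hz i)
    exact (hinv _ _ (norm_alignTo z0 z)).mp h1
  set Q : (ι → ℂ) → ℝ := fun z => ∑ i, (‖z i‖ ^ 2 - ‖z0 i‖ ^ 2) ^ 2 with hQ
  have hQs : ContDiff ℝ ∞ Q :=
    ContDiff.sum fun i _ => ((contDiff_normSq i).sub contDiff_const).pow 2
  let b : ContDiffBump (0 : ℝ) := ⟨ε ^ 2 / 2, ε ^ 2, by positivity, by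
    have : 0 < ε ^ 2 := by positivity
    linarith⟩
  have hQ0 : Q z0 = 0 := by simp [hQ]
  have hcl : IsClosed {z | Q z ≤ ε ^ 2} := isClosed_le hQs.continuous continuous_const
  have hmem : ∀ z, Q z ≤ ε ^ 2 → ∀ i, |‖z i‖ ^ 2 - ‖z0 i‖ ^ 2| ≤ ε := by
    intro z hz i
    refine abs_le_of_sq_le_sq ?_ hε0.le
    exact (Finset.single_le_sum (f := fun i => (‖z i‖ ^ 2 - ‖z0 i‖ ^ 2) ^ 2)
      (fun i _ => sq_nonneg _) (Finset.mem_univ i)).trans hz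
  have hts : tsupport (fun z => b (Q z)) ⊆ {z | Q z ≤ ε ^ 2} := by
    refine closure_minimal (fun z hz => ?_) hcl
    have h1 : Q z ∈ Function.support b := hz
    rw [b.support_eq, Metric.mem_ball, dist_zero_right, Real.norm_eq_abs] at h1
    exact (le_abs_self _).trans h1.le
  refine ⟨fun z => b (Q z), b.contDiff.comp hQs, fun z w h => ?_, ?_, ?_, ?_⟩
  · simp only [hQ, h]
  · have : ContinuousAt Q z0 := hQs.continuous.continuousAt
    have h2 : Tendsto Q (𝓝 z0) (𝓝 0) := by simpa [hQ0] using this.tendsto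
    exact h2.eventually b.eventuallyEq_one
  · refine HasCompactSupport.of_support_subset_isCompact (K := {z | Q z ≤ ε ^ 2}) ?_
      (subset_closure.trans hts)
    refine Metric.isCompact_of_isClosed_isBounded hcl
      ((Metric.isBounded_closedBall (x := 0) (r := 1 + ε + ‖z0‖ ^ 2)).subset ?_)
    intro z hz
    rw [mem_closedBall_zero_iff, pi_norm_le_iff_of_nonneg (by positivity)]
    intro i
    have h1 := (abs_le.1 (hmem z hz i)).2
    have h2 : ‖z0 i‖ ^ 2 ≤ ‖z0‖ ^ 2 := pow_le_pow_left₀ (norm_nonneg _) (norm_le_pi_norm z0 i) 2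
    nlinarith [sq_nonneg (‖z i‖ - 1), sq_nonneg (‖z i‖)]
  · exact hts.trans fun z hz => hsub z (hmem z hz)

/-- Distance to the orbit of `z0`, in terms of the squares of the absolute values. -/
def modDist (z0 z : ι → ℂ) : ℝ := ∑ i, |‖z i‖ ^ 2 - ‖z0 i‖ ^ 2|

theorem le_modDist (z0 z : ι → ℂ) (i : ι) : |‖z i‖ ^ 2 - ‖z0 i‖ ^ 2| ≤ modDist z0 z :=
  Finset.single_le_sum (f := fun i => |‖z i‖ ^ 2 - ‖z0 i‖ ^ 2|) (fun _ _ => abs_nonneg _)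
    (Finset.mem_univ i)

theorem modDist_nonneg (z0 z : ι → ℂ) : 0 ≤ modDist z0 z :=
  Finset.sum_nonneg fun _ _ => abs_nonneg _

theorem continuous_alignTo (z0 : ι → ℂ) : Continuous (alignTo z0) := by
  refine continuous_pi fun i => ?_
  unfold alignTo
  split_ifs <;> fun_prop

theorem alignTo_self (z0 : ι → ℂ) : alignTo z0 z0 = z0 := by
  ext i
  unfold alignTo
  split_ifs with h
  · simp [h]
  · have : (‖z0 i‖ : ℂ) ≠ 0 := by simpa using h
    field_simp

/-- First order expansion of a nonnegative invariant function at a zero. -/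
theorem ModInv.exists_isLittleO {f : (ι → ℂ) → ℝ} (hf : ContDiff ℝ ∞ f) (hinv : ModInv f)
    {z0 : ι → ℂ} (h0 : f z0 = 0) (hnn : ∀ᶠ z in 𝓝 z0, 0 ≤ f z) :
    ∃ c : ι → ℝ, (fun z => f z - ∑ i ∈ Finset.univ.filter (fun i => z0 i = 0), c i * ‖z i‖ ^ 2)
      =o[𝓝 z0] modDist z0 := by
  set Z := Finset.univ.filter (fun i => z0 i = 0) with hZ
  have hz0 : zeroOn Z z0 = z0 := by
    ext i
    rw [zeroOn_apply]
    split_ifs with h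
    · simp only [hZ, Finset.mem_filter] at h
      exact h.2.symm
    · rfl
  obtain ⟨G, hG, e⟩ := hinv.exists_expansion hf Z
  refine ⟨fun i => G i z0, ?_⟩
  set p : (ι → ℂ) → ι → ℂ := fun z => zeroOn Z (alignTo z0 z) with hp
  have hpc : Tendsto p (𝓝 z0) (𝓝 z0) := by
    have : Continuous p := (zeroOn Z).continuous.comp (continuous_alignTo z0)
    simpa [hp, alignTo_self, hz0] using this.tendsto z0
  have hfp : ∀ z, f (zeroOn Z z) = f (p z) := fun z => hinv _ _ fun i => by
    simp only [hp, zeroOn_apply]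
    split_ifs
    · rfl
    · rw [norm_alignTo]
  -- the tangential part
  have h1 : (fun z => f (zeroOn Z z)) =o[𝓝 z0] modDist z0 := by
    have hmin : IsLocalMin f z0 := by
      filter_upwards [hnn] with z hz
      rwa [h0]
    have h2 : (fun z => f z - f z0 - (0 : (ι → ℂ) →L[ℝ] ℝ) (z - z0)) =o[𝓝 z0] fun z => z - z0 := by
      have := (hf.differentiable (by simp) z0).hasFDerivAt.isLittleO
      rwa [hmin.fderiv_eq_zero] at this
    simp only [h0, zero_apply, sub_zero] at h2
    have h3 := h2.comp_tendsto hpc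
    have h4 : (fun z => p z - z0) =O[𝓝 z0] modDist z0 := by
      rw [Asymptotics.isBigO_pi]
      intro i
      by_cases hi : z0 i = 0
      · have : (fun z => (p z - z0) i) = fun _ => 0 := by
          funext z
          simp [hp, zeroOn_apply, hi, hZ]
        rw [this]
        exact Asymptotics.isBigO_zero _ _
      · refine Asymptotics.IsBigO.of_bound (‖z0 i‖⁻¹) (Eventually.of_forall fun z => ?_)
        have hn : 0 < ‖z0 i‖ := norm_pos_iff.2 hi
        have e1 : (p z - z0) i = alignTo z0 z i - z0 i := by
          simp [hp, zeroOn_apply, hi, hZ]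
        rw [e1, norm_alignTo_sub, Real.norm_of_nonneg (modDist_nonneg _ _), ← div_eq_inv_mul,
          le_div_iff₀ hn]
        refine le_trans ?_ (le_modDist z0 z i)
        rw [show ‖z i‖ ^ 2 - ‖z0 i‖ ^ 2 = (‖z i‖ - ‖z0 i‖) * (‖z i‖ + ‖z0 i‖) by ring, abs_mul,
          abs_of_nonneg (by positivity : 0 ≤ ‖z i‖ + ‖z0 i‖)]
        exact mul_le_mul_of_nonneg_left (by linarith [norm_nonneg (z i)]) (abs_nonneg _)
    have h5 := h3.trans_isBigO h4
    refine h5.congr_left fun z => ?_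
    rw [hfp]
    rfl
  have h6 : (fun z => ∑ i ∈ Z, ‖z i‖ ^ 2 * (G i z - G i z0)) =o[𝓝 z0] modDist z0 := by
    refine Asymptotics.IsLittleO.fun_sum fun i hi => ?_
    have hi : z0 i = 0 := by simpa [hZ] using hi
    have h7 : (fun z : ι → ℂ => ‖z i‖ ^ 2) =O[𝓝 z0] modDist z0 := by
      refine Asymptotics.IsBigO.of_bound 1 (Eventually.of_forall fun z => ?_)
      rw [Real.norm_of_nonneg (modDist_nonneg _ _), one_mul]
      refine le_trans (le_of_eq ?_) (le_modDist z0 z i)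
      simp [hi]
    have h8 : (fun z => G i z - G i z0) =o[𝓝 z0] fun _ => (1 : ℝ) := by
      rw [Asymptotics.isLittleO_one_iff]
      have := ((hG i).continuous.tendsto z0).sub_const (G i z0)
      simpa using this
    simpa using h7.mul_isLittleO h8
  refine (h1.add h6).congr_left fun z => ?_
  rw [e z]
  simp only [mul_sub, Finset.sum_sub_distrib]
  have : ∑ i ∈ Z, ‖z i‖ ^ 2 * G i z0 = ∑ i ∈ Z, G i z0 * ‖z i‖ ^ 2 :=
    Finset.sum_congr rfl fun i _ => mul_comm _ _
  rw [this]
  ring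

theorem ModInv.isBigO_curve {f : (ι → ℂ) → ℝ} (hf : ContDiff ℝ ∞ f) (hinv : ModInv f)
    {w0 : ι → ℂ} {j : ι} (hj : w0 j = 0) :
    (fun s : ℝ => f (Function.update w0 j (Real.sqrt s : ℂ)) - f w0) =O[𝓝[>] 0] fun s => s := by
  obtain ⟨G, hG, e⟩ := hinv.exists_expansion hf {j}
  have hc : Continuous fun s : ℝ => G j (Function.update w0 j (Real.sqrt s : ℂ)) :=
    (hG j).continuous.comp (continuous_const.update j (by fun_prop))
  have h1 : (fun s : ℝ => s * G j (Function.update w0 j (Real.sqrt s : ℂ))) =O[𝓝[>] 0]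
      fun s => s * 1 :=
    (Asymptotics.isBigO_refl _ _).mul
      ((hc.tendsto 0).isBigO_one ℝ |>.mono nhdsWithin_le_nhds)
  simp only [mul_one] at h1
  refine h1.congr' ?_ EventuallyEq.rfl
  filter_upwards [self_mem_nhdsWithin] with s hs
  have hs : 0 < s := hs
  rw [e (Function.update w0 j _)]
  have h2 : zeroOn {j} (Function.update w0 j (Real.sqrt s : ℂ)) = w0 := by
    ext k
    rw [zeroOn_apply]
    by_cases hk : k = j
    · subst hk
      simp [hj]
    · simp [hk]
  rw [h2]
  simp [Real.sq_sqrt hs.le]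

end Division

/-! ## Local properties of forms, and pullbacks -/

section LocalForms

variable {P : Type*} {S : Subalgebra ℝ (P → ℝ)} {A : Algebroid S}

instance (A : Algebroid S) : AddCommMonoid A := AddCommGroup.toAddCommMonoid

instance (A : Algebroid S) : SubNegMonoid A := AddGroup.toSubNegMonoid

instance (A : Algebroid S) : Zero A := AddMonoid.toZero

instance (A : Algebroid S) : Add A := AddSemigroup.toAdd

instance (A : Algebroid S) : Sub A := SubNegMonoid.toSub

instance (A : Algebroid S) : Neg A := SubNegMonoid.toNeg

instance (A : Algebroid S) : DistribMulAction S A := Module.toDistribMulAction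

instance (A : Algebroid S) : MulAction S A := DistribMulAction.toMulAction

instance (A : Algebroid S) : SMulZeroClass S A := DistribSMul.toSMulZeroClass

instance (A : Algebroid S) : MulActionWithZero S A := Module.toMulActionWithZero

instance (A : Algebroid S) : SMulWithZero S A := MulActionWithZero.toSMulWithZero S A

/-- The value at a point of the derivative of a function along a section. -/
def val (X : A) (f : S) (x : P) : ℝ := ((X.1 f : S) : P → ℝ) x

theorem val_add (X Y : A) (f : S) (x : P) : val (X + Y) f x = val X f x + val Y f x := rfl

theorem val_sub (X Y : A) (f : S) (x : P) : val (X - Y) f x = val X f x - val Y f x := by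
  have := val_add (X - Y) Y f x
  rw [sub_add_cancel] at this
  linarith

theorem val_smul (g : S) (X : A) (f : S) (x : P) :
    val (g • X) f x = (g : P → ℝ) x * val X f x := rfl

theorem val_zero (f : S) (x : P) : val (0 : A) f x = 0 := rfl

theorem val_sum {ι : Type*} (s : Finset ι) (X : ι → A) (f : S) (x : P) :
    val (∑ i ∈ s, X i) f x = ∑ i ∈ s, val (X i) f x := by
  classical
  induction s using Finset.induction_on with
  | empty => simp [val_zero]
  | insert i s hi ih => rw [Finset.sum_insert hi, Finset.sum_insert hi, val_add, ih]

/-- The constant function. -/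
def cst (S : Subalgebra ℝ (P → ℝ)) (r : ℝ) : S := algebraMap ℝ S r

theorem cst_apply (r : ℝ) (x : P) : (cst S r : P → ℝ) x = r := rfl

/-- The vector field vanishes at the point. -/
def ZeroAt (X : A) (x : P) : Prop := ∀ f : S, val X f x = 0

theorem VanishesAt.add {X Y : A} {p : P} (hX : VanishesAt X p) (hY : VanishesAt Y p) :
    VanishesAt (X + Y) p := Submodule.add_mem _ hX hY

theorem VanishesAt.smul {X : A} {p : P} (f : S) (hX : VanishesAt X p) :
    VanishesAt (f • X) p := Submodule.smul_mem _ f hX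

theorem VanishesAt.sum {ι : Type*} {s : Finset ι} {X : ι → A} {p : P}
    (h : ∀ i ∈ s, VanishesAt (X i) p) : VanishesAt (∑ i ∈ s, X i) p := Submodule.sum_mem _ h

theorem vanishesAt_smul {f : S} {p : P} (hf : (f : P → ℝ) p = 0) (X : A) :
    VanishesAt (f • X) p := Submodule.subset_span ⟨f, X, hf, rfl⟩

theorem vanishesAt_zero (p : P) : VanishesAt (0 : A) p := Submodule.zero_mem _

theorem VanishesAt.congr_sub {X Y : A} {p : P} (h : VanishesAt (X - Y) p) (hY : VanishesAt Y p) :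
    VanishesAt X p := by simpa using h.add hY

theorem VanishesAt.symm_sub {X Y : A} {p : P} (h : VanishesAt (X - Y) p) :
    VanishesAt (Y - X) p := by
  have := Submodule.neg_mem _ h
  rwa [neg_sub] at this

theorem VanishesAt.trans_sub {X Y Z : A} {p : P} (h : VanishesAt (X - Y) p)
    (h' : VanishesAt (Y - Z) p) : VanishesAt (X - Z) p := by
  simpa using h.add h'

theorem vanishesAt_smul_sub {f g : S} {p : P} (h : (f : P → ℝ) p = (g : P → ℝ) p) (X : A) :
    VanishesAt (f • X - g • X) p := by
  rw [← sub_smul]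
  exact vanishesAt_smul (by simp [h]) X

theorem VanishesAt.zeroAt {X : A} {p : P} (h : VanishesAt X p) : ZeroAt X p := by
  intro f
  refine Submodule.span_induction (p := fun Z _ => val Z f p = 0) ?_ (val_zero f p) ?_ ?_ h
  · rintro _ ⟨g, Y, hg, rfl⟩
    rw [val_smul, hg, zero_mul]
  · intro X Y _ _ hX hY
    rw [val_add, hX, hY, add_zero]
  · intro g X _ hX
    rw [val_smul, hX, mul_zero]

theorem form_apply_eq_zero {k : ℕ} (α : Form A k) {v : Fin k → A} {i : Fin k} {p : P}
    (h : VanishesAt (v i) p) : (α v : P → ℝ) p = 0 := by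
  have key : ∀ Y : A, VanishesAt Y p → (α (Function.update v i Y) : P → ℝ) p = 0 := by
    intro Y hY
    refine Submodule.span_induction
      (p := fun Z _ => (α (Function.update v i Z) : P → ℝ) p = 0) ?_ ?_ ?_ ?_ hY
    · rintro _ ⟨g, Y, hg, rfl⟩
      rw [AlternatingMap.map_update_smul]
      simp [hg]
    · rw [AlternatingMap.map_update_zero]
      rfl
    · intro X Y _ _ hX hY
      rw [AlternatingMap.map_update_add]
      simp [hX, hY]
    · intro g X _ hX
      rw [AlternatingMap.map_update_smul]
      simp [hX]
  simpa using key (v i) h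

theorem form_congr_of {k : ℕ} (α : Form A k) {p : P} {N : A → Prop}
    (hN : ∀ (v : Fin k → A) (i : Fin k), N (v i) → (α v : P → ℝ) p = 0) {v w : Fin k → A}
    (h : ∀ i, N (v i - w i)) : (α v : P → ℝ) p = (α w : P → ℝ) p := by
  have key : ∀ s : Finset (Fin k), (α (s.piecewise v w) : P → ℝ) p = (α w : P → ℝ) p := by
    intro s
    induction s using Finset.induction_on with
    | empty => simp
    | insert i s hi ih =>
      rw [← ih, Finset.piecewise_insert]
      have h1 := α.map_update_sub (s.piecewise v w) i (v i) (w i)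
      have h2 : Function.update (s.piecewise v w) i (w i) = s.piecewise v w := by
        rw [Function.update_eq_self_iff, Finset.piecewise_eq_of_notMem _ _ _ hi]
      rw [h2] at h1
      have h3 : (α (Function.update (s.piecewise v w) i (v i - w i)) : P → ℝ) p = 0 :=
        hN _ i (by simpa using h i)
      rw [h1] at h3
      have : (α (Function.update (s.piecewise v w) i (v i)) : P → ℝ) p -
        (α (s.piecewise v w) : P → ℝ) p = 0 := h3
      linarith
  simpa using key Finset.univ

theorem form_congr {k : ℕ} (α : Form A k) {v w : Fin k → A} {p : P}
    (h : ∀ i, VanishesAt (v i - w i) p) : (α v : P → ℝ) p = (α w : P → ℝ) p :=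
  form_congr_of α (N := fun X => VanishesAt X p) (fun _ _ h => form_apply_eq_zero α h) h

theorem form_sum_apply {k : ℕ} {ι : Type*} [Fintype ι] (α : Form A k) (c : Fin k → ι → S)
    (e : ι → A) : α (fun j => ∑ i, c j i • e i) =
      ∑ r : Fin k → ι, (∏ j, c j (r j)) * α (fun j => e (r j)) := by
  classical
  have h1 := α.toMultilinearMap.map_sum (fun j i => c j i • e i)
  have h2 : ∀ r : Fin k → ι, α.toMultilinearMap (fun j => c j (r j) • e (r j)) =
      (∏ j, c j (r j)) * α (fun j => e (r j)) := fun r => by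
    rw [MultilinearMap.map_smul_univ]
    rfl
  simp only [h2] at h1
  exact h1

variable [TopologicalSpace P]

/-- The smooth functions are continuous and local, and there are bump functions. -/
structure LocalAlg (S : Subalgebra ℝ (P → ℝ)) : Prop where
  cont : ∀ f : S, Continuous (f : P → ℝ)
  bump : ∀ p, ∀ U ∈ 𝓝 p, ∃ χ : S, (∀ᶠ x in 𝓝 p, (χ : P → ℝ) x = 1) ∧ ∀ x ∉ U, (χ : P → ℝ) x = 0
  glue : ∀ f : P → ℝ, (∀ p, ∃ g : S, f =ᶠ[𝓝 p] g) → f ∈ S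

theorem LocalAlg.vanishesAt (hS : LocalAlg S) {X : A} {p : P} (h : ∀ᶠ x in 𝓝 p, ZeroAt X x) :
    VanishesAt X p := by
  obtain ⟨χ, h1, h0⟩ := hS.bump p _ h
  have e : χ • X = 0 := by
    refine Subtype.ext (Derivation.ext fun f => Subtype.ext (funext fun x => ?_))
    by_cases hx : x ∈ {x | ZeroAt X x}
    · have : val (χ • X) f x = 0 := by rw [val_smul, hx f, mul_zero]
      exact this
    · have : val (χ • X) f x = 0 := by rw [val_smul, h0 x hx, zero_mul]
      exact this
  have : X = (1 - χ) • X := by rw [sub_smul, one_smul, e, sub_zero]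
  rw [this]
  refine vanishesAt_smul ?_ X
  simp [h1.self_of_nhds]

theorem LocalAlg.vanishesAt_eventually (hS : LocalAlg S) {X : A} {p : P}
    (h : ∀ᶠ x in 𝓝 p, ZeroAt X x) : ∀ᶠ x in 𝓝 p, VanishesAt X x :=
  h.eventually_nhds.mono fun _ h => hS.vanishesAt h

theorem zeroAt_sub_iff {X Y : A} {x : P} : ZeroAt (X - Y) x ↔ ∀ f, val X f x = val Y f x :=
  forall_congr' fun f => by rw [val_sub, sub_eq_zero]

theorem LocalAlg.ext (hS : LocalAlg S) {W : Set P} (hW : Dense W) {f g : S}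
    (h : ∀ x ∈ W, (f : P → ℝ) x = (g : P → ℝ) x) : f = g :=
  Subtype.ext (Continuous.ext_on hW (hS.cont f) (hS.cont g) h)

/-- A local frame, pointwise independent as vector fields at the points of `W`. -/
structure IsFrameAt (W : Set P) {ι : Type} [Fintype ι] (e : ι → A) (p : P) : Prop where
  gen : ∀ X : A, ∃ f : ι → S, ∀ᶠ x in 𝓝 p, ZeroAt (X - ∑ i, f i • e i) x
  indep : ∀ᶠ x in 𝓝 p, x ∈ W → ∀ a : ι → ℝ, (∀ g : S, ∑ i, a i * val (e i) g x = 0) → a = 0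

theorem IsFrameAt.coeff_eq_zero (hS : LocalAlg S) {W : Set P} (hW : Dense W) {ι : Type}
    [Fintype ι] {e : ι → A} {p : P} (he : IsFrameAt W e p) {f : ι → S}
    (h : VanishesAt (∑ i, f i • e i) p) : ∀ i, (f i : P → ℝ) p = 0 := by
  have key : ∀ X : A, VanishesAt X p → ∃ g : ι → S, (∀ i, (g i : P → ℝ) p = 0) ∧
      ∀ᶠ x in 𝓝 p, ZeroAt (X - ∑ i, g i • e i) x := by
    intro X hX
    refine Submodule.span_induction (p := fun X _ => ∃ g : ι → S, (∀ i, (g i : P → ℝ) p = 0) ∧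
      ∀ᶠ x in 𝓝 p, ZeroAt (X - ∑ i, g i • e i) x) ?_ ?_ ?_ ?_ hX
    · rintro _ ⟨c, Y, hc, rfl⟩
      obtain ⟨g, hg⟩ := he.gen Y
      refine ⟨fun i => c * g i, fun i => by simp [hc], ?_⟩
      filter_upwards [hg] with x hx
      rw [zeroAt_sub_iff] at hx ⊢
      intro f
      have := hx f
      rw [val_sum] at this ⊢
      simp only [val_smul] at this ⊢
      rw [this, Finset.mul_sum]
      refine Finset.sum_congr rfl fun i _ => ?_
      rw [← mul_assoc]
      rfl
    · refine ⟨0, fun i => rfl, Eventually.of_forall fun x f => ?_⟩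
      rw [val_sub, val_sum, val_zero, Finset.sum_eq_zero, sub_zero]
      exact fun i _ => (val_smul _ _ _ _).trans (zero_mul _)
    · rintro X Y _ _ ⟨g, hg, hX⟩ ⟨g', hg', hY⟩
      refine ⟨g + g', fun i => by simp [hg, hg'], ?_⟩
      filter_upwards [hX, hY] with x hx hy
      rw [zeroAt_sub_iff] at hx hy ⊢
      intro f
      have h1 := hx f
      have h2 := hy f
      rw [val_sum] at h1 h2 ⊢
      simp only [val_smul] at h1 h2 ⊢
      rw [val_add, h1, h2, ← Finset.sum_add_distrib]
      refine Finset.sum_congr rfl fun i _ => ?_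
      rw [← add_mul]
      rfl
    · rintro c X _ ⟨g, hg, hX⟩
      refine ⟨fun i => c * g i, fun i => by simp [hg], ?_⟩
      filter_upwards [hX] with x hx
      rw [zeroAt_sub_iff] at hx ⊢
      intro f
      have := hx f
      rw [val_sum] at this ⊢
      simp only [val_smul] at this ⊢
      rw [this, Finset.mul_sum]
      refine Finset.sum_congr rfl fun i _ => ?_
      rw [← mul_assoc]
      rfl
  obtain ⟨g, hg, hz⟩ := key _ h
  intro i
  have h1 : ∀ᶠ x in 𝓝 p, x ∈ W → (f i : P → ℝ) x = (g i : P → ℝ) x := by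
    filter_upwards [hz, he.indep] with x hx hi hxW
    have := hi hxW (fun i => (f i : P → ℝ) x - (g i : P → ℝ) x) fun h => by
      have h2 := (zeroAt_sub_iff.1 hx) h
      rw [val_sum, val_sum] at h2
      simp only [val_smul] at h2
      simp only [sub_mul, Finset.sum_sub_distrib]
      linarith
    have h3 := congrFun this i
    simp only [Pi.zero_apply] at h3
    linarith
  have h2 : (f i : P → ℝ) p = (g i : P → ℝ) p := by
    have hne : (𝓝[W] p).NeBot := mem_closure_iff_nhdsWithin_neBot.1 (hW p)
    refine tendsto_nhds_unique_of_eventuallyEq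
      ((hS.cont (f i)).continuousAt.tendsto.mono_left nhdsWithin_le_nhds)
      ((hS.cont (g i)).continuousAt.tendsto.mono_left (nhdsWithin_le_nhds (s := W))) ?_
    filter_upwards [nhdsWithin_le_nhds h1, self_mem_nhdsWithin] with x hx hxW using hx hxW
  rw [h2, hg]

end LocalForms

section Maps

variable {P P' : Type*} {S : Subalgebra ℝ (P → ℝ)} {S' : Subalgebra ℝ (P' → ℝ)}
  {A : Algebroid S} {A' : Algebroid S'} [TopologicalSpace P] [TopologicalSpace P']

/-- Relatedness of sections, in terms of values. -/
theorem Related.val_eq {ψ : P' → P} {X' : A'} {X : A} (h : Related ψ X'.1 X.1) {f' : S'} {f : S}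
    (e : (f' : P' → ℝ) = (f : P → ℝ) ∘ ψ) (x : P') : val X' f' x = val X f (ψ x) :=
  congrFun (h f' f e) x

theorem Related.add {ψ : P' → P} {X' Y' : A'} {X Y : A} (h : Related ψ X'.1 X.1)
    (h' : Related ψ Y'.1 Y.1) : Related ψ (X' + Y').1 (X + Y).1 := fun f f' e => by
  funext x
  exact congrArg₂ (· + ·) (h.val_eq e x) (h'.val_eq e x)

theorem Related.smul {ψ : P' → P} {X' : A'} {X : A} (h : Related ψ X'.1 X.1) {g' : S'} {g : S}
    (hg : (g' : P' → ℝ) = (g : P → ℝ) ∘ ψ) : Related ψ (g' • X').1 (g • X).1 := fun f f' e => by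
  funext x
  exact congrArg₂ (· * ·) (congrFun hg x) (h.val_eq e x)

theorem Related.zero {ψ : P' → P} : Related ψ (0 : A').1 (0 : A).1 := fun _ _ _ => rfl

theorem Related.sum {ψ : P' → P} {ι : Type*} {s : Finset ι} {X' : ι → A'} {X : ι → A}
    (h : ∀ i, Related ψ (X' i).1 (X i).1) : Related ψ (∑ i ∈ s, X' i).1 (∑ i ∈ s, X i).1 := by
  classical
  induction s using Finset.induction_on with
  | empty => exact Related.zero
  | insert i s hi ih =>
    rw [Finset.sum_insert hi, Finset.sum_insert hi]
    exact (h i).add ih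

/-- The map `ψ` is covered by a fibrewise surjective map `A' → A`, with kernel spanned by `x`. -/
structure FrameMap {κ : Type} [Fintype κ] (A : Algebroid S) (x : κ → A') (W' : Set P')
    (W : Set P) (ψ : P' → P) : Prop where
  cont : Continuous ψ
  pull : ∀ g : S, (g : P → ℝ) ∘ ψ ∈ S'
  dense : Dense (ψ ⁻¹' W)
  kernel : ∀ k, Related ψ (x k).1 (0 : A).1
  frames : ∀ p', ∃ (ι : Type) (_ : Fintype ι) (e' : ι → A') (e : ι → A),
    IsFrameAt W' (Sum.elim e' x) p' ∧ IsFrameAt W e (ψ p') ∧ ∀ i, Related ψ (e' i).1 (e i).1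

/-- What is needed of a map to pull back forms by it. -/
structure Pullable (A' : Algebroid S') (A : Algebroid S) (ψ : P' → P) : Prop where
  cont : Continuous ψ
  pull : ∀ g : S, (g : P → ℝ) ∘ ψ ∈ S'
  vanishesAt : ∀ (X' : A') (X : A), Related ψ X'.1 X.1 → ∀ p, VanishesAt X' p →
    VanishesAt X (ψ p)
  gen : ∀ p, ∃ (ι : Type) (_ : Fintype ι) (e' : ι → A') (e : ι → A),
    (∀ i, Related ψ (e' i).1 (e i).1) ∧
      ∀ X' : A', ∃ f : ι → S', ∀ᶠ x in 𝓝 p, VanishesAt (X' - ∑ i, f i • e' i) x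

variable {κ : Type} [Fintype κ] {x : κ → A'} {W' : Set P'} {W : Set P} {ψ : P' → P}

theorem FrameMap.coeff_eq (hS' : LocalAlg S') (h : FrameMap A x W' W ψ)
    {ι : Type} [Fintype ι] {e' : ι → A'} {e : ι → A} {p : P'} (he : IsFrameAt W e (ψ p))
    (hr : ∀ i, Related ψ (e' i).1 (e i).1) {X' : A'} {X : A} (hX : Related ψ X'.1 X.1)
    {f : ι ⊕ κ → S'} (hf : ∀ᶠ y in 𝓝 p, ZeroAt (X' - ∑ i, f i • Sum.elim e' x i) y) {g : ι → S}
    (hg : ∀ᶠ y in 𝓝 (ψ p), ZeroAt (X - ∑ i, g i • e i) y) (i : ι) :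
    (f (Sum.inl i) : P' → ℝ) p = (g i : P → ℝ) (ψ p) := by
  have h1 : ∀ᶠ y in 𝓝 p, y ∈ ψ ⁻¹' W → (f (Sum.inl i) : P' → ℝ) y = (g i : P → ℝ) (ψ y) := by
    filter_upwards [hf, h.cont.continuousAt.eventually hg, h.cont.continuousAt.eventually
      he.indep] with y hfx hgx hind hxW
    have := hind hxW (fun i => (f (Sum.inl i) : P' → ℝ) y - (g i : P → ℝ) (ψ y)) fun u => by
      have h2 := (zeroAt_sub_iff.1 hfx) ⟨(u : P → ℝ) ∘ ψ, h.pull u⟩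
      have h3 := (zeroAt_sub_iff.1 hgx) u
      rw [hX.val_eq (f := u) rfl] at h2
      rw [val_sum] at h2 h3
      simp only [val_smul, Fintype.sum_sum_type, Sum.elim_inl, Sum.elim_inr] at h2 h3
      have h4 : ∀ i, val (e' i) ⟨(u : P → ℝ) ∘ ψ, h.pull u⟩ y = val (e i) u (ψ y) :=
        fun i => (hr i).val_eq rfl y
      have h5 : ∀ k, val (x k) ⟨(u : P → ℝ) ∘ ψ, h.pull u⟩ y = 0 :=
        fun k => ((h.kernel k).val_eq (f := u) rfl y).trans (val_zero _ _)
      simp only [h4, h5, mul_zero, Finset.sum_const_zero, add_zero] at h2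
      simp only [sub_mul, Finset.sum_sub_distrib]
      linarith
    have h3 := congrFun this i
    simp only [Pi.zero_apply] at h3
    linarith
  have hne : (𝓝[ψ ⁻¹' W] p).NeBot := mem_closure_iff_nhdsWithin_neBot.1 (h.dense p)
  refine tendsto_nhds_unique_of_eventuallyEq
    ((hS'.cont _).continuousAt.tendsto.mono_left nhdsWithin_le_nhds)
    ((hS'.cont ⟨_, h.pull (g i)⟩).continuousAt.tendsto.mono_left
      (nhdsWithin_le_nhds (s := ψ ⁻¹' W))) ?_
  filter_upwards [nhdsWithin_le_nhds h1, self_mem_nhdsWithin] with y hx hxW using hx hxW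

theorem FrameMap.exists_vanishesAt (hS' : LocalAlg S') (hS : LocalAlg S)
    (h : FrameMap A x W' W ψ) (hW : Dense W) {X' : A'} {X : A} (hX : Related ψ X'.1 X.1) (p : P')
    (hv : VanishesAt X (ψ p)) : ∃ b : κ → S', VanishesAt (X' - ∑ k, b k • x k) p := by
  obtain ⟨ι, _, e', e, he', he, hr⟩ := h.frames p
  obtain ⟨f, hf⟩ := he'.gen X'
  obtain ⟨g, hg⟩ := he.gen X
  have hg0 : ∀ i, (g i : P → ℝ) (ψ p) = 0 :=
    he.coeff_eq_zero hS hW ((hS.vanishesAt hg).symm_sub.congr_sub hv)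
  have hf0 : ∀ i, (f (Sum.inl i) : P' → ℝ) p = 0 := fun i => by
    rw [h.coeff_eq hS' he hr hX hf hg, hg0]
  refine ⟨fun k => f (Sum.inr k), ?_⟩
  have h1 := hS'.vanishesAt hf
  rw [Fintype.sum_sum_type] at h1
  have h2 : VanishesAt (∑ i, f (Sum.inl i) • e' i) p :=
    VanishesAt.sum fun i _ => vanishesAt_smul (hf0 i) _
  have h3 := h1.add h2
  simp only [Sum.elim_inl, Sum.elim_inr] at h3
  convert h3 using 1
  abel
theorem FrameMap.pullable (hS' : LocalAlg S') (hS : LocalAlg S) (h : FrameMap A x W' W ψ)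
    (hW' : Dense W') : Pullable A' A ψ where
  cont := h.cont
  pull := h.pull
  vanishesAt X' X hX p hv := by
    obtain ⟨ι, _, e', e, he', he, hr⟩ := h.frames p
    obtain ⟨f, hf⟩ := he'.gen X'
    obtain ⟨g, hg⟩ := he.gen X
    have hf0 : ∀ i, (f i : P' → ℝ) p = 0 :=
      he'.coeff_eq_zero hS' hW' ((hS'.vanishesAt hf).symm_sub.congr_sub hv)
    refine (hS.vanishesAt hg).congr_sub (VanishesAt.sum fun i _ => vanishesAt_smul ?_ _)
    rw [← h.coeff_eq hS' he hr hX hf hg, hf0]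
  gen p := by
    obtain ⟨ι, _, e', e, he', he, hr⟩ := h.frames p
    refine ⟨ι ⊕ κ, inferInstance, Sum.elim e' x, Sum.elim e 0, fun i => ?_, fun X' => ?_⟩
    · rcases i with i | k
      · exact hr i
      · exact h.kernel k
    · obtain ⟨f, hf⟩ := he'.gen X'
      exact ⟨f, hS'.vanishesAt_eventually hf⟩

end Maps

/-! ## Existence, uniqueness and naturality of pullbacks -/

section MkForm

variable {P Q : Type*} {S : Subalgebra ℝ (P → ℝ)} {SQ : Subalgebra ℝ (Q → ℝ)}
  {A : Algebroid S} {AQ : Algebroid SQ} [TopologicalSpace P]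

theorem val_ext {X Y : A} (h : ∀ f x, val X f x = val Y f x) : X = Y :=
  Subtype.ext (Derivation.ext fun f => Subtype.ext (funext fun x => h f x))

theorem update_rep {k : ℕ} {Rep : A → AQ → Prop} {v : Fin k → A} {w : Fin k → AQ}
    (h : ∀ i, Rep (v i) (w i)) (i : Fin k) {X : A} {Y : AQ} (hX : Rep X Y) :
    ∀ j, Rep (Function.update v i X j) (Function.update w i Y j) := by
  intro j
  by_cases hj : j = i
  · subst hj
    simpa using hX
  · simpa [hj] using h j

/-- A form on `A` from a form on `AQ` and representatives in `AQ` of the values of sections. -/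
theorem exists_form_of_rep {k : ℕ} (hS : LocalAlg S) (β : Form AQ k) (θ : P → Q)
    (Rep : P → A → AQ → Prop) (hex : ∀ p X, ∃ Y, Rep p X Y)
    (hadd : ∀ p X X' Y Y', Rep p X Y → Rep p X' Y' → Rep p (X + X') (Y + Y'))
    (hsmul : ∀ p (f : S) X Y, Rep p X Y → Rep p (f • X) (cst SQ ((f : P → ℝ) p) • Y))
    (hwd : ∀ p (v : Fin k → A) (w w' : Fin k → AQ), (∀ i, Rep p (v i) (w i)) →
      (∀ i, Rep p (v i) (w' i)) → (β w : Q → ℝ) (θ p) = (β w' : Q → ℝ) (θ p))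
    (hsm : ∀ (v : Fin k → A) (p : P), ∃ g : S, ∀ᶠ x in 𝓝 p, ∃ w : Fin k → AQ,
      (∀ i, Rep x (v i) (w i)) ∧ (g : P → ℝ) x = (β w : Q → ℝ) (θ x)) :
    ∃ α : Form A k, ∀ (v : Fin k → A) (p : P) (w : Fin k → AQ), (∀ i, Rep p (v i) (w i)) →
      (α v : P → ℝ) p = (β w : Q → ℝ) (θ p) := by
  classical
  choose rep hrep using hex
  let α0 : (Fin k → A) → P → ℝ := fun v p => (β (fun i => rep p (v i)) : Q → ℝ) (θ p)
  have hα0 : ∀ (v : Fin k → A) (p : P) (w : Fin k → AQ), (∀ i, Rep p (v i) (w i)) →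
      α0 v p = (β w : Q → ℝ) (θ p) := fun v p w hw => hwd p v _ _ (fun i => hrep p (v i)) hw
  have hmem : ∀ v, α0 v ∈ S := fun v => by
    refine hS.glue _ fun p => ?_
    obtain ⟨g, hg⟩ := hsm v p
    refine ⟨g, hg.mono fun x hx => ?_⟩
    obtain ⟨w, hw, e⟩ := hx
    rw [hα0 v x w hw, e]
  have hadd' : ∀ (v : Fin k → A) (i : Fin k) (X Y : A), α0 (Function.update v i (X + Y)) =
      α0 (Function.update v i X) + α0 (Function.update v i Y) := by
    intro v i X Y
    funext p
    have h1 : ∀ j, Rep p (v j) (rep p (v j)) := fun j => hrep p (v j)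
    rw [Pi.add_apply, hα0 _ p _ (update_rep h1 i (hadd p X Y _ _ (hrep p X) (hrep p Y))),
      hα0 _ p _ (update_rep h1 i (hrep p X)), hα0 _ p _ (update_rep h1 i (hrep p Y)),
      AlternatingMap.map_update_add]
    rfl
  have hsmul' : ∀ (v : Fin k → A) (i : Fin k) (f : S) (X : A),
      α0 (Function.update v i (f • X)) = (f : P → ℝ) * α0 (Function.update v i X) := by
    intro v i f X
    funext p
    have h1 : ∀ j, Rep p (v j) (rep p (v j)) := fun j => hrep p (v j)
    rw [Pi.mul_apply, hα0 _ p _ (update_rep h1 i (hsmul p f X _ (hrep p X))),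
      hα0 _ p _ (update_rep h1 i (hrep p X)), AlternatingMap.map_update_smul]
    rfl
  refine ⟨{ toFun := fun v => ⟨α0 v, hmem v⟩
            map_update_add' := fun {d} v i X Y => ?_
            map_update_smul' := fun {d} v i f X => ?_
            map_eq_zero_of_eq' := fun v i j hv hij => ?_ }, fun v p w hw => hα0 v p w hw⟩
  · rw [Subsingleton.elim d (instDecidableEqFin k)]
    exact Subtype.ext (hadd' v i X Y)
  · rw [Subsingleton.elim d (instDecidableEqFin k)]
    exact Subtype.ext (hsmul' v i f X)
  · refine Subtype.ext (funext fun p => ?_)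
    change (β (fun i => rep p (v i)) : Q → ℝ) (θ p) = 0
    rw [β.map_eq_zero_of_eq _ (by simp only [hv]) hij]
    rfl

end MkForm

section Pullback

variable {P P' : Type*} {S : Subalgebra ℝ (P → ℝ)} {S' : Subalgebra ℝ (P' → ℝ)}
  {A : Algebroid S} {A' : Algebroid S'} [TopologicalSpace P] [TopologicalSpace P']
  {ψ : P' → P}

theorem Related.neg {X' : A'} {X : A} (h : Related ψ X'.1 X.1) : Related ψ (-X').1 (-X).1 :=
  fun f f' e => by
    funext x
    exact congrArg Neg.neg (h.val_eq e x)

theorem Related.sub {X' Y' : A'} {X Y : A} (h : Related ψ X'.1 X.1)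
    (h' : Related ψ Y'.1 Y.1) : Related ψ (X' - Y').1 (X - Y).1 := by
  rw [sub_eq_add_neg, sub_eq_add_neg]
  exact h.add h'.neg

theorem Related.lie {X' Y' : A'} {X Y : A} (h : Related ψ X'.1 X.1) (h' : Related ψ Y'.1 Y.1) : Related ψ ⁅X', Y'⁆.1 ⁅X, Y⁆.1 := by
  intro f f' e
  have h1 := h (Y'.1 f) (Y.1 f') (h' f f' e)
  have h2 := h' (X'.1 f) (X.1 f') (h f f' e)
  change ((⁅X'.1, Y'.1⁆ f : S') : P' → ℝ) = ((⁅X.1, Y.1⁆ f' : S) : P → ℝ) ∘ ψ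
  rw [Derivation.commutator_apply, Derivation.commutator_apply]
  funext x
  exact congrArg₂ (· - ·) (congrFun h1 x) (congrFun h2 x)

theorem Related.smul_cst {X' : A'} {X : A} (h : Related ψ X'.1 X.1) (r : ℝ) :
    Related ψ (cst S' r • X').1 (cst S r • X).1 := h.smul rfl

theorem eventually_vanishesAt_sub_cst {ι : Type*} [Fintype ι] {X : A} {f : ι → S} {e : ι → A}
    {p : P} (h : VanishesAt (X - ∑ i, f i • e i) p) :
    VanishesAt (X - ∑ i, cst S ((f i : P → ℝ) p) • e i) p := by
  refine h.trans_sub ?_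
  rw [← Finset.sum_sub_distrib]
  exact VanishesAt.sum fun i _ => vanishesAt_smul_sub (by rfl) _

theorem Pullable.isPullbackForm (h : Pullable A' A ψ) {k : ℕ} {α : Form A k} {η : Form A' k}
    (hg : ∀ p, ∃ (ι : Type) (_ : Fintype ι) (e' : ι → A') (e : ι → A),
      (∀ i, Related ψ (e' i).1 (e i).1) ∧
      (∀ X' : A', ∃ f : ι → S', VanishesAt (X' - ∑ i, f i • e' i) p) ∧
      ∀ r : Fin k → ι, (η fun j => e' (r j) : P' → ℝ) p = (α fun j => e (r j) : P → ℝ) (ψ p)) :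
    IsPullbackForm ψ α η := by
  intro X' X hX
  funext p
  obtain ⟨ι, _, e', e, hr, hgen, hη⟩ := hg p
  choose f hf using hgen
  have h1 : ∀ j, VanishesAt (X' j - ∑ i, cst S' ((f (X' j) i : P' → ℝ) p) • e' i) p :=
    fun j => eventually_vanishesAt_sub_cst (hf (X' j))
  have h2 : ∀ j, VanishesAt (X j - ∑ i, cst S ((f (X' j) i : P' → ℝ) p) • e i) (ψ p) :=
    fun j => h.vanishesAt _ _ ((hX j).sub (Related.sum fun i => (hr i).smul_cst _)) p (h1 j)
  rw [Function.comp_apply, form_congr η h1, form_congr α h2, form_sum_apply, form_sum_apply]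
  simp only [AddSubmonoidClass.coe_finsetSum, Finset.sum_apply, Subalgebra.coe_mul, Pi.mul_apply,
    hη, SubmonoidClass.coe_finsetProd, Finset.prod_apply, cst_apply]

theorem Pullable.exists_rep (h : Pullable A' A ψ) (p : P') (X' : A') :
    ∃ (Y' : A') (X : A), Related ψ Y'.1 X.1 ∧ VanishesAt (X' - Y') p := by
  obtain ⟨ι, _, e', e, hr, hgen⟩ := h.gen p
  obtain ⟨f, hf⟩ := hgen X'
  exact ⟨_, _, Related.sum fun i => (hr i).smul_cst _,
    eventually_vanishesAt_sub_cst hf.self_of_nhds⟩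

theorem Pullable.existsUnique (hS' : LocalAlg S') (h : Pullable A' A ψ) {k : ℕ} (α : Form A k) :
    ∃! α' : Form A' k, IsPullbackForm ψ α α' := by
  let Rep : P' → A' → A → Prop := fun p X' X =>
    ∃ Y' : A', Related ψ Y'.1 X.1 ∧ VanishesAt (X' - Y') p
  obtain ⟨α', hα'⟩ := exists_form_of_rep (A := A') hS' α ψ Rep
    (fun p X' => by
      obtain ⟨Y', X, h1, h2⟩ := h.exists_rep p X'
      exact ⟨X, Y', h1, h2⟩)
    (by
      rintro p X' Z' X Z ⟨Y1, h1, h2⟩ ⟨Y2, h3, h4⟩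
      refine ⟨Y1 + Y2, h1.add h3, ?_⟩
      rw [add_sub_add_comm]
      exact h2.add h4)
    (by
      rintro p f X' X ⟨Y1, h1, h2⟩
      refine ⟨cst S' ((f : P' → ℝ) p) • Y1, h1.smul_cst _, ?_⟩
      refine VanishesAt.trans_sub (Y := f • Y1) ?_ (vanishesAt_smul_sub (by rfl) _)
      rw [← smul_sub]
      exact h2.smul f)
    (by
      intro p v w w' hw hw'
      refine form_congr α fun i => ?_
      obtain ⟨Y1, h1, h2⟩ := hw i
      obtain ⟨Y2, h3, h4⟩ := hw' i
      exact h.vanishesAt _ _ (h1.sub h3) p (h2.symm_sub.trans_sub h4))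
    (by
      intro v p
      obtain ⟨ι, _, e', e, hr, hgen⟩ := h.gen p
      choose f hf using hgen
      refine ⟨∑ r : Fin k → ι, (∏ j, f (v j) (r j)) * ⟨_, h.pull (α fun j => e (r j))⟩, ?_⟩
      filter_upwards [eventually_all.2 fun j => hf (v j)] with x hx
      refine ⟨fun j => ∑ i, cst S ((f (v j) i : P' → ℝ) x) • e i, fun j =>
        ⟨_, Related.sum fun i => (hr i).smul_cst _, eventually_vanishesAt_sub_cst (hx j)⟩, ?_⟩
      rw [form_sum_apply]
      simp only [AddSubmonoidClass.coe_finsetSum, Finset.sum_apply, Subalgebra.coe_mul,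
        Pi.mul_apply, SubmonoidClass.coe_finsetProd, Finset.prod_apply, cst_apply,
        Function.comp_apply])
  refine ⟨α', fun X' X hX => funext fun p => hα' _ _ _ fun i => ⟨X' i, hX i, ?_⟩,
    fun η hη => ?_⟩
  · rw [sub_self]
    exact vanishesAt_zero p
  · refine AlternatingMap.ext fun v => Subtype.ext (funext fun p => ?_)
    choose Y' X h1 h2 using h.exists_rep p
    rw [form_congr η fun i => h2 (v i), hη _ _ fun i => h1 (v i)]
    exact (hα' v p _ fun i => ⟨_, h1 (v i), h2 (v i)⟩).symm

/-- A pullable map along which sections can be lifted, and which is étale on a dense set. -/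
structure EtaleMap (A' : Algebroid S') (A : Algebroid S) (W' : Set P') (ψ : P' → P) : Prop
    extends Pullable A' A ψ where
  dense : Dense W'
  etale : ∀ p ∈ W', ∀ f' : S', ∃ f : S, (f' : P' → ℝ) =ᶠ[𝓝 p] (f : P → ℝ) ∘ ψ
  lift : ∀ X : A, ∃ X' : A', Related ψ X'.1 X.1

variable {W' : Set P'}

theorem val_congr_of_eventuallyEq (hS : LocalAlg S) (X : A) {f g : S} {p : P}
    (h : (f : P → ℝ) =ᶠ[𝓝 p] g) : val X f p = val X g p := by
  obtain ⟨χ, h1, h0⟩ := hS.bump p _ h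
  have e : χ * f = χ * g := by
    refine Subtype.ext (funext fun x => ?_)
    change (χ : P → ℝ) x * (f : P → ℝ) x = (χ : P → ℝ) x * (g : P → ℝ) x
    by_cases hx : x ∈ {x | (f : P → ℝ) x = (g : P → ℝ) x}
    · rw [show (f : P → ℝ) x = (g : P → ℝ) x from hx]
    · rw [h0 x hx, zero_mul, zero_mul]
  have key : ∀ u : S, val X (χ * u) p = val X u p + (u : P → ℝ) p * val X χ p := by
    intro u
    have := congrArg (fun w : S => (w : P → ℝ) p) (X.1.leibniz χ u)
    change val X (χ * u) p = (χ : P → ℝ) p * val X u p + (u : P → ℝ) p * val X χ p at this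
    rwa [h1.self_of_nhds, one_mul] at this
  have h2 := key f
  rw [e, key g, h.eq_of_nhds] at h2
  linarith

/-- Equality of two sections near a point can be tested on pulled back functions. -/
theorem EtaleMap.zeroAt_of (hS' : LocalAlg S') (h : EtaleMap A' A W' ψ) {X' : A'} {U : Set P'}
    (hU : IsOpen U) (hz : ∀ x ∈ U, ∀ f : S, val X' ⟨_, h.pull f⟩ x = 0) :
    ∀ x ∈ U, ZeroAt X' x := by
  have h1 : ∀ x ∈ W' ∩ U, ZeroAt X' x := by
    rintro x ⟨hx, hxU⟩ f'
    obtain ⟨f, hf⟩ := h.etale x hx f'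
    rw [val_congr_of_eventuallyEq hS' X' (g := ⟨_, h.pull f⟩) hf, hz x hxU]
  intro x hx f'
  have h2 : x ∈ closure (W' ∩ U) := by
    rw [inter_comm]
    exact h.dense.open_subset_closure_inter hU hx
  have h3 : IsClosed {x | val X' f' x = 0} := isClosed_eq (hS'.cont (X'.1 f')) continuous_const
  exact h3.closure_subset_iff.2 (fun y hy => h1 y hy f') h2

theorem EtaleMap.zeroAt_of_related (hS' : LocalAlg S') (h : EtaleMap A' A W' ψ) {X' : A'} {X : A}
    (hX : Related ψ X'.1 X.1) {p : P'} (hz : ∀ᶠ x in 𝓝 (ψ p), ZeroAt X x) :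
    ∀ᶠ x in 𝓝 p, ZeroAt X' x := by
  obtain ⟨U, hU, hUo, hp⟩ := eventually_nhds_iff.1 (h.cont.continuousAt.eventually hz)
  exact eventually_nhds_iff.2 ⟨U, h.zeroAt_of hS' hUo fun x hx f =>
    (hX.val_eq (f := f) rfl x).trans (hU x hx f), hUo, hp⟩

/-- Lifts of local generators are local generators. -/
theorem EtaleMap.gen_of_related (hS' : LocalAlg S') (h : EtaleMap A' A W' ψ) {p : P'} {ι : Type}
    [Fintype ι] {e' : ι → A'} {e : ι → A} (hr : ∀ i, Related ψ (e' i).1 (e i).1)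
    (hgen : ∀ X : A, ∃ f : ι → S, ∀ᶠ x in 𝓝 (ψ p), VanishesAt (X - ∑ i, f i • e i) x)
    (X' : A') : ∃ f : ι → S', ∀ᶠ x in 𝓝 p, VanishesAt (X' - ∑ i, f i • e' i) x := by
  obtain ⟨κ, _, u', u, hu, hgen'⟩ := h.gen p
  obtain ⟨a, ha⟩ := hgen' X'
  choose b hb using fun k => hgen (u k)
  have h1 : ∀ k, ∀ᶠ x in 𝓝 p,
      VanishesAt (u' k - ∑ i, (⟨_, h.pull (b k i)⟩ : S') • e' i) x := fun k =>
    hS'.vanishesAt_eventually (h.zeroAt_of_related hS'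
      ((hu k).sub (Related.sum fun i => (hr i).smul rfl)) ((hb k).mono fun x hx => hx.zeroAt))
  refine ⟨fun i => ∑ k, a k * ⟨_, h.pull (b k i)⟩, ?_⟩
  filter_upwards [ha, eventually_all.2 h1] with x hx h1x
  refine hx.trans_sub ?_
  have : ∑ i, (∑ k, a k * (⟨_, h.pull (b k i)⟩ : S')) • e' i =
      ∑ k, a k • ∑ i, (⟨_, h.pull (b k i)⟩ : S') • e' i := by
    simp only [Finset.sum_smul, Finset.smul_sum, mul_smul]
    exact Finset.sum_comm
  rw [this, ← Finset.sum_sub_distrib]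
  refine VanishesAt.sum fun k _ => ?_
  rw [← smul_sub]
  exact (h1x k).smul (a k)

end Pullback

section Square

variable {P P' R R' : Type*} {S : Subalgebra ℝ (P → ℝ)} {S' : Subalgebra ℝ (P' → ℝ)}
  {SR : Subalgebra ℝ (R → ℝ)} {SR' : Subalgebra ℝ (R' → ℝ)}
  {A : Algebroid S} {A' : Algebroid S'} {AR : Algebroid SR} {AR' : Algebroid SR'}
  [TopologicalSpace P] [TopologicalSpace P'] [TopologicalSpace R] [TopologicalSpace R']
  {ψ : R → P} {ψ' : R' → P'} {g : P' → P} {G : R' → R} {W' : Set P'}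

/-- In a commutative square with `g` étale, a lift of `Y` to `R'` is related to the lift to `P'` of
the section related to `Y`. -/
theorem related_of_square (hS' : LocalAlg S') (hSR' : LocalAlg SR') (hg : EtaleMap A' A W' g)
    (hG : ∀ f : SR, (f : R → ℝ) ∘ G ∈ SR') (hψ : ∀ f : S, (f : P → ℝ) ∘ ψ ∈ SR)
    (hψ' : ∀ f : S', (f : P' → ℝ) ∘ ψ' ∈ SR') (hc : Continuous ψ') (hd : Dense (ψ' ⁻¹' W'))
    (comm : ∀ x, ψ (G x) = g (ψ' x)) {Y' : AR'} {Y : AR} {X : A} {X' : A'}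
    (h1 : Related G Y'.1 Y.1) (h2 : Related ψ Y.1 X.1) (h3 : Related g X'.1 X.1) :
    Related ψ' Y'.1 X'.1 := by
  intro f1 f' e
  have key : ∀ x ∈ ψ' ⁻¹' W', val Y' f1 x = val X' f' (ψ' x) := by
    intro x hx
    obtain ⟨f, hf⟩ := hg.etale _ hx f'
    have e1 : ((⟨_, hG ⟨_, hψ f⟩⟩ : SR') : R' → ℝ) = ((⟨_, hψ' ⟨_, hg.pull f⟩⟩ : SR') : R' → ℝ) :=
      funext fun y => congrArg (f : P → ℝ) (comm y)
    have e2 : (f1 : R' → ℝ) =ᶠ[𝓝 x] ((⟨_, hG ⟨_, hψ f⟩⟩ : SR') : R' → ℝ) := by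
      rw [e1, e]
      exact hc.continuousAt.eventually hf
    rw [val_congr_of_eventuallyEq hSR' Y' e2, h1.val_eq (f := ⟨_, hψ f⟩) rfl,
      h2.val_eq (f := f) rfl, comm, ← h3.val_eq (f' := ⟨_, hg.pull f⟩) rfl]
    exact (val_congr_of_eventuallyEq hS' X' (g := ⟨_, hg.pull f⟩) hf).symm
  refine Continuous.ext_on hd (hSR'.cont _) (hSR'.cont ⟨_, hψ' (X'.1 f')⟩) key

/-- A commutative square of maps along which forms can be pulled back, with two étale sides. -/
structure EtaleSquare (AR' : Algebroid SR') (AR : Algebroid SR) (A' : Algebroid S')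
    (A : Algebroid S) (WR' : Set R') (W' : Set P') (ψ : R → P) (ψ' : R' → P') (g : P' → P)
    (G : R' → R) : Prop where
  localAlg : LocalAlg S'
  localAlg' : LocalAlg SR'
  localAlg'' : LocalAlg SR
  left : EtaleMap A' A W' g
  right : EtaleMap AR' AR WR' G
  bot : Pullable AR A ψ
  top : Pullable AR' A' ψ'
  dense : Dense (ψ' ⁻¹' W')
  comm : ∀ x, ψ (G x) = g (ψ' x)

variable {WR' : Set R'}

theorem EtaleSquare.gen (h : EtaleSquare AR' AR A' A WR' W' ψ ψ' g G) (c : R') :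
    ∃ (ι : Type) (_ : Fintype ι) (e' : ι → AR') (e : ι → AR) (u : ι → A) (u' : ι → A'),
      (∀ i, Related G (e' i).1 (e i).1) ∧ (∀ i, Related ψ (e i).1 (u i).1) ∧
      (∀ i, Related g (u' i).1 (u i).1) ∧ (∀ i, Related ψ' (e' i).1 (u' i).1) ∧
      ∀ X' : AR', ∃ f : ι → SR', VanishesAt (X' - ∑ i, f i • e' i) c := by
  obtain ⟨ι, _, e, u, hr, hgen⟩ := h.bot.gen (G c)
  choose e' he' using fun i => h.right.lift (e i)
  choose u' hu' using fun i => h.left.lift (u i)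
  refine ⟨ι, inferInstance, e', e, u, u', he', hr, hu', fun i => ?_, fun X' => ?_⟩
  · exact related_of_square h.localAlg h.localAlg' h.left h.right.pull h.bot.pull h.top.pull
      h.top.cont h.dense h.comm (he' i) (hr i) (hu' i)
  · obtain ⟨f, hf⟩ := h.right.gen_of_related h.localAlg' he' hgen X'
    exact ⟨f, hf.self_of_nhds⟩

variable {k : ℕ} {α : Form A k} {β : Form AR k} {α' : Form A' k} {β' : Form AR' k}

theorem EtaleSquare.top_of_right (h : EtaleSquare AR' AR A' A WR' W' ψ ψ' g G)
    (hα : IsPullbackForm g α α') (hβ : IsPullbackForm ψ α β) (hβ' : IsPullbackForm G β β') :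
    IsPullbackForm ψ' α' β' := by
  refine h.top.isPullbackForm fun c => ?_
  obtain ⟨ι, i1, e', e, u, u', h1, h2, h3, h4, hgen⟩ := h.gen c
  refine ⟨ι, i1, e', u', h4, hgen, fun r => ?_⟩
  rw [hβ' _ _ fun j => h1 (r j), hα _ _ fun j => h3 (r j), hβ _ _ fun j => h2 (r j)]
  exact congrArg (α fun j => u (r j) : P → ℝ) (h.comm c)

theorem EtaleSquare.right_of_top (h : EtaleSquare AR' AR A' A WR' W' ψ ψ' g G)
    (hα : IsPullbackForm g α α') (hβ : IsPullbackForm ψ α β) (hβ' : IsPullbackForm ψ' α' β') :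
    IsPullbackForm G β β' := by
  refine h.right.toPullable.isPullbackForm fun c => ?_
  obtain ⟨ι, i1, e', e, u, u', h1, h2, h3, h4, hgen⟩ := h.gen c
  refine ⟨ι, i1, e', e, h1, hgen, fun r => ?_⟩
  rw [hβ' _ _ fun j => h4 (r j), hα _ _ fun j => h3 (r j), hβ _ _ fun j => h2 (r j)]
  exact congrArg (α fun j => u (r j) : P → ℝ) (h.comm c).symm

end Square

section Alternating

variable {R M N : Type*} [CommRing R] [AddCommGroup M] [Module R M] [AddCommGroup N] [Module R N]

theorem alternatingMap_sum_apply {ι κ : Type*} (s : Finset κ) (f : κ → M [⋀^ι]→ₗ[R] N)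
    (v : ι → M) : (∑ j ∈ s, f j) v = ∑ j ∈ s, f j v := by
  classical
  induction s using Finset.induction_on with
  | empty => simp
  | insert i s hi ih => rw [Finset.sum_insert hi, Finset.sum_insert hi, ← ih]; rfl

theorem mul'_domCoprod_summand {ι κ : Type*} [Fintype ι] [Fintype κ] [DecidableEq ι]
    [DecidableEq κ] (a : M [⋀^ι]→ₗ[R] R) (b : M [⋀^κ]→ₗ[R] R) (σ : Equiv.Perm (ι ⊕ κ))
    (v : ι ⊕ κ → M) :
    LinearMap.mul' R R (AlternatingMap.domCoprod.summand a b (Quotient.mk'' σ) v) =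
      (Equiv.Perm.sign σ : ℤ) •
        ((a fun i => v (σ (Sum.inl i))) * b fun i => v (σ (Sum.inr i))) := by
  rw [AlternatingMap.domCoprod.summand_mk'']
  rcases Int.units_eq_one_or (Equiv.Perm.sign σ) with h | h
  · rw [h]
    simp
  · rw [h]
    simp

theorem mul'_domCoprod {ι κ : Type*} [Fintype ι] [Fintype κ] [DecidableEq ι]
    [DecidableEq κ] (a : M [⋀^ι]→ₗ[R] R) (b : M [⋀^κ]→ₗ[R] R) (v : ι ⊕ κ → M) :
    LinearMap.mul' R R (a.domCoprod b v) =
      ∑ σ, LinearMap.mul' R R (AlternatingMap.domCoprod.summand a b σ v) := by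
  rw [AlternatingMap.domCoprod_apply, sum_apply, map_sum]

end Alternating

section Operations

variable {P P' : Type*} {S : Subalgebra ℝ (P → ℝ)} {S' : Subalgebra ℝ (P' → ℝ)}
  {A : Algebroid S} {A' : Algebroid S'} {ψ : P' → P}

theorem IsPullbackForm.wedge {k l : ℕ} {α : Form A k} {β : Form A l} {α' : Form A' k}
    {β' : Form A' l} (hα : IsPullbackForm ψ α α') (hβ : IsPullbackForm ψ β β') :
    IsPullbackForm ψ (wedge α β) (wedge α' β') := by
  intro X' X hX
  funext p
  simp only [TDual.wedge, AlternatingMap.domDomCongr_apply, LinearMap.compAlternatingMap_apply,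
    mul'_domCoprod, AddSubmonoidClass.coe_finsetSum, Finset.sum_apply, Function.comp_apply]
  refine Finset.sum_congr rfl fun σ _ => ?_
  refine Quotient.inductionOn' σ fun σ => ?_
  have h1 := congrFun (hα _ _ fun i => hX (finSumFinEquiv (σ (Sum.inl i)))) p
  have h2 := congrFun (hβ _ _ fun i => hX (finSumFinEquiv (σ (Sum.inr i)))) p
  rw [mul'_domCoprod_summand, mul'_domCoprod_summand]
  exact congrArg (((Equiv.Perm.sign σ : ℤ)) • ·) (congrArg₂ (· * ·) h1 h2)

theorem IsPullbackForm.zero {k : ℕ} : IsPullbackForm ψ (0 : Form A k) (0 : Form A' k) :=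
  fun _ _ _ => rfl

theorem IsPullbackForm.wedgeTwo {F : Form A 2} {F' : Form A' 2} (hF : IsPullbackForm ψ F F')
    {ρ : ∀ k, Form A k} {ρ' : ∀ k, Form A' k} (hρ : ∀ k, IsPullbackForm ψ (ρ k) (ρ' k)) :
    ∀ k, IsPullbackForm ψ (wedgeTwo F ρ k) (wedgeTwo F' ρ' k)
  | 0 => IsPullbackForm.zero
  | 1 => IsPullbackForm.zero
  | k + 2 => fun _ _ hX => (hF.wedge (hρ k)) _ _ fun _ => hX _

theorem IsPullbackForm.expWedge {F : Form A 2} {F' : Form A' 2} (hF : IsPullbackForm ψ F F')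
    {ρ : ∀ k, Form A k} {ρ' : ∀ k, Form A' k} (hρ : ∀ k, IsPullbackForm ψ (ρ k) (ρ' k)) (k : ℕ) :
    IsPullbackForm ψ (expWedge F ρ k) (expWedge F' ρ' k) := by
  have key : ∀ j k, IsPullbackForm ψ ((TDual.wedgeTwo F)^[j] ρ k)
      ((TDual.wedgeTwo F')^[j] ρ' k) := by
    intro j
    induction j with
    | zero => exact hρ
    | succ j ih =>
      intro k
      rw [Function.iterate_succ_apply', Function.iterate_succ_apply']
      exact hF.wedgeTwo ih k
  intro X' X hX
  funext p
  simp only [TDual.expWedge, alternatingMap_sum_apply, AddSubmonoidClass.coe_finsetSum,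
    Finset.sum_apply, Function.comp_apply]
  refine Finset.sum_congr rfl fun j _ => ?_
  exact congrArg (((j.factorial : ℝ)⁻¹) * ·) (congrFun (key j k X' X hX) p)

variable [TopologicalSpace P] [TopologicalSpace P']

theorem extD_apply {k : ℕ} (α : Form A (k + 1)) (X : Fin (k + 2) → A) (p : P) :
    (extD α X : P → ℝ) p =
      (∑ i : Fin (k + 2), (-1 : ℝ) ^ (i : ℕ) * val (X i) (α (i.removeNth X)) p) -
      ∑ i : Fin (k + 1), ∑ j ∈ Finset.Ici i, (-1 : ℝ) ^ ((i : ℕ) + (j : ℕ)) *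
        (α (Matrix.vecCons ⁅X i.castSucc, X j.succ⁆
          (j.removeNth (i.castSucc.removeNth X))) : P → ℝ) p := by
  simp only [extD, AddSubgroupClass.coe_sub, Pi.sub_apply, AddSubmonoidClass.coe_finsetSum,
    Finset.sum_apply, Subalgebra.coe_mul, Pi.mul_apply, Subalgebra.coe_pow, Pi.pow_apply,
    Subalgebra.coe_neg, Pi.neg_apply, Subalgebra.coe_one, Pi.one_apply]
  rfl

theorem related_vecCons_removeNth {k : ℕ} {X' : Fin (k + 2) → A'} {X : Fin (k + 2) → A}
    (hX : ∀ i, Related ψ (X' i).1 (X i).1) (i j : Fin (k + 1)) (l : Fin (k + 1)) :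
    Related ψ (Matrix.vecCons ⁅X' i.castSucc, X' j.succ⁆
      (j.removeNth (i.castSucc.removeNth X')) l).1
      (Matrix.vecCons ⁅X i.castSucc, X j.succ⁆ (j.removeNth (i.castSucc.removeNth X)) l).1 := by
  refine Fin.cases ?_ (fun l => ?_) l
  · exact (hX _).lie (hX _)
  · exact hX _

theorem IsPullbackForm.extD {k : ℕ} {α : Form A (k + 1)} {α' : Form A' (k + 1)}
    (h : IsPullbackForm ψ α α') {X' : Fin (k + 2) → A'} {X : Fin (k + 2) → A}
    (hX : ∀ i, Related ψ (X' i).1 (X i).1) (p : P') :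
    (extD α' X' : P' → ℝ) p = (extD α X : P → ℝ) (ψ p) := by
  rw [extD_apply, extD_apply]
  congr 1
  · refine Finset.sum_congr rfl fun i _ => ?_
    exact congrArg _ ((hX i).val_eq (h (i.removeNth X') (i.removeNth X) fun j => hX _) p)
  · refine Finset.sum_congr rfl fun i _ => Finset.sum_congr rfl fun j _ => ?_
    rw [h _ _ (related_vecCons_removeNth hX i j)]
    rfl

theorem extD_congr (hS : LocalAlg S) {k : ℕ} (α : Form A (k + 1))
    {X Y : Fin (k + 2) → A} {p : P} (h : ∀ i, ∀ᶠ x in 𝓝 p, ZeroAt (X i - Y i) x) :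
    (extD α X : P → ℝ) p = (extD α Y : P → ℝ) p := by
  have hv : ∀ᶠ x in 𝓝 p, ∀ i, VanishesAt (X i - Y i) x :=
    eventually_all.2 fun i => hS.vanishesAt_eventually (h i)
  rw [extD_apply, extD_apply]
  congr 1
  · refine Finset.sum_congr rfl fun i _ => ?_
    rw [zeroAt_sub_iff.1 (h i).self_of_nhds, val_congr_of_eventuallyEq hS (Y i)
      (f := α (i.removeNth X)) (g := α (i.removeNth Y))
      (hv.mono fun x hx => form_congr α fun j => hx _)]
  · refine Finset.sum_congr rfl fun i _ => Finset.sum_congr rfl fun j _ => ?_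
    congr 1
    refine form_congr α fun l => ?_
    refine Fin.cases ?_ (fun l => hv.self_of_nhds _) l
    refine hS.vanishesAt ?_
    change ∀ᶠ x in 𝓝 p, ZeroAt (⁅X i.castSucc, X j.succ⁆ - ⁅Y i.castSucc, Y j.succ⁆) x
    filter_upwards [(h i.castSucc).eventually_nhds, (h j.succ).eventually_nhds] with x h1 h2
    rw [zeroAt_sub_iff]
    intro f
    have e : ∀ Z Z' : A, val ⁅Z, Z'⁆ f x = val Z (Z'.1 f) x - val Z' (Z.1 f) x := by
      intro Z Z'
      change ((⁅Z.1, Z'.1⁆ f : S) : P → ℝ) x = _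
      rw [Derivation.commutator_apply]
      rfl
    rw [e, e, zeroAt_sub_iff.1 h1.self_of_nhds, zeroAt_sub_iff.1 h2.self_of_nhds,
      val_congr_of_eventuallyEq hS _ (f := (X j.succ).1 f) (g := (Y j.succ).1 f)
        (h2.mono fun y hy => zeroAt_sub_iff.1 hy f),
      val_congr_of_eventuallyEq hS _ (f := (X i.castSucc).1 f) (g := (Y i.castSucc).1 f)
        (h1.mono fun y hy => zeroAt_sub_iff.1 hy f)]

/-- Near the points where the map is étale every section is a lift. -/
theorem EtaleMap.exists_related_near {W' : Set P'}
    (h : EtaleMap A' A W' ψ) {p : P'} (hp : p ∈ W') (X' : A') :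
    ∃ (Y' : A') (Y : A), Related ψ Y'.1 Y.1 ∧ ∀ᶠ x in 𝓝 p, ZeroAt (X' - Y') x := by
  obtain ⟨ι, _, e', e, hr, hgen⟩ := h.gen p
  obtain ⟨f, hf⟩ := hgen X'
  choose g hg using fun i => h.etale p hp (f i)
  refine ⟨∑ i, (⟨_, h.pull (g i)⟩ : S') • e' i, ∑ i, g i • e i,
    Related.sum fun i => (hr i).smul rfl, ?_⟩
  filter_upwards [hf, eventually_all.2 hg] with x hx hgx
  refine (hx.trans_sub ?_).zeroAt
  rw [← Finset.sum_sub_distrib]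
  exact VanishesAt.sum fun i _ => vanishesAt_smul_sub (hgx i) _

theorem append_update_right {n k : ℕ} {α : Type*} (X : Fin n → α) (v : Fin k → α) (i : Fin k)
    (x : α) : Fin.append X (Function.update v i x) =
      Function.update (Fin.append X v) (Fin.natAdd n i) x := by
  funext j
  refine Fin.addCases (fun j => ?_) (fun j => ?_) j
  · rw [Fin.append_left, Function.update_of_ne, Fin.append_left]
    intro e
    have := congrArg Fin.val e
    simp at this
    omega
  · by_cases h : j = i
    · subst h
      simp
    · have h' : Fin.natAdd n j ≠ Fin.natAdd n i := fun e => h (Fin.natAdd_injective _ _ e)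
      simp [h, h']

/-- The interior product with several sections. -/
def contract {n k : ℕ} (ζ : Form A (n + k)) (X : Fin n → A) : Form A k where
  toFun v := ζ (Fin.append X v)
  map_update_add' {d} v i x y := by
    rw [Subsingleton.elim d (instDecidableEqFin k)]
    simp only [append_update_right, AlternatingMap.map_update_add]
  map_update_smul' {d} v i c x := by
    rw [Subsingleton.elim d (instDecidableEqFin k)]
    simp only [append_update_right, AlternatingMap.map_update_smul]
  map_eq_zero_of_eq' v i j hv hij := by
    refine ζ.map_eq_zero_of_eq _ (i := Fin.natAdd n i) (j := Fin.natAdd n j) ?_ ?_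
    · simpa using hv
    · simpa using hij

theorem contract_eq_zero {n k : ℕ} (ζ : Form A (n + k)) (X : Fin n → A) {v : Fin k → A}
    {i : Fin k} {j : Fin n} (h : v i = X j) : contract ζ X v = 0 := by
  refine ζ.map_eq_zero_of_eq _ (i := Fin.castAdd k j) (j := Fin.natAdd n i) ?_ ?_
  · simp [h]
  · intro e
    have := congrArg Fin.val e
    simp at this
    omega

theorem IsPullbackForm.contract {n k : ℕ} {ζ : Form A (n + k)} {ζ' : Form A' (n + k)}
    (h : IsPullbackForm ψ ζ ζ') {X' : Fin n → A'} {X : Fin n → A}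
    (hX : ∀ i, Related ψ (X' i).1 (X i).1) :
    IsPullbackForm ψ (contract ζ X) (contract ζ' X') := by
  intro v' v hv
  refine h _ _ fun i => ?_
  refine Fin.addCases (fun i => ?_) (fun i => ?_) i
  · simpa using hX i
  · simpa using hv i

end Operations

section Descent

variable {P P' : Type*} {S : Subalgebra ℝ (P → ℝ)} {S' : Subalgebra ℝ (P' → ℝ)}
  {A : Algebroid S} {A' : Algebroid S'} [TopologicalSpace P] [TopologicalSpace P']
  {κ : Type} [Fintype κ] {x : κ → A'} {W' : Set P'} {W : Set P} {ψ : P' → P}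

/-- Basic forms descend. -/
theorem FrameMap.existsUnique_descent (hS' : LocalAlg S') (hS : LocalAlg S)
    (h : FrameMap A x W' W ψ) (hW : Dense W) (hsurj : Function.Surjective ψ)
    (hsm : ∀ f : P → ℝ, f ∘ ψ ∈ S' → f ∈ S) {k : ℕ} (T : Form A' k)
    (hT : ∀ (v : Fin k → A') (i : Fin k) (j : κ), v i = x j → T v = 0)
    (htr : ∀ c c', ψ c = ψ c' → ∃ g : P' → P', g c = c' ∧ (∀ y, ψ (g y) = ψ y) ∧
      IsPullbackForm g T T ∧ ∀ X : A', ∃ X' : A', Related g X'.1 X.1) :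
    ∃! σ : Form A k, IsPullbackForm ψ σ T := by
  have hker : ∀ (c : P') (v : Fin k → A') (i : Fin k),
      (∃ b : κ → S', VanishesAt (v i - ∑ j, b j • x j) c) → (T v : P' → ℝ) c = 0 := by
    rintro c v i ⟨b, hb⟩
    have h1 : (T v : P' → ℝ) c = (T (Function.update v i (∑ j, b j • x j)) : P' → ℝ) c := by
      refine form_congr T fun l => ?_
      by_cases hl : l = i
      · subst hl
        simpa using hb
      · simpa [hl] using vanishesAt_zero c
    rw [h1, AlternatingMap.map_update_sum, AddSubmonoidClass.coe_finsetSum, Finset.sum_apply]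
    refine Finset.sum_eq_zero fun j _ => ?_
    rw [AlternatingMap.map_update_smul, hT _ i j (Function.update_self _ _ _), smul_zero]
    rfl
  have hcongr : ∀ (c : P') (Y Y' : Fin k → A') (Z Z' : Fin k → A),
      (∀ i, Related ψ (Y i).1 (Z i).1) → (∀ i, Related ψ (Y' i).1 (Z' i).1) →
      (∀ i, VanishesAt (Z i - Z' i) (ψ c)) → (T Y : P' → ℝ) c = (T Y' : P' → ℝ) c := by
    intro c Y Y' Z Z' h1 h2 h3
    exact form_congr_of T (N := fun X => ∃ b : κ → S', VanishesAt (X - ∑ j, b j • x j) c)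
      (hker c) fun i => h.exists_vanishesAt hS' hS hW ((h1 i).sub (h2 i)) c (h3 i)
  have hfib : ∀ (c c' : P') (Y : Fin k → A') (Z : Fin k → A), (∀ i, Related ψ (Y i).1 (Z i).1) →
      ψ c = ψ c' → (T Y : P' → ℝ) c = (T Y : P' → ℝ) c' := by
    intro c c' Y Z hYZ hcc
    obtain ⟨g, hgc, hg, hgT, hgl⟩ := htr c c' hcc
    choose Y' hY' using fun i => hgl (Y i)
    have h1 : ∀ i, Related ψ (Y' i).1 (Z i).1 := by
      intro i f f' e
      have e1 : (f : P' → ℝ) = (f : P' → ℝ) ∘ g := by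
        rw [e]
        funext y
        exact congrArg (f' : P → ℝ) (hg y).symm
      rw [hY' i f f e1, hYZ i f f' e]
      funext y
      exact congrArg _ (hg y)
    have h2 := congrFun (hgT _ _ hY') c
    rw [Function.comp_apply, hgc] at h2
    rw [← h2]
    exact hcongr c _ _ _ _ hYZ h1 fun i => by rw [sub_self]; exact vanishesAt_zero _
  choose θ hθ using hsurj
  let Rep : P → A → A' → Prop := fun p Z Y => ∃ Z' : A, Related ψ Y.1 Z'.1 ∧ VanishesAt (Z - Z') p
  obtain ⟨σ, hσ⟩ := exists_form_of_rep (A := A) hS T θ Rep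
    (by
      intro p Z
      obtain ⟨ι, _, e', e, he', he, hr⟩ := h.frames (θ p)
      rw [hθ] at he
      obtain ⟨f, hf⟩ := he.gen Z
      exact ⟨_, _, Related.sum fun i => (hr i).smul_cst ((f i : P → ℝ) p),
        eventually_vanishesAt_sub_cst (hS.vanishesAt hf)⟩)
    (by
      rintro p Z1 Z2 Y1 Y2 ⟨Z1', h1, h2⟩ ⟨Z2', h3, h4⟩
      refine ⟨Z1' + Z2', h1.add h3, ?_⟩
      rw [add_sub_add_comm]
      exact h2.add h4)
    (by
      rintro p f Z Y ⟨Z', h1, h2⟩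
      refine ⟨cst S ((f : P → ℝ) p) • Z', h1.smul_cst _, ?_⟩
      refine VanishesAt.trans_sub (Y := f • Z') ?_ (vanishesAt_smul_sub (by rfl) _)
      rw [← smul_sub]
      exact h2.smul f)
    (by
      intro p v w w' hw hw'
      choose Z h1 h2 using hw
      choose Z' h3 h4 using hw'
      refine hcongr _ _ _ Z Z' h1 h3 fun i => ?_
      rw [hθ]
      exact (h2 i).symm_sub.trans_sub (h4 i))
    (by
      intro v p
      obtain ⟨ι, _, e', e, he', he, hr⟩ := h.frames (θ p)
      rw [hθ] at he
      choose f hf using fun j => he.gen (v j)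
      have hu : ∀ r : Fin k → ι, (fun y => (T (fun j => e' (r j)) : P' → ℝ) (θ y)) ∘ ψ =
          (T (fun j => e' (r j)) : P' → ℝ) := fun r => funext fun c =>
        hfib _ _ _ _ (fun j => hr (r j)) (hθ (ψ c))
      have hm : ∀ r : Fin k → ι, (fun y => (T (fun j => e' (r j)) : P' → ℝ) (θ y)) ∈ S :=
        fun r => hsm _ (by rw [hu]; exact (T _).2)
      refine ⟨∑ r : Fin k → ι, (∏ j, f j (r j)) * ⟨_, hm r⟩, ?_⟩
      filter_upwards [eventually_all.2 fun j => hS.vanishesAt_eventually (hf j)] with y hy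
      refine ⟨fun j => ∑ i, cst S' ((f j i : P → ℝ) y) • e' i, fun j =>
        ⟨_, Related.sum fun i => (hr i).smul_cst _, eventually_vanishesAt_sub_cst (hy j)⟩, ?_⟩
      rw [form_sum_apply]
      simp only [AddSubmonoidClass.coe_finsetSum, Finset.sum_apply, Subalgebra.coe_mul,
        Pi.mul_apply, SubmonoidClass.coe_finsetProd, Finset.prod_apply, cst_apply])
  refine ⟨σ, fun Y Z hYZ => funext fun c => ?_, fun η hη => ?_⟩
  · rw [Function.comp_apply, hσ Z (ψ c) Y fun i => ⟨Z i, hYZ i, by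
      rw [sub_self]; exact vanishesAt_zero _⟩]
    exact hfib _ _ _ _ hYZ (hθ _).symm
  · refine AlternatingMap.ext fun v => Subtype.ext (funext fun p => ?_)
    obtain ⟨ι, _, e', e, he', he, hr⟩ := h.frames (θ p)
    rw [hθ] at he
    choose f hf using fun j => he.gen (v j)
    have h1 := fun j => eventually_vanishesAt_sub_cst (hS.vanishesAt (hf j))
    have h2 := fun j => Related.sum (ψ := ψ) (s := Finset.univ) fun i =>
      (hr i).smul_cst ((f j i : P → ℝ) p)
    have h3 := congrFun (hη _ _ h2) (θ p)
    rw [Function.comp_apply, hθ] at h3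
    rw [form_congr η h1, ← h3]
    exact (hσ v p _ fun j => ⟨_, h2 j, h1 j⟩).symm

end Descent

section Cutoff

variable {E F : Type*} [NormedAddCommGroup E] [NormedSpace ℝ E] [FiniteDimensional ℝ E]
  [NormedAddCommGroup F] [NormedSpace ℝ F]

theorem exists_bump_of_mem_nhds {U : Set E} {z : E} (hU : U ∈ 𝓝 z) :
    ∃ χ : E → ℝ, ContDiff ℝ ∞ χ ∧ (∀ᶠ y in 𝓝 z, χ y = 1) ∧ HasCompactSupport χ ∧
      tsupport χ ⊆ U := by
  obtain ⟨ε, hε, hb⟩ := Metric.nhds_basis_closedBall.mem_iff.1 hU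
  let f : ContDiffBump z := ⟨ε / 2, ε, by positivity, by linarith⟩
  refine ⟨f, f.contDiff, f.eventuallyEq_one, f.hasCompactSupport, ?_⟩
  rw [f.tsupport_eq]
  exact hb

theorem contDiff_smul_of_tsupport_subset {U : Set E} (hU : IsOpen U) {f : E → F}
    (hf : ContDiffOn ℝ ∞ f U) {χ : E → ℝ} (hχ : ContDiff ℝ ∞ χ) (hs : tsupport χ ⊆ U) :
    ContDiff ℝ ∞ fun y => χ y • f y := by
  rw [contDiff_iff_contDiffAt]
  intro y
  by_cases hy : y ∈ tsupport χ
  · exact hχ.contDiffAt.smul (hf.contDiffAt (hU.mem_nhds (hs hy)))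
  · refine contDiffAt_const (c := (0 : F)) |>.congr_of_eventuallyEq ?_
    filter_upwards [(isClosed_tsupport χ).isOpen_compl.mem_nhds hy] with w hw
    rw [image_eq_zero_of_notMem_tsupport hw, zero_smul]

theorem exists_contDiff_eq {U : Set E} (hU : IsOpen U) {z : E} (hz : z ∈ U) {f : E → F}
    (hf : ContDiffOn ℝ ∞ f U) : ∃ G : E → F, ContDiff ℝ ∞ G ∧ G =ᶠ[𝓝 z] f := by
  obtain ⟨χ, hχ, h1, -, hs⟩ := exists_bump_of_mem_nhds (hU.mem_nhds hz)
  exact ⟨_, contDiff_smul_of_tsupport_subset hU hf hχ hs, h1.mono fun y hy => by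
    simp only [hy, one_smul]⟩

theorem exists_hadamard {E : Type} [NormedAddCommGroup E] [NormedSpace ℝ E]
    [FiniteDimensional ℝ E] {G : E → ℝ} (hG : ContDiff ℝ ∞ G) (z0 : E) :
    ∃ H : E → E →L[ℝ] ℝ, ContDiff ℝ ∞ H ∧ H z0 = fderiv ℝ G z0 ∧
      ∀ z, G z = G z0 + H z (z - z0) := by
  refine ⟨fun z => ∫ s in (0 : ℝ)..1, fderiv ℝ G (z0 + s • (z - z0)), ?_, ?_, ?_⟩
  · refine contDiff_integral_param (f := fun q : E × ℝ => fderiv ℝ G (z0 + q.2 • (q.1 - z0))) ?_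
    have : ContDiff ℝ ∞ (fderiv ℝ G) := hG.fderiv_right (by simp)
    exact this.comp (by fun_prop)
  · simp
  · intro z
    have hd : ∀ s : ℝ, HasDerivAt (fun s : ℝ => G (z0 + s • (z - z0)))
        (fderiv ℝ G (z0 + s • (z - z0)) (z - z0)) s := by
      intro s
      have h1 := (hG.differentiable (by simp) (z0 + s • (z - z0))).hasFDerivAt
      have h2 : HasDerivAt (fun s : ℝ => z0 + s • (z - z0)) (z - z0) s := by
        simpa using ((hasDerivAt_id s).smul_const (z - z0)).const_add z0
      exact h1.comp_hasDerivAt s h2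
    have hc : Continuous fun s : ℝ => fderiv ℝ G (z0 + s • (z - z0)) :=
      (hG.continuous_fderiv (by simp)).comp (by fun_prop)
    have h3 := intervalIntegral.integral_eq_sub_of_hasDerivAt (a := 0) (b := 1)
      (fun s _ => hd s) ((hc.clm_apply continuous_const).intervalIntegrable _ _)
    rw [ContinuousLinearMap.intervalIntegral_apply (hc.intervalIntegrable _ _), h3]
    simp

end Cutoff

section Charts

variable {P : Type*} [TopologicalSpace P] {S : Subalgebra ℝ (P → ℝ)} {ι : Type} [Fintype ι]
  {C : Set (OpenPartialHomeomorph P (ι → ℂ))}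

/-- The charts in `C` cover `P`, and smoothness can be tested in them. -/
structure SmoothCharts (S : Subalgebra ℝ (P → ℝ)) (C : Set (OpenPartialHomeomorph P (ι → ℂ))) :
    Prop where
  cover : ∀ p, ∃ φ ∈ C, p ∈ φ.source
  smooth : ∀ f : S, ∀ φ ∈ C, ∀ p ∈ φ.source, ∃ G : (ι → ℂ) → ℝ, ContDiff ℝ ∞ G ∧
    ∀ᶠ x in 𝓝 p, (f : P → ℝ) x = G (φ x)
  of_local : ∀ f : P → ℝ, (∀ p, ∃ φ ∈ C, p ∈ φ.source ∧ ∃ G : (ι → ℂ) → ℝ, ContDiff ℝ ∞ G ∧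
    ∀ᶠ x in 𝓝 p, f x = G (φ x)) → f ∈ S

theorem tendsto_chart {φ : OpenPartialHomeomorph P (ι → ℂ)} {p : P} (hp : p ∈ φ.source) :
    Tendsto φ (𝓝 p) (𝓝 (φ p)) := φ.continuousAt hp

theorem SmoothCharts.exists_bump [T2Space P] (h : SmoothCharts S C)
    {φ : OpenPartialHomeomorph P (ι → ℂ)} (hφ : φ ∈ C) {χ : (ι → ℂ) → ℝ} (hχ : ContDiff ℝ ∞ χ)
    (hc : HasCompactSupport χ) (hs : tsupport χ ⊆ φ.target) :
    ∃ f : S, (∀ x ∈ φ.source, (f : P → ℝ) x = χ (φ x)) ∧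
      ∀ x ∉ φ.source, ∀ᶠ y in 𝓝 x, (f : P → ℝ) y = 0 := by
  classical
  have hK : IsClosed (φ.symm '' tsupport χ) :=
    (hc.isCompact.image_of_continuousOn (φ.continuousOn_symm.mono hs)).isClosed
  have hz : ∀ p ∉ φ.source, ∀ᶠ x in 𝓝 p, (if x ∈ φ.source then χ (φ x) else 0) = 0 := by
    intro p hp
    have : p ∉ φ.symm '' tsupport χ := by
      rintro ⟨z, hz, rfl⟩
      exact hp (φ.map_target (hs hz))
    filter_upwards [hK.isOpen_compl.mem_nhds this] with x hx
    by_cases hxs : x ∈ φ.source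
    · rw [if_pos hxs]
      refine image_eq_zero_of_notMem_tsupport fun hm => hx ⟨_, hm, φ.left_inv hxs⟩
    · rw [if_neg hxs]
  refine ⟨⟨fun x => if x ∈ φ.source then χ (φ x) else 0, h.of_local _ fun p => ?_⟩,
    fun x hx => if_pos hx, hz⟩
  by_cases hp : p ∈ φ.source
  · exact ⟨φ, hφ, hp, χ, hχ, by
      filter_upwards [φ.open_source.mem_nhds hp] with x hx using if_pos hx⟩
  · obtain ⟨φ', hφ', hp'⟩ := h.cover p
    exact ⟨φ', hφ', hp', fun _ => 0, contDiff_const, hz p hp⟩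

/-- Smooth functions of the coordinates extend. -/
theorem SmoothCharts.exists_eq [T2Space P] (h : SmoothCharts S C)
    {φ : OpenPartialHomeomorph P (ι → ℂ)} (hφ : φ ∈ C) {p : P} (hp : p ∈ φ.source)
    {G : (ι → ℂ) → ℝ} (hG : ContDiff ℝ ∞ G) :
    ∃ f : S, ∀ᶠ x in 𝓝 p, (f : P → ℝ) x = G (φ x) := by
  obtain ⟨χ, hχ, h1, hc, hs⟩ :=
    exists_bump_of_mem_nhds (φ.open_target.mem_nhds (φ.map_source hp))
  have hs' : tsupport (fun z => χ z * G z) ⊆ tsupport χ := tsupport_mul_subset_left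
  obtain ⟨f, hf, -⟩ := h.exists_bump hφ (hχ.mul hG) (hc.mul_right) (hs'.trans hs)
  refine ⟨f, ?_⟩
  filter_upwards [φ.open_source.mem_nhds hp, (tendsto_chart hp).eventually h1] with x hx h1x
  rw [hf x hx]
  simp [h1x]

theorem SmoothCharts.localAlg [T2Space P] (h : SmoothCharts S C) : LocalAlg S where
  cont f := continuous_iff_continuousAt.2 fun p => by
    obtain ⟨φ, hφ, hp⟩ := h.cover p
    obtain ⟨G, hG, e⟩ := h.smooth f φ hφ p hp
    exact (hG.continuous.continuousAt.comp (φ.continuousAt hp)).congr (e.mono fun x hx => hx.symm)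
  bump p U hU := by
    obtain ⟨φ, hφ, hp⟩ := h.cover p
    have hV : φ.target ∩ φ.symm ⁻¹' U ∈ 𝓝 (φ p) := by
      refine inter_mem (φ.open_target.mem_nhds (φ.map_source hp)) ?_
      have := φ.continuousAt_symm (φ.map_source hp)
      rw [ContinuousAt, φ.left_inv hp] at this
      exact this hU
    obtain ⟨χ, hχ, h1, hc, hs⟩ := exists_bump_of_mem_nhds hV
    obtain ⟨f, hf, hf0⟩ := h.exists_bump hφ hχ hc (hs.trans inter_subset_left)
    refine ⟨f, ?_, fun x hx => ?_⟩
    · filter_upwards [φ.open_source.mem_nhds hp, (tendsto_chart hp).eventually h1] with x hx h1x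
      rw [hf x hx, h1x]
    · by_cases hxs : x ∈ φ.source
      · rw [hf x hxs]
        refine image_eq_zero_of_notMem_tsupport fun hm => hx ?_
        have := (hs hm).2
        rwa [mem_preimage, φ.left_inv hxs] at this
      · exact (hf0 x hxs).self_of_nhds
  glue f hf := h.of_local f fun p => by
    obtain ⟨φ, hφ, hp⟩ := h.cover p
    obtain ⟨g, hg⟩ := hf p
    obtain ⟨G, hG, e⟩ := h.smooth g φ hφ p hp
    exact ⟨φ, hφ, hp, G, hG, (hg.and e).mono fun x hx => hx.1.trans hx.2⟩

/-- The derivative of a function at a point along a vector, in a chart. -/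
def dch (φ : OpenPartialHomeomorph P (ι → ℂ)) (f : P → ℝ) (x : P) : (ι → ℂ) →L[ℝ] ℝ :=
  fderiv ℝ (f ∘ φ.symm) (φ x)

theorem comp_symm_eventuallyEq {φ : OpenPartialHomeomorph P (ι → ℂ)} {f : P → ℝ}
    {G : (ι → ℂ) → ℝ} {x : P} (hx : x ∈ φ.source) (h : ∀ᶠ y in 𝓝 x, f y = G (φ y)) :
    f ∘ φ.symm =ᶠ[𝓝 (φ x)] G := by
  have h1 := φ.continuousAt_symm (φ.map_source hx)
  rw [ContinuousAt, φ.left_inv hx] at h1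
  filter_upwards [h1.eventually h, φ.open_target.mem_nhds (φ.map_source hx)] with z hz hzt
  rw [Function.comp_apply, hz, φ.right_inv hzt]

theorem dch_eq {φ : OpenPartialHomeomorph P (ι → ℂ)} {f : P → ℝ} {G : (ι → ℂ) → ℝ} {x : P}
    (hx : x ∈ φ.source) (h : ∀ᶠ y in 𝓝 x, f y = G (φ y)) : dch φ f x = fderiv ℝ G (φ x) :=
  (comp_symm_eventuallyEq hx h).fderiv_eq

/-- Derivations are vector fields. -/
theorem SmoothCharts.exists_vector [T2Space P] (h : SmoothCharts S C) {A : Algebroid S} (X : A)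
    {φ : OpenPartialHomeomorph P (ι → ℂ)} (hφ : φ ∈ C) {p : P} (hp : p ∈ φ.source) :
    ∃ v : (ι → ℂ) → ι → ℂ, ContDiff ℝ ∞ v ∧
      ∀ᶠ x in 𝓝 p, ∀ f : S, val X f x = dch φ f x (v (φ x)) := by
  let b := Module.finBasis ℝ (ι → ℂ)
  let l : Fin (Module.finrank ℝ (ι → ℂ)) → (ι → ℂ) →L[ℝ] ℝ := fun k =>
    LinearMap.toContinuousLinearMap (b.coord k)
  have hl : ∀ z, ∑ k, l k z • b k = z := fun z => b.sum_repr z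
  choose r hr using fun k => h.exists_eq hφ hp (l k).contDiff
  choose V hV eV using fun k => h.smooth (X.1 (r k)) φ hφ p hp
  refine ⟨fun z => ∑ k, V k z • b k, ContDiff.sum fun k _ => (hV k).smul contDiff_const, ?_⟩
  filter_upwards [φ.open_source.mem_nhds hp, eventually_all.2 fun k => (hr k).eventually_nhds,
    eventually_all.2 eV] with x hx hrx hVx f
  obtain ⟨G, hG, eG⟩ := h.smooth f φ hφ x hx
  obtain ⟨H, hH, hH0, eH⟩ := exists_hadamard hG (φ x)
  choose g hg using fun k => h.exists_eq hφ hx (hH.clm_apply (contDiff_const (c := b k)))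
  have e1 : (f : P → ℝ) =ᶠ[𝓝 x]
      ((cst S (G (φ x)) + ∑ k, (r k - cst S (l k (φ x))) * g k : S) : P → ℝ) := by
    filter_upwards [eG, eventually_all.2 hg, eventually_all.2 hrx] with y hy hgy hry
    simp only [AddMemClass.coe_add, Pi.add_apply, cst_apply, AddSubmonoidClass.coe_finsetSum,
      Finset.sum_apply, MulMemClass.coe_mul, Pi.mul_apply, AddSubgroupClass.coe_sub, Pi.sub_apply]
    rw [hy, eH (φ y)]
    congr 1
    conv_lhs => rw [← hl (φ y - φ x), map_sum]
    refine Finset.sum_congr rfl fun k _ => ?_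
    rw [hgy, hry, map_smul, map_sub, smul_eq_mul]
  rw [val_congr_of_eventuallyEq h.localAlg X e1, dch_eq hx eG]
  have e2 : val X (cst S (G (φ x)) + ∑ k, (r k - cst S (l k (φ x))) * g k) x =
      ∑ k, val X (r k) x * (g k : P → ℝ) x := by
    have e3 : ∀ c : ℝ, X.1 (cst S c) = 0 := fun c => Derivation.map_algebraMap X.1 c
    have e4 : ∀ k, ((r k : P → ℝ) x) = l k (φ x) := fun k => (hrx k).self_of_nhds
    unfold val
    simp only [map_add, map_sum, map_sub, e3, zero_add, sub_zero, Derivation.leibniz, smul_eq_mul,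
      AddSubmonoidClass.coe_finsetSum, Finset.sum_apply, AddMemClass.coe_add, Pi.add_apply,
      MulMemClass.coe_mul, Pi.mul_apply, AddSubgroupClass.coe_sub, Pi.sub_apply, cst_apply, e4,
      sub_self, zero_mul]
    exact Finset.sum_congr rfl fun k _ => mul_comm _ _
  rw [e2, map_sum]
  refine Finset.sum_congr rfl fun k _ => ?_
  rw [(hg k).self_of_nhds, hH0, map_smul, smul_eq_mul]
  congr 1
  exact hVx k

/-- Vectors are determined by the derivatives along them. -/
theorem SmoothCharts.eq_zero_of_dch [T2Space P] (h : SmoothCharts S C)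
    {φ : OpenPartialHomeomorph P (ι → ℂ)} (hφ : φ ∈ C) {p : P} (hp : p ∈ φ.source) {u : ι → ℂ}
    (hu : ∀ f : S, dch φ f p u = 0) : u = 0 := by
  let b := Module.finBasis ℝ (ι → ℂ)
  refine b.ext_elem fun k => ?_
  let l : (ι → ℂ) →L[ℝ] ℝ := LinearMap.toContinuousLinearMap (b.coord k)
  obtain ⟨f, hf⟩ := h.exists_eq hφ hp l.contDiff
  have := hu f
  rw [dch_eq hp hf, l.fderiv] at this
  simpa [l] using this

/-- The section is given by the logarithmic components `c` at `x`. -/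
def HasComps {A : Algebroid S} (φ : OpenPartialHomeomorph P (ι → ℂ)) (X : A)
    (c : (ι → ℂ) → ι → ℂ) (x : P) : Prop :=
  ∀ f : S, val X f x = dch φ f x (c (φ x) * φ x)

/-- The Lie algebroid `A` consists of the vector fields with smooth logarithmic components in the
charts in `C`; the points of `W` are those with nonzero coordinates. -/
structure LogCharts (A : Algebroid S) (C : Set (OpenPartialHomeomorph P (ι → ℂ))) (W : Set P) :
    Prop extends SmoothCharts S C where
  t2 : T2Space P
  comps : ∀ X : A, ∀ φ ∈ C, ∀ p ∈ φ.source, ∃ c : (ι → ℂ) → ι → ℂ, ContDiff ℝ ∞ c ∧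
    ∀ᶠ x in 𝓝 p, HasComps φ X c x
  mem : ∀ X : (preserving (⊤ : Ideal S)), (∀ p, ∃ φ ∈ C, p ∈ φ.source ∧
    ∃ c : (ι → ℂ) → ι → ℂ, ContDiff ℝ ∞ c ∧ ∀ᶠ x in 𝓝 p, HasComps φ X c x) → X.1 ∈ A
  principal : ∀ φ ∈ C, ∀ p ∈ φ.source, (p ∈ W ↔ ∀ i, φ p i ≠ 0)

variable {A : Algebroid S} {W : Set P}

theorem LogCharts.dense [DecidableEq ι] (h : LogCharts A C W) : Dense W := by
  intro p
  obtain ⟨φ, hφ, hp⟩ := h.cover p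
  have h1 : φ p ∈ closure {z : ι → ℂ | ∀ i, z i ≠ 0} := dense_ne_zero _
  rw [mem_closure_iff_frequently] at h1 ⊢
  have h2 := φ.continuousAt_symm (φ.map_source hp)
  rw [ContinuousAt, φ.left_inv hp] at h2
  refine h2.frequently ((h1.and_eventually (φ.open_target.mem_nhds (φ.map_source hp))).mono ?_)
  rintro z ⟨hz, hzt⟩
  rw [h.principal φ hφ _ (φ.map_target hzt), φ.right_inv hzt]
  exact hz

theorem contDiff_fderiv_comps {G : (ι → ℂ) → ℝ} (hG : ContDiff ℝ ∞ G) {c : (ι → ℂ) → ι → ℂ}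
    (hc : ContDiff ℝ ∞ c) : ContDiff ℝ ∞ fun z => fderiv ℝ G z (c z * z) :=
  (hG.fderiv_right (by simp) : ContDiff ℝ ∞ (fderiv ℝ G)).clm_apply (hc.mul contDiff_id)

/-- Construction of sections from compatible local components. -/
theorem LogCharts.exists_section [DecidableEq ι] (h : LogCharts A C W) (T : P → S → ℝ)
    (hT : ∀ p, ∃ φ ∈ C, p ∈ φ.source ∧ ∃ c : (ι → ℂ) → ι → ℂ, ContDiff ℝ ∞ c ∧
      ∀ᶠ x in 𝓝 p, x ∈ W → ∀ f : S, T x f = dch φ f x (c (φ x) * φ x)) :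
    ∃ X : A, ∀ φ ∈ C, ∀ p ∈ φ.source, ∀ c : (ι → ℂ) → ι → ℂ, ContDiff ℝ ∞ c →
      (∀ᶠ x in 𝓝 p, x ∈ W → ∀ f : S, T x f = dch φ f x (c (φ x) * φ x)) →
      ∀ᶠ x in 𝓝 p, HasComps φ X c x := by
  have := h.t2
  choose φ hφ hp c hc hTc using hT
  let D : S → P → ℝ := fun f p => dch (φ p) f p (c p (φ p p) * φ p p)
  have key : ∀ ψ ∈ C, ∀ p ∈ ψ.source, ∀ d : (ι → ℂ) → ι → ℂ, ContDiff ℝ ∞ d →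
      (∀ᶠ x in 𝓝 p, x ∈ W → ∀ f : S, T x f = dch ψ f x (d (ψ x) * ψ x)) →
      ∀ᶠ x in 𝓝 p, ∀ f : S, D f x = dch ψ f x (d (ψ x) * ψ x) := by
    intro ψ hψ p hpψ d hd hTd
    filter_upwards [hTd.eventually_nhds, ψ.open_source.mem_nhds hpψ] with x hx hxψ f
    obtain ⟨G, hG, eG⟩ := h.smooth f ψ hψ x hxψ
    obtain ⟨G', hG', eG'⟩ := h.smooth f (φ x) (hφ x) x (hp x)
    change dch (φ x) f x (c x (φ x x) * φ x x) = _
    rw [dch_eq hxψ eG, dch_eq (hp x) eG']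
    have hne : (𝓝[W] x).NeBot := mem_closure_iff_nhdsWithin_neBot.1 (h.dense x)
    refine tendsto_nhds_unique_of_eventuallyEq (l := 𝓝[W] x)
      (f := fun y => fderiv ℝ G' (φ x y) (c x (φ x y) * φ x y))
      (g := fun y => fderiv ℝ G (ψ y) (d (ψ y) * ψ y)) ?_ ?_ ?_
    · exact (((contDiff_fderiv_comps hG' (hc x)).continuous.continuousAt (x := φ x x)).comp
        (f := φ x) ((φ x).continuousAt (hp x))).tendsto.mono_left nhdsWithin_le_nhds
    · exact (((contDiff_fderiv_comps hG hd).continuous.continuousAt (x := ψ x)).comp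
        (f := ψ) (ψ.continuousAt hxψ)).tendsto.mono_left nhdsWithin_le_nhds
    · filter_upwards [nhdsWithin_le_nhds hx, nhdsWithin_le_nhds (hTc x),
        nhdsWithin_le_nhds eG.eventually_nhds, nhdsWithin_le_nhds eG'.eventually_nhds,
        nhdsWithin_le_nhds (ψ.open_source.mem_nhds hxψ),
        nhdsWithin_le_nhds ((φ x).open_source.mem_nhds (hp x)), self_mem_nhdsWithin]
        with y h1 h2 h3 h4 h5 h6 h7
      rw [← dch_eq h5 h3, ← dch_eq h6 h4, ← h1 h7, ← h2 h7]
  have hmem : ∀ f, D f ∈ S := fun f => h.of_local _ fun p => by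
    obtain ⟨G, hG, eG⟩ := h.smooth f (φ p) (hφ p) p (hp p)
    refine ⟨φ p, hφ p, hp p, _, contDiff_fderiv_comps hG (hc p), ?_⟩
    filter_upwards [key (φ p) (hφ p) p (hp p) (c p) (hc p) (hTc p), eG.eventually_nhds,
      (φ p).open_source.mem_nhds (hp p)] with x h1 h2 h3
    rw [h1 f, dch_eq h3 h2]
  have hdiff : ∀ (f : S) p, DifferentiableAt ℝ ((f : P → ℝ) ∘ (φ p).symm) (φ p p) := fun f p => by
    obtain ⟨G, hG, eG⟩ := h.smooth f (φ p) (hφ p) p (hp p)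
    exact (hG.differentiable (by simp) _).congr_of_eventuallyEq (comp_symm_eventuallyEq (hp p) eG)
  have hadd : ∀ f g, D (f + g) = D f + D g := fun f g => funext fun p => by
    have : dch (φ p) (f + g : S) p = dch (φ p) f p + dch (φ p) g p :=
      fderiv_add (hdiff f p) (hdiff g p)
    change dch (φ p) (f + g : S) p _ = _
    rw [this]
    rfl
  have hmul : ∀ f g : S, D (f * g) = (f : P → ℝ) * D g + (g : P → ℝ) * D f := fun f g =>
    funext fun p => by
      have h1 := fderiv_mul (hdiff f p) (hdiff g p)
      have h2 : dch (φ p) (f * g : S) p =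
        (f : P → ℝ) ((φ p).symm (φ p p)) • dch (φ p) g p +
        (g : P → ℝ) ((φ p).symm (φ p p)) • dch (φ p) f p := h1
      rw [(φ p).left_inv (hp p)] at h2
      change dch (φ p) (f * g : S) p _ = _
      rw [h2]
      rfl
  have hsmul : ∀ (r : ℝ) (f : S), D (r • f) = r • D f := fun r f => funext fun p => by
    have : dch (φ p) (r • f : S) p = r • dch (φ p) f p := fderiv_const_smul (hdiff f p) r
    change dch (φ p) (r • f : S) p _ = _
    rw [this]
    rfl
  let D' : Derivation ℝ S S := Derivation.mk'
    { toFun := fun f => ⟨D f, hmem f⟩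
      map_add' := fun f g => Subtype.ext (hadd f g)
      map_smul' := fun r f => Subtype.ext (hsmul r f) }
    fun f g => Subtype.ext (hmul f g)
  have hD' : ∀ ψ ∈ C, ∀ p ∈ ψ.source, ∀ d : (ι → ℂ) → ι → ℂ, ContDiff ℝ ∞ d →
      (∀ᶠ x in 𝓝 p, x ∈ W → ∀ f : S, T x f = dch ψ f x (d (ψ x) * ψ x)) →
      ∀ᶠ x in 𝓝 p, ∀ f : S, ((D' f : S) : P → ℝ) x = dch ψ f x (d (ψ x) * ψ x) := key
  have hA : D' ∈ A := h.mem ⟨D', fun _ _ => trivial⟩ fun p =>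
    ⟨φ p, hφ p, hp p, c p, hc p, hD' _ (hφ p) p (hp p) _ (hc p) (hTc p)⟩
  exact ⟨⟨D', hA⟩, hD'⟩

end Charts

section LogEtale

variable {P P' : Type*} [TopologicalSpace P] [TopologicalSpace P'] {S : Subalgebra ℝ (P → ℝ)}
  {S' : Subalgebra ℝ (P' → ℝ)} {ι : Type} [Fintype ι] [DecidableEq ι]
  {C : Set (OpenPartialHomeomorph P (ι → ℂ))} {C' : Set (OpenPartialHomeomorph P' (ι → ℂ))}
  {A : Algebroid S} {A' : Algebroid S'} {W : Set P} {W' : Set P'} {ψ : P' → P}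

/-- The action of a real matrix on complex vectors. -/
def realMul (L : Matrix ι ι ℝ) : (ι → ℂ) →L[ℝ] (ι → ℂ) :=
  LinearMap.toContinuousLinearMap ((Matrix.mulVecLin (L.map Complex.ofReal)).restrictScalars ℝ)

theorem realMul_apply (L : Matrix ι ι ℝ) (c : ι → ℂ) (i : ι) :
    realMul L c i = ∑ j, (L i j : ℂ) * c j := rfl

theorem realMul_mul (L L' : Matrix ι ι ℝ) (c : ι → ℂ) :
    realMul L (realMul L' c) = realMul (L * L') c := by
  have : (L * L').map Complex.ofReal = L.map Complex.ofReal * L'.map Complex.ofReal :=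
    Matrix.map_mul (f := Complex.ofRealHom)
  change (L.map Complex.ofReal).mulVec ((L'.map Complex.ofReal).mulVec c) =
    ((L * L').map Complex.ofReal).mulVec c
  rw [this, Matrix.mulVec_mulVec]

theorem realMul_one (c : ι → ℂ) : realMul 1 c = c := by
  change ((1 : Matrix ι ι ℝ).map Complex.ofReal).mulVec c = c
  rw [Matrix.map_one _ Complex.ofReal_zero Complex.ofReal_one, Matrix.one_mulVec]

/-- In suitable charts at `p`, the map acts on logarithmic components by a real matrix. -/
structure LogEtaleAt (C' : Set (OpenPartialHomeomorph P' (ι → ℂ)))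
    (C : Set (OpenPartialHomeomorph P (ι → ℂ))) (ψ : P' → P) (p : P')
    (φ' : OpenPartialHomeomorph P' (ι → ℂ)) (φ : OpenPartialHomeomorph P (ι → ℂ))
    (L L' : Matrix ι ι ℝ) (Ψ : (ι → ℂ) → ι → ℂ) : Prop where
  mem' : φ' ∈ C'
  mem : φ ∈ C
  source' : p ∈ φ'.source
  source : ψ p ∈ φ.source
  inv : L * L' = 1
  contDiff : ContDiff ℝ ∞ Ψ
  eq : ∀ᶠ x in 𝓝 p, φ (ψ x) = Ψ (φ' x)
  fderiv_eq : ∀ᶠ z in 𝓝 (φ' p), ∀ c, fderiv ℝ Ψ z (c * z) = realMul L c * Ψ z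

/-- Maps that are étale on `W'` and preserve logarithmic vector fields. -/
structure LogEtale (S' : Subalgebra ℝ (P' → ℝ)) (S : Subalgebra ℝ (P → ℝ))
    (C' : Set (OpenPartialHomeomorph P' (ι → ℂ))) (C : Set (OpenPartialHomeomorph P (ι → ℂ)))
    (W' : Set P') (ψ : P' → P) : Prop where
  cont : Continuous ψ
  pull : ∀ g : S, (g : P → ℝ) ∘ ψ ∈ S'
  etale : ∀ p ∈ W', ∀ f' : S', ∃ f : S, (f' : P' → ℝ) =ᶠ[𝓝 p] (f : P → ℝ) ∘ ψ
  charts : ∀ p, ∃ φ' φ L L' Ψ, LogEtaleAt C' C ψ p φ' φ L L' Ψ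

theorem LogEtaleAt.dch_comp (hC : SmoothCharts S C) {p : P'}
    {φ' : OpenPartialHomeomorph P' (ι → ℂ)} {φ : OpenPartialHomeomorph P (ι → ℂ)}
    {L L' : Matrix ι ι ℝ} {Ψ : (ι → ℂ) → ι → ℂ} (h : LogEtaleAt C' C ψ p φ' φ L L' Ψ)
    (hψ : Continuous ψ) :
    ∀ᶠ x in 𝓝 p, ∀ (f : S) (f' : P' → ℝ), f' =ᶠ[𝓝 x] (f : P → ℝ) ∘ ψ → ∀ c,
      dch φ' f' x (c * φ' x) = dch φ f (ψ x) (realMul L c * φ (ψ x)) := by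
  filter_upwards [h.eq.eventually_nhds, φ'.open_source.mem_nhds h.source',
    hψ.continuousAt.eventually (φ.open_source.mem_nhds h.source),
    (tendsto_chart h.source').eventually h.fderiv_eq] with x h1 h2 h3 h4 f f' hf c
  obtain ⟨G, hG, eG⟩ := hC.smooth f φ h.mem (ψ x) h3
  have e1 : ∀ᶠ y in 𝓝 x, f' y = (G ∘ Ψ) (φ' y) := by
    filter_upwards [hf, hψ.continuousAt.eventually eG, h1] with y hy1 hy2 hy3
    rw [hy1, Function.comp_apply, hy2, hy3]
    rfl
  rw [dch_eq h2 e1, dch_eq h3 eG, fderiv_comp _ (hG.differentiable (by simp) _)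
    (h.contDiff.differentiable (by simp) _), ContinuousLinearMap.comp_apply, h4,
    h1.self_of_nhds]

theorem LogEtale.lift (hC' : LogCharts A' C' W') (hC : LogCharts A C W)
    (h : LogEtale S' S C' C W' ψ) (X : A) : ∃ X' : A', Related ψ X'.1 X.1 := by
  classical
  have := hC.t2
  have := hC'.t2
  have hS := hC.localAlg
  let T : P' → S' → ℝ := fun x f' =>
    if hf : ∃ f : S, (f' : P' → ℝ) =ᶠ[𝓝 x] (f : P → ℝ) ∘ ψ then val X hf.choose (ψ x) else 0
  have hT : ∀ p φ' φ L L' Ψ, LogEtaleAt C' C ψ p φ' φ L L' Ψ → ∀ c : (ι → ℂ) → ι → ℂ,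
      ContDiff ℝ ∞ c → (∀ᶠ y in 𝓝 (ψ p), HasComps φ X c y) → ∀ᶠ x in 𝓝 p, x ∈ W' →
        ∀ f' : S', T x f' = dch φ' f' x (realMul L' (c (Ψ (φ' x))) * φ' x) := by
    intro p φ' φ L L' Ψ hp c hc hXc
    filter_upwards [hp.dch_comp hC.toSmoothCharts h.cont, h.cont.continuousAt.eventually hXc,
      hp.eq] with x h1 h2 h3 hxW f'
    have hf := h.etale x hxW f'
    have e : T x f' = val X hf.choose (ψ x) := dif_pos hf
    rw [e, h2, h1 hf.choose f' hf.choose_spec, realMul_mul, hp.inv, realMul_one, h3]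
  obtain ⟨X', hX'⟩ := hC'.exists_section T fun p => by
    obtain ⟨φ', φ, L, L', Ψ, hp⟩ := h.charts p
    obtain ⟨c, hc, hXc⟩ := hC.comps X φ hp.mem _ hp.source
    exact ⟨φ', hp.mem', hp.source', fun z => realMul L' (c (Ψ z)),
      (realMul L').contDiff.comp (hc.comp hp.contDiff), hT p φ' φ L L' Ψ hp c hc hXc⟩
  refine ⟨X', fun f' f e => funext fun p => ?_⟩
  obtain ⟨φ', φ, L, L', Ψ, hp⟩ := h.charts p
  obtain ⟨c, hc, hXc⟩ := hC.comps X φ hp.mem _ hp.source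
  have h1 := hX' φ' hp.mem' p hp.source' (fun z => realMul L' (c (Ψ z)))
    ((realMul L').contDiff.comp (hc.comp hp.contDiff)) (hT p φ' φ L L' Ψ hp c hc hXc)
  have h2 := (hp.dch_comp hC.toSmoothCharts h.cont).self_of_nhds f f' (by rw [e])
    (realMul L' (c (Ψ (φ' p))))
  have h3 : val X' f' p = dch φ' f' p (realMul L' (c (Ψ (φ' p))) * φ' p) := h1.self_of_nhds f'
  change val X' f' p = val X f (ψ p)
  rw [h3, h2, hXc.self_of_nhds, realMul_mul, hp.inv, realMul_one, hp.eq.self_of_nhds]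

theorem LogEtale.hasComps (hC' : LogCharts A' C' W') (hC : LogCharts A C W)
    (h : LogEtale S' S C' C W' ψ) {X' : A'} {X : A} (hX : Related ψ X'.1 X.1) {p : P'}
    {φ' : OpenPartialHomeomorph P' (ι → ℂ)} {φ : OpenPartialHomeomorph P (ι → ℂ)}
    {L L' : Matrix ι ι ℝ} {Ψ : (ι → ℂ) → ι → ℂ} (hp : LogEtaleAt C' C ψ p φ' φ L L' Ψ)
    {c : (ι → ℂ) → ι → ℂ} (hc : ContDiff ℝ ∞ c) (hXc : ∀ᶠ y in 𝓝 (ψ p), HasComps φ X c y) :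
    ∀ᶠ x in 𝓝 p, HasComps φ' X' (fun z => realMul L' (c (Ψ z))) x := by
  have := hC'.t2
  have := hC.t2
  obtain ⟨d, hd, hX'd⟩ := hC'.comps X' φ' hp.mem' p hp.source'
  have hT : ∀ᶠ x in 𝓝 p, x ∈ W' → d (φ' x) = realMul L' (c (Ψ (φ' x))) := by
    filter_upwards [hp.dch_comp hC.toSmoothCharts h.cont, h.cont.continuousAt.eventually hXc,
      hp.eq, hX'd, φ'.open_source.mem_nhds hp.source'] with x h1 h2 h3 h4 h5 hxW
    have h6 : d (φ' x) * φ' x - realMul L' (c (Ψ (φ' x))) * φ' x = 0 := by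
      refine hC'.eq_zero_of_dch hp.mem' h5 fun f' => ?_
      obtain ⟨f, hf⟩ := h.etale x hxW f'
      rw [map_sub, h1 f f' hf (realMul L' (c (Ψ (φ' x)))), realMul_mul, hp.inv, realMul_one,
        ← h3, ← h2 f, ← h4 f', val_congr_of_eventuallyEq hC'.localAlg X'
        (g := ⟨_, h.pull f⟩) hf, hX.val_eq (f := f) rfl, sub_self]
    rw [← sub_mul] at h6
    funext i
    have h7 := congrFun h6 i
    rcases mul_eq_zero.1 h7 with h8 | h8
    · exact sub_eq_zero.1 h8
    · exact absurd h8 ((hC'.principal φ' hp.mem' x h5).1 hxW i)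
  have h9 : ∀ᶠ x in 𝓝 p, d (φ' x) = realMul L' (c (Ψ (φ' x))) := by
    filter_upwards [hT.eventually_nhds, φ'.open_source.mem_nhds hp.source'] with x hx hxs
    have hne : (𝓝[W'] x).NeBot := mem_closure_iff_nhdsWithin_neBot.1 (hC'.dense x)
    have hc' : Continuous fun z => realMul L' (c (Ψ z)) :=
      (realMul L').continuous.comp (hc.continuous.comp hp.contDiff.continuous)
    refine tendsto_nhds_unique_of_eventuallyEq (l := 𝓝[W'] x) (f := fun y => d (φ' y))
      (g := fun y => realMul L' (c (Ψ (φ' y)))) ?_ ?_ ?_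
    · exact ((hd.continuous.tendsto _).comp (φ'.continuousAt hxs).tendsto).mono_left
        nhdsWithin_le_nhds
    · exact ((hc'.tendsto _).comp (φ'.continuousAt hxs).tendsto).mono_left nhdsWithin_le_nhds
    · filter_upwards [nhdsWithin_le_nhds hx, self_mem_nhdsWithin] with y h1 h2 using h1 h2
  filter_upwards [h9, hX'd] with x hx hx' f
  rw [hx' f, hx]

/-- Sections with constant components forming a real basis are a frame. -/
theorem LogCharts.isFrameAt (hC : LogCharts A C W) {κ : Type} [Fintype κ] (b : Module.Basis κ ℝ (ι → ℂ))
    {φ : OpenPartialHomeomorph P (ι → ℂ)} (hφ : φ ∈ C) {p : P} (hp : p ∈ φ.source) {e : κ → A}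
    (he : ∀ k, ∀ᶠ x in 𝓝 p, HasComps φ (e k) (fun _ => b k) x) : IsFrameAt W e p := by
  have := hC.t2
  let l : κ → (ι → ℂ) →L[ℝ] ℝ := fun k => LinearMap.toContinuousLinearMap (b.coord k)
  have hl : ∀ z, ∑ k, l k z • b k = z := fun z => b.sum_repr z
  refine ⟨fun X => ?_, ?_⟩
  · obtain ⟨c, hc, hX⟩ := hC.comps X φ hφ p hp
    choose f hf using fun k => hC.exists_eq hφ hp ((l k).contDiff.comp hc)
    refine ⟨f, ?_⟩
    filter_upwards [hX, eventually_all.2 he, eventually_all.2 hf] with x h1 h2 h3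
    rw [zeroAt_sub_iff]
    intro g
    rw [h1 g, val_sum]
    conv_lhs => rw [← hl (c (φ x)), Finset.sum_mul, map_sum]
    refine Finset.sum_congr rfl fun k _ => ?_
    rw [val_smul, h2 k g, h3 k, smul_mul_assoc, map_smul]
    rfl
  · filter_upwards [eventually_all.2 he, φ.open_source.mem_nhds hp] with x h1 hx hxW a ha
    have h2 : (∑ k, a k • b k) * φ x = 0 := by
      refine hC.eq_zero_of_dch hφ hx fun g => ?_
      rw [← ha g, Finset.sum_mul, map_sum]
      refine Finset.sum_congr rfl fun k _ => ?_
      rw [h1 k g, smul_mul_assoc, map_smul, smul_eq_mul]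
    have h3 : ∑ k, a k • b k = 0 := by
      funext i
      rcases mul_eq_zero.1 (congrFun h2 i) with h | h
      · exact h
      · exact absurd h ((hC.principal φ hφ x hx).1 hxW i)
    funext k
    exact Fintype.linearIndependent_iff.1 b.linearIndependent a h3 k

/-- Sections with prescribed compactly supported components in a chart. -/
theorem LogCharts.exists_section_of_compact (hC : LogCharts A C W)
    {φ : OpenPartialHomeomorph P (ι → ℂ)} (hφ : φ ∈ C) {c : (ι → ℂ) → ι → ℂ} (hc : ContDiff ℝ ∞ c)
    {K : Set (ι → ℂ)} (hK : IsCompact K) (hKφ : K ⊆ φ.target) (hcK : ∀ z ∉ K, c z = 0) :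
    ∃ X : A, (∀ x ∈ φ.source, HasComps φ X c x) ∧ ∀ x ∉ φ.source, ZeroAt X x := by
  classical
  have := hC.t2
  let T : P → S → ℝ := fun x f => if x ∈ φ.source then dch φ f x (c (φ x) * φ x) else 0
  have hK' : IsClosed (φ.symm '' K) :=
    (hK.image_of_continuousOn (φ.continuousOn_symm.mono hKφ)).isClosed
  have key : ∀ q ∈ φ.source, ∀ᶠ x in 𝓝 q, x ∈ W → ∀ f : S,
      T x f = dch φ f x (c (φ x) * φ x) := fun q hq => by
    filter_upwards [φ.open_source.mem_nhds hq] with x hx _ f using if_pos hx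
  have key' : ∀ q ∉ φ.source, ∀ φ' : OpenPartialHomeomorph P (ι → ℂ), ∀ᶠ x in 𝓝 q, x ∈ W → ∀ f : S,
      T x f = dch φ' f x (0 * φ' x) := by
    intro q hq φ'
    have : q ∉ φ.symm '' K := by
      rintro ⟨z, hz, rfl⟩
      exact hq (φ.map_target (hKφ hz))
    filter_upwards [hK'.isOpen_compl.mem_nhds this] with x hx _ f
    rw [zero_mul, map_zero]
    by_cases hxs : x ∈ φ.source
    · have h0 : c (φ x) = 0 := hcK _ fun hm => hx ⟨_, hm, φ.left_inv hxs⟩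
      have : T x f = _ := if_pos hxs
      rw [this, h0, zero_mul, map_zero]
    · exact if_neg hxs
  obtain ⟨X, hX⟩ := hC.exists_section T fun q => by
    by_cases hq : q ∈ φ.source
    · exact ⟨φ, hφ, hq, _, hc, key q hq⟩
    · obtain ⟨φ', hφ', hq'⟩ := hC.cover q
      exact ⟨φ', hφ', hq', fun _ => 0, contDiff_const, key' q hq φ'⟩
  refine ⟨X, fun x hx => (hX φ hφ x hx _ hc (key x hx)).self_of_nhds, fun x hx f => ?_⟩
  obtain ⟨φ', hφ', hx'⟩ := hC.cover x
  rw [(hX φ' hφ' x hx' (fun _ => 0) contDiff_const (key' x hx φ')).self_of_nhds f, zero_mul,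
    map_zero]

/-- Sections with prescribed components near a point. -/
theorem LogCharts.exists_local_section (hC : LogCharts A C W)
    {φ : OpenPartialHomeomorph P (ι → ℂ)} (hφ : φ ∈ C) {p : P} (hp : p ∈ φ.source)
    {c : (ι → ℂ) → ι → ℂ} (hc : ContDiff ℝ ∞ c) :
    ∃ X : A, ∀ᶠ x in 𝓝 p, HasComps φ X c x := by
  obtain ⟨χ, hχ, h1, hcs, hs⟩ :=
    exists_bump_of_mem_nhds (φ.open_target.mem_nhds (φ.map_source hp))
  obtain ⟨X, hX, -⟩ := hC.exists_section_of_compact hφ (c := fun z => χ z • c z) (hχ.smul hc) hcs hs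
    fun z hz => by rw [image_eq_zero_of_notMem_tsupport hz, zero_smul]
  refine ⟨X, ?_⟩
  filter_upwards [φ.open_source.mem_nhds hp, (tendsto_chart hp).eventually h1] with x hx h1x f
  rw [hX x hx f]
  simp only [h1x, one_smul]

theorem realMul_injective {L L' : Matrix ι ι ℝ} (h : L * L' = 1) :
    Function.Injective (realMul L') := fun c d e => by
  have := congrArg (realMul L) e
  rwa [realMul_mul, realMul_mul, h, realMul_one, realMul_one] at this

theorem LogEtale.frameMap (hC' : LogCharts A' C' W') (hC : LogCharts A C W)
    (h : LogEtale S' S C' C W' ψ) (hd : Dense (ψ ⁻¹' W)) :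
    FrameMap A (Empty.elim : Empty → A') W' W ψ where
  cont := h.cont
  pull := h.pull
  dense := hd
  kernel k := k.elim
  frames p := by
    obtain ⟨φ', φ, L, L', Ψ, hp⟩ := h.charts p
    let b := Module.finBasis ℝ (ι → ℂ)
    choose e he using fun k => hC.exists_local_section hp.mem hp.source
      (contDiff_const (c := b k))
    choose e' he' using fun k => h.lift hC' hC (e k)
    have h1 := fun k => h.hasComps hC' hC (he' k) hp contDiff_const (he k)
    let R : (ι → ℂ) ≃ₗ[ℝ] (ι → ℂ) := LinearEquiv.ofInjectiveEndo (realMul L').toLinearMap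
      (realMul_injective hp.inv)
    refine ⟨_, inferInstance, e', e, ?_, hC.isFrameAt b hp.mem hp.source he, he'⟩
    let σ : Fin (Module.finrank ℝ (ι → ℂ)) ≃ Fin (Module.finrank ℝ (ι → ℂ)) ⊕ Empty :=
      (Equiv.sumEmpty _ _).symm
    refine hC'.isFrameAt ((b.map R).reindex σ) hp.mem' hp.source' fun k => ?_
    rcases k with k | k
    · rw [Module.Basis.reindex_apply, Module.Basis.map_apply]
      exact h1 k
    · exact k.elim

theorem LogEtale.etaleMap (hC' : LogCharts A' C' W') (hC : LogCharts A C W)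
    (h : LogEtale S' S C' C W' ψ) (hd : Dense (ψ ⁻¹' W)) : EtaleMap A' A W' ψ := by
  have := hC.t2
  have := hC'.t2
  exact
  { toPullable := (h.frameMap hC' hC hd).pullable hC'.localAlg hC.localAlg hC'.dense
    dense := hC'.dense
    etale := h.etale
    lift := h.lift hC' hC }

end LogEtale

/-! ## Standard charts -/

section StdCharts

variable {n : ℕ} {M : Type*} [TopologicalSpace M] [ChartedSpace (Model n) M]
  [MulAction (Torus n) M]

variable (n M) in
/-- The standard charts. -/
def stdCharts : Set (OpenPartialHomeomorph M (Model n)) := {φ | ∃ K a, IsStdChart φ K a}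

variable (n M) in
/-- The points of free orbits. -/
def principal : Set M := {m | ∀ t : Torus n, t • m = m → t = 1}

variable {φ : OpenPartialHomeomorph M (Model n)} {K : Finset (Fin n)} {a : Torus n ≃ₜ* Torus n}

theorem IsStdChart.mem_target (h : IsStdChart φ K a) {z w : Model n} (hz : z ∈ φ.target)
    (e : ∀ i, z i = 0 ↔ w i = 0) : w ∈ φ.target := by
  rw [h.target_eq] at hz ⊢
  exact fun i hi => fun h0 => hz i hi ((e i).2 h0)

theorem IsStdChart.mem_target_of_norm (h : IsStdChart φ K a) {z w : Model n} (hz : z ∈ φ.target)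
    (e : ∀ i, ‖z i‖ = ‖w i‖) : w ∈ φ.target :=
  h.mem_target hz fun i => by rw [← norm_eq_zero, e i, norm_eq_zero]

theorem IsStdChart.norm_smul (h : IsStdChart φ K a) (t : Torus n) {m : M} (hm : m ∈ φ.source)
    (i : Fin n) : ‖φ (t • m) i‖ = ‖φ m i‖ := by
  rw [h.map_smul t m hm i, norm_mul, Circle.norm_coe, one_mul]

theorem IsStdChart.smul_symm (h : IsStdChart φ K a) (t : Torus n) {z : Model n}
    (hz : z ∈ φ.target) : t • φ.symm z = φ.symm fun i => (a t i : ℂ) * z i := by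
  have h1 := φ.map_target hz
  rw [← φ.left_inv (h.smul_mem t _ h1)]
  congr 1
  funext i
  rw [h.map_smul t _ h1, φ.right_inv hz]

theorem exists_circle_mul_eq {z w : ℂ} (h : ‖z‖ = ‖w‖) : ∃ u : Circle, (u : ℂ) * z = w := by
  by_cases hz : z = 0
  · refine ⟨1, ?_⟩
    rw [hz, norm_zero, eq_comm, norm_eq_zero] at h
    simp [hz, h]
  · refine ⟨⟨w / z, mem_sphere_zero_iff_norm.2 ?_⟩, div_mul_cancel₀ _ hz⟩
    rw [norm_div, h, div_self]
    rw [← h]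
    exact norm_ne_zero_iff.2 hz

theorem IsStdChart.exists_smul_eq (h : IsStdChart φ K a) {m m' : M} (hm : m ∈ φ.source)
    (hm' : m' ∈ φ.source) (e : ∀ i, ‖φ m i‖ = ‖φ m' i‖) : ∃ t : Torus n, t • m = m' := by
  choose u hu using fun i => exists_circle_mul_eq (e i)
  refine ⟨a.symm u, φ.injOn (h.smul_mem _ _ hm) hm' (funext fun i => ?_)⟩
  rw [h.map_smul _ _ hm, ContinuousMulEquiv.apply_symm_apply, hu]

theorem IsStdChart.mem_principal_iff (h : IsStdChart φ K a) {m : M} (hm : m ∈ φ.source) :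
    m ∈ principal n M ↔ ∀ i, φ m i ≠ 0 := by
  constructor
  · intro hp i hi
    let u : Torus n := Function.update 1 i (Circle.exp Real.pi)
    have h1 : a.symm u • m = m := by
      refine φ.injOn (h.smul_mem _ _ hm) hm (funext fun j => ?_)
      rw [h.map_smul _ _ hm, ContinuousMulEquiv.apply_symm_apply]
      by_cases hj : j = i
      · rw [hj, hi, mul_zero]
      · simp [u, hj]
    have h2 : u = 1 := by
      have := hp _ h1
      rwa [map_eq_one_iff a.symm a.symm.injective] at this
    have h3 := congrArg (fun c : Circle => (c : ℂ)) (congrFun h2 i)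
    simp [u, Circle.coe_exp] at h3
    norm_num at h3
  · intro hne t ht
    have h1 : a t = 1 := by
      funext i
      have h2 := h.map_smul t m hm i
      rw [ht] at h2
      have h3 : (a t i : ℂ) = 1 := mul_right_cancel₀ (hne i) (by rw [← h2, one_mul])
      exact Circle.ext h3
    exact (map_eq_one_iff a a.injective).1 h1

variable [SmoothManifold n M]

theorem smoothCharts (hM : IsStandard n M) : SmoothCharts (Smooth n M) (stdCharts n M) where
  cover p := by
    obtain ⟨φ, K, a, h, hp⟩ := hM p
    exact ⟨φ, ⟨K, a, h⟩, hp⟩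
  smooth f φ hφ p hp := by
    obtain ⟨K, a, h⟩ := hφ
    have h1 : ContDiffOn ℝ ∞ ((f : M → ℝ) ∘ φ.symm) φ.target := by
      rw [← contMDiffOn_iff_contDiffOn]
      have h2 : ContMDiff 𝓘(ℝ, Model n) 𝓘(ℝ, ℝ) ∞ (f : M → ℝ) := f.2
      exact h2.comp_contMDiffOn (contMDiffOn_symm_of_mem_maximalAtlas h.mem_atlas)
    obtain ⟨G, hG, e⟩ := exists_contDiff_eq φ.open_target (φ.map_source hp) h1
    refine ⟨G, hG, ?_⟩
    filter_upwards [φ.open_source.mem_nhds hp, (tendsto_chart hp).eventually e] with x hx ex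
    rw [ex, Function.comp_apply, φ.left_inv hx]
  of_local f hf := by
    intro p
    obtain ⟨φ, ⟨K, a, h⟩, hp, G, hG, e⟩ := hf p
    have h1 : ContMDiffAt 𝓘(ℝ, Model n) 𝓘(ℝ, Model n) ∞ φ p :=
      (contMDiffOn_of_mem_maximalAtlas h.mem_atlas).contMDiffAt (φ.open_source.mem_nhds hp)
    have h2 : ContMDiffAt 𝓘(ℝ, Model n) 𝓘(ℝ, ℝ) ∞ (fun x => G (φ x)) p :=
      hG.contMDiff.contMDiffAt.comp p h1
    exact h2.congr_of_eventuallyEq e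

theorem IsStandard.continuousSMul (hM : IsStandard n M) : ContinuousSMul (Torus n) M := by
  refine ⟨continuous_iff_continuousAt.2 fun ⟨t, m⟩ => ?_⟩
  obtain ⟨φ, K, a, h, hm⟩ := hM m
  have hz := φ.map_source hm
  have h1 : ContinuousAt (fun p : Torus n × M => φ.symm fun i => (a p.1 i : ℂ) * φ p.2 i) (t, m) := by
    have h2 : ContinuousAt (fun p : Torus n × M => fun i => (a p.1 i : ℂ) * φ p.2 i) (t, m) := by
      refine continuousAt_pi.2 fun i => ContinuousAt.mul ?_ ?_
      · have : Continuous fun p : Torus n × M => (a p.1 i : ℂ) :=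
          continuous_induced_dom.comp ((continuous_apply i).comp (a.continuous.comp continuous_fst))
        exact this.continuousAt
      · exact (continuousAt_pi.1 ((φ.continuousAt hm).comp (f := Prod.snd) continuousAt_snd)) i
    refine ContinuousAt.comp (g := φ.symm) ?_ h2
    refine φ.continuousAt_symm ?_
    exact h.mem_target_of_norm hz fun i => by simp only [norm_mul, Circle.norm_coe, one_mul]
  refine h1.congr ?_
  filter_upwards [continuousAt_snd.eventually (φ.open_source.mem_nhds hm)] with p hp
  rw [← h.smul_symm p.1 (φ.map_source hp), φ.left_inv hp]

theorem IsStandard.continuous_smul (hM : IsStandard n M) (t : Torus n) :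
    Continuous fun m : M => t • m := by
  have := hM.continuousSMul
  exact continuous_const_smul t

end StdCharts

section Bases

variable {n : ℕ} {M N B : Type*}
  [TopologicalSpace M] [ChartedSpace (Model n) M] [MulAction (Torus n) M] [SmoothManifold n M]
  [TopologicalSpace N] [ChartedSpace (Model n) N] [MulAction (Torus n) N] [SmoothManifold n N]
  [TopologicalSpace B] {π : M → B} {ϖ : N → B}

theorem SameBase.symm (h : SameBase (n := n) π ϖ) : SameBase (n := n) ϖ π :=
  ⟨h.quot', h.quot, h.eq_iff', h.eq_iff, fun U f hU => (h.smooth_iff U f hU).symm⟩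

theorem SameBase.isOpenMap (h : SameBase (n := n) π ϖ) (hM : IsStandard n M) : IsOpenMap π := by
  intro U hU
  rw [← h.quot.isOpen_preimage]
  have : π ⁻¹' (π '' U) = ⋃ t : Torus n, (fun m => t • m) ⁻¹' U := by
    ext m
    simp only [mem_preimage, mem_image, mem_iUnion]
    constructor
    · rintro ⟨m', hm', e⟩
      obtain ⟨t, ht⟩ := (h.eq_iff _ _).1 e.symm
      exact ⟨t, by rwa [ht]⟩
    · rintro ⟨t, ht⟩
      exact ⟨t • m, ht, ((h.eq_iff _ _).2 ⟨t, rfl⟩).symm⟩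
  rw [this]
  exact isOpen_iUnion fun t => hU.preimage (hM.continuous_smul t)

theorem SameBase.map_nhds (h : SameBase (n := n) π ϖ) (hM : IsStandard n M) (m : M) :
    map π (𝓝 m) = 𝓝 (π m) :=
  (h.isOpenMap hM).map_nhds_eq h.quot.continuous.continuousAt

variable {φ : OpenPartialHomeomorph M (Model n)} {K : Finset (Fin n)} {a : Torus n ≃ₜ* Torus n}
  {ψ : OpenPartialHomeomorph N (Model n)} {K' : Finset (Fin n)} {a' : Torus n ≃ₜ* Torus n}

theorem SameBase.mem_source (h : SameBase (n := n) π ϖ) (hφ : IsStdChart φ K a) {m m' : M}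
    (e : π m = π m') (hm : m ∈ φ.source) : m' ∈ φ.source := by
  obtain ⟨t, rfl⟩ := (h.eq_iff _ _).1 e
  exact hφ.smul_mem t m hm

theorem SameBase.norm_eq (h : SameBase (n := n) π ϖ) (hφ : IsStdChart φ K a) {m m' : M}
    (e : π m = π m') (hm : m ∈ φ.source) (i : Fin n) : ‖φ m i‖ = ‖φ m' i‖ := by
  obtain ⟨t, rfl⟩ := (h.eq_iff _ _).1 e
  rw [hφ.norm_smul t hm]

/-- Smooth functions on the base are functions of the moduli of the coordinates. -/
theorem SameBase.exists_modInv (h : SameBase (n := n) π ϖ) (hψ : IsStdChart ψ K' a')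
    {U : Set B} (hU : IsOpen U) {f : B → ℝ}
    (hf : ContMDiffOn 𝓘(ℝ, Model n) 𝓘(ℝ, ℝ) ∞ (f ∘ π) (π ⁻¹' U)) {y : N} (hy : y ∈ ψ.source)
    (hyU : ϖ y ∈ U) : ∃ V : Model n → ℝ, ContDiff ℝ ∞ V ∧ ModInv V ∧
      ∀ᶠ y' in 𝓝 y, V (ψ y') = f (ϖ y') := by
  have hf' := (h.smooth_iff U f hU).1 hf
  set Ω := ψ.target ∩ ψ.symm ⁻¹' (ϖ ⁻¹' U) with hΩ
  have hΩo : IsOpen Ω := ψ.isOpen_inter_preimage_symm (hU.preimage h.quot'.continuous)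
  have horb : ∀ z w : Model n, z ∈ ψ.target → (∀ i, ‖z i‖ = ‖w i‖) →
      w ∈ ψ.target ∧ ϖ (ψ.symm z) = ϖ (ψ.symm w) := by
    intro z w hz e
    have hw := hψ.mem_target_of_norm hz e
    refine ⟨hw, (h.eq_iff' _ _).2 (hψ.exists_smul_eq (ψ.map_target hz) (ψ.map_target hw) ?_)⟩
    rwa [ψ.right_inv hz, ψ.right_inv hw]
  have hΩi : ModInv (· ∈ Ω) := by
    have : ∀ z w : Model n, (∀ i, ‖z i‖ = ‖w i‖) → z ∈ Ω → w ∈ Ω := by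
      rintro z w e ⟨hz, hzU⟩
      obtain ⟨hw, e'⟩ := horb z w hz e
      refine ⟨hw, ?_⟩
      change ϖ (ψ.symm w) ∈ U
      rw [← e']
      exact hzU
    exact fun z w e => propext ⟨this z w e, this w z fun i => (e i).symm⟩
  have h0 : ψ y ∈ Ω := ⟨ψ.map_source hy, by
    change ϖ (ψ.symm (ψ y)) ∈ U
    rwa [ψ.left_inv hy]⟩
  obtain ⟨χ, hχ, hχi, h1, -, hs⟩ := exists_modInv_bump hΩo hΩi h0
  have hsm : ContDiffOn ℝ ∞ (fun z => f (ϖ (ψ.symm z))) Ω := by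
    rw [← contMDiffOn_iff_contDiffOn]
    exact hf'.comp ((contMDiffOn_symm_of_mem_maximalAtlas hψ.mem_atlas).mono inter_subset_left)
      fun z hz => hz.2
  refine ⟨fun z => χ z • f (ϖ (ψ.symm z)), contDiff_smul_of_tsupport_subset hΩo hsm hχ hs,
    fun z w e => ?_, ?_⟩
  · by_cases hz : z ∈ Ω
    · simp only [hχi z w e, (horb z w hz.1 e).2]
    · have hw : w ∉ Ω := fun hw => hz (cast (hΩi z w e).symm hw)
      simp only [image_eq_zero_of_notMem_tsupport fun hm => hz (hs hm),
        image_eq_zero_of_notMem_tsupport fun hm => hw (hs hm), zero_smul]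
  · filter_upwards [ψ.open_source.mem_nhds hy, (tendsto_chart hy).eventually h1] with y' hy' h1y
    simp only [h1y, one_smul, ψ.left_inv hy']

open Classical in
/-- The squared moduli of the coordinates, as functions on the base. -/
def modBase (π : M → B) (φ : OpenPartialHomeomorph M (Model n)) (i : Fin n) (b : B) : ℝ :=
  if h : ∃ m ∈ φ.source, π m = b then ‖φ h.choose i‖ ^ 2 else 0

theorem SameBase.modBase_eq (h : SameBase (n := n) π ϖ) (hφ : IsStdChart φ K a) {m : M}
    (hm : m ∈ φ.source) (i : Fin n) : modBase π φ i (π m) = ‖φ m i‖ ^ 2 := by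
  have h1 : ∃ m' ∈ φ.source, π m' = π m := ⟨m, hm, rfl⟩
  rw [modBase, dif_pos h1, h.norm_eq hφ h1.choose_spec.2 h1.choose_spec.1]

theorem SameBase.isOpen_image (h : SameBase (n := n) π ϖ) (hM : IsStandard n M) :
    IsOpen (π '' φ.source) := h.isOpenMap hM _ φ.open_source

theorem SameBase.preimage_image (h : SameBase (n := n) π ϖ) (hφ : IsStdChart φ K a) :
    π ⁻¹' (π '' φ.source) = φ.source := by
  ext m
  constructor
  · rintro ⟨m', hm', e⟩
    exact h.mem_source hφ e hm'
  · exact fun hm => ⟨m, hm, rfl⟩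

theorem SameBase.contMDiffOn_modBase (h : SameBase (n := n) π ϖ) (hφ : IsStdChart φ K a)
    (i : Fin n) : ContMDiffOn 𝓘(ℝ, Model n) 𝓘(ℝ, ℝ) ∞ (modBase π φ i ∘ π)
      (π ⁻¹' (π '' φ.source)) := by
  rw [h.preimage_image hφ]
  have h1 : ContMDiffOn 𝓘(ℝ, Model n) 𝓘(ℝ, ℝ) ∞ ((fun z : Model n => ‖z i‖ ^ 2) ∘ φ) φ.source :=
    ((contDiff_normSq i).contMDiff).comp_contMDiffOn (contMDiffOn_of_mem_maximalAtlas hφ.mem_atlas)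
  exact h1.congr fun m hm => h.modBase_eq hφ hm i

theorem SameBase.exists_modInv_modBase (h : SameBase (n := n) π ϖ) (hM : IsStandard n M)
    (hφ : IsStdChart φ K a) (hψ : IsStdChart ψ K' a') {x : M} {y : N} (hx : x ∈ φ.source)
    (hy : y ∈ ψ.source) (e : π x = ϖ y) (i : Fin n) :
    ∃ V : Model n → ℝ, ContDiff ℝ ∞ V ∧ ModInv V ∧
      ∀ᶠ y' in 𝓝 y, V (ψ y') = modBase π φ i (ϖ y') :=
  h.exists_modInv hψ (h.isOpen_image hM) (h.contMDiffOn_modBase hφ i) hy (by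
    rw [← e]
    exact ⟨x, hx, rfl⟩)

theorem SameBase.eventually_base (h : SameBase (n := n) π ϖ) (hM : IsStandard n M)
    (hN : IsStandard n N) {x : M} {y : N} (e : π x = ϖ y) {p : B → Prop}
    (hp : ∀ᶠ y' in 𝓝 y, p (ϖ y')) : ∀ᶠ x' in 𝓝 x, p (π x') := by
  have h1 : ∀ᶠ b in 𝓝 (ϖ y), p b := by
    rw [← h.symm.map_nhds hN]
    exact hp
  rw [← e, ← h.map_nhds hM] at h1
  exact h1

end Bases

/-! ## Comparison of standard charts with the same base -/

section Match

variable {n : ℕ} {M N B : Type*}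
  [TopologicalSpace M] [ChartedSpace (Model n) M] [MulAction (Torus n) M] [SmoothManifold n M]
  [TopologicalSpace N] [ChartedSpace (Model n) N] [MulAction (Torus n) N] [SmoothManifold n N]
  [TopologicalSpace B] {π : M → B} {ϖ : N → B}
  {φ : OpenPartialHomeomorph M (Model n)} {K : Finset (Fin n)} {a : Torus n ≃ₜ* Torus n}
  {ψ : OpenPartialHomeomorph N (Model n)} {K' : Finset (Fin n)} {a' : Torus n ≃ₜ* Torus n}

theorem modBase_nonneg (i : Fin n) (b : B) : 0 ≤ modBase π φ i b := by
  unfold modBase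
  split_ifs
  · positivity
  · exact le_rfl

theorem eventually_chart {φ : OpenPartialHomeomorph M (Model n)} {p : M} (hp : p ∈ φ.source)
    {q : Model n → Prop} : (∀ᶠ z in 𝓝 (φ p), q z) ↔ ∀ᶠ x in 𝓝 p, q (φ x) := by
  rw [← φ.map_nhds_eq hp, eventually_map]

theorem eq_zero_of_mul_isLittleO {c : ℝ} (h : (fun s : ℝ => c * s) =o[𝓝[>] 0] fun s => s) :
    c = 0 := by
  by_contra hc
  have h1 := h.def (c := |c| / 2) (by positivity)
  obtain ⟨s, hs, hs0⟩ := (h1.and self_mem_nhdsWithin).exists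
  have hs0 : 0 < s := hs0
  rw [norm_mul, Real.norm_eq_abs, Real.norm_eq_abs] at hs
  have h2 : 0 < |s| := by positivity
  have h3 : 0 < |c| := by positivity
  nlinarith

theorem SameBase.card_zero_le (h : SameBase (n := n) π ϖ) (hM : IsStandard n M)
    (hN : IsStandard n N) (hφ : IsStdChart φ K a) (hψ : IsStdChart ψ K' a') {x : M} {y : N}
    (hx : x ∈ φ.source) (hy : y ∈ ψ.source) (e : π x = ϖ y) :
    (Finset.univ.filter fun i => φ x i = 0).card ≤ (Finset.univ.filter fun i => ψ y i = 0).card := by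
  classical
  choose V hV hVi eV using fun k => h.exists_modInv_modBase hM hφ hψ hx hy e k
  choose U hU hUi eU using fun j => h.symm.exists_modInv_modBase hN hψ hφ hy hx e.symm j
  set Zφ := Finset.univ.filter fun i => φ x i = 0 with hZφ
  set Zψ := Finset.univ.filter fun i => ψ y i = 0 with hZψ
  have hC : ∀ k, ∃ c : Fin n → ℝ, φ x k = 0 →
      (fun z => V k z - ∑ j ∈ Zψ, c j * ‖z j‖ ^ 2) =o[𝓝 (ψ y)] modDist (ψ y) := by
    intro k
    by_cases hk : φ x k = 0
    · have h0 : V k (ψ y) = 0 := by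
        rw [(eV k).self_of_nhds, ← e, h.modBase_eq hφ hx, hk]
        simp
      obtain ⟨c, hc⟩ := (hVi k).exists_isLittleO (hV k) h0 ((eventually_chart hy).2
        ((eV k).mono fun y' hy' => by rw [hy']; exact modBase_nonneg _ _))
      exact ⟨c, fun _ => hc⟩
    · exact ⟨0, fun h => absurd h hk⟩
  have hC' : ∀ j, ∃ c : Fin n → ℝ, ψ y j = 0 →
      (fun z => U j z - ∑ i ∈ Zφ, c i * ‖z i‖ ^ 2) =o[𝓝 (φ x)] modDist (φ x) := by
    intro j
    by_cases hj : ψ y j = 0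
    · have h0 : U j (φ x) = 0 := by
        rw [(eU j).self_of_nhds, e, h.symm.modBase_eq hψ hy, hj]
        simp
      obtain ⟨c, hc⟩ := (hUi j).exists_isLittleO (hU j) h0 ((eventually_chart hx).2
        ((eU j).mono fun y' hy' => by rw [hy']; exact modBase_nonneg _ _))
      exact ⟨c, fun _ => hc⟩
    · exact ⟨0, fun h => absurd h hj⟩
  choose c hc using hC
  choose c' hc' using hC'
  have h1 : ∀ k ∈ Zφ, (fun z => ‖z k‖ ^ 2 - ∑ j ∈ Zψ, c k j * U j z) =o[𝓝 (φ x)]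
      fun z => ∑ j, |U j z - U j (φ x)| := by
    intro k hk
    rw [Asymptotics.isLittleO_iff]
    intro ε hε
    have h2 : ∀ᶠ y' in 𝓝 y, |modBase π φ k (ϖ y') - ∑ j ∈ Zψ, c k j * modBase ϖ ψ j (ϖ y')| ≤
        ε * ∑ j, |modBase ϖ ψ j (ϖ y') - modBase ϖ ψ j (ϖ y)| := by
      have h3 := (eventually_chart hy).1 ((hc k (Finset.mem_filter.1 hk).2).def hε)
      filter_upwards [h3, eV k, ψ.open_source.mem_nhds hy] with y' h4 h5 h6
      simp only [h.symm.modBase_eq hψ h6, h.symm.modBase_eq hψ hy]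
      rw [← h5]
      rw [Real.norm_eq_abs, Real.norm_eq_abs, abs_of_nonneg (modDist_nonneg _ _)] at h4
      exact h4
    rw [eventually_chart hx]
    filter_upwards [h.eventually_base hM hN e (p := fun b => |modBase π φ k b -
      ∑ j ∈ Zψ, c k j * modBase ϖ ψ j b| ≤ ε * ∑ j, |modBase ϖ ψ j b - modBase ϖ ψ j (ϖ y)|) h2,
      eventually_all.2 eU, φ.open_source.mem_nhds hx] with x' h4 h5 h6
    simp only [h5, (eU _).self_of_nhds, e]
    have h7 : 0 ≤ ∑ j, |modBase ϖ ψ j (π x') - modBase ϖ ψ j (ϖ y)| :=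
      Finset.sum_nonneg fun _ _ => abs_nonneg _
    rw [Real.norm_eq_abs, Real.norm_eq_abs, abs_of_nonneg h7, ← h.modBase_eq hφ h6]
    exact h4
  have key : ∀ k ∈ Zφ, ∀ i ∈ Zφ, ∑ j ∈ Zψ, c k j * c' j i = if k = i then 1 else 0 := by
    intro k hk i hi
    have hi0 : φ x i = 0 := (Finset.mem_filter.1 hi).2
    have hk0 : φ x k = 0 := (Finset.mem_filter.1 hk).2
    set γ : ℝ → Model n := fun s => Function.update (φ x) i (Real.sqrt s : ℂ) with hγ
    have ht : Tendsto γ (𝓝[>] 0) (𝓝 (φ x)) := by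
      have hcont : Continuous γ := continuous_const.update i (by fun_prop)
      have h0 : γ 0 = φ x := by
        simp only [hγ, Real.sqrt_zero, Complex.ofReal_zero]
        rw [← hi0, Function.update_eq_self]
      have := hcont.tendsto 0
      rw [h0] at this
      exact this.mono_left nhdsWithin_le_nhds
    have hO : (fun s => ∑ j, |U j (γ s) - U j (φ x)|) =O[𝓝[>] 0] fun s : ℝ => s := by
      have := Asymptotics.IsBigO.sum (s := Finset.univ) fun j _ =>
        ((hUi j).isBigO_curve (hU j) hi0).norm_left
      refine this.congr_left fun s => ?_
      rw [Finset.sum_apply]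
      rfl
    have hnorm : ∀ s : ℝ, 0 < s → ∀ l, ‖γ s l‖ ^ 2 = ‖φ x l‖ ^ 2 + if l = i then s else 0 := by
      intro s hs l
      by_cases hl : l = i
      · subst hl
        simp [hγ, hi0, abs_of_nonneg (Real.sqrt_nonneg s), Real.sq_sqrt hs.le]
      · simp [hγ, hl]
    have e1 : (fun s => (if k = i then s else 0) - ∑ j ∈ Zψ, c k j * U j (γ s)) =o[𝓝[>] 0]
        fun s : ℝ => s := by
      refine (((h1 k hk).comp_tendsto ht).trans_isBigO hO).congr' ?_ EventuallyEq.rfl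
      filter_upwards [self_mem_nhdsWithin] with s hs
      simp only [Function.comp_apply, hnorm s hs, hk0]
      simp
    have e2 : ∀ j ∈ Zψ, (fun s => U j (γ s) - c' j i * s) =o[𝓝[>] 0] fun s : ℝ => s := by
      intro j hj
      refine ((hc' j (Finset.mem_filter.1 hj).2).comp_tendsto ht).congr' ?_ ?_
      · filter_upwards [self_mem_nhdsWithin] with s hs
        simp only [Function.comp_apply, hnorm s hs]
        congr 1
        rw [Finset.sum_eq_single_of_mem i hi]
        · simp [hi0]
        · intro l hl hli
          simp [hli, (Finset.mem_filter.1 hl).2]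
      · filter_upwards [self_mem_nhdsWithin] with s hs
        have hs : 0 < s := hs
        simp only [Function.comp_apply, modDist, hnorm s hs, add_sub_cancel_left]
        rw [Finset.sum_eq_single i]
        · simp [abs_of_pos hs]
        · intro l _ hl
          simp [hl]
        · simp
    have e3 := e1.add (Asymptotics.IsLittleO.sum fun j hj => (e2 j hj).const_mul_left (c k j))
    have e4 : (fun s : ℝ => ((if k = i then 1 else 0) - ∑ j ∈ Zψ, c k j * c' j i) * s)
        =o[𝓝[>] 0] fun s => s := by
      refine e3.congr_left fun s => ?_
      have : ∑ j ∈ Zψ, c k j * (U j (γ s) - c' j i * s) =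
          ∑ j ∈ Zψ, c k j * U j (γ s) - (∑ j ∈ Zψ, c k j * c' j i) * s := by
        rw [Finset.sum_mul, ← Finset.sum_sub_distrib]
        exact Finset.sum_congr rfl fun j _ => by ring
      rw [Finset.sum_apply, this]
      split_ifs <;> ring
    have := eq_zero_of_mul_isLittleO e4
    linarith
  let Q : Matrix Zφ Zψ ℝ := fun k j => c k j
  let Q' : Matrix Zψ Zφ ℝ := fun j i => c' j i
  have hQ : Q * Q' = 1 := by
    ext ⟨k, hk⟩ ⟨i, hi⟩
    rw [Matrix.mul_apply, Matrix.one_apply]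
    simp only [Q, Q', Subtype.mk.injEq]
    rw [← key k hk i hi]
    exact Finset.sum_coe_sort Zψ fun j => c k j * c' j i
  have h4 : (1 : Matrix Zφ Zφ ℝ).rank ≤ Fintype.card Zψ := by
    rw [← hQ]
    exact (Matrix.rank_mul_le_left Q Q').trans Q.rank_le_card_width
  rwa [Matrix.rank_one, Fintype.card_coe, Fintype.card_coe] at h4

theorem exists_modNhd {z0 : Model n} {U : Set (Model n)} (hU : U ∈ 𝓝 z0) :
    ∃ ε > 0, ∀ z : Model n, (∀ i, |‖z i‖ ^ 2 - ‖z0 i‖ ^ 2| < ε) → alignTo z0 z ∈ U := by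
  obtain ⟨δ, hδ, hball⟩ := Metric.mem_nhds_iff.1 hU
  refine ⟨(δ / 2) ^ 2, by positivity, fun z hz => hball ?_⟩
  rw [Metric.mem_ball, dist_eq_norm]
  refine lt_of_le_of_lt ((pi_norm_le_iff_of_nonneg (by positivity : 0 ≤ δ / 2)).2 fun i => ?_)
    (half_lt_self hδ)
  rw [Pi.sub_apply, norm_alignTo_sub]
  exact (abs_le_of_sq_le_sq' (by
    exact (abs_sub_sq_le (norm_nonneg _) (norm_nonneg _)).trans (hz i).le) (by positivity)).2

/-- Where one coordinate on `N` vanishes, so does one coordinate on `M`. -/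
theorem SameBase.exists_vanish (h : SameBase (n := n) π ϖ) (hM : IsStandard n M)
    (hN : IsStandard n N) (hφ : IsStdChart φ K a) (hψ : IsStdChart ψ K' a') {x : M} {y : N}
    (hx : x ∈ φ.source) (hy : y ∈ ψ.source) (e : π x = ϖ y) {j : Fin n} (hj : ψ y j = 0) :
    ∃ k, φ x k = 0 ∧ ∃ G : Model n → ℝ, ContDiff ℝ ∞ G ∧ ModInv G ∧
      ∀ᶠ y' in 𝓝 y, modBase π φ k (ϖ y') = ‖ψ y' j‖ ^ 2 * G (ψ y') := by
  classical
  choose V hV hVi eV using fun k => h.exists_modInv_modBase hM hφ hψ hx hy e k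
  have hgood : ∀ᶠ y' in 𝓝 y, y' ∈ ψ.source ∧ (∀ k, V k (ψ y') = modBase π φ k (ϖ y')) ∧
      ϖ y' ∈ π '' φ.source := by
    filter_upwards [ψ.open_source.mem_nhds hy, eventually_all.2 eV,
      h.quot'.continuous.continuousAt.eventually ((h.isOpen_image hM).mem_nhds
        (show ϖ y ∈ π '' φ.source from ⟨x, hx, e⟩))] with y' h1 h2 h3 using ⟨h1, h2, h3⟩
  have hgood' : ∀ᶠ z in 𝓝 (ψ y), z ∈ ψ.target ∧ (∀ k, V k z = modBase π φ k (ϖ (ψ.symm z))) ∧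
      ϖ (ψ.symm z) ∈ π '' φ.source := by
    rw [eventually_chart hy]
    filter_upwards [hgood] with y' h1
    rw [ψ.left_inv h1.1]
    exact ⟨ψ.map_source h1.1, h1.2⟩
  obtain ⟨ε, hε, hgε⟩ := exists_modNhd hgood'
  set Ω : Set (Model n) := {z | ∀ i, |‖z i‖ ^ 2 - ‖ψ y i‖ ^ 2| < ε} with hΩ
  have hΩV : ∀ z ∈ Ω, ∃ y' ∈ ψ.source, ∃ x' ∈ φ.source, π x' = ϖ y' ∧ ψ y' = z ∧
      ∀ k, V k z = ‖φ x' k‖ ^ 2 := by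
    intro z hz
    obtain ⟨h1, h2, x', hx', h3⟩ := hgε z hz
    have hzt : z ∈ ψ.target := hψ.mem_target_of_norm h1 fun i => norm_alignTo _ _ i
    obtain ⟨t, ht⟩ := hψ.exists_smul_eq (ψ.map_target h1) (ψ.map_target hzt) fun i => by
      rw [ψ.right_inv h1, ψ.right_inv hzt, norm_alignTo]
    refine ⟨ψ.symm z, ψ.map_target hzt, x', hx', h3.trans ((h.eq_iff' _ _).2 ⟨t, ht⟩),
      ψ.right_inv hzt, fun k => ?_⟩
    rw [← hVi k _ z fun i => norm_alignTo (ψ y) z i, h2 k, ← h3, h.modBase_eq hφ hx']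
  have hΩc : ∀ z ∈ Ω, (Finset.univ.filter fun k => V k z = 0).card =
      (Finset.univ.filter fun i => z i = 0).card := by
    intro z hz
    obtain ⟨y', hy', x', hx', e', rfl, hk⟩ := hΩV z hz
    have h1 : (Finset.univ.filter fun k => V k (ψ y') = 0) =
        Finset.univ.filter fun k => φ x' k = 0 :=
      Finset.filter_congr fun k _ => by simp [hk]
    rw [h1]
    exact le_antisymm (h.card_zero_le hM hN hφ hψ hx' hy' e')
      (h.symm.card_zero_le hN hM hψ hφ hy' hx' e'.symm)
  set D : Set (Fin n → ℝ) := {t | t j = 0 ∧ ∀ l, l ≠ j → 0 < t l ∧ |t l - ‖ψ y l‖ ^ 2| < ε}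
    with hD
  set q : (Fin n → ℝ) → Model n := fun t l => (Real.sqrt (t l) : ℂ) with hq
  have hqc : Continuous q := continuous_pi fun l => by fun_prop
  have hqn : ∀ t : Fin n → ℝ, (∀ l, 0 ≤ t l) → ∀ l, ‖q t l‖ ^ 2 = t l := by
    intro t ht l
    simp [hq, Real.sq_sqrt (ht l), abs_of_nonneg (Real.sqrt_nonneg _)]
  have hDnn : ∀ t ∈ D, ∀ l, 0 ≤ t l := by
    intro t ht l
    by_cases hl : l = j
    · rw [hl, ht.1]
    · exact (ht.2 l hl).1.le
  have hDq : ∀ t ∈ D, q t ∈ Ω := by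
    intro t ht l
    rw [hqn t (hDnn t ht)]
    by_cases hl : l = j
    · rw [hl, ht.1, hj]
      simpa using hε
    · exact (ht.2 l hl).2
  have hDu : ∀ t ∈ D, ∃ k, ∀ k', V k' (q t) = 0 ↔ k' = k := by
    intro t ht
    have h1 := hΩc _ (hDq t ht)
    have h2 : (Finset.univ.filter fun i => q t i = 0) = {j} := by
      ext l
      rw [Finset.mem_filter, Finset.mem_singleton, ← norm_eq_zero,
        ← pow_eq_zero_iff two_ne_zero, hqn t (hDnn t ht)]
      constructor
      · rintro ⟨-, h3⟩
        by_contra hl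
        exact (ht.2 l hl).1.ne' h3
      · rintro rfl
        exact ⟨Finset.mem_univ _, ht.1⟩
    rw [h2, Finset.card_singleton, Finset.card_eq_one] at h1
    obtain ⟨k, hk⟩ := h1
    refine ⟨k, fun k' => ?_⟩
    have h3 : k' ∈ Finset.univ.filter (fun k => V k (q t) = 0) ↔ k' = k := by
      rw [hk, Finset.mem_singleton]
    rw [← h3, Finset.mem_filter]
    simp
  have hDconv : Convex ℝ D := by
    have e1 : D = Set.pi Set.univ fun l => if l = j then ({0} : Set ℝ) else
        Set.Ioi 0 ∩ Metric.ball (‖ψ y l‖ ^ 2) ε := by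
      ext t
      rw [Set.mem_univ_pi]
      constructor
      · intro ht l
        by_cases hl : l = j
        · rw [if_pos hl, hl]
          exact ht.1
        · rw [if_neg hl]
          exact ⟨(ht.2 l hl).1, by rw [Metric.mem_ball, Real.dist_eq]; exact (ht.2 l hl).2⟩
      · intro ht
        refine ⟨by simpa using ht j, fun l hl => ?_⟩
        have := ht l
        rw [if_neg hl, mem_inter_iff, Metric.mem_ball, Real.dist_eq] at this
        exact this
    rw [e1]
    refine convex_pi fun l _ => ?_
    split_ifs
    · exact convex_singleton _
    · exact (convex_Ioi _).inter (convex_ball _ _)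
  have hvan : ∃ k, ∀ t ∈ D, V k (q t) = 0 := by
    have ht0 : (fun l => if l = j then 0 else ‖ψ y l‖ ^ 2 + ε / 2) ∈ D := by
      refine ⟨if_pos rfl, fun l hl => ?_⟩
      simp only [if_neg hl]
      refine ⟨by positivity, ?_⟩
      rw [add_sub_cancel_left, abs_of_pos (by positivity)]
      linarith
    obtain ⟨k, hk⟩ := hDu _ ht0
    refine ⟨k, fun t ht => ?_⟩
    by_contra hne
    have hclosed : ∀ k', IsClosed {t | V k' (q t) = 0} := fun k' =>
      isClosed_eq ((hV k').continuous.comp hqc) continuous_const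
    have hcl2 : IsClosed (⋃ k' ∈ {k' | k' ≠ k}, {t | V k' (q t) = 0}) :=
      (Set.toFinite _).isClosed_biUnion fun k' _ => hclosed k'
    obtain ⟨t', ht', h1, h2⟩ := isPreconnected_closed_iff.1 hDconv.isPreconnected _ _ (hclosed k)
      hcl2 (fun t'' ht'' => by
        obtain ⟨k', hk'⟩ := hDu t'' ht''
        by_cases hkk : k' = k
        · left
          exact (hk' k).2 hkk.symm
        · right
          exact mem_biUnion (show k' ∈ {k' | k' ≠ k} from hkk) ((hk' k').2 rfl))
      ⟨_, ht0, (hk k).2 rfl⟩ (by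
        obtain ⟨k', hk'⟩ := hDu t ht
        refine ⟨t, ht, mem_biUnion (show k' ∈ {k' | k' ≠ k} from ?_) ((hk' k').2 rfl)⟩
        rintro rfl
        exact hne ((hk' k').2 rfl))
    obtain ⟨k', hk'k, h3⟩ := mem_iUnion₂.1 h2
    obtain ⟨k'', hk''⟩ := hDu t' ht'
    exact hk'k (((hk'' k').1 h3).trans ((hk'' k).1 h1).symm)
  obtain ⟨k, hk⟩ := hvan
  have hvan' : ∀ z ∈ Ω, z j = 0 → V k z = 0 := by
    intro z hz hzj
    let τ : ℝ → Fin n → ℝ := fun s l => if l = j then 0 else ‖z l‖ ^ 2 + s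
    have hτ : Continuous τ := continuous_pi fun l => by
      by_cases hl : l = j
      · simp only [τ, if_pos hl]
        exact continuous_const
      · simp only [τ, if_neg hl]
        fun_prop
    have hτD : ∀ᶠ s in 𝓝[>] (0 : ℝ), τ s ∈ D := by
      have h1 : ∀ l, ∀ᶠ s in 𝓝[>] (0 : ℝ), |‖z l‖ ^ 2 + s - ‖ψ y l‖ ^ 2| < ε := by
        intro l
        have : Continuous fun s : ℝ => |‖z l‖ ^ 2 + s - ‖ψ y l‖ ^ 2| := by fun_prop
        refine nhdsWithin_le_nhds (this.continuousAt.eventually_lt continuousAt_const ?_)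
        simpa using hz l
      filter_upwards [eventually_all.2 h1, self_mem_nhdsWithin] with s hs hs0
      have hs0 : 0 < s := hs0
      refine ⟨if_pos rfl, fun l hl => ?_⟩
      simp only [τ, if_neg hl]
      exact ⟨by positivity, hs l⟩
    have h2 : Tendsto (fun s => V k (q (τ s))) (𝓝[>] 0) (𝓝 (V k (q (τ 0)))) :=
      (((hV k).continuous.comp (hqc.comp hτ)).tendsto 0).mono_left nhdsWithin_le_nhds
    have h3 : V k (q (τ 0)) = 0 :=
      tendsto_nhds_unique_of_eventuallyEq h2 tendsto_const_nhds
        (hτD.mono fun s hs => hk _ hs)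
    rw [← h3]
    refine hVi k _ _ fun l => ?_
    by_cases hl : l = j
    · simp [hl, hzj, q, τ]
    · simp [q, τ, hl, Real.sqrt_sq (norm_nonneg _)]
  have hΩo : IsOpen Ω := by
    rw [hΩ]
    simp only [ofPred_forall]
    refine isOpen_iInter_of_finite fun i => ?_
    exact isOpen_lt (by fun_prop) continuous_const
  have hΩi : ModInv (· ∈ Ω) := fun z w hzw => by
    simp only [hΩ, mem_ofPred_eq, hzw]
  have h0 : ψ y ∈ Ω := fun i => by simpa using hε
  obtain ⟨χ, hχ, hχi, h1, -, hs⟩ := exists_modInv_bump hΩo hΩi h0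
  obtain ⟨G, hG, hGi, eG⟩ := ModInv.exists_eq_normSq_mul (U := fun z => χ z * V k z)
    (hχ.mul (hV k)) (fun z w hzw => by simp only [hχi z w hzw, hVi k z w hzw]) j fun z hz => by
      by_cases hzΩ : z ∈ Ω
      · rw [hvan' z hzΩ hz, mul_zero]
      · rw [image_eq_zero_of_notMem_tsupport fun hm => hzΩ (hs hm), zero_mul]
  have hfin : ∀ᶠ y' in 𝓝 y, modBase π φ k (ϖ y') = ‖ψ y' j‖ ^ 2 * G (ψ y') := by
    filter_upwards [eV k, (tendsto_chart hy).eventually h1] with y' h2 h3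
    rw [← h2, ← eG, h3, one_mul]
  refine ⟨k, ?_, G, hG, hGi, hfin⟩
  have := hfin.self_of_nhds
  rw [← e, h.modBase_eq hφ hx, hj] at this
  simpa using this

/-- Near points with the same image in the base, the squared moduli of standard coordinates agree
up to a permutation and positive smooth factors. -/
theorem SameBase.exists_match (h : SameBase (n := n) π ϖ) (hM : IsStandard n M)
    (hN : IsStandard n N) (hφ : IsStdChart φ K a) (hψ : IsStdChart ψ K' a') {x : M} {y : N}
    (hx : x ∈ φ.source) (hy : y ∈ ψ.source) (e : π x = ϖ y) :
    ∃ (σ : Equiv.Perm (Fin n)) (g : Fin n → Model n → ℝ), (∀ i, ContDiff ℝ ∞ (g i)) ∧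
      (∀ i, ModInv (g i)) ∧ (∀ i, 0 < g i (ψ y)) ∧
      ∀ᶠ y' in 𝓝 y, ∀ i, modBase π φ i (ϖ y') = ‖ψ y' (σ i)‖ ^ 2 * g i (ψ y') := by
  classical
  choose V hV hVi eV using fun k => h.exists_modInv_modBase hM hφ hψ hx hy e k
  have hA : ∀ j, ∃ k G, ψ y j = 0 → φ x k = 0 ∧ ContDiff ℝ ∞ G ∧ ModInv G ∧
      ∀ᶠ y' in 𝓝 y, modBase π φ k (ϖ y') = ‖ψ y' j‖ ^ 2 * G (ψ y') := by
    intro j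
    by_cases hj : ψ y j = 0
    · obtain ⟨k, h1, G, h2⟩ := h.exists_vanish hM hN hφ hψ hx hy e hj
      exact ⟨k, G, fun _ => ⟨h1, h2⟩⟩
    · exact ⟨j, 0, fun h => absurd h hj⟩
  have hA' : ∀ i, ∃ k G, φ x i = 0 → ψ y k = 0 ∧ ContDiff ℝ ∞ G ∧ ModInv G ∧
      ∀ᶠ x' in 𝓝 x, modBase ϖ ψ k (π x') = ‖φ x' i‖ ^ 2 * G (φ x') := by
    intro i
    by_cases hi : φ x i = 0
    · obtain ⟨k, h1, G, h2⟩ := h.symm.exists_vanish hN hM hψ hφ hy hx e.symm hi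
      exact ⟨k, G, fun _ => ⟨h1, h2⟩⟩
    · exact ⟨i, 0, fun h => absurd h hi⟩
  choose τ G hτ using hA
  choose τ' G' hτ' using hA'
  have hgen : ∀ (m : Model n) (i k : Fin n), (∀ᶠ z in 𝓝 m, z i = 0 → z k = 0) → m i = 0 →
      k = i := by
    intro m i k hev hmi
    by_contra hk
    let γ : ℝ → Model n := fun s l => if l = i then 0 else if m l = 0 then (s : ℂ) else m l
    have hγ : Continuous γ := continuous_pi fun l => by
      simp only [γ]
      split_ifs <;> fun_prop
    have hγ0 : γ 0 = m := funext fun l => by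
      simp only [γ]
      split_ifs with h1 h2
      · rw [h1, hmi]
      · simp [h2]
      · rfl
    have ht := hγ.tendsto 0
    rw [hγ0] at ht
    obtain ⟨s, hs, hs0⟩ := (((ht.mono_left (nhdsWithin_le_nhds (s := {0}ᶜ))).eventually hev).and
      self_mem_nhdsWithin).exists
    have h1 := hs (if_pos rfl)
    simp only [γ, if_neg hk] at h1
    split_ifs at h1 with h2
    · exact hs0 (by simpa using h1)
    · exact h2 h1
  have hττ' : ∀ i, φ x i = 0 → τ (τ' i) = i := by
    intro i hi
    obtain ⟨h1, -, -, h2⟩ := hτ' i hi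
    obtain ⟨-, -, -, h3⟩ := hτ _ h1
    refine hgen (φ x) i _ ((eventually_chart hx).2 ?_) hi
    have h4 : ∀ᶠ x' in 𝓝 x, modBase ϖ ψ (τ' i) (π x') = 0 → modBase π φ (τ (τ' i)) (π x') = 0 := by
      refine h.eventually_base hM hN e
        (p := fun b => modBase ϖ ψ (τ' i) b = 0 → modBase π φ (τ (τ' i)) b = 0) ?_
      filter_upwards [h3, ψ.open_source.mem_nhds hy] with y' h5 h6 h7
      rw [h.symm.modBase_eq hψ h6] at h7
      rw [h5, h7, zero_mul]
    filter_upwards [h2, h4, φ.open_source.mem_nhds hx] with x' h5 h6 h7 h8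
    rw [h8] at h5
    have := h6 (by rw [h5]; simp)
    rw [h.modBase_eq hφ h7] at this
    simpa using this
  have hτ'τ : ∀ j, ψ y j = 0 → τ' (τ j) = j := by
    intro j hj
    obtain ⟨h1, -, -, h2⟩ := hτ j hj
    obtain ⟨-, -, -, h3⟩ := hτ' _ h1
    refine hgen (ψ y) j _ ((eventually_chart hy).2 ?_) hj
    have h4 : ∀ᶠ y' in 𝓝 y, modBase π φ (τ j) (ϖ y') = 0 → modBase ϖ ψ (τ' (τ j)) (ϖ y') = 0 := by
      refine h.symm.eventually_base hN hM e.symm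
        (p := fun b => modBase π φ (τ j) b = 0 → modBase ϖ ψ (τ' (τ j)) b = 0) ?_
      filter_upwards [h3, φ.open_source.mem_nhds hx] with x' h5 h6 h7
      rw [h.modBase_eq hφ h6] at h7
      rw [h5, h7, zero_mul]
    filter_upwards [h2, h4, ψ.open_source.mem_nhds hy] with y' h5 h6 h7 h8
    rw [h8] at h5
    have := h6 (by rw [h5]; simp)
    rw [h.symm.modBase_eq hψ h7] at this
    simpa using this
  let E : {i // φ x i = 0} ≃ {j // ψ y j = 0} :=
    { toFun := fun i => ⟨τ' i, (hτ' i i.2).1⟩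
      invFun := fun j => ⟨τ j, (hτ j j.2).1⟩
      left_inv := fun i => Subtype.ext (hττ' i i.2)
      right_inv := fun j => Subtype.ext (hτ'τ j j.2) }
  let σ : Equiv.Perm (Fin n) := E.extendSubtype
  have hσ : ∀ i, φ x i = 0 → σ i = τ' i := fun i hi => E.extendSubtype_apply_of_mem i hi
  have hσ' : ∀ i, φ x i ≠ 0 → ψ y (σ i) ≠ 0 := fun i hi => E.extendSubtype_not_mem i hi
  have main : ∀ i, ∃ g : Model n → ℝ, ContDiff ℝ ∞ g ∧ ModInv g ∧ 0 < g (ψ y) ∧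
      ∀ᶠ y' in 𝓝 y, modBase π φ i (ϖ y') = ‖ψ y' (σ i)‖ ^ 2 * g (ψ y') := by
    intro i
    by_cases hi : φ x i = 0
    · obtain ⟨h1, hG', hGi', h2⟩ := hτ' i hi
      obtain ⟨-, hG, hGi, h3⟩ := hτ _ h1
      rw [hττ' i hi] at h3
      refine ⟨G (τ' i), hG, hGi, ?_, by rw [hσ i hi]; exact h3⟩
      obtain ⟨c, hc0, hc⟩ : ∃ c > 0, ∀ᶠ x' in 𝓝 x, G' i (φ x') ≤ c := by
        refine ⟨|G' i (φ x)| + 1, by positivity, ?_⟩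
        have h4 : G' i (φ x) < |G' i (φ x)| + 1 := (le_abs_self _).trans_lt (lt_add_one _)
        refine (eventually_chart hx (q := fun z => G' i z ≤ |G' i (φ x)| + 1)).1 ?_
        exact (hG'.continuous.continuousAt.eventually_lt continuousAt_const h4).mono fun _ h => h.le
      have h4 : ∀ᶠ y' in 𝓝 y, modBase ϖ ψ (τ' i) (ϖ y') ≤ c * modBase π φ i (ϖ y') := by
        refine h.symm.eventually_base hN hM e.symm
          (p := fun b => modBase ϖ ψ (τ' i) b ≤ c * modBase π φ i b) ?_
        filter_upwards [h2, hc, φ.open_source.mem_nhds hx] with x' h5 h6 h7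
        rw [h5, h.modBase_eq hφ h7, mul_comm]
        exact mul_le_mul_of_nonneg_right h6 (by positivity)
      have h5 : ∀ᶠ z in 𝓝 (ψ y), z (τ' i) ≠ 0 → 1 ≤ c * G (τ' i) z := by
        rw [eventually_chart hy]
        filter_upwards [h3, h4, ψ.open_source.mem_nhds hy] with y' h6 h7 h8 h9
        rw [h6, h.symm.modBase_eq hψ h8] at h7
        have h10 : 0 < ‖ψ y' (τ' i)‖ ^ 2 := by positivity
        nlinarith
      have h6 : 1 ≤ c * G (τ' i) (ψ y) := by
        have hd := dense_coord_ne_zero (τ' i) (ψ y)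
        rw [mem_closure_iff_nhdsWithin_neBot] at hd
        refine ge_of_tendsto (b := 1) (x := 𝓝[{z : Model n | z (τ' i) ≠ 0}] (ψ y))
          (((continuous_const.mul hG.continuous).tendsto (ψ y)).mono_left nhdsWithin_le_nhds) ?_
        filter_upwards [nhdsWithin_le_nhds h5, self_mem_nhdsWithin] with z h7 h8 using h7 h8
      by_contra hneg
      push Not at hneg
      nlinarith
    · have hσi := hσ' i hi
      have hΩo : IsOpen {z : Model n | z (σ i) ≠ 0} :=
        isOpen_ne_fun (continuous_apply _) continuous_const
      have hΩi : ModInv (· ∈ {z : Model n | z (σ i) ≠ 0}) := fun z w hzw => by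
        have h1 : z (σ i) ≠ 0 ↔ w (σ i) ≠ 0 := by
          rw [← norm_ne_zero_iff, hzw, norm_ne_zero_iff]
        exact propext h1
      obtain ⟨χ, hχ, hχi, h1, -, hs⟩ := exists_modInv_bump hΩo hΩi hσi
      have hsm : ContDiffOn ℝ ∞ (fun z : Model n => V i z / ‖z (σ i)‖ ^ 2)
          {z : Model n | z (σ i) ≠ 0} :=
        (hV i).contDiffOn.div (contDiff_normSq (σ i)).contDiffOn fun z hz => by
          have : z (σ i) ≠ 0 := hz
          positivity
      refine ⟨_, contDiff_smul_of_tsupport_subset hΩo hsm hχ hs, fun z w hzw => ?_, ?_, ?_⟩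
      · simp only [hχi z w hzw, hVi i z w hzw, hzw]
      · simp only [h1.self_of_nhds, one_smul]
        rw [(eV i).self_of_nhds, ← e, h.modBase_eq hφ hx]
        positivity
      · filter_upwards [eV i, (tendsto_chart hy).eventually h1,
          (tendsto_chart hy).eventually (hΩo.mem_nhds hσi)] with y' h2 h3 h4
        have h4 : ψ y' (σ i) ≠ 0 := h4
        simp only [h3, one_smul]
        rw [← h2, mul_div_cancel₀ _ (by positivity)]
  choose g hg hgi hgp hge using main
  exact ⟨σ, g, hg, hgi, hgp, eventually_all.2 hge⟩

end Match

/-! ## Vector fields that preserve an ideal -/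

section IdealCharts

variable {P : Type*} [TopologicalSpace P] {S : Subalgebra ℝ (P → ℝ)} {ι : Type} [Fintype ι]
  [DecidableEq ι] {C : Set (OpenPartialHomeomorph P (ι → ℂ))} {A : Algebroid S}

/-- The product of the squared moduli of some of the coordinates. -/
def normProd (T : Finset ι) (z : ι → ℂ) : ℝ := ∏ i ∈ T, ‖z i‖ ^ 2

theorem contDiff_normProd (T : Finset ι) : ContDiff ℝ ∞ (normProd T) :=
  contDiff_prod fun i _ => contDiff_normSq i

theorem fderiv_normProd (T : Finset ι) (z v : ι → ℂ) : fderiv ℝ (normProd T) z v =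
    ∑ i ∈ T, 2 * (starRingEnd ℂ (z i) * v i).re * ∏ j ∈ T.erase i, ‖z j‖ ^ 2 := by
  have h1 : ∀ i ∈ T, HasFDerivAt (fun z : ι → ℂ => ‖z i‖ ^ 2)
      (2 • (innerSL ℝ (z i)).comp (ContinuousLinearMap.proj i)) z := fun i _ =>
    (hasFDerivAt_apply i z).norm_sq
  have h2 := HasFDerivAt.finsetProd h1
  have h3 : HasFDerivAt (normProd T) _ z := h2
  rw [h3.fderiv, sum_apply]
  refine Finset.sum_congr rfl fun i _ => ?_
  simp only [smul_apply, ContinuousLinearMap.comp_apply, ContinuousLinearMap.proj_apply,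
    innerSL_apply_apply, Complex.inner, smul_eq_mul, nsmul_eq_mul]
  push_cast
  ring_nf

theorem fderiv_normProd_mul (T : Finset ι) (z c : ι → ℂ) : fderiv ℝ (normProd T) z (c * z) =
    normProd T z * ∑ i ∈ T, 2 * (c i).re := by
  rw [fderiv_normProd, Finset.mul_sum]
  refine Finset.sum_congr rfl fun i hi => ?_
  rw [normProd, ← Finset.mul_prod_erase T _ hi, Pi.mul_apply]
  have : (starRingEnd ℂ (z i) * (c i * z i)).re = ‖z i‖ ^ 2 * (c i).re := by
    have h1 : starRingEnd ℂ (z i) * (c i * z i) = ((‖z i‖ ^ 2 : ℝ) : ℂ) * c i := by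
      rw [← Complex.normSq_eq_norm_sq, Complex.normSq_eq_conj_mul_self]
      ring
    rw [h1, Complex.re_ofReal_mul]
  rw [this]
  ring

theorem normProd_ne_zero {T : Finset ι} {z : ι → ℂ} (h : ∀ i, z i ≠ 0) : normProd T z ≠ 0 :=
  Finset.prod_ne_zero_iff.2 fun i _ => pow_ne_zero _ (norm_ne_zero_iff.2 (h i))

/-- The ideal `J` is generated locally by the product of `|φ_i|^2` with `i ∈ T`. -/
structure IdealCharts (J : Ideal S) (C : Set (OpenPartialHomeomorph P (ι → ℂ)))
    (T : Finset ι) : Prop where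
  rep : ∀ f ∈ J, ∀ φ ∈ C, ∀ p ∈ φ.source, ∃ G : (ι → ℂ) → ℝ, ContDiff ℝ ∞ G ∧
    ∀ᶠ x in 𝓝 p, (f : P → ℝ) x = normProd T (φ x) * G (φ x)
  gen : ∀ φ ∈ C, ∀ p ∈ φ.source, ∃ f ∈ J, ∀ᶠ x in 𝓝 p, (f : P → ℝ) x = normProd T (φ x)
  of_local : ∀ f : S, (∀ p, ∃ φ ∈ C, p ∈ φ.source ∧ ∃ G : (ι → ℂ) → ℝ, ContDiff ℝ ∞ G ∧
    ∀ᶠ x in 𝓝 p, (f : P → ℝ) x = normProd T (φ x) * G (φ x)) → f ∈ J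

theorem IdealCharts.exists_comps {J : Ideal S} {T : Finset ι} (hJ : IdealCharts J C T) {X : A}
    (hX : X.1 ∈ preserving J) {φ : OpenPartialHomeomorph P (ι → ℂ)} (hφ : φ ∈ C) {p : P}
    (hp : p ∈ φ.source) {v : (ι → ℂ) → ι → ℂ} (hv : ContDiff ℝ ∞ v)
    (hXv : ∀ᶠ x in 𝓝 p, ∀ f : S, val X f x = dch φ f x (v (φ x))) {i : ι} (hi : i ∈ T) :
    ∃ c : (ι → ℂ) → ℂ, ContDiff ℝ ∞ c ∧ ∀ᶠ z in 𝓝 (φ p), v z i = c z * z i := by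
  obtain ⟨f, hf, ef⟩ := hJ.gen φ hφ p hp
  obtain ⟨h, hh, eh⟩ := hJ.rep _ (hX f hf) φ hφ p hp
  have h1 : ∀ᶠ z in 𝓝 (φ p), fderiv ℝ (normProd T) z (v z) = normProd T z * h z := by
    rw [← φ.map_nhds_eq hp, eventually_map]
    filter_upwards [hXv, ef.eventually_nhds, eh, φ.open_source.mem_nhds hp] with x h1 h2 h3 h4
    rw [← dch_eq h4 h2, ← h1 f, ← h3]
    rfl
  obtain ⟨χ, hχ, hχ1, -, hs⟩ := exists_bump_of_mem_nhds h1
  obtain ⟨c, hc, e⟩ := exists_log_components T (hχ.smul hv) (hχ.mul hh) (fun z => by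
    by_cases hz : z ∈ {z | fderiv ℝ (normProd T) z (v z) = normProd T z * h z}
    · have h2 : fderiv ℝ (normProd T) z (χ z • v z) = χ z * (normProd T z * h z) := by
        rw [map_smul, hz, smul_eq_mul]
      rw [fderiv_normProd] at h2
      refine h2.trans ?_
      rw [normProd]
      ring
    · have h0 : χ z = 0 := image_eq_zero_of_notMem_tsupport fun hm => hz (hs hm)
      simp [h0]) hi
  refine ⟨c, hc, hχ1.mono fun z hz => ?_⟩
  rw [← e z, Pi.smul_apply', hz, one_smul]

theorem IdealCharts.preserving {J : Ideal S} {T : Finset ι}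
    (hJ : IdealCharts J C T) {X : A} (hX : ∀ p, ∃ φ ∈ C, p ∈ φ.source ∧
      ∃ c : (ι → ℂ) → ι → ℂ, ContDiff ℝ ∞ c ∧ ∀ᶠ x in 𝓝 p, HasComps φ X c x) :
    X.1 ∈ preserving J := by
  intro f hf
  refine hJ.of_local _ fun p => ?_
  obtain ⟨φ, hφ, hp, c, hc, hXc⟩ := hX p
  obtain ⟨G, hG, eG⟩ := hJ.rep f hf φ hφ p hp
  refine ⟨φ, hφ, hp, fun z => (∑ i ∈ T, 2 * (c z i).re) * G z + fderiv ℝ G z (c z * z), ?_, ?_⟩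
  · refine ContDiff.add (ContDiff.mul (ContDiff.sum fun i _ => contDiff_const.mul ?_) hG)
      (contDiff_fderiv_comps hG hc)
    exact Complex.reCLM.contDiff.comp (contDiff_pi.1 hc i)
  · filter_upwards [hXc, eG.eventually_nhds, φ.open_source.mem_nhds hp] with x h1 h2 h3
    have h4 := h1 f
    rw [dch_eq h3 h2 (G := fun z => normProd T z * G z),
      fderiv_fun_mul ((contDiff_normProd T).differentiable (by simp) _)
      (hG.differentiable (by simp) _), add_apply, smul_apply, smul_apply, fderiv_normProd_mul] at h4
    refine Eq.trans h4 ?_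
    simp only [smul_eq_mul]
    ring

theorem SmoothCharts.exists_comps (hC : SmoothCharts S C) [T2Space P] {X : A}
    {φ : OpenPartialHomeomorph P (ι → ℂ)} (hφ : φ ∈ C) {p : P} (hp : p ∈ φ.source)
    (hX : ∀ v : (ι → ℂ) → ι → ℂ, ContDiff ℝ ∞ v →
      (∀ᶠ x in 𝓝 p, ∀ f : S, val X f x = dch φ f x (v (φ x))) → ∀ i,
        ∃ c : (ι → ℂ) → ℂ, ContDiff ℝ ∞ c ∧ ∀ᶠ z in 𝓝 (φ p), v z i = c z * z i) :
    ∃ c : (ι → ℂ) → ι → ℂ, ContDiff ℝ ∞ c ∧ ∀ᶠ x in 𝓝 p, HasComps φ X c x := by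
  obtain ⟨v, hv, hXv⟩ := hC.exists_vector X hφ hp
  choose c hc e using hX v hv hXv
  refine ⟨fun z i => c i z, contDiff_pi.2 hc, ?_⟩
  filter_upwards [hXv, (tendsto_chart hp).eventually (eventually_all.2 e)] with x h1 h2 f
  rw [h1 f]
  congr 1
  funext i
  exact h2 i

end IdealCharts

section Elliptic

variable {n : ℕ} {M : Type*} [TopologicalSpace M] [ChartedSpace (Model n) M]
  [MulAction (Torus n) M] [SmoothManifold n M]

theorem sameBase_orbitMap : SameBase (n := n) (orbitMap n M) (orbitMap n M) := by
  have h1 : Topology.IsQuotientMap (orbitMap n M) := isQuotientMap_quot_mk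
  have h2 : ∀ m₁ m₂ : M, orbitMap n M m₁ = orbitMap n M m₂ ↔ ∃ t : Torus n, t • m₁ = m₂ := by
    intro m₁ m₂
    have : orbitMap n M m₁ = orbitMap n M m₂ ↔ orbitMap n M m₂ = orbitMap n M m₁ := eq_comm
    rw [this]
    exact Quotient.eq.trans MulAction.orbitRel_apply
  exact ⟨h1, h1, h2, h2, fun _ _ _ => Iff.rfl⟩

/-- Near a point two standard charts have the same product of squared moduli up to a positive
factor. -/
theorem exists_normProd_eq (hM : IsStandard n M) {φ ψ : OpenPartialHomeomorph M (Model n)}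
    (hφ : φ ∈ stdCharts n M) (hψ : ψ ∈ stdCharts n M) {p : M} (hp : p ∈ φ.source)
    (hp' : p ∈ ψ.source) : ∃ Γ : Model n → ℝ, ContDiff ℝ ∞ Γ ∧ 0 < Γ (ψ p) ∧
      ∀ᶠ x in 𝓝 p, normProd Finset.univ (φ x) = normProd Finset.univ (ψ x) * Γ (ψ x) := by
  obtain ⟨K, a, hφ⟩ := hφ
  obtain ⟨K', a', hψ⟩ := hψ
  have hB := sameBase_orbitMap (n := n) (M := M)
  obtain ⟨σ, g, hg, -, hgp, e⟩ := hB.exists_match hM hM hφ hψ hp hp' rfl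
  refine ⟨fun z => ∏ i, g i z, contDiff_prod fun i _ => hg i, Finset.prod_pos fun i _ => hgp i, ?_⟩
  filter_upwards [e, φ.open_source.mem_nhds hp] with x h1 h2
  have h3 : ∀ i, ‖φ x i‖ ^ 2 = ‖ψ x (σ i)‖ ^ 2 * g i (ψ x) := fun i => by
    rw [← h1, hB.modBase_eq hφ h2]
  rw [normProd, Finset.prod_congr rfl fun i _ => h3 i, Finset.prod_mul_distrib, normProd]
  congr 1
  exact Equiv.prod_comp σ fun i => ‖ψ x i‖ ^ 2

theorem glue_quotients {U : Set (Model n)} (hU : IsOpen U) {u f : Model n → ℝ}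
    (hd : Dense {z | u z ≠ 0}) (hf : ∀ z ∈ U, ∃ G : Model n → ℝ, ContDiff ℝ ∞ G ∧
      ∀ᶠ w in 𝓝 z, f w = u w * G w) :
    ∃ g : Model n → ℝ, ContDiffOn ℝ ∞ g U ∧ ∀ z ∈ U, f z = u z * g z := by
  classical
  choose! G hG e using hf
  have key : ∀ z ∈ U, ∀ᶠ w in 𝓝 z, G w w = G z w := by
    intro z hz
    filter_upwards [(e z hz).eventually_nhds, hU.mem_nhds hz] with w hw hwU
    have hne : (𝓝[{z | u z ≠ 0}] w).NeBot := mem_closure_iff_nhdsWithin_neBot.1 (hd w)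
    refine tendsto_nhds_unique_of_eventuallyEq
      (((hG w hwU).continuous.tendsto w).mono_left nhdsWithin_le_nhds)
      (((hG z hz).continuous.tendsto w).mono_left (nhdsWithin_le_nhds (s := {z | u z ≠ 0}))) ?_
    filter_upwards [nhdsWithin_le_nhds hw, nhdsWithin_le_nhds (e w hwU), self_mem_nhdsWithin]
      with y h1 h2 h3
    have h3 : u y ≠ 0 := h3
    exact mul_left_cancel₀ h3 (h2.symm.trans h1)
  exact ⟨fun z => G z z, fun z hz => ((hG z hz).contDiffAt.congr_of_eventuallyEq
    (key z hz)).contDiffWithinAt, fun z hz => (e z hz).self_of_nhds⟩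

theorem dense_normProd_ne_zero : Dense {z : Model n | normProd Finset.univ z ≠ 0} :=
  dense_ne_zero.mono fun _ hz => normProd_ne_zero hz

theorem normProd_univ (z : Model n) : normProd Finset.univ z = ∏ i, ‖z i‖ ^ 2 := rfl

theorem idealCharts_elliptic (hM : IsStandard n M) :
    IdealCharts (ellipticIdeal n M) (stdCharts n M) Finset.univ := by
  have of_local : ∀ f : Smooth n M, (∀ p, ∃ φ ∈ stdCharts n M, p ∈ φ.source ∧
      ∃ G : Model n → ℝ, ContDiff ℝ ∞ G ∧
      ∀ᶠ x in 𝓝 p, (f : M → ℝ) x = normProd Finset.univ (φ x) * G (φ x)) →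
      f ∈ ellipticIdeal n M := by
    intro f hf ψ K a hψ
    have hψ' : ψ ∈ stdCharts n M := ⟨K, a, hψ⟩
    obtain ⟨g, hg, e⟩ := glue_quotients ψ.open_target
      (f := fun z => (f : M → ℝ) (ψ.symm z)) 
      dense_normProd_ne_zero fun z hz => by
        have hp := ψ.map_target hz
        obtain ⟨φ, hφ, hpφ, G, hG, eG⟩ := hf (ψ.symm z)
        obtain ⟨Γ, hΓ, -, eΓ⟩ := exists_normProd_eq hM hφ hψ' hpφ hp
        obtain ⟨f2, e2⟩ := (smoothCharts hM).exists_eq hφ hpφ hG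
        obtain ⟨G2, hG2, e3⟩ := (smoothCharts hM).smooth f2 ψ hψ' _ hp
        refine ⟨fun w => Γ w * G2 w, hΓ.mul hG2, ?_⟩
        have ht := ψ.continuousAt_symm hz
        filter_upwards [ht.eventually eG, ht.eventually eΓ, ht.eventually e2, ht.eventually e3,
          ψ.open_target.mem_nhds hz] with w h1 h2 h3 h4 h5
        rw [h1, h2, ← h3, h4, ψ.right_inv h5, mul_assoc]
    exact ⟨g, hg, e⟩
  refine ⟨fun f hf φ hφ p hp => ?_, fun φ hφ p hp => ?_, of_local⟩
  · obtain ⟨K, a, hφ⟩ := hφ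
    obtain ⟨g, hg, e⟩ := hf φ K a hφ
    obtain ⟨G, hG, eG⟩ := exists_contDiff_eq φ.open_target (φ.map_source hp) hg
    refine ⟨G, hG, ?_⟩
    filter_upwards [φ.open_source.mem_nhds hp, (tendsto_chart hp).eventually eG] with x h1 h2
    rw [h2, normProd_univ, ← e _ (φ.map_source h1), φ.left_inv h1]
  · obtain ⟨χ, hχ, h1, hc, hs⟩ :=
      exists_bump_of_mem_nhds (φ.open_target.mem_nhds (φ.map_source hp))
    have hs' : tsupport (fun z => normProd Finset.univ z * χ z) ⊆ tsupport χ :=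
      tsupport_mul_subset_right
    obtain ⟨f, hf, hf0⟩ := (smoothCharts hM).exists_bump hφ ((contDiff_normProd Finset.univ).mul hχ)
      hc.mul_left (hs'.trans hs)
    refine ⟨f, of_local f fun q => ?_, ?_⟩
    · by_cases hq : q ∈ φ.source
      · refine ⟨φ, hφ, hq, χ, hχ, ?_⟩
        filter_upwards [φ.open_source.mem_nhds hq] with x hx using hf x hx
      · obtain ⟨φ', hφ', hq'⟩ := (smoothCharts hM).cover q
        exact ⟨φ', hφ', hq', fun _ => 0, contDiff_const, (hf0 q hq).mono fun x hx => by
          rw [hx, mul_zero]⟩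
    · filter_upwards [φ.open_source.mem_nhds hp, (tendsto_chart hp).eventually h1] with x hx h2
      rw [hf x hx, h2, mul_one]

theorem logCharts (hM : IsStandard n M) :
    LogCharts (elliptic n M) (stdCharts n M) (principal n M) where
  toSmoothCharts := smoothCharts hM
  t2 := inferInstance
  comps X φ hφ p hp := (smoothCharts hM).exists_comps hφ hp fun v hv hXv i =>
    (idealCharts_elliptic hM).exists_comps X.2 hφ hp hv hXv (Finset.mem_univ i)
  mem X hX := (idealCharts_elliptic hM).preserving hX
  principal φ hφ p hp := by
    obtain ⟨K, a, hφ⟩ := hφ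
    exact hφ.mem_principal_iff hp

/-- A global generator of the elliptic ideal. -/
theorem exists_generator (hM : IsStandard n M) : ∃ f ∈ ellipticIdeal n M,
    ∀ φ ∈ stdCharts n M, ∀ p ∈ φ.source, ∃ G : Model n → ℝ, ContDiff ℝ ∞ G ∧ 0 < G (φ p) ∧
      ∀ᶠ x in 𝓝 p, (f : M → ℝ) x = normProd Finset.univ (φ x) * G (φ x) := by
  classical
  choose φ hφ hp using (smoothCharts hM).cover
  have : LocallyCompactSpace M := Manifold.locallyCompact_of_finiteDimensional 𝓘(ℝ, Model n)
  obtain ⟨ρ, hρ⟩ := SmoothPartitionOfUnity.exists_isSubordinate 𝓘(ℝ, Model n) isClosed_univ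
    (fun p => (φ p).source) (fun p => (φ p).open_source) fun p _ => mem_iUnion.2 ⟨p, hp p⟩
  let f : M → ℝ := fun x => ∑ᶠ p, ρ p x • normProd Finset.univ (φ p x)
  have hf : ContMDiff 𝓘(ℝ, Model n) 𝓘(ℝ, ℝ) ∞ f := by
    refine ρ.contMDiff_finsum_smul fun p x hx => ?_
    obtain ⟨K, a, hφp⟩ := hφ p
    exact (contDiff_normProd Finset.univ).contMDiff.contMDiffAt.comp x
      ((contMDiffOn_of_mem_maximalAtlas hφp.mem_atlas).contMDiffAt
        ((φ p).open_source.mem_nhds (hρ p hx)))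
  have hrep : ∀ ψ ∈ stdCharts n M, ∀ p ∈ ψ.source, ∃ G : Model n → ℝ, ContDiff ℝ ∞ G ∧
      0 < G (ψ p) ∧ ∀ᶠ x in 𝓝 p, f x = normProd Finset.univ (ψ x) * G (ψ x) := by
    intro ψ hψ p hpψ
    obtain ⟨I, hI⟩ : ∃ I : Finset M, ∀ᶠ x in 𝓝 p, ∑ i ∈ I, ρ i x = 1 ∧
        (Function.support fun i => ρ i x) ⊆ I := ρ.toPartitionOfUnity.exists_finset_nhds p
    have h1 : ∀ i, ∃ Γ : Model n → ℝ, ContDiff ℝ ∞ Γ ∧ 0 < Γ (ψ p) ∧ ∀ᶠ x in 𝓝 p,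
        ρ i x * normProd Finset.univ (φ i x) =
          ρ i x * (normProd Finset.univ (ψ x) * Γ (ψ x)) := by
      intro i
      by_cases hi : p ∈ tsupport (ρ i)
      · obtain ⟨Γ, hΓ, hpos, e⟩ := exists_normProd_eq hM (hφ i) hψ (hρ i hi) hpψ
        exact ⟨Γ, hΓ, hpos, e.mono fun x hx => by rw [hx]⟩
      · refine ⟨fun _ => 1, contDiff_const, one_pos, ?_⟩
        filter_upwards [(isClosed_tsupport (ρ i)).isOpen_compl.mem_nhds hi] with x hx
        rw [image_eq_zero_of_notMem_tsupport hx, zero_mul, zero_mul]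
    choose Γ hΓ hpos eΓ using h1
    have h2 : ∀ i, ∃ R : Model n → ℝ, ContDiff ℝ ∞ R ∧ ∀ᶠ x in 𝓝 p, ρ i x = R (ψ x) := fun i =>
      (smoothCharts hM).smooth ⟨ρ i, (ρ i).contMDiff⟩ ψ hψ p hpψ
    choose R hR eR using h2
    refine ⟨fun z => ∑ i ∈ I, R i z * Γ i z, ContDiff.sum fun i _ => (hR i).mul (hΓ i), ?_, ?_⟩
    · have h3 : ∑ i ∈ I, ρ i p = 1 := hI.self_of_nhds.1
      simp only [← (eR _).self_of_nhds]
      have h4 : ∀ i ∈ I, 0 ≤ ρ i p * Γ i (ψ p) := fun i _ =>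
        mul_nonneg (ρ.nonneg i p) (hpos i).le
      obtain ⟨i, hi, h5⟩ := Finset.exists_ne_zero_of_sum_ne_zero (h3.trans_ne one_ne_zero)
      refine Finset.sum_pos' h4 ⟨i, hi, mul_pos (lt_of_le_of_ne (ρ.nonneg i p) h5.symm) (hpos i)⟩
    · filter_upwards [hI, (Finset.eventually_all I).2 fun i _ => eΓ i,
        (Finset.eventually_all I).2 fun i _ => eR i] with x h3 h4 h5
      have h6 : f x = ∑ i ∈ I, ρ i x • normProd Finset.univ (φ i x) :=
        finsum_eq_sum_of_support_subset _ fun i hi => h3.2 (by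
          intro h0
          apply hi
          have h0 : ρ i x = 0 := h0
          simp only [h0, zero_smul])
      rw [h6, Finset.mul_sum]
      refine Finset.sum_congr rfl fun i hi => ?_
      rw [smul_eq_mul, h4 i hi, h5 i hi]
      ring
  refine ⟨⟨f, hf⟩, (idealCharts_elliptic hM).of_local _ fun p => ?_, hrep⟩
  obtain ⟨ψ, hψ, hpψ⟩ := (smoothCharts hM).cover p
  obtain ⟨G, hG, -, e⟩ := hrep ψ hψ p hpψ
  exact ⟨ψ, hψ, hpψ, G, hG, e⟩

end Elliptic

section LogEtaleCharts

variable {P P' : Type*} [TopologicalSpace P] [TopologicalSpace P'] {S : Subalgebra ℝ (P → ℝ)}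
  {S' : Subalgebra ℝ (P' → ℝ)} {ι : Type} [Fintype ι] [DecidableEq ι]
  {C : Set (OpenPartialHomeomorph P (ι → ℂ))} {C' : Set (OpenPartialHomeomorph P' (ι → ℂ))}
  {A : Algebroid S} {A' : Algebroid S'} {W : Set P} {W' : Set P'} {ψ : P' → P}

/-- Where no coordinate vanishes, a map that acts on logarithmic components by an invertible matrix
has a smooth local inverse. -/
theorem LogEtaleAt.exists_localInverse {p : P'} {φ' : OpenPartialHomeomorph P' (ι → ℂ)}
    {φ : OpenPartialHomeomorph P (ι → ℂ)} {L L' : Matrix ι ι ℝ} {Ψ : (ι → ℂ) → ι → ℂ}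
    (h : LogEtaleAt C' C ψ p φ' φ L L' Ψ) (h0 : ∀ i, φ' p i ≠ 0) (h1 : ∀ i, φ (ψ p) i ≠ 0) :
    ∃ Θ : (ι → ℂ) → ι → ℂ, ContDiff ℝ ∞ Θ ∧ Θ (φ (ψ p)) = φ' p ∧
      (∀ᶠ z in 𝓝 (φ' p), Θ (Ψ z) = z) ∧ ∀ᶠ w in 𝓝 (φ (ψ p)), Ψ (Θ w) = w := by
  have e0 : φ (ψ p) = Ψ (φ' p) := h.eq.self_of_nhds
  have hinj : ∀ᶠ z in 𝓝 (φ' p), Function.Injective (fderiv ℝ Ψ z) := by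
    have h2 : ∀ᶠ z in 𝓝 (φ' p), ∀ i, Ψ z i ≠ 0 := by
      refine eventually_all.2 fun i => ?_
      have h3 : Continuous fun z => Ψ z i := (continuous_apply i).comp h.contDiff.continuous
      exact h3.continuousAt.eventually_ne (by rw [← e0]; exact h1 i)
    have h3 : ∀ᶠ z in 𝓝 (φ' p), ∀ i, z i ≠ 0 := eventually_all.2 fun i =>
      (continuous_apply i).continuousAt.eventually_ne (h0 i)
    filter_upwards [h.fderiv_eq, h2, h3] with z h4 h5 h6
    rw [injective_iff_map_eq_zero]
    intro v hv
    have e : (v / z) * z = v := funext fun i => div_mul_cancel₀ _ (h6 i)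
    have h7 := h4 (v / z)
    rw [e, hv] at h7
    have h8 : realMul L (v / z) = 0 := funext fun i => by
      rcases mul_eq_zero.1 (congrFun h7 i).symm with h8 | h8
      · exact h8
      · exact absurd h8 (h5 i)
    have h9 := realMul_injective (L := L') (L' := L) (mul_eq_one_comm.1 h.inv)
    have h10 : v / z = 0 := h9 (by rw [h8, map_zero])
    rw [← e, h10, zero_mul]
  have hequiv : ∀ z, Function.Injective (fderiv ℝ Ψ z) →
      ∃ T : (ι → ℂ) ≃L[ℝ] (ι → ℂ), HasFDerivAt Ψ (T : (ι → ℂ) →L[ℝ] (ι → ℂ)) z := by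
    intro z hz
    refine ⟨(LinearEquiv.ofInjectiveEndo (fderiv ℝ Ψ z).toLinearMap hz).toContinuousLinearEquiv, ?_⟩
    convert! (h.contDiff.differentiable (by simp) z).hasFDerivAt using 1
  obtain ⟨T, hT⟩ := hequiv _ hinj.self_of_nhds
  let e := h.contDiff.contDiffAt.toOpenPartialHomeomorph Ψ hT (by simp)
  have hz : φ' p ∈ e.source :=
    h.contDiff.contDiffAt.mem_toOpenPartialHomeomorph_source hT (by simp)
  have hez : ∀ z, e z = Ψ z := fun _ => rfl
  have hmem : φ (ψ p) ∈ e.target := by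
    rw [e0]
    exact e.map_source hz
  have hsymm : e.symm (φ (ψ p)) = φ' p := by
    rw [e0]
    exact e.left_inv hz
  have htend : Tendsto e.symm (𝓝 (φ (ψ p))) (𝓝 (φ' p)) := by
    have := e.continuousAt_symm hmem
    rwa [ContinuousAt, hsymm] at this
  obtain ⟨V, hV, hVo, hmemV⟩ := eventually_nhds_iff.1 (htend.eventually hinj)
  have hsm : ContDiffOn ℝ ∞ e.symm (V ∩ e.target) := fun w hw => by
    obtain ⟨T', hT'⟩ := hequiv _ (hV w hw.1)
    exact (e.contDiffAt_symm hw.2 hT' h.contDiff.contDiffAt).contDiffWithinAt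
  obtain ⟨Θ, hΘ, eΘ⟩ := exists_contDiff_eq (hVo.inter e.open_target) ⟨hmemV, hmem⟩ hsm
  refine ⟨Θ, hΘ, eΘ.self_of_nhds.trans hsymm, ?_, ?_⟩
  · have h2 : Tendsto Ψ (𝓝 (φ' p)) (𝓝 (φ (ψ p))) := by
      rw [e0]
      exact h.contDiff.continuous.continuousAt
    filter_upwards [h2.eventually eΘ, e.open_source.mem_nhds hz] with z h3 h4
    rw [h3, ← hez, e.left_inv h4]
  · filter_upwards [eΘ, e.open_target.mem_nhds hmem] with w h3 h4
    rw [h3, ← hez, e.right_inv h4]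

theorem LogEtaleAt.map_nhds (hC' : LogCharts A' C' W') (hC : LogCharts A C W) {p : P'}
    {φ' : OpenPartialHomeomorph P' (ι → ℂ)} {φ : OpenPartialHomeomorph P (ι → ℂ)}
    {L L' : Matrix ι ι ℝ} {Ψ : (ι → ℂ) → ι → ℂ} (h : LogEtaleAt C' C ψ p φ' φ L L' Ψ)
    (hψ : Continuous ψ) (hp : p ∈ W') (hp' : ψ p ∈ W) : map ψ (𝓝 p) = 𝓝 (ψ p) := by
  refine le_antisymm hψ.continuousAt ?_
  obtain ⟨Θ, hΘ, e1, -, e3⟩ := h.exists_localInverse ((hC'.principal _ h.mem' _ h.source').1 hp)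
    ((hC.principal _ h.mem _ h.source).1 hp')
  have h1 : Tendsto (fun y => φ'.symm (Θ (φ y))) (𝓝 (ψ p)) (𝓝 p) := by
    have h2 := φ'.continuousAt_symm (φ'.map_source h.source')
    rw [ContinuousAt, φ'.left_inv h.source', ← e1] at h2
    exact h2.comp (hΘ.continuous.continuousAt.tendsto.comp (tendsto_chart h.source))
  have h4 : ∀ᶠ y in 𝓝 (ψ p), ψ (φ'.symm (Θ (φ y))) = y := by
    have h5 : Tendsto (fun y => Θ (φ y)) (𝓝 (ψ p)) (𝓝 (φ' p)) := by
      rw [← e1]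
      exact hΘ.continuous.continuousAt.tendsto.comp (tendsto_chart h.source)
    filter_upwards [h1.eventually h.eq,
      h1.eventually (hψ.continuousAt.eventually (φ.open_source.mem_nhds h.source)),
      h5.eventually (φ'.open_target.mem_nhds (φ'.map_source h.source')),
      (tendsto_chart h.source).eventually e3, φ.open_source.mem_nhds h.source] with y h6 h7 h8 h9 h10
    rw [φ'.right_inv h8, h9] at h6
    exact φ.injOn h7 h10 h6
  intro V hV
  filter_upwards [h4, h1.eventually hV] with y h5 h6
  rw [← h5]
  exact h6

theorem logEtale_of_charts (hC' : LogCharts A' C' W') (hC : LogCharts A C W) (hψ : Continuous ψ)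
    (hW : ∀ p ∈ W', ψ p ∈ W)
    (hc : ∀ p, ∃ φ' φ L L' Ψ, LogEtaleAt C' C ψ p φ' φ L L' Ψ) : LogEtale S' S C' C W' ψ where
  cont := hψ
  charts := hc
  pull g := hC'.of_local _ fun p => by
    obtain ⟨φ', φ, L, L', Ψ, h⟩ := hc p
    obtain ⟨G, hG, e⟩ := hC.smooth g φ h.mem _ h.source
    refine ⟨φ', h.mem', h.source', G ∘ Ψ, hG.comp h.contDiff, ?_⟩
    filter_upwards [h.eq, hψ.continuousAt.eventually e] with x h1 h2
    rw [Function.comp_apply, h2, h1]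
    rfl
  etale p hp f' := by
    have := hC.t2
    obtain ⟨φ', φ, L, L', Ψ, h⟩ := hc p
    obtain ⟨Θ, hΘ, -, e2, -⟩ := h.exists_localInverse
      ((hC'.principal _ h.mem' _ h.source').1 hp) ((hC.principal _ h.mem _ h.source).1 (hW p hp))
    obtain ⟨G, hG, e⟩ := hC'.smooth f' φ' h.mem' _ h.source'
    obtain ⟨f, hf⟩ := hC.exists_eq h.mem h.source (hG.comp hΘ)
    refine ⟨f, ?_⟩
    filter_upwards [hψ.continuousAt.eventually hf, e, h.eq, (tendsto_chart h.source').eventually e2]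
      with x h1 h2 h3 h4
    rw [Function.comp_apply, h1, Function.comp_apply, h3, h4, h2]

theorem hasDerivAt_comp_chart {φ : OpenPartialHomeomorph P (ι → ℂ)} (hC : SmoothCharts S C)
    (hφ : φ ∈ C) {x : P} (hx : x ∈ φ.source) (f : S) {θ : ℝ → P} {ζ : ℝ → ι → ℂ} {v : ι → ℂ}
    (hζ : HasDerivAt ζ v 0) (h0 : ζ 0 = φ x) (hθ : ∀ᶠ s in 𝓝 0, θ s = φ.symm (ζ s)) :
    HasDerivAt (fun s => (f : P → ℝ) (θ s)) (dch φ f x v) 0 := by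
  obtain ⟨G, hG, eG⟩ := hC.smooth f φ hφ x hx
  rw [dch_eq hx eG, ← h0]
  have h1 := ((hG.differentiable (by simp) (ζ 0)).hasFDerivAt).comp_hasDerivAt 0 hζ
  refine h1.congr_of_eventuallyEq ?_
  have h2 := comp_symm_eventuallyEq hx eG
  have h3 : Tendsto ζ (𝓝 0) (𝓝 (φ x)) := by
    rw [← h0]
    exact hζ.continuousAt
  filter_upwards [hθ, h3.eventually h2] with s h4 h5
  rw [h4]
  exact h5

/-- A flow which rotates the coordinates of the charts is generated by a section. -/
theorem LogCharts.exists_rotation (hC : LogCharts A C W) (θ : ℝ → P → P)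
    (hθ : ∀ φ ∈ C, ∃ β : ι → ℝ, ∀ x ∈ φ.source, ∀ s,
      θ s x ∈ φ.source ∧ φ (θ s x) = fun i => Complex.exp (β i * s * Complex.I) * φ x i) :
    ∃ X : A, (∀ (f : S) x, HasDerivAt (fun s => (f : P → ℝ) (θ s x)) (val X f x) 0) ∧
      ∀ φ ∈ C, ∀ β : ι → ℝ, (∀ x ∈ φ.source, ∀ s,
        θ s x ∈ φ.source ∧ φ (θ s x) = fun i => Complex.exp (β i * s * Complex.I) * φ x i) →
        ∀ x ∈ φ.source, HasComps φ X (fun _ i => β i * Complex.I) x := by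
  have key : ∀ φ ∈ C, ∀ β : ι → ℝ, (∀ x ∈ φ.source, ∀ s,
      θ s x ∈ φ.source ∧ φ (θ s x) = fun i => Complex.exp (β i * s * Complex.I) * φ x i) →
      ∀ x ∈ φ.source, ∀ f : S, HasDerivAt (fun s => (f : P → ℝ) (θ s x))
        (dch φ f x ((fun i => β i * Complex.I) * φ x)) 0 := by
    intro φ hφ β hβ x hx f
    refine hasDerivAt_comp_chart hC.toSmoothCharts hφ hx f
      (ζ := fun s i => Complex.exp (β i * s * Complex.I) * φ x i) ?_ (by simp)
      (.of_forall fun s => ?_)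
    · refine hasDerivAt_pi.2 fun i => ?_
      have h1 : HasDerivAt (fun s : ℝ => (β i : ℂ) * s * Complex.I) (β i * Complex.I) 0 := by
        have := ((Complex.ofRealCLM.hasDerivAt (x := (0 : ℝ))).const_mul (β i : ℂ)).mul_const
          Complex.I
        simpa using this
      have h2 := h1.cexp.mul_const (φ x i)
      simpa using h2
    · rw [← (hβ x hx s).2, φ.left_inv (hβ x hx s).1]
  obtain ⟨X, hX⟩ := hC.exists_section (fun x f => deriv (fun s => (f : P → ℝ) (θ s x)) 0)
    fun p => by
      obtain ⟨φ, hφ, hp⟩ := hC.cover p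
      obtain ⟨β, hβ⟩ := hθ φ hφ
      exact ⟨φ, hφ, hp, fun _ i => β i * Complex.I, contDiff_const, by
        filter_upwards [φ.open_source.mem_nhds hp] with x hx _ f using (key φ hφ β hβ x hx f).deriv⟩
  have hX' : ∀ φ ∈ C, ∀ β : ι → ℝ, (∀ x ∈ φ.source, ∀ s,
      θ s x ∈ φ.source ∧ φ (θ s x) = fun i => Complex.exp (β i * s * Complex.I) * φ x i) →
      ∀ x ∈ φ.source, HasComps φ X (fun _ i => β i * Complex.I) x := fun φ hφ β hβ x hx =>
    (hX φ hφ x hx _ contDiff_const (by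
      filter_upwards [φ.open_source.mem_nhds hx] with y hy _ f
      exact (key φ hφ β hβ y hy f).deriv)).self_of_nhds
  refine ⟨X, fun f x => ?_, hX'⟩
  obtain ⟨φ, hφ, hx⟩ := hC.cover x
  obtain ⟨β, hβ⟩ := hθ φ hφ
  rw [hX' φ hφ β hβ x hx f]
  exact key φ hφ β hβ x hx f

end LogEtaleCharts

/-! ## Products -/

section PulledIdeal

variable {n : ℕ} {M : Type*} [TopologicalSpace M] [ChartedSpace (Model n) M]
  [MulAction (Torus n) M] [SmoothManifold n M] {P : Type*} [TopologicalSpace P]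
  {S : Subalgebra ℝ (P → ℝ)} {ι : Type} [Fintype ι] [DecidableEq ι]
  {C : Set (OpenPartialHomeomorph P (ι → ℂ))}

theorem normProd_map {κ : Type} [Fintype κ] (e : κ ↪ ι) (z : ι → ℂ) :
    normProd (Finset.univ.map e) z = normProd Finset.univ fun i => z (e i) :=
  Finset.prod_map _ _ _

/-- The ideal generated by the pullback of the elliptic ideal by a projection. -/
theorem idealCharts_pull (hM : IsStandard n M) (hC : SmoothCharts S C) {pr : P → M}
    (hpr : Continuous pr) (hpull : ∀ f : Smooth n M, (f : M → ℝ) ∘ pr ∈ S) (e : Fin n ↪ ι)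
    (hd : Dense (pr ⁻¹' principal n M))
    (hc : ∀ Φ ∈ C, ∃ φ ∈ stdCharts n M, ∀ p ∈ Φ.source, pr p ∈ φ.source ∧
      ∀ i, Φ p (e i) = φ (pr p) i) :
    IdealCharts (Ideal.span {h : S | ∃ f ∈ ellipticIdeal n M, (h : P → ℝ) = (f : M → ℝ) ∘ pr}) C
      (Finset.univ.map e) := by
  have hI := idealCharts_elliptic hM
  have hprod : ∀ Φ ∈ C, ∀ φ : OpenPartialHomeomorph M (Model n),
      (∀ p ∈ Φ.source, pr p ∈ φ.source ∧ ∀ i, Φ p (e i) = φ (pr p) i) → ∀ p ∈ Φ.source,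
      normProd (Finset.univ.map e) (Φ p) = normProd Finset.univ (φ (pr p)) := by
    intro Φ hΦ φ h p hp
    rw [normProd_map]
    congr 1
    exact funext (h p hp).2
  have hproj : ContDiff ℝ ∞ fun (z : ι → ℂ) (i : Fin n) => z (e i) :=
    contDiff_pi.2 fun _ => contDiff_apply _ _ _
  have hrep : ∀ f ∈ ellipticIdeal n M, ∀ Φ ∈ C, ∀ p ∈ Φ.source, ∃ G : (ι → ℂ) → ℝ,
      ContDiff ℝ ∞ G ∧ ∀ᶠ x in 𝓝 p, (f : M → ℝ) (pr x) =
        normProd (Finset.univ.map e) (Φ x) * G (Φ x) := by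
    intro f hf Φ hΦ p hp
    obtain ⟨φ, hφ, h⟩ := hc Φ hΦ
    obtain ⟨G, hG, eG⟩ := hI.rep f hf φ hφ _ (h p hp).1
    refine ⟨fun z => G fun i => z (e i), hG.comp hproj, ?_⟩
    filter_upwards [hpr.continuousAt.eventually eG, Φ.open_source.mem_nhds hp] with x h1 h2
    rw [h1, hprod Φ hΦ φ h x h2]
    congr 2
    exact (funext (h x h2).2).symm
  refine ⟨fun f hf Φ hΦ p hp => ?_, fun Φ hΦ p hp => ?_, fun f hf => ?_⟩
  · refine Submodule.span_induction (p := fun (f : S) _ => ∃ G : (ι → ℂ) → ℝ, ContDiff ℝ ∞ G ∧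
      ∀ᶠ x in 𝓝 p, (f : P → ℝ) x = normProd (Finset.univ.map e) (Φ x) * G (Φ x)) ?_ ?_ ?_ ?_ hf
    · rintro f ⟨f0, hf0, e0⟩
      rw [e0]
      exact hrep f0 hf0 Φ hΦ p hp
    · exact ⟨fun _ => 0, contDiff_const, .of_forall fun x => by simp⟩
    · rintro f f' - - ⟨G, hG, eG⟩ ⟨G', hG', eG'⟩
      refine ⟨fun z => G z + G' z, hG.add hG', ?_⟩
      filter_upwards [eG, eG'] with x h1 h2
      rw [Subalgebra.coe_add, Pi.add_apply, h1, h2, mul_add]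
    · rintro c f - ⟨G, hG, eG⟩
      obtain ⟨R, hR, eR⟩ := hC.smooth c Φ hΦ p hp
      refine ⟨fun z => R z * G z, hR.mul hG, ?_⟩
      filter_upwards [eG, eR] with x h1 h2
      rw [smul_eq_mul, Subalgebra.coe_mul, Pi.mul_apply, h1, h2]
      ring
  · obtain ⟨φ, hφ, h⟩ := hc Φ hΦ
    obtain ⟨f, hf, ef⟩ := hI.gen φ hφ _ (h p hp).1
    refine ⟨⟨_, hpull f⟩, Ideal.subset_span ⟨f, hf, rfl⟩, ?_⟩
    filter_upwards [hpr.continuousAt.eventually ef, Φ.open_source.mem_nhds hp] with x h1 h2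
    rw [hprod Φ hΦ φ h x h2, ← h1]
    rfl
  · obtain ⟨f0, hf0, h0⟩ := exists_generator hM
    choose Φ hΦ hp G hG eG using hf
    choose φ hφ h using fun p => hc (Φ p) (hΦ p)
    choose Γ hΓ hpos eΓ using fun p => h0 (φ p) (hφ p) _ (h p p (hp p)).1
    have hk : ∀ p, ∃ κ : (ι → ℂ) → ℝ, ContDiff ℝ ∞ κ ∧ ∀ᶠ x in 𝓝 p,
        (f : P → ℝ) x = (f0 : M → ℝ) (pr x) * κ (Φ p x) := by
      intro p
      have h1 : ContDiff ℝ ∞ fun z : ι → ℂ => Γ p fun i => z (e i) := (hΓ p).comp hproj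
      have h2 : IsOpen {z : ι → ℂ | Γ p (fun i => z (e i)) ≠ 0} :=
        isOpen_ne_fun h1.continuous continuous_const
      have h3 : Φ p p ∈ {z : ι → ℂ | Γ p (fun i => z (e i)) ≠ 0} := by
        have : (fun i => Φ p p (e i)) = φ p (pr p) := funext (h p p (hp p)).2
        change Γ p (fun i => Φ p p (e i)) ≠ 0
        rw [this]
        exact (hpos p).ne'
      obtain ⟨κ, hκ, eκ⟩ := exists_contDiff_eq h2 h3
        ((hG p).contDiffOn.div h1.contDiffOn fun z hz => hz)
      refine ⟨κ, hκ, ?_⟩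
      filter_upwards [eG p, hpr.continuousAt.eventually (eΓ p), (Φ p).open_source.mem_nhds (hp p),
        (tendsto_chart (hp p)).eventually eκ, (tendsto_chart (hp p)).eventually (h2.mem_nhds h3)]
        with x h4 h5 h6 h7 h8
      have h9 : (fun i => Φ p x (e i)) = φ p (pr x) := funext (h p x h6).2
      have h8 : Γ p (fun i => Φ p x (e i)) ≠ 0 := h8
      rw [h9] at h8
      rw [h4, h5, h7, hprod _ (hΦ p) _ (h p) x h6]
      change _ = _ * (G p (Φ p x) / Γ p fun i => Φ p x (e i))
      rw [h9]
      field_simp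
    choose κ hκ eκ using hk
    have hf0ne : ∀ x ∈ pr ⁻¹' principal n M, (f0 : M → ℝ) (pr x) ≠ 0 := by
      intro x hx
      have h1 := (h x x (hp x)).1
      rw [(eΓ x).self_of_nhds]
      exact mul_ne_zero (normProd_ne_zero (((logCharts hM).principal _ (hφ x) _ h1).1 hx))
        (hpos x).ne'
    have hcont : ∀ p, ∀ x ∈ (Φ p).source, ContinuousAt (fun x => κ p (Φ p x)) x := fun p x hx =>
      (hκ p).continuous.continuousAt.comp ((Φ p).continuousAt hx)
    have hglue : ∀ p, ∀ᶠ x in 𝓝 p, κ x (Φ x x) = κ p (Φ p x) := by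
      intro p
      filter_upwards [(eκ p).eventually_nhds, (Φ p).open_source.mem_nhds (hp p)] with x h1 h2
      have hne : (𝓝[pr ⁻¹' principal n M] x).NeBot := mem_closure_iff_nhdsWithin_neBot.1 (hd x)
      refine tendsto_nhds_unique_of_eventuallyEq (l := 𝓝[pr ⁻¹' principal n M] x)
        ((hcont x x (hp x)).tendsto.mono_left nhdsWithin_le_nhds)
        ((hcont p x h2).tendsto.mono_left nhdsWithin_le_nhds) ?_
      filter_upwards [nhdsWithin_le_nhds h1, nhdsWithin_le_nhds (eκ x), self_mem_nhdsWithin]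
        with y h3 h4 h5
      exact mul_left_cancel₀ (hf0ne y h5) (h4.symm.trans h3)
    have hkS : (fun x => κ x (Φ x x)) ∈ S := hC.of_local _ fun p =>
      ⟨Φ p, hΦ p, hp p, κ p, hκ p, hglue p⟩
    have hfk : f = (⟨_, hkS⟩ : S) • (⟨_, hpull f0⟩ : S) := Subtype.ext (funext fun x => by
      have := (eκ x).self_of_nhds
      simp only [smul_eq_mul, Subalgebra.coe_mul, Pi.mul_apply, Function.comp_apply]
      rw [this, mul_comm])
    rw [hfk]
    exact Submodule.smul_mem _ _ (Ideal.subset_span ⟨f0, hf0, rfl⟩)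

end PulledIdeal

section Prod

variable {n : ℕ} {M N : Type*}
  [TopologicalSpace M] [ChartedSpace (Model n) M] [MulAction (Torus n) M] [SmoothManifold n M]
  [TopologicalSpace N] [ChartedSpace (Model n) N] [MulAction (Torus n) N] [SmoothManifold n N]

variable (n) in
/-- `ℂ^n × ℂ^n ≃ ℂ^(2n)`. -/
def sumCLE : (Model n × Model n) ≃L[ℝ] (Fin n ⊕ Fin n → ℂ) :=
  (ContinuousLinearEquiv.sumPiEquivProdPi ℝ (Fin n) (Fin n) fun _ => ℂ).symm

theorem sumCLE_inl (z w : Model n) (i : Fin n) :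
    sumCLE n (z, w) (.inl i) = z i := rfl

theorem sumCLE_inr (z w : Model n) (i : Fin n) : sumCLE n (z, w) (.inr i) = w i := rfl

/-- The product of two charts. -/
def prodChart (φ : OpenPartialHomeomorph M (Model n)) (ψ : OpenPartialHomeomorph N (Model n)) :
    OpenPartialHomeomorph (M × N) (Fin n ⊕ Fin n → ℂ) :=
  (φ.prod ψ).transHomeomorph (sumCLE n).toHomeomorph

variable (φ : OpenPartialHomeomorph M (Model n)) (ψ : OpenPartialHomeomorph N (Model n))

theorem prodChart_apply (p : M × N) : prodChart φ ψ p = sumCLE n (φ p.1, ψ p.2) := rfl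

variable (n M N) in
/-- The products of standard charts. -/
def prodCharts : Set (OpenPartialHomeomorph (M × N) (Fin n ⊕ Fin n → ℂ)) :=
  {Φ | ∃ φ ∈ stdCharts n M, ∃ ψ ∈ stdCharts n N, Φ = prodChart φ ψ}

theorem contDiff_inl : ContDiff ℝ ∞ fun (z : Fin n ⊕ Fin n → ℂ) (i : Fin n) => z (.inl i) :=
  contDiff_pi.2 fun _ => contDiff_apply _ _ _

theorem contDiff_inr : ContDiff ℝ ∞ fun (z : Fin n ⊕ Fin n → ℂ) (i : Fin n) => z (.inr i) :=
  contDiff_pi.2 fun _ => contDiff_apply _ _ _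

variable {φ ψ}

theorem smoothCharts_prod (hM : IsStandard n M) (hN : IsStandard n N) :
    SmoothCharts (SmoothProd n M N) (prodCharts n M N) where
  cover p := by
    obtain ⟨φ, hφ, hp⟩ := (smoothCharts hM).cover p.1
    obtain ⟨ψ, hψ, hp'⟩ := (smoothCharts hN).cover p.2
    exact ⟨_, ⟨φ, hφ, ψ, hψ, rfl⟩, hp, hp'⟩
  smooth f Φ hΦ p hp := by
    obtain ⟨φ, ⟨K, a, hφ⟩, ψ, ⟨K', a', hψ⟩, rfl⟩ := hΦ
    have h1 : ContDiffOn ℝ ∞ ((f : M × N → ℝ) ∘ (prodChart φ ψ).symm) (prodChart φ ψ).target := by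
      rw [← contMDiffOn_iff_contDiffOn]
      have h2 : ContMDiff (𝓘(ℝ, Model n).prod 𝓘(ℝ, Model n)) 𝓘(ℝ, ℝ) ∞ (f : M × N → ℝ) := f.2
      refine h2.comp_contMDiffOn (ContMDiffOn.prodMk ?_ ?_)
      · exact (contMDiffOn_symm_of_mem_maximalAtlas hφ.mem_atlas).comp
          (contDiff_inl.contMDiff.contMDiffOn) fun z hz => hz.1
      · exact (contMDiffOn_symm_of_mem_maximalAtlas hψ.mem_atlas).comp
          (contDiff_inr.contMDiff.contMDiffOn) fun z hz => hz.2
    obtain ⟨G, hG, e⟩ := exists_contDiff_eq (prodChart φ ψ).open_target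
      ((prodChart φ ψ).map_source hp) h1
    refine ⟨G, hG, ?_⟩
    filter_upwards [(prodChart φ ψ).open_source.mem_nhds hp, (tendsto_chart hp).eventually e]
      with x hx ex
    rw [ex, Function.comp_apply, (prodChart φ ψ).left_inv hx]
  of_local f hf := by
    intro p
    obtain ⟨_, ⟨φ, ⟨K, a, hφ⟩, ψ, ⟨K', a', hψ⟩, rfl⟩, hp, G, hG, e⟩ := hf p
    have h1 : ContMDiffAt (𝓘(ℝ, Model n).prod 𝓘(ℝ, Model n)) 𝓘(ℝ, Model n) ∞
        (fun p : M × N => φ p.1) p :=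
      ((contMDiffOn_of_mem_maximalAtlas hφ.mem_atlas).contMDiffAt
        (φ.open_source.mem_nhds hp.1)).comp p contMDiffAt_fst
    have h2 : ContMDiffAt (𝓘(ℝ, Model n).prod 𝓘(ℝ, Model n)) 𝓘(ℝ, Model n) ∞
        (fun p : M × N => ψ p.2) p :=
      ((contMDiffOn_of_mem_maximalAtlas hψ.mem_atlas).contMDiffAt
        (ψ.open_source.mem_nhds hp.2)).comp p contMDiffAt_snd
    have h3 := h1.prodMk_space h2
    have h4 : ContMDiffAt (𝓘(ℝ, Model n).prod 𝓘(ℝ, Model n)) 𝓘(ℝ, ℝ) ∞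
        (fun x => G (sumCLE n (φ x.1, ψ x.2))) p :=
      ContMDiffAt.comp (g := G ∘ sumCLE n) p
        (hG.comp (sumCLE n).contDiff).contMDiff.contMDiffAt h3
    exact h4.congr_of_eventuallyEq e

theorem logCharts_prod (hM : IsStandard n M) (hN : IsStandard n N) :
    LogCharts (ellipticProd n M N) (prodCharts n M N) (principal n M ×ˢ principal n N) := by
  have hC := smoothCharts_prod hM hN
  have hdM := (logCharts hM).dense
  have hdN := (logCharts hN).dense
  have h1 := idealCharts_pull hM hC (pr := Prod.fst) continuous_fst
    (fun f => (show ContMDiff _ _ _ _ from f.2).comp contMDiff_fst) ⟨Sum.inl, Sum.inl_injective⟩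
    (hdM.preimage isOpenMap_fst) (by
      rintro _ ⟨φ, hφ, ψ, hψ, rfl⟩
      exact ⟨φ, hφ, fun p hp => ⟨hp.1, fun _ => rfl⟩⟩)
  have h2 := idealCharts_pull hN hC (pr := Prod.snd) continuous_snd
    (fun f => (show ContMDiff _ _ _ _ from f.2).comp contMDiff_snd) ⟨Sum.inr, Sum.inr_injective⟩
    (hdN.preimage isOpenMap_snd) (by
      rintro _ ⟨φ, hφ, ψ, hψ, rfl⟩
      exact ⟨ψ, hψ, fun p hp => ⟨hp.2, fun _ => rfl⟩⟩)
  exact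
  { toSmoothCharts := hC
    t2 := inferInstance
    comps := fun X Φ hΦ p hp => hC.exists_comps hΦ hp fun v hv hXv i => by
      rcases i with i | i
      · exact h1.exists_comps X.2.1 hΦ hp hv hXv (Finset.mem_map_of_mem _ (Finset.mem_univ i))
      · exact h2.exists_comps X.2.2 hΦ hp hv hXv (Finset.mem_map_of_mem _ (Finset.mem_univ i))
    mem := fun X hX => ⟨h1.preserving hX, h2.preserving hX⟩
    principal := by
      rintro _ ⟨φ, hφ, ψ, hψ, rfl⟩ p hp
      rw [mem_prod, (logCharts hM).principal φ hφ _ hp.1, (logCharts hN).principal ψ hψ _ hp.2,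
        Sum.forall]
      rfl }

end Prod

/-! ## Weights of the torus -/

section Weights

theorem exists_circle_weight {f : ℝ → Circle} (hf : Continuous f)
    (hadd : ∀ s t, f (s + t) = f s * f t) : ∃ r : ℝ, ∀ s, f s = Circle.exp (r * s) := by
  have h0 : f 0 = 1 := by
    have := hadd 0 0
    rw [add_zero] at this
    exact (left_eq_mul.1 this)
  obtain ⟨g, ⟨hg0, hg⟩, huniq⟩ := Circle.isCoveringMap_exp.existsUnique_continuousMap_lifts
    (f := ⟨f, hf⟩) (a₀ := (0 : ℝ)) (e₀ := (0 : ℝ)) (by simp [h0])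
  have hg' : ∀ s, Circle.exp (g s) = f s := fun s => congrFun hg s
  have hsum : ∀ s t, g (s + t) = g s + g t := by
    intro s t
    have h1 := huniq ⟨fun s => g (s + t) - g t, by fun_prop⟩
      ⟨by simp, funext fun s => by
        change Circle.exp (g (s + t) - g t) = f s
        rw [Circle.exp_sub, hg', hg', hadd, mul_div_cancel_right]⟩
    have h2 := DFunLike.congr_fun h1 s
    change g (s + t) - g t = g s at h2
    linarith
  refine ⟨g 1, fun s => ?_⟩
  have h1 := map_real_smul (AddMonoidHom.mk' g hsum) (g.continuous) s 1
  have h2 : g s = s * g 1 := by simpa using h1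
  rw [← hg', h2, mul_comm]

theorem eq_zero_of_circle_exp {r : ℝ} (h : ∀ s, Circle.exp (r * s) = 1) : r = 0 := by
  by_contra hr
  have h1 := congrArg (fun c : Circle => (c : ℂ)) (h (Real.pi / r))
  rw [mul_div_cancel₀ _ hr] at h1
  simp [Circle.coe_exp] at h1
  norm_num at h1

variable {n : ℕ}

/-- The exponential map of the torus. -/
def torusExp (v : Fin n → ℝ) : Torus n := fun i => Circle.exp (v i)

theorem torusExp_add (v w : Fin n → ℝ) : torusExp (v + w) = torusExp v * torusExp w :=
  funext fun i => Circle.exp_add (v i) (w i)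

theorem circleExp_eq (i : Fin n) (s : ℝ) : circleExp i s = torusExp (s • Pi.single i 1) := by
  funext j
  by_cases h : j = i
  · subst h
    simp [circleExp, torusExp]
  · simp [circleExp, torusExp, h]

theorem continuous_torusExp : Continuous (torusExp (n := n)) :=
  continuous_pi fun i => Circle.exp.continuous.comp (continuous_apply i)

theorem exists_torus_weights (a : Torus n ≃ₜ* Torus n) :
    ∃ β : Matrix (Fin n) (Fin n) ℝ, ∀ v, a (torusExp v) = torusExp (Matrix.vecMul v β) := by
  have h1 : ∀ w : Fin n → ℝ, ∀ j, ∃ r : ℝ, ∀ s : ℝ, a (torusExp (s • w)) j = Circle.exp (r * s) := by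
    intro w j
    refine exists_circle_weight (f := fun s => a (torusExp (s • w)) j) ?_ fun s t => ?_
    · exact (continuous_apply j).comp (a.continuous.comp (continuous_torusExp.comp (by fun_prop)))
    · rw [add_smul, torusExp_add, map_mul, Pi.mul_apply]
  choose β hβ using fun i => h1 (Pi.single i 1)
  refine ⟨Matrix.of β, fun v => ?_⟩
  have h2 : ∀ s : Finset (Fin n), torusExp (∑ i ∈ s, v i • Pi.single i (1 : ℝ)) =
      ∏ i ∈ s, torusExp (v i • Pi.single i (1 : ℝ)) := by
    intro s
    induction s using Finset.induction_on with
    | empty => exact funext fun i => Circle.exp_zero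
    | insert i s hi ih => rw [Finset.sum_insert hi, Finset.prod_insert hi, torusExp_add, ih]
  have h3 : ∀ (s : Finset (Fin n)) (u : Fin n → ℝ), Circle.exp (∑ i ∈ s, u i) =
      ∏ i ∈ s, Circle.exp (u i) := by
    intro s u
    induction s using Finset.induction_on with
    | empty => simp
    | insert i s hi ih => rw [Finset.sum_insert hi, Finset.prod_insert hi, Circle.exp_add, ih]
  have h4 : v = ∑ i, v i • Pi.single i (1 : ℝ) := by
    funext j
    simp [Finset.sum_apply, Pi.single_apply]
  funext j
  conv_lhs => rw [h4, h2, map_prod, Finset.prod_apply]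
  simp only [hβ]
  rw [← h3]
  congr 1
  exact Finset.sum_congr rfl fun i _ => mul_comm _ _

theorem exists_weights (a : Torus n ≃ₜ* Torus n) : ∃ β β' : Matrix (Fin n) (Fin n) ℝ,
    β * β' = 1 ∧ ∀ i s j, (a (circleExp i s) j : ℂ) = Complex.exp (β i j * s * Complex.I) := by
  obtain ⟨β, hβ⟩ := exists_torus_weights a
  obtain ⟨β', hβ'⟩ := exists_torus_weights a.symm
  refine ⟨β, β', ?_, fun i s j => ?_⟩
  · have h1 : ∀ v : Fin n → ℝ, torusExp v = torusExp (Matrix.vecMul v (β * β')) := fun v => by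
      rw [← Matrix.vecMul_vecMul, ← hβ', ← hβ, ContinuousMulEquiv.symm_apply_apply]
    ext i j
    have h2 : (1 : Matrix (Fin n) (Fin n) ℝ) i j - (β * β') i j = 0 := by
      refine eq_zero_of_circle_exp fun s => ?_
      have h3 := congrFun (h1 (s • Pi.single i 1)) j
      rw [Matrix.smul_vecMul, Matrix.single_one_vecMul] at h3
      have h4 : (1 : Matrix (Fin n) (Fin n) ℝ) i j = (Pi.single i 1 : Fin n → ℝ) j := by
        rw [Matrix.one_apply, Pi.single_apply]
        exact if_congr eq_comm rfl rfl
      rw [sub_mul, Circle.exp_sub, h4, div_eq_one, mul_comm, mul_comm _ s]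
      exact h3
    linarith
  · rw [circleExp_eq, hβ, Matrix.smul_vecMul, Matrix.single_one_vecMul, torusExp, Circle.coe_exp]
    simp only [Pi.smul_apply, smul_eq_mul, Complex.ofReal_mul, Matrix.row]
    ring_nf

end Weights

/-! ## Logarithmic étale maps between the manifolds and between their products -/

section LogEtaleMaps

variable {n : ℕ} {M N M' N' : Type*}
  [TopologicalSpace M] [ChartedSpace (Model n) M] [MulAction (Torus n) M] [SmoothManifold n M]
  [TopologicalSpace N] [ChartedSpace (Model n) N] [MulAction (Torus n) N] [SmoothManifold n N]
  [TopologicalSpace M'] [ChartedSpace (Model n) M'] [MulAction (Torus n) M'] [SmoothManifold n M']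
  [TopologicalSpace N'] [ChartedSpace (Model n) N'] [MulAction (Torus n) N'] [SmoothManifold n N']

theorem smul_mem_principal_iff (t : Torus n) (m : M) : t • m ∈ principal n M ↔ m ∈ principal n M := by
  have : ∀ s : Torus n, s • t • m = t • m ↔ s • m = m := fun s => by
    rw [smul_smul, mul_comm, ← smul_smul, smul_left_cancel_iff]
  exact forall_congr' fun s => by rw [this]

theorem logEtaleAt_smul (hM : IsStandard n M) (t : Torus n) (m : M) :
    ∃ φ' φ L L' Ψ, LogEtaleAt (stdCharts n M) (stdCharts n M) (fun m : M => t • m) m φ' φ L L' Ψ := by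
  obtain ⟨φ, K, a, h, hm⟩ := hM m
  let D : (Fin n → ℂ) →L[ℝ] (Fin n → ℂ) := ContinuousLinearMap.pi fun i =>
    (ContinuousLinearMap.mul ℝ ℂ (a t i : ℂ)).comp (ContinuousLinearMap.proj i)
  refine ⟨φ, φ, 1, 1, D, ⟨K, a, h⟩, ⟨K, a, h⟩, hm, h.smul_mem t m hm, one_mul 1, D.contDiff, ?_, ?_⟩
  · filter_upwards [φ.open_source.mem_nhds hm] with x hx
    exact funext (h.map_smul t x hx)
  · refine .of_forall fun z c => ?_
    rw [D.fderiv, realMul_one]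
    funext i
    change (a t i : ℂ) * (c i * z i) = c i * ((a t i : ℂ) * z i)
    ring

theorem logEtale_smul (hM : IsStandard n M) (t : Torus n) :
    LogEtale (Smooth n M) (Smooth n M) (stdCharts n M) (stdCharts n M) (principal n M)
      (fun m : M => t • m) :=
  logEtale_of_charts (logCharts hM) (logCharts hM) (hM.continuous_smul t)
    (fun m hm => (smul_mem_principal_iff t m).2 hm) (logEtaleAt_smul hM t)

theorem logEtaleAt_prod {q : M' → M} {r : N' → N} {p : M' × N'}
    (h1 : ∃ φ' φ L L' Ψ, LogEtaleAt (stdCharts n M') (stdCharts n M) q p.1 φ' φ L L' Ψ)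
    (h2 : ∃ φ' φ L L' Ψ, LogEtaleAt (stdCharts n N') (stdCharts n N) r p.2 φ' φ L L' Ψ) :
    ∃ φ' φ L L' Ψ, LogEtaleAt (prodCharts n M' N') (prodCharts n M N) (Prod.map q r) p
      φ' φ L L' Ψ := by
  obtain ⟨φ', φ, L, L', Ψ, h⟩ := h1
  obtain ⟨φ₂', φ₂, L₂, L₂', Ψ₂, h₂⟩ := h2
  let fst : (Fin n ⊕ Fin n → ℂ) →L[ℝ] Model n :=
    (ContinuousLinearMap.fst ℝ (Model n) (Model n)).comp ((sumCLE n).symm : _ →L[ℝ] _)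
  let snd : (Fin n ⊕ Fin n → ℂ) →L[ℝ] Model n :=
    (ContinuousLinearMap.snd ℝ (Model n) (Model n)).comp ((sumCLE n).symm : _ →L[ℝ] _)
  refine ⟨prodChart φ' φ₂', prodChart φ φ₂, Matrix.fromBlocks L 0 0 L₂, Matrix.fromBlocks L' 0 0 L₂',
    fun z => sumCLE n (Ψ (fst z), Ψ₂ (snd z)), ⟨_, h.mem', _, h₂.mem', rfl⟩,
    ⟨_, h.mem, _, h₂.mem, rfl⟩, ⟨h.source', h₂.source'⟩, ⟨h.source, h₂.source⟩, ?_, ?_, ?_, ?_⟩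
  · rw [Matrix.fromBlocks_multiply]
    simp [h.inv, h₂.inv]
  · exact (sumCLE n).contDiff.comp
      ((h.contDiff.comp fst.contDiff).prodMk (h₂.contDiff.comp snd.contDiff))
  · filter_upwards [continuous_fst.continuousAt.eventually h.eq,
      continuous_snd.continuousAt.eventually h₂.eq] with x e1 e2
    rw [prodChart_apply, Prod.map_fst, Prod.map_snd, e1, e2]
    rfl
  · have e1 := (fst.continuous.tendsto (prodChart φ' φ₂' p)).eventually h.fderiv_eq
    have e2 := (snd.continuous.tendsto (prodChart φ' φ₂' p)).eventually h₂.fderiv_eq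
    filter_upwards [e1, e2] with z h3 h4 c
    have h5 : HasFDerivAt (fun z => sumCLE n (Ψ (fst z), Ψ₂ (snd z)))
        (((sumCLE n : _ →L[ℝ] _)).comp (((fderiv ℝ Ψ (fst z)).comp fst).prod
          ((fderiv ℝ Ψ₂ (snd z)).comp snd))) z := by
      refine (sumCLE n).hasFDerivAt.comp z (HasFDerivAt.prodMk ?_ ?_)
      · exact (h.contDiff.differentiable (by simp) _).hasFDerivAt.comp z fst.hasFDerivAt
      · exact (h₂.contDiff.differentiable (by simp) _).hasFDerivAt.comp z snd.hasFDerivAt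
    rw [h5.fderiv]
    change sumCLE n (fderiv ℝ Ψ (fst z) (fst c * fst z), fderiv ℝ Ψ₂ (snd z) (snd c * snd z)) = _
    rw [h3, h4]
    funext i
    rcases i with i | i
    · rw [sumCLE_inl, Pi.mul_apply, Pi.mul_apply, sumCLE_inl, realMul_apply, realMul_apply,
        Fintype.sum_sum_type]
      simp only [Matrix.fromBlocks_apply₁₁, Matrix.fromBlocks_apply₁₂, Matrix.zero_apply,
        Complex.ofReal_zero, zero_mul, Finset.sum_const_zero, add_zero]
      rfl
    · rw [sumCLE_inr, Pi.mul_apply, Pi.mul_apply, sumCLE_inr, realMul_apply, realMul_apply,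
        Fintype.sum_sum_type]
      simp only [Matrix.fromBlocks_apply₂₁, Matrix.fromBlocks_apply₂₂, Matrix.zero_apply,
        Complex.ofReal_zero, zero_mul, Finset.sum_const_zero, zero_add]
      rfl

theorem LogEtale.prodMap (hM : IsStandard n M) (hN : IsStandard n N) (hM' : IsStandard n M')
    (hN' : IsStandard n N') {q : M' → M} {r : N' → N}
    (hq : LogEtale (Smooth n M') (Smooth n M) (stdCharts n M') (stdCharts n M) (principal n M') q)
    (hr : LogEtale (Smooth n N') (Smooth n N) (stdCharts n N') (stdCharts n N) (principal n N') r)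
    (hq' : ∀ m ∈ principal n M', q m ∈ principal n M)
    (hr' : ∀ m ∈ principal n N', r m ∈ principal n N) :
    LogEtale (SmoothProd n M' N') (SmoothProd n M N) (prodCharts n M' N') (prodCharts n M N)
      (principal n M' ×ˢ principal n N') (Prod.map q r) :=
  logEtale_of_charts (logCharts_prod hM' hN') (logCharts_prod hM hN) (hq.cont.prodMap hr.cont)
    (fun _ hp => ⟨hq' _ hp.1, hr' _ hp.2⟩)
    fun p => logEtaleAt_prod (hq.charts p.1) (hr.charts p.2)

theorem logEtale_swap (hM : IsStandard n M) (hN : IsStandard n N) :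
    LogEtale (SmoothProd n M N) (SmoothProd n N M) (prodCharts n M N) (prodCharts n N M)
      (principal n M ×ˢ principal n N) Prod.swap := by
  refine logEtale_of_charts (logCharts_prod hM hN) (logCharts_prod hN hM) continuous_swap
    (fun _ hp => ⟨hp.2, hp.1⟩) fun p => ?_
  obtain ⟨φ, hφ, hp⟩ := (smoothCharts hM).cover p.1
  obtain ⟨ψ, hψ, hp'⟩ := (smoothCharts hN).cover p.2
  let D : (Fin n ⊕ Fin n → ℂ) →L[ℝ] (Fin n ⊕ Fin n → ℂ) := ContinuousLinearMap.pi fun i =>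
    ContinuousLinearMap.proj i.swap
  let L : Matrix (Fin n ⊕ Fin n) (Fin n ⊕ Fin n) ℝ := .of fun i j => if i.swap = j then 1 else 0
  have hL : ∀ c i, realMul L c i = c i.swap := fun c i => by
    rw [realMul_apply, Finset.sum_eq_single i.swap]
    · simp [L]
    · intro j _ hj
      simp [L, hj.symm]
    · simp
  refine ⟨prodChart φ ψ, prodChart ψ φ, L, L, D, ⟨φ, hφ, ψ, hψ, rfl⟩, ⟨ψ, hψ, φ, hφ, rfl⟩, ⟨hp, hp'⟩,
    ⟨hp', hp⟩, ?_, D.contDiff, ?_, ?_⟩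
  · ext i j
    rw [Matrix.mul_apply, Finset.sum_eq_single i.swap]
    · simp [L, Matrix.one_apply]
    · intro k _ hk
      simp [L, hk.symm]
    · simp
  · refine .of_forall fun x => funext fun i => ?_
    rcases i with i | i <;> rfl
  · refine .of_forall fun z c => ?_
    rw [D.fderiv]
    funext i
    rw [Pi.mul_apply, hL]
    rfl

end LogEtaleMaps

/-! ## The correspondence space -/

section Coefficients

variable {V E : Type*} [NormedAddCommGroup V] [NormedSpace ℝ V] [FiniteDimensional ℝ V]
  [NormedAddCommGroup E] [NormedSpace ℝ E] [FiniteDimensional ℝ E] {κ : Type} [Fintype κ]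

/-- Smooth coefficients with respect to a smooth family of bases. -/
theorem exists_smooth_coeffs {T : κ → V → E} (hT : ∀ k, ContDiff ℝ ∞ (T k)) {z0 : V}
    (hi : LinearIndependent ℝ fun k => T k z0) (hcard : Fintype.card κ = Module.finrank ℝ E) :
    ∃ R : V → E →L[ℝ] κ → ℝ, ContDiff ℝ ∞ R ∧
      ∀ᶠ z in 𝓝 z0, (∀ v, ∑ k, R z v k • T k z = v) ∧
        ∀ a : κ → ℝ, ∑ k, a k • T k z = 0 → a = 0 := by
  classical
  let L : V → (κ → ℝ) →L[ℝ] E := fun z =>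
    ∑ k, (ContinuousLinearMap.proj (R := ℝ) (φ := fun _ : κ => ℝ) k).smulRight (T k z)
  have hLa : ∀ z a, L z a = ∑ k, a k • T k z := fun z a => by
    simp [L, sum_apply]
  have hL : ContDiff ℝ ∞ L := ContDiff.sum fun k _ =>
    ((ContinuousLinearMap.smulRightL ℝ (κ → ℝ) E (ContinuousLinearMap.proj k)).contDiff).comp (hT k)
  have hinj : Function.Injective (L z0) := by
    rw [injective_iff_map_eq_zero]
    intro a ha
    rw [hLa] at ha
    exact funext (Fintype.linearIndependent_iff.1 hi a ha)
  let e0 : (κ → ℝ) ≃L[ℝ] E := (LinearEquiv.ofInjectiveOfFinrankEq (L z0 : (κ → ℝ) →ₗ[ℝ] E) hinj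
    (by rw [Module.finrank_fintype_fun_eq_card, hcard])).toContinuousLinearEquiv
  have he0 : (e0 : (κ → ℝ) →L[ℝ] E) = L z0 := by
    ext a
    rfl
  let U : Set V := L ⁻¹' range ((↑) : ((κ → ℝ) ≃L[ℝ] E) → (κ → ℝ) →L[ℝ] E)
  have hU : IsOpen U :=
    (ContinuousLinearEquiv.isOpen (𝕜 := ℝ) (E := κ → ℝ) (F := E)).preimage hL.continuous
  have hz0 : z0 ∈ U := ⟨e0, he0⟩
  have hsm : ContDiffOn ℝ ∞ (fun z => ContinuousLinearMap.inverse (L z)) U := by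
    rintro z ⟨e, he⟩
    refine (ContDiffAt.comp (g := fun T : (κ → ℝ) →L[ℝ] E => ContinuousLinearMap.inverse T) z ?_ hL.contDiffAt).contDiffWithinAt
    rw [← he]
    exact contDiffAt_map_inverse e
  obtain ⟨R, hR, eR⟩ := exists_contDiff_eq hU hz0 hsm
  refine ⟨R, hR, ?_⟩
  filter_upwards [eR, hU.mem_nhds hz0] with z h1 h2
  obtain ⟨e, he⟩ := h2
  have h3 : R z = (e.symm : E →L[ℝ] κ → ℝ) := by
    rw [h1]
    rw [← he, ContinuousLinearMap.inverse_equiv]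
  refine ⟨fun v => ?_, fun a ha => ?_⟩
  · rw [← hLa, h3, ← he]
    exact e.apply_symm_apply v
  · rw [← hLa, ← he] at ha
    exact e.injective (ha.trans (map_zero e).symm)

end Coefficients

section Corr

variable {n : ℕ} {M N B : Type*}
  [TopologicalSpace M] [ChartedSpace (Model n) M] [MulAction (Torus n) M] [SmoothManifold n M]
  [TopologicalSpace N] [ChartedSpace (Model n) N] [MulAction (Torus n) N] [SmoothManifold n N]
  [TopologicalSpace B] {π : M → B} {ϖ : N → B}

instance (π : M → B) (ϖ : N → B) : TopologicalSpace (Corr π ϖ) := instTopologicalSpaceSubtype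

/-- The inclusion of the correspondence space. -/
abbrev Corr.incl (π : M → B) (ϖ : N → B) (c : Corr π ϖ) : M × N := c.1

theorem Corr.continuous_incl : Continuous (Corr.incl π ϖ) := continuous_subtype_val

theorem IsStandard.isClosed_orbitRel (hM : IsStandard n M) :
    IsClosed {p : M × M | ∃ t : Torus n, t • p.1 = p.2} := by
  have := hM.continuousSMul
  have h1 : IsClosed {p : Torus n × M × M | p.1 • p.2.1 = p.2.2} :=
    isClosed_eq (by fun_prop) (by fun_prop)
  have h2 := isClosedMap_snd_of_compactSpace (X := Torus n) (Y := M × M) _ h1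
  convert! h2 using 1
  ext p
  simp

theorem SameBase.t2Space (h : SameBase (n := n) π ϖ) (hM : IsStandard n M) : T2Space B := by
  have h1 : IsOpenQuotientMap π := ⟨h.quot.surjective, h.quot.continuous, h.isOpenMap hM⟩
  rw [t2Space_iff_of_isOpenQuotientMap h1]
  convert! hM.isClosed_orbitRel using 1
  ext p
  exact h.eq_iff p.1 p.2

theorem SameBase.isClosed_corr (h : SameBase (n := n) π ϖ) (hM : IsStandard n M) :
    IsClosed {p : M × N | π p.1 = ϖ p.2} := by
  have := h.t2Space hM
  exact isClosed_eq (h.quot.continuous.comp continuous_fst) (h.quot'.continuous.comp continuous_snd)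

theorem Corr.nhds_eq (c : Corr π ϖ) : 𝓝 c = comap (Corr.incl π ϖ) (𝓝 c.1) := nhds_induced _ _

theorem Corr.eventually_nhds {c : Corr π ϖ} {p : M × N → Prop} (h : ∀ᶠ x in 𝓝 c.1, p x) :
    ∀ᶠ c' in 𝓝 c, p (Corr.incl π ϖ c') :=
  Corr.continuous_incl.continuousAt.eventually h

theorem Corr.eventually_nhds_iff {c : Corr π ϖ} {p : M × N → Prop} :
    (∀ᶠ c' in 𝓝 c, p (Corr.incl π ϖ c')) ↔ ∀ᶠ x in 𝓝 c.1, π x.1 = ϖ x.2 → p x := by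
  constructor
  · intro h
    rw [Corr.nhds_eq, eventually_comap] at h
    filter_upwards [h] with x hx hxc
    exact hx ⟨x, hxc⟩ rfl
  · intro h
    filter_upwards [Corr.eventually_nhds h] with c' hc'
    exact hc' c'.2

/-- Restriction of smooth functions. -/
def Corr.res (π : M → B) (ϖ : N → B) (f : SmoothProd n M N) : SmoothCorr (n := n) π ϖ :=
  ⟨_, smoothCorr_restrict_mem f⟩

theorem Corr.exists_res (f : SmoothCorr (n := n) π ϖ) : ∃ F : SmoothProd n M N,
    Corr.res π ϖ F = f := by
  obtain ⟨F, hF, e⟩ := f.2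
  exact ⟨⟨F, hF⟩, Subtype.ext e⟩

theorem SameBase.localAlg (h : SameBase (n := n) π ϖ) (hM : IsStandard n M) (hN : IsStandard n N) :
    LocalAlg (SmoothCorr (n := n) π ϖ) where
  cont f := by
    obtain ⟨F, rfl⟩ := Corr.exists_res f
    exact ((smoothCharts_prod hM hN).localAlg.cont F).comp continuous_subtype_val
  bump c U hU := by
    rw [Corr.nhds_eq, mem_comap] at hU
    obtain ⟨V, hV, hVU⟩ := hU
    obtain ⟨χ, h1, h2⟩ := (smoothCharts_prod hM hN).localAlg.bump c.1 V hV
    exact ⟨Corr.res π ϖ χ, Corr.eventually_nhds h1, fun x hx => h2 _ fun hm => hx (hVU hm)⟩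
  glue f hf := by
    classical
    have : LocallyCompactSpace (M × N) :=
      Manifold.locallyCompact_of_finiteDimensional (𝓘(ℝ, Model n).prod 𝓘(ℝ, Model n))
    have hcl := h.isClosed_corr hM
    choose g hg using hf
    choose G hG using fun c => Corr.exists_res (g c)
    let t : M × N → Set ℝ := fun p => {y | ∀ hp : π p.1 = ϖ p.2, y = f ⟨p, hp⟩}
    obtain ⟨F, hF⟩ := exists_contMDiffMap_forall_mem_convex_of_local
      (𝓘(ℝ, Model n).prod 𝓘(ℝ, Model n)) (n := (⊤ : ℕ∞)) (t := t) (fun p => by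
        rw [convex_iff_forall_pos]
        intro x hx y hy a b _ _ hab hp
        rw [hx hp, hy hp, ← add_smul, hab, one_smul]) (fun p => by
        by_cases hp : π p.1 = ϖ p.2
        · obtain ⟨c, rfl⟩ : ∃ c : Corr π ϖ, c.1 = p := ⟨⟨p, hp⟩, rfl⟩
          have h1 : ∀ᶠ x in 𝓝 c.1, ∀ hx : π x.1 = ϖ x.2, (G c : M × N → ℝ) x = f ⟨x, hx⟩ := by
            have h2 : ∀ᶠ c' in 𝓝 c, f c' = (Corr.res π ϖ (G c) : Corr π ϖ → ℝ) c' := by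
              rw [hG]
              exact hg c
            rw [Corr.nhds_eq, eventually_comap] at h2
            filter_upwards [h2] with x hx hxc
            exact (hx ⟨x, hxc⟩ rfl).symm
          exact ⟨_, h1, _, (show ContMDiff _ _ _ _ from (G c).2).contMDiffOn, fun y hy => hy⟩
        · exact ⟨_, hcl.isOpen_compl.mem_nhds hp, fun _ => 0, contMDiffOn_const,
            fun y hy hy' => absurd hy' hy⟩)
    exact ⟨F, F.contMDiff, funext fun c => hF c.1 c.2⟩

variable (n π ϖ) in
/-- The points of the correspondence space over free orbits. -/
def Corr.principal : Set (Corr π ϖ) := {c | c.1 ∈ TDual.principal n M ×ˢ TDual.principal n N}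

theorem SameBase.mem_principal (h : SameBase (n := n) π ϖ) (hM : IsStandard n M)
    (hN : IsStandard n N) {m : M} {m' : N} (e : π m = ϖ m') (hm : m ∈ principal n M) :
    m' ∈ principal n N := by
  obtain ⟨φ, K, a, hφ, hmφ⟩ := hM m
  obtain ⟨ψ, K', a', hψ, hmψ⟩ := hN m'
  obtain ⟨σ, g, -, -, -, eg⟩ := h.exists_match hM hN hφ hψ hmφ hmψ e
  rw [hψ.mem_principal_iff hmψ]
  intro i hi
  have h1 := eg.self_of_nhds (σ.symm i)
  rw [← e, h.modBase_eq hφ hmφ, Equiv.apply_symm_apply, hi, norm_zero] at h1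
  have h2 := (hφ.mem_principal_iff hmφ).1 hm (σ.symm i)
  have : ‖φ m (σ.symm i)‖ ^ 2 = 0 := by rw [h1]; ring
  exact h2 (norm_eq_zero.1 (pow_eq_zero_iff two_ne_zero |>.1 this))

theorem SameBase.mem_principal_fst (h : SameBase (n := n) π ϖ) (hM : IsStandard n M)
    (hN : IsStandard n N) {c : Corr π ϖ} :
    c ∈ Corr.principal n π ϖ ↔ c.fst ∈ principal n M :=
  ⟨fun hc => hc.1, fun hc => ⟨hc, h.mem_principal hM hN c.2 hc⟩⟩

theorem SameBase.dense_principal (h : SameBase (n := n) π ϖ) (hM : IsStandard n M)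
    (hN : IsStandard n N) : Dense (Corr.principal n π ϖ) := by
  intro c
  rw [mem_closure_iff_nhds]
  intro U hU
  rw [Corr.nhds_eq, mem_comap] at hU
  obtain ⟨V, hV, hVU⟩ := hU
  obtain ⟨V1, hV1, V2, hV2, hVV⟩ := mem_nhds_prod_iff.1 hV
  have h1 : ϖ '' V2 ∈ 𝓝 (π c.1.1) := by
    rw [c.2, ← h.symm.map_nhds hN]
    exact image_mem_map hV2
  obtain ⟨m, ⟨hm1, hm2⟩, hm⟩ := (mem_closure_iff_nhds.1 ((logCharts hM).dense c.1.1)) _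
    (inter_mem hV1 (h.quot.continuous.continuousAt h1))
  obtain ⟨m', hm', e⟩ := hm2
  exact ⟨⟨(m, m'), e.symm⟩, hVU (hVV ⟨hm1, hm'⟩), (h.mem_principal_fst hM hN).2 hm⟩

theorem Corr.related_res {Y : ellipticCorr (n := n) π ϖ} {X : ellipticProd n M N}
    (h : Related (Corr.incl π ϖ) Y.1 X.1) (f : SmoothProd n M N) (c : Corr π ϖ) :
    val Y (Corr.res π ϖ f) c = val X f c.1 :=
  h.val_eq rfl c

theorem Corr.exists_ambient (Y : ellipticCorr (n := n) π ϖ) :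
    ∃ X : ellipticProd n M N, Related (Corr.incl π ϖ) Y.1 X.1 := by
  obtain ⟨X, hX, e⟩ := Y.2
  exact ⟨⟨X, hX⟩, e⟩

/-- Tangent sections restrict. -/
theorem SameBase.exists_restrict (h : SameBase (n := n) π ϖ) (hM : IsStandard n M)
    (hN : IsStandard n N) {X : ellipticProd n M N}
    (hX : ∀ f : SmoothProd n M N, (∀ c : Corr π ϖ, (f : M × N → ℝ) c.1 = 0) →
      ∀ c ∈ Corr.principal n π ϖ, val X f c.1 = 0) :
    ∃ Y : ellipticCorr (n := n) π ϖ, Related (Corr.incl π ϖ) Y.1 X.1 := by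
  have hS := h.localAlg hM hN
  have h0 : ∀ f : SmoothProd n M N, Corr.res π ϖ f = 0 → Corr.res π ϖ (X.1 f) = 0 := fun f hf =>
    hS.ext (h.dense_principal hM hN) fun c hc => hX f
      (fun c => congrFun (congrArg Subtype.val hf) c) c hc
  have hsub : ∀ f f' : SmoothProd n M N, Corr.res π ϖ (f - f') = Corr.res π ϖ f - Corr.res π ϖ f' :=
    fun f f' => rfl
  have h1 : ∀ f f' : SmoothProd n M N, Corr.res π ϖ f = Corr.res π ϖ f' →
      Corr.res π ϖ (X.1 f) = Corr.res π ϖ (X.1 f') := fun f f' e => by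
    have h2 := h0 (f - f') (by rw [hsub, e, sub_self])
    rwa [map_sub, hsub, sub_eq_zero] at h2
  choose E hE using fun f => Corr.exists_res (π := π) (ϖ := ϖ) (n := n) f
  let D : Derivation ℝ (SmoothCorr (n := n) π ϖ) (SmoothCorr (n := n) π ϖ) := Derivation.mk'
    { toFun := fun f => Corr.res π ϖ (X.1 (E f))
      map_add' := fun f g => by
        rw [h1 (E (f + g)) (E f + E g) (by rw [hE]; exact congrArg₂ _ (hE f).symm (hE g).symm),
          map_add]
        rfl
      map_smul' := fun r f => by
        rw [h1 (E (r • f)) (r • E f) (by rw [hE]; exact congrArg _ (hE f).symm), X.1.map_smul]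
        rfl }
    fun f g => by
      have h2 := h1 (E (f * g)) (E f * E g)
        (by rw [hE]; exact congrArg₂ _ (hE f).symm (hE g).symm)
      change Corr.res π ϖ (X.1 (E (f * g))) = _
      rw [h2, Derivation.leibniz]
      change Corr.res π ϖ (E f) * Corr.res π ϖ (X.1 (E g)) +
        Corr.res π ϖ (E g) * Corr.res π ϖ (X.1 (E f)) = _
      rw [hE, hE]
      rfl
  have hD : Related (Corr.incl π ϖ) D X.1 := by
    intro f F e
    have h2 : Corr.res π ϖ (X.1 (E f)) = Corr.res π ϖ (X.1 F) := h1 _ _ (by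
      rw [hE]
      exact Subtype.ext e)
    exact congrArg Subtype.val h2
  exact ⟨⟨D, X.1, X.2, hD⟩, hD⟩

/-- Sections on the correspondence space are tangent to it. -/
theorem SameBase.tangent (h : SameBase (n := n) π ϖ) (hM : IsStandard n M)
    (hN : IsStandard n N) {Y : ellipticCorr (n := n) π ϖ} {X : ellipticProd n M N}
    (hY : Related (Corr.incl π ϖ) Y.1 X.1) {Φ : OpenPartialHomeomorph (M × N) (Fin n ⊕ Fin n → ℂ)}
    (hΦ : Φ ∈ prodCharts n M N) {c : Corr π ϖ} (hc : c.1 ∈ Φ.source)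
    {C : (Fin n ⊕ Fin n → ℂ) → Fin n ⊕ Fin n → ℂ} (hC : ∀ᶠ x in 𝓝 c.1, HasComps Φ X C x)
    {H : (Fin n ⊕ Fin n → ℂ) → ℝ} (hH : ContDiff ℝ ∞ H)
    (h0 : ∀ᶠ c' in 𝓝 c, H (Φ (Corr.incl π ϖ c')) = 0) :
    ∀ᶠ c' in 𝓝 c, fderiv ℝ H (Φ c'.1) (C (Φ c'.1) * Φ c'.1) = 0 := by
  obtain ⟨f, hf⟩ := (smoothCharts_prod hM hN).exists_eq hΦ hc hH
  filter_upwards [h0.eventually_nhds, Corr.eventually_nhds hC, Corr.eventually_nhds hf.eventually_nhds,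
    Corr.eventually_nhds (Φ.open_source.mem_nhds hc)] with c' h1 h2 h3 h4
  rw [← dch_eq h4 h3, ← h2 f, ← Corr.related_res hY]
  have h5 : (Corr.res π ϖ f : Corr π ϖ → ℝ) =ᶠ[𝓝 c'] ((0 : SmoothCorr (n := n) π ϖ) : _ → ℝ) := by
    filter_upwards [h1, Corr.eventually_nhds h3] with c'' h6 h7
    exact h7.trans h6
  rw [val_congr_of_eventuallyEq (h.localAlg hM hN) Y h5]
  have : Y.1 (0 : SmoothCorr (n := n) π ϖ) = 0 := map_zero Y.1
  exact congrFun (congrArg Subtype.val this) c'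

variable {φ : OpenPartialHomeomorph M (Model n)} {ψ : OpenPartialHomeomorph N (Model n)}

theorem normProd_singleton {ι : Type} [Fintype ι] [DecidableEq ι] (i : ι) (z : ι → ℂ) :
    normProd {i} z = ‖z i‖ ^ 2 := Finset.prod_singleton _ _

/-- The real parts of the logarithmic components on `M` of a section on the correspondence space
are determined by the components on `N`. -/
theorem SameBase.comps_eq_zero (h : SameBase (n := n) π ϖ) (hM : IsStandard n M)
    (hN : IsStandard n N) (hφ : φ ∈ stdCharts n M) (hψ : ψ ∈ stdCharts n N)
    {Y : ellipticCorr (n := n) π ϖ} {X : ellipticProd n M N}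
    (hY : Related (Corr.incl π ϖ) Y.1 X.1) {c : Corr π ϖ} (hc : c.1 ∈ (prodChart φ ψ).source)
    {C : (Fin n ⊕ Fin n → ℂ) → Fin n ⊕ Fin n → ℂ} (hCs : ContDiff ℝ ∞ C)
    (hC : ∀ᶠ x in 𝓝 c.1, HasComps (prodChart φ ψ) X C x) :
    ∀ᶠ c' in 𝓝 c, (∀ i, (C (prodChart φ ψ (Corr.incl π ϖ c')) (.inl i)).im = 0) →
      (∀ i, C (prodChart φ ψ c'.1) (.inr i) = 0) → C (prodChart φ ψ c'.1) = 0 := by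
  obtain ⟨K, a, hφ'⟩ := hφ
  obtain ⟨K', a', hψ'⟩ := hψ
  obtain ⟨σ, g, hg, -, hgp, eg⟩ := h.exists_match hM hN hφ' hψ' hc.1 hc.2 c.2
  set Φ := prodChart φ ψ with hΦ
  have hΦC : Φ ∈ prodCharts n M N := ⟨φ, ⟨K, a, hφ'⟩, ψ, ⟨K', a', hψ'⟩, rfl⟩
  let inr : (Fin n ⊕ Fin n → ℂ) →L[ℝ] Model n := ContinuousLinearMap.pi fun i =>
    ContinuousLinearMap.proj (.inr i)
  have hmatch : ∀ᶠ c' in 𝓝 c, ∀ i, ‖Φ (Corr.incl π ϖ c') (.inl i)‖ ^ 2 =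
      ‖Φ c'.1 (.inr (σ i))‖ ^ 2 * g i (inr (Φ c'.1)) := by
    filter_upwards [Corr.eventually_nhds (continuous_snd.continuousAt.eventually eg),
      Corr.eventually_nhds (Φ.open_source.mem_nhds hc)] with c' h1 h2 i
    have h3 := h1 i
    rw [← c'.2, h.modBase_eq hφ' h2.1] at h3
    exact h3
  have hrel : ∀ i, ∀ᶠ c' in 𝓝 c, g i (inr (Φ (Corr.incl π ϖ c'))) * (2 * (C (Φ c'.1) (.inl i)).re) =
      2 * (C (Φ c'.1) (.inr (σ i))).re * g i (inr (Φ c'.1)) +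
        fderiv ℝ (g i) (inr (Φ c'.1)) (inr (C (Φ c'.1) * Φ c'.1)) := by
    intro i
    have hd1 := (contDiff_normProd (ι := Fin n ⊕ Fin n) {.inl i}).differentiable (by simp)
    have hd2 := (contDiff_normProd (ι := Fin n ⊕ Fin n) {.inr (σ i)}).differentiable (by simp)
    have hd3 : ContDiff ℝ ∞ (g i ∘ inr) := (hg i).comp inr.contDiff
    have hH : ContDiff ℝ ∞ fun z : Fin n ⊕ Fin n → ℂ =>
        normProd {.inl i} z - normProd {.inr (σ i)} z * (g i ∘ inr) z :=
      (contDiff_normProd _).sub ((contDiff_normProd _).mul hd3)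
    have h1 := h.tangent hM hN hY hΦC hc hC hH (by
      filter_upwards [hmatch] with c' h1
      rw [normProd_singleton, normProd_singleton, h1 i]
      exact sub_self _)
    have h2 : ∀ᶠ c' in 𝓝 c, c' ∈ Corr.principal n π ϖ →
        g i (inr (Φ (Corr.incl π ϖ c'))) * (2 * (C (Φ c'.1) (.inl i)).re) =
        2 * (C (Φ c'.1) (.inr (σ i))).re * g i (inr (Φ c'.1)) +
        fderiv ℝ (g i) (inr (Φ c'.1)) (inr (C (Φ c'.1) * Φ c'.1)) := by
      filter_upwards [h1, hmatch, Corr.eventually_nhds (Φ.open_source.mem_nhds hc)] with c' h1 h2 h3 h4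
      rw [fderiv_fun_sub (hd1 _) ((hd2 _).fun_mul (hd3.differentiable (by simp) _)),
        fderiv_fun_mul (hd2 _) (hd3.differentiable (by simp) _), sub_apply, add_apply, smul_apply,
        smul_apply, fderiv_normProd_mul, fderiv_normProd_mul,
        fderiv_comp _ ((hg i).differentiable (by simp) _) inr.differentiableAt,
        ContinuousLinearMap.comp_apply, inr.fderiv, normProd_singleton, normProd_singleton,
        Finset.sum_singleton, Finset.sum_singleton, h2 i] at h1
      have h5 : Φ c'.1 (.inr (σ i)) ≠ 0 := (hψ'.mem_principal_iff h3.2).1 h4.2 (σ i)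
      have h6 : ‖Φ c'.1 (.inr (σ i))‖ ^ 2 ≠ 0 := pow_ne_zero _ (norm_ne_zero_iff.2 h5)
      refine mul_left_cancel₀ h6 ?_
      simp only [smul_eq_mul, Function.comp_apply] at h1
      linear_combination h1
    filter_upwards [h2.eventually_nhds, Corr.eventually_nhds (Φ.open_source.mem_nhds hc)]
      with c' h3 h4
    have hne : (𝓝[Corr.principal n π ϖ] c').NeBot :=
      mem_closure_iff_nhdsWithin_neBot.1 (h.dense_principal hM hN c')
    have hΦc : ContinuousAt (fun c' : Corr π ϖ => Φ c'.1) c' :=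
      ContinuousAt.comp (g := Φ) (f := Corr.incl π ϖ) (Φ.continuousAt h4)
        Corr.continuous_incl.continuousAt
    have hg' : Continuous (fderiv ℝ (g i)) := (hg i).continuous_fderiv (by simp)
    have hCi : ∀ k, Continuous fun z => (C z k).re := fun k =>
      Complex.continuous_re.comp ((continuous_apply k).comp hCs.continuous)
    have hgc := (hg i).continuous
    refine tendsto_nhds_unique_of_eventuallyEq (l := 𝓝[Corr.principal n π ϖ] c')
      (f := (fun z => g i (inr z) * (2 * (C z (.inl i)).re)) ∘ fun c' : Corr π ϖ => Φ c'.1)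
      (g := (fun z => 2 * (C z (.inr (σ i))).re * g i (inr z) +
        fderiv ℝ (g i) (inr z) (inr (C z * z))) ∘ fun c' : Corr π ϖ => Φ c'.1) ?_ ?_ ?_
    · refine (ContinuousAt.comp (Continuous.continuousAt ?_) hΦc).tendsto.mono_left
        nhdsWithin_le_nhds
      exact (hgc.comp inr.continuous).mul (continuous_const.mul (hCi _))
    · refine (ContinuousAt.comp (Continuous.continuousAt ?_) hΦc).tendsto.mono_left
        nhdsWithin_le_nhds
      exact ((continuous_const.mul (hCi _)).mul (hgc.comp inr.continuous)).add
        ((hg'.comp inr.continuous).clm_apply (inr.continuous.comp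
          (hCs.continuous.mul continuous_id)))
    · filter_upwards [nhdsWithin_le_nhds h3, self_mem_nhdsWithin] with y h5 h6 using h5 h6
  have hpos : ∀ᶠ c' in 𝓝 c, ∀ i, 0 < g i (inr (Φ (Corr.incl π ϖ c'))) := by
    refine eventually_all.2 fun i => ?_
    have h1 : ∀ᶠ x in 𝓝 c.1, 0 < g i (inr (Φ x)) :=
      (((hg i).continuous.comp inr.continuous).continuousAt.comp (Φ.continuousAt hc)).eventually
        (lt_mem_nhds (hgp i))
    exact Corr.eventually_nhds h1
  filter_upwards [eventually_all.2 hrel, hpos] with c' h1 h2 h3 h4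
  have h5 : inr (C (Φ c'.1) * Φ c'.1) = 0 := funext fun i => by
    change C (Φ c'.1) (.inr i) * _ = 0
    rw [h4, zero_mul]
  funext k
  rcases k with i | i
  · have h6 := h1 i
    rw [h4, h5, map_zero, Complex.zero_re, mul_zero, zero_mul, add_zero] at h6
    have h7 : (C (Φ c'.1) (.inl i)).re = 0 := by
      rcases mul_eq_zero.1 h6 with h7 | h7
      · exact absurd h7 (h2 i).ne'
      · linarith
    exact Complex.ext h7 (h3 i)
  · exact h4 i

/-- Sections with independent components form a frame on the correspondence space if there are
`3n` of them. -/
theorem SameBase.isFrameAt (h : SameBase (n := n) π ϖ) (hM : IsStandard n M)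
    (hN : IsStandard n N) (hφ : φ ∈ stdCharts n M) (hψ : ψ ∈ stdCharts n N) {κ : Type} [Fintype κ]
    {e : κ → ellipticCorr (n := n) π ϖ} {X : κ → ellipticProd n M N}
    (he : ∀ k, Related (Corr.incl π ϖ) (e k).1 (X k).1) {c : Corr π ϖ}
    (hc : c.1 ∈ (prodChart φ ψ).source) {C : κ → (Fin n ⊕ Fin n → ℂ) → Fin n ⊕ Fin n → ℂ}
    (hCs : ∀ k, ContDiff ℝ ∞ (C k))
    (hC : ∀ k, ∀ᶠ x in 𝓝 c.1, HasComps (prodChart φ ψ) (X k) (C k) x)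
    (hi : LinearIndependent ℝ fun k => C k (prodChart φ ψ c.1)) (hcard : Fintype.card κ = 3 * n) :
    IsFrameAt (Corr.principal n π ϖ) e c := by
  have hP := logCharts_prod hM hN
  have := hP.t2
  set Φ := prodChart φ ψ with hΦ
  have hΦC : Φ ∈ prodCharts n M N := ⟨φ, hφ, ψ, hψ, rfl⟩
  let pr : (Fin n ⊕ Fin n → ℂ) →L[ℝ] (Fin n → ℝ) × (Fin n → ℂ) :=
    (ContinuousLinearMap.pi fun i => Complex.imCLM.comp (ContinuousLinearMap.proj (.inl i))).prod
      (ContinuousLinearMap.pi fun i => ContinuousLinearMap.proj (.inr i))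
  have hpr : ∀ v, pr v = 0 → (∀ i, (v (.inl i)).im = 0) ∧ ∀ i, v (.inr i) = 0 := fun v hv =>
    ⟨fun i => congrFun (congrArg Prod.fst hv) i, fun i => congrFun (congrArg Prod.snd hv) i⟩
  have hcomb : ∀ f : κ → SmoothProd n M N, ∀ R : κ → (Fin n ⊕ Fin n → ℂ) → ℝ,
      (∀ k, ∀ᶠ x in 𝓝 c.1, (f k : M × N → ℝ) x = R k (Φ x)) →
      ∀ᶠ x in 𝓝 c.1, HasComps Φ (∑ k, f k • X k) (fun z => ∑ k, R k z • C k z) x := by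
    intro f R hR
    filter_upwards [eventually_all.2 hR, eventually_all.2 hC] with x h1 h2 u
    rw [val_sum, Finset.sum_mul, map_sum]
    refine Finset.sum_congr rfl fun k _ => ?_
    rw [val_smul, h1 k, h2 k u, smul_mul_assoc, map_smul, smul_eq_mul]
  have hrel : ∀ f : κ → SmoothProd n M N, Related (Corr.incl π ϖ)
      (∑ k, Corr.res π ϖ (f k) • e k).1 (∑ k, f k • X k).1 := fun f =>
    Related.sum fun k => (he k).smul rfl
  have hi' : LinearIndependent ℝ fun k => pr (C k (Φ c.1)) := by
    rw [Fintype.linearIndependent_iff]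
    intro a ha
    have h1 := h.comps_eq_zero hM hN hφ hψ (hrel fun k => cst _ (a k)) hc
      (ContDiff.sum fun k _ => (contDiff_const (c := a k)).smul (hCs k))
      (hcomb _ (fun k _ => a k) fun k => .of_forall fun x => rfl)
    have h2 := hpr (∑ k, a k • C k (Φ c.1)) (by
      rw [map_sum, ← ha]
      exact Finset.sum_congr rfl fun k _ => map_smul _ _ _)
    exact Fintype.linearIndependent_iff.1 hi a (h1.self_of_nhds h2.1 h2.2)
  obtain ⟨R, hR, eR⟩ := exists_smooth_coeffs (T := fun k z => pr (C k z))
    (fun k => pr.contDiff.comp (hCs k)) hi' (by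
      rw [hcard, Module.finrank_prod, Module.finrank_fintype_fun_eq_card,
        Module.finrank_pi_fintype]
      simp
      ring)
  refine ⟨fun Y => ?_, ?_⟩
  · obtain ⟨Z, hZ⟩ := Corr.exists_ambient Y
    obtain ⟨D, hD, hZD⟩ := hP.comps Z Φ hΦC c.1 hc
    have hRk : ∀ k, ContDiff ℝ ∞ fun z => R z (pr (D z)) k := fun k =>
      contDiff_pi.1 (hR.clm_apply (pr.contDiff.comp hD)) k
    choose f hf using fun k => hP.exists_eq hΦC hc (hRk k)
    refine ⟨fun k => Corr.res π ϖ (f k), ?_⟩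
    have h1 := h.comps_eq_zero hM hN hφ hψ (hZ.sub (hrel f)) hc
      (C := fun z => D z - ∑ k, R z (pr (D z)) k • C k z)
      (hD.sub (ContDiff.sum fun k _ => (hRk k).smul (hCs k))) (by
        filter_upwards [hcomb f (fun k z => R z (pr (D z)) k) hf, hZD] with x h1 h2 u
        rw [val_sub, h1 u, h2 u, sub_mul, map_sub])
    filter_upwards [h1, Corr.eventually_nhds ((tendsto_chart hc).eventually eR),
      Corr.eventually_nhds (hcomb f (fun k z => R z (pr (D z)) k) hf), Corr.eventually_nhds hZD] with c' h2 h3 h4 h5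
    have h6 := hpr (D (Φ c'.1) - ∑ k, R (Φ c'.1) (pr (D (Φ c'.1))) k • C k (Φ c'.1)) (by
      rw [map_sub, map_sum, sub_eq_zero]
      simp only [map_smul]
      exact (h3.1 _).symm)
    have h7 := h2 h6.1 h6.2
    rw [zeroAt_sub_iff]
    intro u
    obtain ⟨U, rfl⟩ := Corr.exists_res u
    rw [Corr.related_res hZ, Corr.related_res (hrel f), h5 U, h4 U, sub_eq_zero.1 h7]
  · filter_upwards [Corr.eventually_nhds ((tendsto_chart hc).eventually eR),
      Corr.eventually_nhds (eventually_all.2 hC),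
      Corr.eventually_nhds (Φ.open_source.mem_nhds hc)] with c' h1 h2 h3 hW a ha
    refine h1.2 a ?_
    have h4 : (∑ k, a k • C k (Φ c'.1)) * Φ c'.1 = 0 := by
      refine hP.eq_zero_of_dch hΦC h3 fun f => ?_
      rw [← ha (Corr.res π ϖ f), Finset.sum_mul, map_sum]
      refine Finset.sum_congr rfl fun k _ => ?_
      rw [Corr.related_res (he k), h2 k f, smul_mul_assoc, map_smul, smul_eq_mul]
    have h5 : ∑ k, a k • C k (Φ c'.1) = 0 := funext fun i => by
      rcases mul_eq_zero.1 (congrFun h4 i) with h6 | h6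
      · exact h6
      · exact absurd h6 ((hP.principal Φ hΦC _ h3).1 hW i)
    have h6 := congrArg pr h5
    rw [map_sum, map_zero] at h6
    simpa only [map_smul] using h6

/-- A flow on the correspondence space which rotates the coordinates is generated by a section. -/
theorem SameBase.exists_rotation (h : SameBase (n := n) π ϖ) (hM : IsStandard n M)
    (hN : IsStandard n N) (θ : ℝ → M × N → M × N)
    (hθ : ∀ Φ ∈ prodCharts n M N, ∃ β : Fin n ⊕ Fin n → ℝ, ∀ x ∈ Φ.source, ∀ s,
      θ s x ∈ Φ.source ∧ Φ (θ s x) = fun i => Complex.exp (β i * s * Complex.I) * Φ x i)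
    (θC : ℝ → Corr π ϖ → Corr π ϖ) (hC : ∀ s c, (θC s c).1 = θ s c.1) :
    ∃ (Y : ellipticCorr (n := n) π ϖ) (X : ellipticProd n M N), Related (Corr.incl π ϖ) Y.1 X.1 ∧
      (∀ (f : SmoothCorr (n := n) π ϖ) c, HasDerivAt (fun s => (f : Corr π ϖ → ℝ) (θC s c)) (val Y f c) 0) ∧
      ∀ Φ ∈ prodCharts n M N, ∀ β : Fin n ⊕ Fin n → ℝ, (∀ x ∈ Φ.source, ∀ s,
        θ s x ∈ Φ.source ∧ Φ (θ s x) = fun i => Complex.exp (β i * s * Complex.I) * Φ x i) →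
        ∀ x ∈ Φ.source, HasComps Φ X (fun _ i => β i * Complex.I) x := by
  obtain ⟨X, hX, hXc⟩ := (logCharts_prod hM hN).exists_rotation θ hθ
  obtain ⟨Y, hY⟩ := h.exists_restrict hM hN (X := X) fun f hf c _ => by
    refine (hX f c.1).unique ?_
    simp only [← hC, hf]
    exact hasDerivAt_const _ _
  refine ⟨Y, X, hY, fun f c => ?_, hXc⟩
  obtain ⟨F, rfl⟩ := Corr.exists_res f
  rw [Corr.related_res hY]
  have h1 := hX F c.1
  simp only [← hC] at h1
  exact h1

theorem IsStdChart.exists_bump {K : Finset (Fin n)} {a : Torus n ≃ₜ* Torus n}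
    (hψ : IsStdChart ψ K a) {y : N} (hy : y ∈ ψ.source) {D : Set N} (hD : D ∈ 𝓝 y)
    (hinv : ∀ t : Torus n, ∀ x ∈ D, t • x ∈ D) :
    ∃ (Ω : Set (Model n)) (χ : Model n → ℝ), IsOpen Ω ∧ Ω ⊆ ψ.target ∧ (∀ w ∈ Ω, ψ.symm w ∈ D) ∧
      ContDiff ℝ ∞ χ ∧ ModInv χ ∧ (∀ᶠ z in 𝓝 (ψ y), χ z = 1) ∧ HasCompactSupport χ ∧
      tsupport χ ⊆ Ω := by
  have hU : ψ.target ∩ ψ.symm ⁻¹' D ∈ 𝓝 (ψ y) := by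
    refine inter_mem (ψ.open_target.mem_nhds (ψ.map_source hy)) ?_
    have := ψ.continuousAt_symm (ψ.map_source hy)
    rw [ContinuousAt, ψ.left_inv hy] at this
    exact this hD
  obtain ⟨ε, hε, hεU⟩ := exists_modNhd hU
  let Ω : Set (Model n) := {z | ∀ i, |‖z i‖ ^ 2 - ‖ψ y i‖ ^ 2| < ε}
  have hΩo : IsOpen Ω := by
    have : Ω = ⋂ i, {z : Model n | |‖z i‖ ^ 2 - ‖ψ y i‖ ^ 2| < ε} := by
      ext z
      simp [Ω]
    rw [this]
    exact isOpen_iInter_of_finite fun i => isOpen_lt (by fun_prop) continuous_const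
  have hΩi : ModInv (· ∈ Ω) := fun z w e => by
    have : z ∈ Ω ↔ w ∈ Ω := forall_congr' fun i => by rw [e i]
    exact propext this
  have h0 : ψ y ∈ Ω := fun i => by simpa using hε
  have hΩt : ∀ w ∈ Ω, w ∈ ψ.target ∧ ψ.symm w ∈ D := by
    intro w hw
    obtain ⟨h1, h2⟩ := hεU w hw
    have h3 : w ∈ ψ.target := hψ.mem_target_of_norm h1 fun i => norm_alignTo _ _ i
    refine ⟨h3, ?_⟩
    obtain ⟨t, ht⟩ := hψ.exists_smul_eq (ψ.map_target h1) (ψ.map_target h3) fun i => by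
      rw [ψ.right_inv h1, ψ.right_inv h3, norm_alignTo]
    rw [← ht]
    exact hinv t _ h2
  obtain ⟨χ, h1, h2, h3, h4, h5⟩ := exists_modInv_bump hΩo hΩi h0
  exact ⟨Ω, χ, hΩo, fun w hw => (hΩt w hw).1, fun w hw => (hΩt w hw).2, h1, h2, h3, h4, h5⟩

/-- The logarithmic derivative of `|w_k| √g` along the `j`-th Euler vector field. -/
def matchDeriv (g : Model n → ℝ) (k j : Fin n) (w : Model n) : ℝ :=
  (Pi.single j 1 : Fin n → ℝ) k + fderiv ℝ g w ((Pi.single j 1 : Fin n → ℂ) * w) / (2 * g w)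

theorem hasDerivAt_exp_mul (w : Model n) (j : Fin n) :
    HasDerivAt (fun (s : ℝ) (k : Fin n) =>
      (Real.exp (s * (Pi.single j 1 : Fin n → ℝ) k) : ℂ) * w k)
      ((Pi.single j 1 : Fin n → ℂ) * w) 0 := by
  refine hasDerivAt_pi.2 fun k => ?_
  have h1 : HasDerivAt (fun s : ℝ => Real.exp (s * (Pi.single j 1 : Fin n → ℝ) k))
      ((Pi.single j 1 : Fin n → ℝ) k) 0 := by
    have := ((hasDerivAt_id (0 : ℝ)).mul_const ((Pi.single j 1 : Fin n → ℝ) k)).exp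
    simpa using this
  have h2 := h1.ofReal_comp.mul_const (w k)
  have h3 : (((Pi.single j 1 : Fin n → ℝ) k : ℝ) : ℂ) = (Pi.single j 1 : Fin n → ℂ) k := by
    by_cases hk : k = j
    · subst hk
      simp
    · simp [hk]
  rw [h3] at h2
  exact h2

/-- Moduli of a match along the exponential curves. -/
theorem hasDerivAt_match {g : Model n → ℝ} (hg : ContDiff ℝ ∞ g) {k j : Fin n} {w : Model n} {z : ℂ}
    (hz : z ≠ 0) (e : ‖z‖ ^ 2 = ‖w k‖ ^ 2 * g w) (hpos : 0 < g w) {ω' : ℝ → Model n}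
    (hω : HasDerivAt ω' ((Pi.single j 1 : Fin n → ℂ) * w) 0) (hω0 : ω' 0 = w) :
    HasDerivAt (fun s => ((√(‖ω' s k‖ ^ 2 * g (ω' s)) / ‖z‖ : ℝ) : ℂ) * z)
      (matchDeriv g k j w * z) 0 := by
  have hz' : ‖z‖ ≠ 0 := norm_ne_zero_iff.2 hz
  have hd1 := (contDiff_normProd (ι := Fin n) {k}).differentiable (by simp)
  have hd2 := hg.differentiable (by simp)
  have h1 : HasDerivAt (fun s => ‖ω' s k‖ ^ 2 * g (ω' s)) (‖z‖ ^ 2 * (2 * matchDeriv g k j w)) 0 := by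
    have h2 : HasFDerivAt (fun z => normProd {k} z * g z) _ (ω' 0) :=
      (hd1 _).hasFDerivAt.mul (hd2 _).hasFDerivAt
    have h3 := h2.comp_hasDerivAt 0 hω
    rw [hω0] at h3
    simp only [add_apply, smul_apply, fderiv_normProd_mul, normProd_singleton, Finset.sum_singleton,
      smul_eq_mul] at h3
    refine (h3.congr_of_eventuallyEq (.of_forall fun s => rfl)).congr_deriv ?_
    have h4 : ((Pi.single j 1 : Fin n → ℂ) k).re = (Pi.single j 1 : Fin n → ℝ) k := by
      by_cases hk : k = j
      · subst hk
        simp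
      · simp [hk]
    rw [h4, e, matchDeriv]
    field_simp
    ring
  have h2 := h1.sqrt (by rw [hω0, ← e]; positivity)
  rw [hω0, ← e, Real.sqrt_sq (norm_nonneg z)] at h2
  have h3 := (h2.div_const ‖z‖).ofReal_comp.mul_const z
  refine h3.congr_deriv ?_
  congr 2
  field_simp

theorem dch_snd (hψ : ψ ∈ stdCharts n N) (hN : IsStandard n N) {p : M × N}
    (hp : p ∈ (prodChart φ ψ).source) (f : Smooth n N) (v : Fin n ⊕ Fin n → ℂ) :
    dch (prodChart φ ψ) (fun p => (f : N → ℝ) p.2) p v =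
      dch ψ (f : N → ℝ) p.2 (fun i => v (.inr i)) := by
  obtain ⟨G, hG, eG⟩ := (smoothCharts hN).smooth f ψ hψ p.2 hp.2
  let inr : (Fin n ⊕ Fin n → ℂ) →L[ℝ] Model n := ContinuousLinearMap.pi fun i =>
    ContinuousLinearMap.proj (.inr i)
  rw [dch_eq hp.2 eG, dch_eq hp (G := G ∘ inr) (continuous_snd.continuousAt.eventually eG),
    fderiv_comp _ (hG.differentiable (by simp) _) inr.differentiableAt, inr.fderiv]
  rfl

/-- The Euler vector fields on `N` lift to the correspondence space. -/
theorem SameBase.exists_euler (h : SameBase (n := n) π ϖ) (hM : IsStandard n M)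
    (hN : IsStandard n N) (hφ : φ ∈ stdCharts n M) (hψ : ψ ∈ stdCharts n N) {c : Corr π ϖ}
    (hc : c.1 ∈ (prodChart φ ψ).source) (j : Fin n) :
    ∃ (Y : ellipticCorr (n := n) π ϖ) (X : ellipticProd n M N) (Z : elliptic n N)
      (C : (Fin n ⊕ Fin n → ℂ) → Fin n ⊕ Fin n → ℂ), Related (Corr.incl π ϖ) Y.1 X.1 ∧
      Related Corr.snd Y.1 Z.1 ∧ ContDiff ℝ ∞ C ∧
      (∀ᶠ x in 𝓝 c.1, HasComps (prodChart φ ψ) X C x) ∧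
      (∀ k, C (prodChart φ ψ c.1) (.inr k) = (Pi.single j 1 : Fin n → ℂ) k) ∧
      ∀ᶠ y in 𝓝 c.1.2, HasComps ψ Z (fun _ => (Pi.single j 1 : Fin n → ℂ)) y := by
  have hP := logCharts_prod hM hN
  have hφ0 := hφ
  have hψ0 := hψ
  obtain ⟨K, a, hφ⟩ := hφ
  obtain ⟨K', a', hψ⟩ := hψ
  obtain ⟨σ, g, hg, hgi, hgp, eg⟩ := h.exists_match hM hN hφ hψ hc.1 hc.2 c.2
  obtain ⟨Ω', γ, -, hΩ', -, hγ, hγi, hγ1, hγc, hγs⟩ :=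
    hφ.exists_bump hc.1 univ_mem fun _ _ _ => mem_univ _
  let D : Set N := {y | y ∈ ψ.source ∧ (∀ i, modBase π φ i (ϖ y) = ‖ψ y (σ i)‖ ^ 2 * g i (ψ y)) ∧
    (∀ i, 0 < g i (ψ y)) ∧ ∃ m, (m ∈ φ.source ∧ γ (φ m) = 1) ∧ π m = ϖ y}
  have hD : D ∈ 𝓝 c.1.2 := by
    have h1 : ∀ᶠ y in 𝓝 c.1.2, ∃ m, (m ∈ φ.source ∧ γ (φ m) = 1) ∧ π m = ϖ y := by
      refine h.symm.eventually_base hN hM c.2.symm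
        (p := fun b => ∃ m, (m ∈ φ.source ∧ γ (φ m) = 1) ∧ π m = b) ?_
      filter_upwards [φ.open_source.mem_nhds hc.1, (tendsto_chart hc.1).eventually hγ1]
        with m h1 h2 using ⟨m, ⟨h1, h2⟩, rfl⟩
    have h2 : ∀ᶠ y in 𝓝 c.1.2, ∀ i, 0 < g i (ψ y) := eventually_all.2 fun i =>
      ((hg i).continuous.continuousAt.comp (ψ.continuousAt hc.2)).eventually (lt_mem_nhds (hgp i))
    filter_upwards [ψ.open_source.mem_nhds hc.2, eg, h2, h1] with y h3 h4 h5 h6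
      using ⟨h3, h4, h5, h6⟩
  obtain ⟨Ω, χ, hΩo, hΩt, hΩD, hχ, hχi, hχ1, hχc, hχs⟩ := hψ.exists_bump hc.2 hD (by
    rintro t y ⟨h1, h2, h3, h4⟩
    have h5 : ϖ (t • y) = ϖ y := ((h.eq_iff' _ _).2 ⟨t, rfl⟩).symm
    have h6 : ∀ i, g i (ψ (t • y)) = g i (ψ y) := fun i => hgi i _ _ fun k => hψ.norm_smul t h1 k
    refine ⟨hψ.smul_mem t y h1, fun i => ?_, fun i => ?_, ?_⟩
    · rw [h5, h6, hψ.norm_smul t h1, h2]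
    · rw [h6]
      exact h3 i
    · rw [h5]
      exact h4)
  have hΩg : ∀ w ∈ Ω, ∀ i, 0 < g i w := fun w hw i => by
    have := (hΩD w hw).2.2.1 i
    rwa [ψ.right_inv (hΩt hw)] at this
  have hBsm : ∀ i, ContDiff ℝ ∞ fun w => χ w • matchDeriv (g i) (σ i) j w := fun i => by
    refine contDiff_smul_of_tsupport_subset (U := {w | g i w ≠ 0})
      (isOpen_ne_fun (hg i).continuous continuous_const) ?_ hχ
      fun w hw => (hΩg w (hχs hw) i).ne'
    have h1 : ContDiff ℝ ∞ fun w => fderiv ℝ (g i) w ((Pi.single j 1 : Fin n → ℂ) * w) :=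
      contDiff_fderiv_comps (hg i) contDiff_const
    exact contDiffOn_const.add (h1.contDiffOn.div (contDiff_const.mul (hg i)).contDiffOn
      fun w hw => mul_ne_zero two_ne_zero hw)
  -- the vector, and its cut-off
  let u : (Fin n ⊕ Fin n → ℂ) → Fin n ⊕ Fin n → ℂ := fun z => Sum.elim
    (fun i => ((matchDeriv (g i) (σ i) j fun k => z (.inr k) : ℝ) : ℂ)) (Pi.single j 1)
  let C : (Fin n ⊕ Fin n → ℂ) → Fin n ⊕ Fin n → ℂ := fun z =>
    ((γ fun k => z (.inl k)) * χ fun k => z (.inr k)) • u z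
  have hCs : ContDiff ℝ ∞ C := by
    have h1 : ContDiff ℝ ∞ fun z : Fin n ⊕ Fin n → ℂ => γ fun k => z (.inl k) := hγ.comp contDiff_inl
    have h2 : ContDiff ℝ ∞ fun z : Fin n ⊕ Fin n → ℂ => χ fun k => z (.inr k) := hχ.comp contDiff_inr
    refine contDiff_pi.2 fun k => ?_
    rcases k with i | k
    · have h3 : (fun z => C z (.inl i)) = fun z => ((((γ fun k => z (.inl k)) *
          ((χ fun k => z (.inr k)) • matchDeriv (g i) (σ i) j fun k => z (.inr k)) : ℝ)) : ℂ) := by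
        funext z
        simp [C, u, mul_assoc]
      rw [h3]
      exact Complex.ofRealCLM.contDiff.comp (h1.mul ((hBsm i).comp contDiff_inr))
    · exact (h1.mul h2).smul contDiff_const
  let Q : Set (Fin n ⊕ Fin n → ℂ) := sumCLE n '' (tsupport γ ×ˢ tsupport χ)
  obtain ⟨X, hX, hX0⟩ := hP.exists_section_of_compact (φ := prodChart φ ψ) ⟨φ, hφ0, ψ, hψ0, rfl⟩
    hCs (K := Q) ((hγc.isCompact.prod hχc).image (sumCLE n).continuous)
    (by
      rintro _ ⟨⟨z, w⟩, ⟨hz, hw⟩, rfl⟩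
      exact ⟨hΩ' (hγs hz), hΩt (hχs hw)⟩)
    fun z hz => by
      have h1 : (γ fun k => z (.inl k)) * (χ fun k => z (.inr k)) = 0 := by
        by_contra h0
        refine hz ⟨(fun k => z (.inl k), fun k => z (.inr k)),
          ⟨subset_tsupport _ (left_ne_zero_of_mul h0), subset_tsupport _ (right_ne_zero_of_mul h0)⟩,
          funext fun k => ?_⟩
        rcases k with k | k <;> rfl
      change _ • _ = _
      rw [h1, zero_smul]
  have htan : ∀ f : SmoothProd n M N, (∀ c : Corr π ϖ, (f : M × N → ℝ) c.1 = 0) →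
      ∀ c ∈ Corr.principal n π ϖ, val X f c.1 = 0 := by
    intro f hf c' hc'
    by_cases hs : c'.1 ∈ (prodChart φ ψ).source
    swap
    · exact hX0 _ hs f
    rw [hX _ hs f]
    change dch _ _ _ ((_ • _) * _) = 0
    rw [smul_mul_assoc, map_smul]
    by_cases hχ0 : χ (ψ c'.1.2) = 0
    · have : (γ fun k => prodChart φ ψ c'.1 (.inl k)) * (χ fun k => prodChart φ ψ c'.1 (.inr k)) = 0 :=
        mul_eq_zero_of_right _ hχ0
      rw [this, zero_smul]
    have hw : ψ c'.1.2 ∈ Ω := hχs (subset_tsupport _ hχ0)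
    have hz0 := (hφ.mem_principal_iff hs.1).1 hc'.1
    have hgw := hΩg _ hw
    have hmod : ∀ i, ‖φ c'.1.1 i‖ ^ 2 = ‖ψ c'.1.2 (σ i)‖ ^ 2 * g i (ψ c'.1.2) := fun i => by
      have h1 := (hΩD _ hw).2.1 i
      rw [ψ.left_inv hs.2, ← c'.2, h.modBase_eq hφ hs.1] at h1
      exact h1
    have hω := hasDerivAt_exp_mul (ψ c'.1.2) j
    set ω' : ℝ → Model n := fun s k =>
      (Real.exp (s * (Pi.single j 1 : Fin n → ℝ) k) : ℂ) * ψ c'.1.2 k with hω'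
    have hω0 : ω' 0 = ψ c'.1.2 := by simp [hω']
    let ζ : ℝ → Fin n ⊕ Fin n → ℂ := fun s => Sum.elim
      (fun i => ((√(‖ω' s (σ i)‖ ^ 2 * g i (ω' s)) / ‖φ c'.1.1 i‖ : ℝ) : ℂ) * φ c'.1.1 i) (ω' s)
    have hζ : HasDerivAt ζ (u (prodChart φ ψ c'.1) * prodChart φ ψ c'.1) 0 := by
      refine hasDerivAt_pi.2 fun k => ?_
      rcases k with i | k
      · exact hasDerivAt_match (hg i) (hz0 i) (hmod i) (hgw i) hω hω0
      · exact hasDerivAt_pi.1 hω k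
    have hζ0 : ζ 0 = prodChart φ ψ c'.1 := by
      funext k
      rcases k with i | k
      · change ((√(‖ω' 0 (σ i)‖ ^ 2 * g i (ω' 0)) / ‖φ c'.1.1 i‖ : ℝ) : ℂ) * φ c'.1.1 i = φ c'.1.1 i
        rw [hω0, ← hmod, Real.sqrt_sq (norm_nonneg _), div_self (norm_ne_zero_iff.2 (hz0 i)),
          Complex.ofReal_one, one_mul]
      · exact congrFun hω0 k
    have h1 := hasDerivAt_comp_chart hP.toSmoothCharts ⟨φ, hφ0, ψ, hψ0, rfl⟩ hs f hζ hζ0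
      (θ := fun s => (prodChart φ ψ).symm (ζ s)) (.of_forall fun _ => rfl)
    have h2 : ∀ᶠ s in 𝓝 (0 : ℝ), (f : M × N → ℝ) ((prodChart φ ψ).symm (ζ s)) = 0 := by
      have h3 : ∀ᶠ s in 𝓝 (0 : ℝ), ω' s ∈ Ω := hω.continuousAt.eventually
        (hΩo.mem_nhds (by rw [hω0]; exact hw))
      have h4 : ∀ᶠ s in 𝓝 (0 : ℝ), ζ s ∈ (prodChart φ ψ).target := hζ.continuousAt.eventually
        ((prodChart φ ψ).open_target.mem_nhds (by
          rw [hζ0]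
          exact (prodChart φ ψ).map_source hs))
      filter_upwards [h3, h4] with s h5 h6
      obtain ⟨h7, h8, -, m, ⟨hm, -⟩, e⟩ := hΩD _ h5
      rw [ψ.right_inv (hΩt h5)] at h8
      have hmem := φ.map_target h6.1
      have h9 : ∃ t : Torus n, t • m = φ.symm fun i => ζ s (.inl i) := by
        refine hφ.exists_smul_eq hm hmem fun i => ?_
        have h10 := h8 i
        rw [← e, h.modBase_eq hφ hm] at h10
        have h11 : φ (φ.symm fun i => ζ s (.inl i)) = fun i => ζ s (.inl i) := φ.right_inv h6.1
        rw [h11]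
        change ‖φ m i‖ = ‖((√(‖ω' s (σ i)‖ ^ 2 * g i (ω' s)) / ‖φ c'.1.1 i‖ : ℝ) : ℂ) * φ c'.1.1 i‖
        rw [← h10, Real.sqrt_sq (norm_nonneg _), norm_mul, Complex.norm_real, norm_div, norm_norm,
          norm_norm, div_mul_cancel₀ _ (norm_ne_zero_iff.2 (hz0 i))]
      exact hf ⟨(prodChart φ ψ).symm (ζ s), ((h.eq_iff _ _).2 h9).symm.trans e⟩
    have h3 := h1.unique ((hasDerivAt_const 0 (0 : ℝ)).congr_of_eventuallyEq h2)
    rw [h3, smul_zero]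
  obtain ⟨Y, hY⟩ := h.exists_restrict hM hN htan
  obtain ⟨Z, hZ, hZ0⟩ := (logCharts hN).exists_section_of_compact hψ0
    (c := fun w => χ w • (Pi.single j 1 : Fin n → ℂ)) (hχ.smul contDiff_const) hχc
    (hχs.trans hΩt) fun w hw => by rw [image_eq_zero_of_notMem_tsupport hw, zero_smul]
  have hsupp : ∀ c' : Corr π ϖ, c'.1.2 ∈ ψ.source → χ (ψ c'.1.2) ≠ 0 →
      c'.1.1 ∈ φ.source ∧ γ (φ c'.1.1) = 1 := by
    intro c' hs hχ0
    obtain ⟨-, -, -, m, ⟨hm, hγm⟩, e⟩ := hΩD _ (hχs (subset_tsupport _ hχ0))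
    rw [ψ.left_inv hs, ← c'.2] at e
    refine ⟨h.mem_source hφ e hm, ?_⟩
    rw [← hγm]
    exact hγi _ _ fun i => (h.norm_eq hφ e hm i).symm
  refine ⟨Y, X, Z, C, hY, fun f f' e => funext fun c' => ?_, hCs, ?_, fun k => ?_, ?_⟩
  · have hf' : (fun p : M × N => (f' : N → ℝ) p.2) ∈ SmoothProd n M N :=
      (show ContMDiff _ _ _ _ from f'.2).comp contMDiff_snd
    have e' : f = Corr.res π ϖ ⟨_, hf'⟩ := Subtype.ext e
    change val Y f c' = val Z f' c'.1.2
    rw [e', Corr.related_res hY]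
    by_cases hs' : c'.1.2 ∈ ψ.source
    swap
    · rw [hZ0 _ hs' f', hX0 _ (fun hs => hs' hs.2)]
    rw [hZ _ hs' f', smul_mul_assoc, map_smul]
    by_cases hs : c'.1 ∈ (prodChart φ ψ).source
    · rw [hX _ hs, dch_snd hψ0 hN hs]
      have e2 : (fun i => (C (prodChart φ ψ c'.1) * prodChart φ ψ c'.1) (.inr i)) =
          (γ (φ c'.1.1) * χ (ψ c'.1.2)) • ((Pi.single j 1 : Fin n → ℂ) * ψ c'.1.2) := by
        rw [← smul_mul_assoc]
        rfl
      rw [e2, map_smul]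
      by_cases hχ0 : χ (ψ c'.1.2) = 0
      · simp only [hχ0, mul_zero, zero_smul]
      · rw [(hsupp c' hs' hχ0).2, one_mul]
    · have hχ0 : χ (ψ c'.1.2) = 0 := by
        by_contra hχ0
        exact hs ⟨(hsupp c' hs' hχ0).1, hs'⟩
      rw [hX0 _ hs, hχ0, zero_smul]
  · filter_upwards [(prodChart φ ψ).open_source.mem_nhds hc] with x hx using hX x hx
  · change (γ (φ c.1.1) * χ (ψ c.1.2)) • (Pi.single j 1 : Fin n → ℂ) k = _
    rw [hγ1.self_of_nhds, hχ1.self_of_nhds, one_mul, one_smul]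
  · filter_upwards [ψ.open_source.mem_nhds hc.2, (tendsto_chart hc.2).eventually hχ1] with y h1 h2 f
    rw [hZ y h1 f]
    simp only [h2, one_smul]

/-! ## The generators of the torus actions -/

theorem IsStdChart.rotation {K : Finset (Fin n)} {a : Torus n ≃ₜ* Torus n} (hφ : IsStdChart φ K a)
    {β : Matrix (Fin n) (Fin n) ℝ}
    (hβ : ∀ i s j, (a (circleExp i s) j : ℂ) = Complex.exp (β i j * s * Complex.I)) (i : Fin n)
    (x : M) (hx : x ∈ φ.source) (s : ℝ) : circleExp i s • x ∈ φ.source ∧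
      φ (circleExp i s • x) = fun j => Complex.exp (β i j * s * Complex.I) * φ x j :=
  ⟨hφ.smul_mem _ _ hx, funext fun j => by rw [hφ.map_smul _ _ hx, hβ]⟩

theorem exists_torusGen (hM : IsStandard n M) (i : Fin n) : ∃ X : elliptic n M,
    (∀ (f : Smooth n M) x, HasDerivAt (fun s => (f : M → ℝ) (circleExp i s • x)) (val X f x) 0) ∧
      ∀ φ ∈ stdCharts n M, ∀ β : Fin n → ℝ, (∀ x ∈ φ.source, ∀ s, circleExp i s • x ∈ φ.source ∧
        φ (circleExp i s • x) = fun j => Complex.exp (β j * s * Complex.I) * φ x j) →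
        ∀ x ∈ φ.source, HasComps φ X (fun _ j => β j * Complex.I) x :=
  (logCharts hM).exists_rotation (fun s x => circleExp i s • x) fun φ ⟨K, a, hφ⟩ => by
    obtain ⟨β, -, -, hβ⟩ := exists_weights a
    exact ⟨β i, hφ.rotation hβ i⟩

/-- The generators of the torus action. -/
def torusGen (hM : IsStandard n M) (i : Fin n) : elliptic n M := (exists_torusGen hM i).choose

theorem torusGen_deriv (hM : IsStandard n M) (i : Fin n) (f : Smooth n M) (x : M) :
    HasDerivAt (fun s => (f : M → ℝ) (circleExp i s • x)) (val (torusGen hM i) f x) 0 :=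
  (exists_torusGen hM i).choose_spec.1 f x

theorem torusGen_comps (hM : IsStandard n M) {K : Finset (Fin n)} {a : Torus n ≃ₜ* Torus n}
    (hφ : IsStdChart φ K a) {β : Matrix (Fin n) (Fin n) ℝ}
    (hβ : ∀ i s j, (a (circleExp i s) j : ℂ) = Complex.exp (β i j * s * Complex.I)) (i : Fin n)
    {x : M} (hx : x ∈ φ.source) : HasComps φ (torusGen hM i) (fun _ j => β i j * Complex.I) x :=
  (exists_torusGen hM i).choose_spec.2 φ ⟨K, a, hφ⟩ _ (hφ.rotation hβ i) x hx

/-- The one-parameter subgroups of the two tori. -/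
def pairExp (i : Fin n ⊕ Fin n) (s : ℝ) : Torus n × Torus n :=
  i.elim (fun i => (circleExp i s, 1)) fun i => (1, circleExp i s)

theorem prodChart_rotation {K : Finset (Fin n)} {a : Torus n ≃ₜ* Torus n} (hφ : IsStdChart φ K a)
    {K' : Finset (Fin n)} {a' : Torus n ≃ₜ* Torus n} (hψ : IsStdChart ψ K' a')
    {β : Matrix (Fin n) (Fin n) ℝ}
    (hβ : ∀ i s j, (a (circleExp i s) j : ℂ) = Complex.exp (β i j * s * Complex.I))
    {γ : Matrix (Fin n) (Fin n) ℝ}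
    (hγ : ∀ i s j, (a' (circleExp i s) j : ℂ) = Complex.exp (γ i j * s * Complex.I))
    (i : Fin n ⊕ Fin n) (x : M × N) (hx : x ∈ (prodChart φ ψ).source) (s : ℝ) :
    ((pairExp i s).1 • x.1, (pairExp i s).2 • x.2) ∈ (prodChart φ ψ).source ∧
      prodChart φ ψ ((pairExp i s).1 • x.1, (pairExp i s).2 • x.2) = fun j =>
        Complex.exp (Matrix.fromBlocks β 0 0 γ i j * s * Complex.I) * prodChart φ ψ x j := by
  refine ⟨⟨hφ.smul_mem _ _ hx.1, hψ.smul_mem _ _ hx.2⟩, funext fun j => ?_⟩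
  rcases i with i | i <;> rcases j with j | j
  · exact congrFun (hφ.rotation hβ i _ hx.1 s).2 j
  · simp [pairExp, prodChart_apply, sumCLE_inr]
  · simp [pairExp, prodChart_apply, sumCLE_inl]
  · exact congrFun (hψ.rotation hγ i _ hx.2 s).2 j

theorem SameBase.exists_gen (h : SameBase (n := n) π ϖ) (hM : IsStandard n M)
    (hN : IsStandard n N) (i : Fin n ⊕ Fin n) :
    ∃ (Y : ellipticCorr (n := n) π ϖ) (X : ellipticProd n M N), Related (Corr.incl π ϖ) Y.1 X.1 ∧
      (∀ (f : SmoothCorr (n := n) π ϖ) c, HasDerivAt (fun s => (f : Corr π ϖ → ℝ)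
        (h.act (pairExp i s).1 (pairExp i s).2 c)) (val Y f c) 0) ∧
      ∀ Φ ∈ prodCharts n M N, ∀ β : Fin n ⊕ Fin n → ℝ, (∀ x ∈ Φ.source, ∀ s,
        ((pairExp i s).1 • x.1, (pairExp i s).2 • x.2) ∈ Φ.source ∧
          Φ ((pairExp i s).1 • x.1, (pairExp i s).2 • x.2) =
            fun j => Complex.exp (β j * s * Complex.I) * Φ x j) →
        ∀ x ∈ Φ.source, HasComps Φ X (fun _ j => β j * Complex.I) x :=
  h.exists_rotation hM hN (fun s x => ((pairExp i s).1 • x.1, (pairExp i s).2 • x.2))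
    (by
      rintro _ ⟨φ, ⟨K, a, hφ⟩, ψ, ⟨K', a', hψ⟩, rfl⟩
      obtain ⟨β, -, -, hβ⟩ := exists_weights a
      obtain ⟨γ, -, -, hγ⟩ := exists_weights a'
      exact ⟨_, prodChart_rotation hφ hψ hβ hγ i⟩) _ fun _ _ => rfl

/-- The generators of the action on the correspondence space. -/
def SameBase.gen (h : SameBase (n := n) π ϖ) (hM : IsStandard n M) (hN : IsStandard n N)
    (i : Fin n ⊕ Fin n) : ellipticCorr (n := n) π ϖ := (h.exists_gen hM hN i).choose

theorem SameBase.gen_deriv (h : SameBase (n := n) π ϖ) (hM : IsStandard n M) (hN : IsStandard n N)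
    (i : Fin n ⊕ Fin n) (f : SmoothCorr (n := n) π ϖ) (c : Corr π ϖ) :
    HasDerivAt (fun s => (f : Corr π ϖ → ℝ) (h.act (pairExp i s).1 (pairExp i s).2 c))
      (val (h.gen hM hN i) f c) 0 := (h.exists_gen hM hN i).choose_spec.choose_spec.2.1 f c

theorem SameBase.gen_eq (h : SameBase (n := n) π ϖ) (hM : IsStandard n M) (hN : IsStandard n N)
    (i : Fin n ⊕ Fin n) {X : ellipticCorr (n := n) π ϖ} (hX : ∀ f c, val X f c =
      deriv (fun s => (f : Corr π ϖ → ℝ) (h.act (pairExp i s).1 (pairExp i s).2 c)) 0) :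
    X = h.gen hM hN i :=
  val_ext fun f c => (hX f c).trans (h.gen_deriv hM hN i f c).deriv

theorem SameBase.related_snd_inr (h : SameBase (n := n) π ϖ) (hM : IsStandard n M)
    (hN : IsStandard n N) (i : Fin n) :
    Related Corr.snd (h.gen hM hN (.inr i)).1 (torusGen hN i).1 := fun f f' e => funext fun c => by
  have h1 := h.gen_deriv hM hN (.inr i) f c
  rw [e] at h1
  exact h1.unique (torusGen_deriv hN i f' c.snd)

theorem SameBase.related_fst_inr (h : SameBase (n := n) π ϖ) (hM : IsStandard n M)
    (hN : IsStandard n N) (i : Fin n) :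
    Related Corr.fst (h.gen hM hN (.inr i)).1 (0 : elliptic n M).1 := fun f f' e =>
  funext fun c => by
    have h1 := h.gen_deriv hM hN (.inr i) f c
    have e2 : (fun s => (f : Corr π ϖ → ℝ) (h.act (pairExp (.inr i) s).1 (pairExp (.inr i) s).2 c)) =
        fun _ => (f' : M → ℝ) c.fst := funext fun s => by
      rw [e]
      exact congrArg (f' : M → ℝ) (one_smul (Torus n) c.fst)
    rw [e2] at h1
    exact h1.unique (hasDerivAt_const _ _)

theorem SameBase.related_snd_inl (h : SameBase (n := n) π ϖ) (hM : IsStandard n M)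
    (hN : IsStandard n N) (i : Fin n) :
    Related Corr.snd (h.gen hM hN (.inl i)).1 (0 : elliptic n N).1 := fun f f' e =>
  funext fun c => by
    have h1 := h.gen_deriv hM hN (.inl i) f c
    have e2 : (fun s => (f : Corr π ϖ → ℝ) (h.act (pairExp (.inl i) s).1 (pairExp (.inl i) s).2 c)) =
        fun _ => (f' : N → ℝ) c.snd := funext fun s => by
      rw [e]
      exact congrArg (f' : N → ℝ) (one_smul (Torus n) c.snd)
    rw [e2] at h1
    exact h1.unique (hasDerivAt_const _ _)

theorem weights_eq_zero {β β' : Matrix (Fin n) (Fin n) ℝ} (hβ : β * β' = 1) {a b : Fin n → ℝ}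
    (h : ∀ k, ∑ i, (a i : ℂ) * (β i k * Complex.I) + b k = 0) : a = 0 ∧ b = 0 := by
  have h1 : ∀ k, ((Matrix.vecMul a β k : ℝ) : ℂ) * Complex.I + b k = 0 := fun k => by
    have e : Matrix.vecMul a β k = ∑ i, a i * β i k := rfl
    rw [← h k, e, Complex.ofReal_sum, Finset.sum_mul]
    refine congrArg (· + _) (Finset.sum_congr rfl fun i _ => ?_)
    rw [Complex.ofReal_mul]
    ring
  have h2 : Matrix.vecMul a β = 0 := funext fun k => by simpa using congrArg Complex.im (h1 k)
  refine ⟨?_, funext fun k => by simpa using congrArg Complex.re (h1 k)⟩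
  rw [← Matrix.vecMul_one a, ← hβ, ← Matrix.vecMul_vecMul, h2, Matrix.zero_vecMul]

theorem SameBase.exists_frame (h : SameBase (n := n) π ϖ) (hM : IsStandard n M)
    (hN : IsStandard n N) (hφ : φ ∈ stdCharts n M) (hψ : ψ ∈ stdCharts n N) {c : Corr π ϖ}
    (hc : c.1 ∈ (prodChart φ ψ).source) :
    ∃ (e : (Fin n ⊕ Fin n) ⊕ Fin n → ellipticCorr (n := n) π ϖ)
      (X : (Fin n ⊕ Fin n) ⊕ Fin n → ellipticProd n M N)
      (C : (Fin n ⊕ Fin n) ⊕ Fin n → (Fin n ⊕ Fin n → ℂ) → Fin n ⊕ Fin n → ℂ)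
      (u : Fin n ⊕ Fin n → elliptic n N),
      (∀ k, Related (Corr.incl π ϖ) (e k).1 (X k).1) ∧ (∀ k, ContDiff ℝ ∞ (C k)) ∧
      (∀ k, ∀ᶠ x in 𝓝 c.1, HasComps (prodChart φ ψ) (X k) (C k) x) ∧
      LinearIndependent ℝ (fun k => C k (prodChart φ ψ c.1)) ∧
      IsFrameAt (principal n N) u c.snd ∧ (∀ i, Related Corr.snd (e (.inl i)).1 (u i).1) ∧
      ∀ i, e (.inr i) = h.gen hM hN (.inl i) := by
  have hφ0 := hφ
  have hψ0 := hψ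
  obtain ⟨K, a, hφ⟩ := hφ
  obtain ⟨K', a', hψ⟩ := hψ
  obtain ⟨β, β', hβ1, hβ⟩ := exists_weights a
  obtain ⟨γ, γ', hγ1, hγ⟩ := exists_weights a'
  choose Y X Z C hYX hYZ hC hXC hCr hZ using fun j => h.exists_euler hM hN hφ0 hψ0 hc j
  let X' : Fin n ⊕ Fin n → ellipticProd n M N := fun i => (h.exists_gen hM hN i).choose_spec.choose
  have hX' : ∀ i, Related (Corr.incl π ϖ) (h.gen hM hN i).1 (X' i).1 := fun i =>
    (h.exists_gen hM hN i).choose_spec.choose_spec.1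
  have hXc : ∀ i, ∀ᶠ x in 𝓝 c.1, HasComps (prodChart φ ψ) (X' i)
      (fun _ j => Matrix.fromBlocks β 0 0 γ i j * Complex.I) x := fun i => by
    filter_upwards [(prodChart φ ψ).open_source.mem_nhds hc] with x hx
    exact (h.exists_gen hM hN i).choose_spec.choose_spec.2.2 _ ⟨φ, hφ0, ψ, hψ0, rfl⟩ _
      (prodChart_rotation hφ hψ hβ hγ i) x hx
  have hsum : ∀ (b : Fin n → ℝ) k, ∑ j, (b j : ℂ) * (Pi.single j 1 : Fin n → ℂ) k = b k :=
    fun b k => by simp [Pi.single_apply]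
  refine ⟨Sum.elim (Sum.elim (fun i => h.gen hM hN (.inr i)) Y) fun i => h.gen hM hN (.inl i),
    Sum.elim (Sum.elim (fun i => X' (.inr i)) X) fun i => X' (.inl i),
    Sum.elim (Sum.elim (fun i _ j => Matrix.fromBlocks β 0 0 γ (.inr i) j * Complex.I) C)
      fun i _ j => Matrix.fromBlocks β 0 0 γ (.inl i) j * Complex.I,
    Sum.elim (torusGen hN) Z, ?_, ?_, ?_, ?_, ?_, ?_, fun i => rfl⟩
  · rintro ((i | j) | i)
    exacts [hX' _, hYX j, hX' _]
  · rintro ((i | j) | i)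
    exacts [contDiff_const, hC j, contDiff_const]
  · rintro ((i | j) | i)
    exacts [hXc _, hXC j, hXc _]
  · rw [Fintype.linearIndependent_iff]
    intro r hr
    have h1 : (fun i => r (.inl (.inl i))) = 0 ∧ (fun i => r (.inl (.inr i))) = 0 := by
      refine weights_eq_zero hγ1 fun k => ?_
      have h2 := congrFun hr (.inr k)
      simp only [Fintype.sum_sum_type, Sum.elim_inl, Sum.elim_inr, Finset.sum_apply,
        Pi.smul_apply, Complex.real_smul, Matrix.fromBlocks_apply₁₂, Matrix.fromBlocks_apply₂₂,
        Matrix.zero_apply, Complex.ofReal_zero, zero_mul, mul_zero, Finset.sum_const_zero,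
        add_zero, Pi.zero_apply, hCr, hsum fun j => r (.inl (.inr j))] at h2
      exact h2
    have h3 : (fun i => r (.inr i)) = 0 := by
      refine (weights_eq_zero hβ1 (b := 0) fun k => ?_).1
      have h2 := congrFun hr (.inl k)
      have e1 : ∀ i, r (.inl (.inl i)) = 0 := congrFun h1.1
      have e2 : ∀ i, r (.inl (.inr i)) = 0 := congrFun h1.2
      simp only [Fintype.sum_sum_type, Sum.elim_inl, Sum.elim_inr, Finset.sum_apply,
        Pi.smul_apply, Complex.real_smul, Matrix.fromBlocks_apply₁₁, e1, e2, Complex.ofReal_zero,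
        zero_mul, Finset.sum_const_zero, zero_add, Pi.zero_apply] at h2
      rw [Pi.zero_apply, Complex.ofReal_zero, add_zero]
      exact h2
    rintro ((i | j) | i)
    exacts [congrFun h1.1 i, congrFun h1.2 j, congrFun h3 i]
  · let b : Fin n ⊕ Fin n → Fin n → ℂ :=
      Sum.elim (fun i j => γ i j * Complex.I) fun j => Pi.single j 1
    have hb : LinearIndependent ℝ b := by
      rw [Fintype.linearIndependent_iff]
      intro r hr
      have h1 := weights_eq_zero hγ1 (a := fun i => r (.inl i)) (b := fun j => r (.inr j))
        fun k => by
          have h2 := congrFun hr k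
          simp only [b, Fintype.sum_sum_type, Sum.elim_inl, Sum.elim_inr,
            Finset.sum_apply, Pi.smul_apply, Complex.real_smul, Pi.zero_apply,
            hsum fun j => r (.inr j)] at h2
          exact h2
      rintro (i | i)
      exacts [congrFun h1.1 i, congrFun h1.2 i]
    refine (logCharts hN).isFrameAt (basisOfLinearIndependentOfCardEqFinrank' b hb (by
      rw [Module.finrank_pi_fintype]
      simp
      ring)) hψ0 hc.2 fun k => ?_
    rw [coe_basisOfLinearIndependentOfCardEqFinrank']
    rcases k with i | j
    · filter_upwards [ψ.open_source.mem_nhds hc.2] with y hy using torusGen_comps hN hψ hγ i hy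
    · exact hZ j
  · rintro (i | j)
    exacts [h.related_snd_inr hM hN i, hYZ j]

theorem dense_preimage_snd (h : SameBase (n := n) π ϖ) (hM : IsStandard n M) (hN : IsStandard n N) :
    Dense (Corr.snd ⁻¹' principal n N : Set (Corr π ϖ)) :=
  (h.dense_principal hM hN).mono fun _ hc => hc.2

theorem SameBase.frameMap_snd (h : SameBase (n := n) π ϖ) (hM : IsStandard n M)
    (hN : IsStandard n N) : FrameMap (elliptic n N) (fun i => h.gen hM hN (.inl i))
      (Corr.principal n π ϖ) (principal n N) Corr.snd where
  cont := continuous_snd.comp Corr.continuous_incl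
  pull g := ⟨(g : N → ℝ) ∘ Prod.snd,
    (show ContMDiff _ _ _ _ from g.2).comp contMDiff_snd, rfl⟩
  dense := dense_preimage_snd h hM hN
  kernel := h.related_snd_inl hM hN
  frames c := by
    obtain ⟨φ, hφ, hc1⟩ := (smoothCharts hM).cover c.1.1
    obtain ⟨ψ, hψ, hc2⟩ := (smoothCharts hN).cover c.1.2
    obtain ⟨e, X, C, u, h1, h2, h3, h4, h5, h6, h7⟩ := h.exists_frame hM hN hφ hψ ⟨hc1, hc2⟩
    refine ⟨_, inferInstance, fun i => e (.inl i), u, ?_, h5, h6⟩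
    have e1 : (Sum.elim (fun i => e (.inl i)) fun i => h.gen hM hN (.inl i)) = e := by
      funext k
      rcases k with k | k
      exacts [rfl, (h7 k).symm]
    rw [e1]
    exact h.isFrameAt hM hN hφ hψ h1 ⟨hc1, hc2⟩ h2 h3 h4 (by simp; ring)

end Corr

/-! ## Maps of correspondence spaces -/

section EtaleFrames

variable {P P' : Type*} {S : Subalgebra ℝ (P → ℝ)} {S' : Subalgebra ℝ (P' → ℝ)}
  {A : Algebroid S} {A' : Algebroid S'} [TopologicalSpace P] [TopologicalSpace P']
  {ψ : P' → P} {W : Set P} {W' : Set P'}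

theorem EtaleMap.isFrameAt (hS' : LocalAlg S') (hS : LocalAlg S) (h : EtaleMap A' A W' ψ)
    (hW : ∀ p ∈ W', ψ p ∈ W) {ι : Type} [Fintype ι] {e' : ι → A'} {e : ι → A} {p : P'}
    (he : IsFrameAt W e (ψ p)) (hr : ∀ i, Related ψ (e' i).1 (e i).1) : IsFrameAt W' e' p := by
  refine ⟨fun X' => ?_, ?_⟩
  · obtain ⟨f, hf⟩ := h.gen_of_related hS' hr (fun X => by
      obtain ⟨f, hf⟩ := he.gen X
      exact ⟨f, hS.vanishesAt_eventually hf⟩) X'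
    exact ⟨f, hf.mono fun x hx => hx.zeroAt⟩
  · filter_upwards [h.cont.continuousAt.eventually he.indep] with x hx hxW a ha
    refine hx (hW x hxW) a fun g => ?_
    rw [← ha ⟨_, h.pull g⟩]
    exact Finset.sum_congr rfl fun i _ => by rw [(hr i).val_eq (f := g) rfl]

end EtaleFrames

section CorrMaps

variable {n : ℕ} {M N B M' N' B' : Type*}
  [TopologicalSpace M] [ChartedSpace (Model n) M] [MulAction (Torus n) M] [SmoothManifold n M]
  [TopologicalSpace N] [ChartedSpace (Model n) N] [MulAction (Torus n) N] [SmoothManifold n N]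
  [TopologicalSpace M'] [ChartedSpace (Model n) M'] [MulAction (Torus n) M'] [SmoothManifold n M']
  [TopologicalSpace N'] [ChartedSpace (Model n) N'] [MulAction (Torus n) N'] [SmoothManifold n N']
  [TopologicalSpace B] [TopologicalSpace B'] {π : M → B} {ϖ : N → B} {π' : M' → B'} {ϖ' : N' → B'}

/-- A logarithmic étale map of the ambient spaces under which the correspondence spaces correspond
induces an étale map of the correspondence spaces. -/
theorem SameBase.etaleMap (h : SameBase (n := n) π ϖ) (hM : IsStandard n M) (hN : IsStandard n N)
    (h' : SameBase (n := n) π' ϖ') (hM' : IsStandard n M') (hN' : IsStandard n N')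
    {Θ : M' × N' → M × N} (hΘ : LogEtale (SmoothProd n M' N') (SmoothProd n M N)
      (prodCharts n M' N') (prodCharts n M N) (principal n M' ×ˢ principal n N') Θ)
    (hW : ∀ p ∈ principal n M' ×ˢ principal n N', Θ p ∈ principal n M ×ˢ principal n N)
    {ΘC : Corr π' ϖ' → Corr π ϖ} (hC : ∀ c, (ΘC c).1 = Θ c.1)
    (hconv : ∀ c ∈ Corr.principal n π' ϖ', ∀ᶠ p in 𝓝 c.1,
      π (Θ p).1 = ϖ (Θ p).2 → π' p.1 = ϖ' p.2) :
    EtaleMap (ellipticCorr (n := n) π' ϖ') (ellipticCorr (n := n) π ϖ)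
      (Corr.principal n π' ϖ') ΘC := by
  have hP := logCharts_prod hM hN
  have hP' := logCharts_prod hM' hN'
  have hS := h.localAlg hM hN
  have hS' := h'.localAlg hM' hN'
  have hpull : ∀ F : SmoothProd n M N, (Corr.res π ϖ F : Corr π ϖ → ℝ) ∘ ΘC =
      (Corr.res π' ϖ' ⟨_, hΘ.pull F⟩ : Corr π' ϖ' → ℝ) := fun F => funext fun c =>
    congrArg (F : M × N → ℝ) (hC c)
  have hcont : Continuous ΘC := by
    have h1 : Continuous fun c => (ΘC c).1 := by
      simp only [hC]
      exact hΘ.cont.comp Corr.continuous_incl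
    exact continuous_induced_rng.2 h1
  have hamb : ∀ {Y : ellipticCorr (n := n) π ϖ} {X : ellipticProd n M N}
      {X' : ellipticProd n M' N'} {Y' : ellipticCorr (n := n) π' ϖ'},
      Related (Corr.incl π ϖ) Y.1 X.1 → Related Θ X'.1 X.1 →
      Related (Corr.incl π' ϖ') Y'.1 X'.1 → Related ΘC Y'.1 Y.1 := by
    intro Y X X' Y' hY hX hY' f' f e
    obtain ⟨F, rfl⟩ := Corr.exists_res f
    have e' : f' = Corr.res π' ϖ' ⟨_, hΘ.pull F⟩ := Subtype.ext (e.trans (hpull F))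
    funext c
    rw [e']
    change val Y' _ c = val Y _ (ΘC c)
    rw [Corr.related_res hY', Corr.related_res hY, hX.val_eq (f := F) rfl, hC]
  have hlift : ∀ (Y : ellipticCorr (n := n) π ϖ) (X : ellipticProd n M N),
      Related (Corr.incl π ϖ) Y.1 X.1 → ∃ (Y' : ellipticCorr (n := n) π' ϖ')
        (X' : ellipticProd n M' N'), Related ΘC Y'.1 Y.1 ∧ Related Θ X'.1 X.1 ∧
        Related (Corr.incl π' ϖ') Y'.1 X'.1 := by
    intro Y X hY
    obtain ⟨X', hX'⟩ := hΘ.lift hP' hP X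
    obtain ⟨Y', hY'⟩ := h'.exists_restrict hM' hN' (X := X') fun f hf c hc => by
      obtain ⟨g, hg⟩ := hΘ.etale c.1 hc f
      obtain ⟨φ', φ, L, L', Ψ, hL⟩ := hΘ.charts c.1
      have h1 : ∀ᶠ y in 𝓝 (Θ c.1), π y.1 = ϖ y.2 → (g : M × N → ℝ) y = 0 := by
        rw [← hL.map_nhds hP' hP hΘ.cont hc (hW _ hc), eventually_map]
        filter_upwards [hg, hconv c hc] with p h2 h3 h4
        rw [← hf ⟨p, h3 h4⟩]
        exact h2.symm
      rw [← hC c] at h1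
      have h2 : (Corr.res π ϖ g : Corr π ϖ → ℝ) =ᶠ[𝓝 (ΘC c)] ((0 : SmoothCorr (n := n) π ϖ) : _) :=
        Corr.eventually_nhds_iff.2 h1
      rw [val_congr_of_eventuallyEq hP'.localAlg X' (g := ⟨_, hΘ.pull g⟩) hg,
        hX'.val_eq (f := g) rfl, ← hC c, ← Corr.related_res hY,
        val_congr_of_eventuallyEq hS Y h2]
      exact congrFun (congrArg Subtype.val (map_zero Y.1)) _
    exact ⟨Y', X', hamb hY hX' hY', hX', hY'⟩
  have hpull' : ∀ g : SmoothCorr (n := n) π ϖ, (g : Corr π ϖ → ℝ) ∘ ΘC ∈ SmoothCorr (n := n) π' ϖ' := by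
    intro g
    obtain ⟨F, rfl⟩ := Corr.exists_res g
    rw [hpull]
    exact (Corr.res π' ϖ' _).2
  have hd' := h'.dense_principal hM' hN'
  have hfm : FrameMap (ellipticCorr (n := n) π ϖ)
      (Empty.elim : Empty → ellipticCorr (n := n) π' ϖ') (Corr.principal n π' ϖ')
      (Corr.principal n π ϖ) ΘC :=
    { cont := hcont
      pull := hpull'
      dense := hd'.mono fun c hc => by
        change (ΘC c).1 ∈ principal n M ×ˢ principal n N
        rw [hC]
        exact hW _ hc
      kernel := fun k => k.elim
      frames := fun c => by
        obtain ⟨Φ', Φ, L, L', Ψ, hL⟩ := hΘ.charts c.1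
        obtain ⟨φ', hφ', ψ', hψ', rfl⟩ := hL.mem'
        obtain ⟨φ, hφ, ψ, hψ, rfl⟩ := hL.mem
        have hs : (ΘC c).1 ∈ (prodChart φ ψ).source := by
          rw [hC]
          exact hL.source
        obtain ⟨e, X, C, u, h1, h2, h3, h4, -, -, -⟩ := h.exists_frame hM hN hφ hψ hs
        choose e' X' he' hX' heX' using fun k => hlift (e k) (X k) (h1 k)
        refine ⟨_, inferInstance, e', e,
          ?_, h.isFrameAt hM hN hφ hψ h1 hs h2 h3 h4 (by simp; ring), he'⟩
        let σ := Equiv.sumEmpty ((Fin n ⊕ Fin n) ⊕ Fin n) Empty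
        refine h'.isFrameAt hM' hN' hφ' hψ' (X := X' ∘ σ)
          (C := fun k z => realMul L' (C (σ k) (Ψ z))) ?_ hL.source' ?_ ?_ ?_ (by simp; ring)
        · rintro (k | k)
          exacts [heX' k, k.elim]
        · exact fun k => (realMul L').contDiff.comp ((h2 _).comp hL.contDiff)
        · intro k
          have h5 := h3 (σ k)
          rw [hC] at h5
          exact hΘ.hasComps hP' hP (hX' (σ k)) hL (h2 _) h5
        · have h6 : Ψ (prodChart φ' ψ' c.1) = prodChart φ ψ (ΘC c).1 := by
            rw [hC]
            exact hL.eq.self_of_nhds.symm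
          rw [h6]
          exact (h4.map' (realMul L').toLinearMap
            (LinearMap.ker_eq_bot.2 (realMul_injective hL.inv))).comp σ σ.injective }
  exact
  { toPullable := hfm.pullable hS' hS hd'
    dense := hd'
    etale := fun c hc f' => by
      obtain ⟨F', rfl⟩ := Corr.exists_res f'
      obtain ⟨F, hF⟩ := hΘ.etale c.1 hc F'
      refine ⟨Corr.res π ϖ F, ?_⟩
      rw [hpull]
      exact Corr.eventually_nhds hF
    lift := fun Y => by
      obtain ⟨X, hX⟩ := Corr.exists_ambient Y
      obtain ⟨Y', -, hY', -⟩ := hlift Y X hX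
      exact ⟨Y', hY'⟩ }

/-- Exchange of the factors. -/
def Corr.swap (c : Corr π ϖ) : Corr ϖ π := ⟨c.1.swap, c.2.symm⟩

theorem SameBase.etaleMap_swap (h : SameBase (n := n) π ϖ) (hM : IsStandard n M)
    (hN : IsStandard n N) : EtaleMap (ellipticCorr (n := n) π ϖ) (ellipticCorr (n := n) ϖ π)
      (Corr.principal n π ϖ) Corr.swap :=
  h.symm.etaleMap hN hM h hM hN (logEtale_swap hM hN) (fun _ hp => ⟨hp.2, hp.1⟩) (fun _ => rfl)
    fun _ _ => .of_forall fun _ => Eq.symm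

theorem SameBase.related_swap (h : SameBase (n := n) π ϖ) (hM : IsStandard n M)
    (hN : IsStandard n N) (i : Fin n) :
    Related Corr.swap (h.gen hM hN (.inr i)).1 (h.symm.gen hN hM (.inl i)).1 := fun f f' e =>
  funext fun c => by
    have h1 := h.gen_deriv hM hN (.inr i) f c
    rw [e] at h1
    exact h1.unique (h.symm.gen_deriv hN hM (.inl i) f' (Corr.swap c))

theorem SameBase.frameMap_fst (h : SameBase (n := n) π ϖ) (hM : IsStandard n M)
    (hN : IsStandard n N) : FrameMap (elliptic n M) (fun i => h.gen hM hN (.inr i))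
      (Corr.principal n π ϖ) (principal n M) Corr.fst where
  cont := continuous_fst.comp Corr.continuous_incl
  pull g := ⟨(g : M → ℝ) ∘ Prod.fst,
    (show ContMDiff _ _ _ _ from g.2).comp contMDiff_fst, rfl⟩
  dense := (h.dense_principal hM hN).mono fun _ hc => hc.1
  kernel := h.related_fst_inr hM hN
  frames c := by
    have hsw := h.etaleMap_swap hM hN
    obtain ⟨ι, _, e, u, h1, h2, h3⟩ := (h.symm.frameMap_snd hN hM).frames (Corr.swap c)
    choose e' he' using fun i => hsw.lift (e i)
    refine ⟨ι, inferInstance, e', u, ?_, h2, fun i f f' hf => ?_⟩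
    · refine hsw.isFrameAt (h.localAlg hM hN) (h.symm.localAlg hN hM) (fun c
        (hc : c ∈ Corr.principal n π ϖ) => (⟨hc.2, hc.1⟩ : Corr.swap c ∈ Corr.principal n ϖ π)) h1 ?_
      rintro (i | i)
      exacts [he' i, h.related_swap hM hN i]
    · funext c'
      have h4 : (f' : M → ℝ) ∘ Corr.snd ∈ SmoothCorr (n := n) ϖ π :=
        (h.symm.frameMap_snd hN hM).pull f'
      change val (e' i) f c' = val (u i) f' c'.fst
      rw [(he' i).val_eq (f := ⟨_, h4⟩) hf, (h3 i).val_eq (f := f') rfl]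
      rfl

theorem SameBase.etaleMap_act (h : SameBase (n := n) π ϖ) (hM : IsStandard n M)
    (hN : IsStandard n N) (t s : Torus n) : EtaleMap (ellipticCorr (n := n) π ϖ)
      (ellipticCorr (n := n) π ϖ) (Corr.principal n π ϖ) (h.act t s) := by
  have hp1 : ∀ m ∈ principal n M, t • m ∈ principal n M := fun m => (smul_mem_principal_iff t m).2
  have hp2 : ∀ m ∈ principal n N, s • m ∈ principal n N := fun m => (smul_mem_principal_iff s m).2
  refine h.etaleMap hM hN h hM hN (LogEtale.prodMap hM hN hM hN (logEtale_smul hM t)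
    (logEtale_smul hN s) hp1 hp2) (fun p hp => ⟨hp1 _ hp.1, hp2 _ hp.2⟩) (fun _ => rfl)
    fun _ _ => .of_forall fun p e => ?_
  exact ((h.eq_iff _ _).2 ⟨t, rfl⟩).trans (e.trans ((h.eq_iff' _ _).2 ⟨s, rfl⟩).symm)

theorem etaleMap_smul (hM : IsStandard n M) (t : Torus n) :
    EtaleMap (elliptic n M) (elliptic n M) (principal n M) (fun m : M => t • m) :=
  (logEtale_smul hM t).etaleMap (logCharts hM) (logCharts hM)
    ((logCharts hM).dense.mono fun m hm => (smul_mem_principal_iff t m).2 hm)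

/-- Local sections of the second projection of the correspondence space. -/
theorem SameBase.exists_local_section (h : SameBase (n := n) π ϖ) (hM : IsStandard n M)
    (hN : IsStandard n N) (y : N) : ∃ s : N → M,
      ContMDiffAt 𝓘(ℝ, Model n) 𝓘(ℝ, Model n) ∞ s y ∧ ∀ᶠ y' in 𝓝 y, π (s y') = ϖ y' := by
  obtain ⟨x, e⟩ := h.quot.surjective (ϖ y)
  obtain ⟨φ, K, a, hφ, hx⟩ := hM x
  obtain ⟨ψ, K', a', hψ, hy⟩ := hN y
  obtain ⟨σ, g, hg, -, hgp, eg⟩ := h.exists_match hM hN hφ hψ hx hy e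
  let Z : Model n → Model n := fun w i => (√(g i w) : ℂ) * w (σ i)
  have hZ : ContDiffAt ℝ ∞ Z (ψ y) := contDiffAt_pi.2 fun i =>
    (Complex.ofRealCLM.contDiff.contDiffAt.comp _ ((hg i).contDiffAt.sqrt (hgp i).ne')).mul
      (contDiff_apply ℝ ℂ (σ i)).contDiffAt
  have hn : ∀ w, (∀ i, 0 < g i w) → ∀ i, ‖Z w i‖ ^ 2 = ‖w (σ i)‖ ^ 2 * g i w := fun w hw i => by
    rw [norm_mul, Complex.norm_real, Real.norm_eq_abs, mul_pow, sq_abs, Real.sq_sqrt (hw i).le,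
      mul_comm]
  have h1 : ∀ᶠ y' in 𝓝 y, ∀ i, 0 < g i (ψ y') := eventually_all.2 fun i =>
    ((hg i).continuous.continuousAt.comp (ψ.continuousAt hy)).eventually (lt_mem_nhds (hgp i))
  have key : ∀ y' x', π x' = ϖ y' → x' ∈ φ.source → (∀ i, 0 < g i (ψ y')) →
      (∀ i, modBase π φ i (ϖ y') = ‖ψ y' (σ i)‖ ^ 2 * g i (ψ y')) →
      Z (ψ y') ∈ φ.target ∧ π (φ.symm (Z (ψ y'))) = ϖ y' := by
    intro y' x' e' hx' hp hm
    have h2 : ∀ i, ‖φ x' i‖ = ‖Z (ψ y') i‖ := fun i => by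
      rw [← sq_eq_sq₀ (norm_nonneg _) (norm_nonneg _), hn _ hp, ← hm, ← e', h.modBase_eq hφ hx']
    have h3 := hφ.mem_target_of_norm (φ.map_source hx') h2
    refine ⟨h3, e' ▸ (h.eq_iff _ _).2 (hφ.exists_smul_eq (φ.map_target h3) hx' fun i => ?_)⟩
    rw [φ.right_inv h3, h2]
  have h3 : ∀ᶠ y' in 𝓝 y, ∃ x', π x' = ϖ y' ∧ x' ∈ φ.source := by
    have h4 : φ.source ∈ 𝓝 x := φ.open_source.mem_nhds hx
    have h5 := image_mem_map (m := π) h4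
    rw [h.map_nhds hM, e] at h5
    filter_upwards [h.quot'.continuous.continuousAt h5] with y' ⟨x', h6, h7⟩ using ⟨x', h7, h6⟩
  refine ⟨fun y' => φ.symm (Z (ψ y')), ?_, ?_⟩
  · have ht := (key y x e hx hgp eg.self_of_nhds).1
    refine ContMDiffAt.comp y ((contMDiffOn_symm_of_mem_maximalAtlas hφ.mem_atlas).contMDiffAt
      (φ.open_target.mem_nhds ht)) (ContMDiffAt.comp y hZ.contMDiffAt ?_)
    exact (contMDiffOn_of_mem_maximalAtlas hψ.mem_atlas).contMDiffAt (ψ.open_source.mem_nhds hy)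
  · filter_upwards [h1, eg, h3] with y' h4 h5 ⟨x', h6, h7⟩ using (key y' x' h6 h7 h4 h5).2

/-- Functions on `N` are smooth if their pullbacks to the correspondence space are. -/
theorem SameBase.mem_smooth_of_comp_snd (h : SameBase (n := n) π ϖ) (hM : IsStandard n M)
    (hN : IsStandard n N) {f : N → ℝ} (hf : f ∘ Corr.snd ∈ SmoothCorr (n := n) π ϖ) :
    f ∈ Smooth n N := by
  obtain ⟨F, hF, e⟩ := hf
  intro y
  obtain ⟨s, hs, hs'⟩ := h.exists_local_section hM hN y
  have h1 : ContMDiffAt 𝓘(ℝ, Model n) 𝓘(ℝ, ℝ) ∞ (fun y' => F (s y', y')) y :=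
    (show ContMDiff _ _ _ _ from hF).contMDiffAt.comp y (hs.prodMk contMDiffAt_id)
  refine h1.congr_of_eventuallyEq ?_
  filter_upwards [hs'] with y' hy'
  exact (congrFun e ⟨(s y', y'), hy'⟩).symm

end CorrMaps

/-! ## Charts of blow-ups -/

section BlowUpCharts

variable {n : ℕ}

/-- The blow-down map in an affine chart. -/
def blowDown (i : Fin n) (w : Model n) : Model n := fun j => if j = i then w i else w i * w j

theorem contDiff_blowDown (i : Fin n) : ContDiff ℝ ∞ (blowDown i) := by
  refine contDiff_pi.2 fun j => ?_
  by_cases hj : j = i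
  · simp only [blowDown, if_pos hj]
    exact contDiff_apply ℝ ℂ i
  · simp only [blowDown, if_neg hj]
    exact (contDiff_apply ℝ ℂ i).mul (contDiff_apply ℝ ℂ j)

theorem fderiv_blowDown (i : Fin n) (w v : Model n) : fderiv ℝ (blowDown i) w v =
    fun j => if j = i then v i else w i * v j + w j * v i := by
  funext j
  have h1 : ∀ k : Fin n, HasFDerivAt (fun w : Model n => w k)
    (ContinuousLinearMap.proj (R := ℝ) (φ := fun _ : Fin n => ℂ) k) w := fun k => hasFDerivAt_apply k w
  have h2 := hasFDerivAt_pi'.1 ((contDiff_blowDown i).differentiable (by simp) w).hasFDerivAt j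
  by_cases hj : j = i
  · simp only [blowDown, if_pos hj] at h2 ⊢
    exact DFunLike.congr_fun (h2.unique (h1 i)) v
  · simp only [blowDown, if_neg hj] at h2 ⊢
    exact DFunLike.congr_fun (h2.unique ((h1 i).fun_mul (h1 j))) v

/-- The automorphism of the torus in an affine chart of the blow-up. -/
def blowUpAut (i : Fin n) : Torus n ≃ₜ* Torus n where
  toFun c j := if j = i then c i else c j / c i
  invFun c j := if j = i then c i else c j * c i
  left_inv c := funext fun j => by
    by_cases hj : j = i
    · subst hj
      simp
    · simp [hj]
  right_inv c := funext fun j => by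
    by_cases hj : j = i
    · subst hj
      simp
    · simp [hj]
  map_mul' c d := funext fun j => by
    by_cases hj : j = i
    · simp [hj]
    · simp [hj, mul_div_mul_comm]
  continuous_toFun := continuous_pi fun j => by
    by_cases hj : j = i
    · simp only [if_pos hj]
      exact continuous_apply i
    · simp only [if_neg hj]
      fun_prop
  continuous_invFun := continuous_pi fun j => by
    by_cases hj : j = i
    · simp only [if_pos hj]
      exact continuous_apply i
    · simp only [if_neg hj]
      fun_prop

theorem blowUpAut_apply (i : Fin n) (c : Torus n) (j : Fin n) :
    blowUpAut i c j = if j = i then c i else c j / c i := rfl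

theorem dense_apply_ne_zero (i : Fin n) : Dense {w : Model n | w i ≠ 0} :=
  dense_normProd_ne_zero.mono fun w (hw : normProd Finset.univ w ≠ 0) h0 =>
    hw (Finset.prod_eq_zero (Finset.mem_univ i) (by rw [h0, norm_zero, sq, zero_mul]))

variable {M M' : Type*}
  [TopologicalSpace M] [ChartedSpace (Model n) M] [MulAction (Torus n) M] [SmoothManifold n M]
  [TopologicalSpace M'] [ChartedSpace (Model n) M'] [MulAction (Torus n) M'] [SmoothManifold n M']
  {x : M} {q : M' → M} {φ : OpenPartialHomeomorph M (Model n)} {K : Finset (Fin n)}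
  {a : Torus n ≃ₜ* Torus n}

theorem IsStdChart.apply_eq_zero (hφ : IsStdChart φ K a) (hx : ∀ t : Torus n, t • x = x)
    (hxφ : x ∈ φ.source) (i : Fin n) : φ x i = 0 := by
  have h1 := hφ.map_smul (a.symm fun _ => Circle.exp Real.pi) x hxφ i
  rw [hx, ContinuousMulEquiv.apply_symm_apply, Circle.coe_exp, Complex.exp_pi_mul_I, neg_one_mul] at h1
  exact self_eq_neg.1 h1

/-- Away from a fixed point there are standard charts that do not contain it. -/
theorem IsStandard.exists_chart_notMem (hM : IsStandard n M) (hx : ∀ t : Torus n, t • x = x) {m : M}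
    (hm : m ≠ x) : ∃ φ ∈ stdCharts n M, m ∈ φ.source ∧ x ∉ φ.source := by
  obtain ⟨φ, K, a, hφ, hmφ⟩ := hM m
  by_cases hxφ : x ∈ φ.source
  swap
  · exact ⟨φ, ⟨K, a, hφ⟩, hmφ, hxφ⟩
  have h0 := hφ.apply_eq_zero hx hxφ
  obtain ⟨i, hi⟩ : ∃ i, φ m i ≠ 0 := by
    by_contra! h1
    exact hm (φ.injOn hmφ hxφ (funext fun i => (h1 i).trans (h0 i).symm))
  have hso : IsOpen (φ.source ∩ φ ⁻¹' {z | z i ≠ 0}) :=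
    φ.isOpen_inter_preimage (isOpen_ne_fun (continuous_apply i) continuous_const)
  have hsrc : (φ.restr (φ.source ∩ φ ⁻¹' {z | z i ≠ 0})).source = φ.source ∩ φ ⁻¹' {z | z i ≠ 0} := by
    rw [φ.restr_source' _ hso, ← inter_assoc, inter_self]
  refine ⟨φ.restr (φ.source ∩ φ ⁻¹' {z | z i ≠ 0}), ⟨K.erase i, a, ?_, ?_, ?_, ?_⟩, ?_, ?_⟩
  · exact restr_mem_maximalAtlas _ hφ.mem_atlas hso
  · ext z
    rw [φ.restr_target, hso.interior_eq, mem_inter_iff, hφ.target_eq]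
    constructor
    · rintro ⟨h1, h2, h3⟩ j hj h4
      by_cases hji : j = i
      · subst hji
        have h5 : φ (φ.symm z) j ≠ 0 := h3
        rw [φ.right_inv (by rw [hφ.target_eq]; exact h1)] at h5
        exact h5 h4
      · exact h1 j (fun hjK => hj (Finset.mem_erase.2 ⟨hji, hjK⟩)) h4
    · intro h1
      have h2 : z ∈ φ.target := by
        rw [hφ.target_eq]
        exact fun j hj => h1 j fun h => hj (Finset.mem_of_mem_erase h)
      refine ⟨fun j hj => h1 j fun h => hj (Finset.mem_of_mem_erase h), φ.map_target h2, ?_⟩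
      change φ (φ.symm z) i ≠ 0
      rw [φ.right_inv h2]
      exact h1 i (Finset.notMem_erase i K)
  · rw [hsrc]
    rintro t m' ⟨h1, h2⟩
    refine ⟨hφ.smul_mem t m' h1, ?_⟩
    change φ (t • m') i ≠ 0
    rw [hφ.map_smul t m' h1]
    exact mul_ne_zero (Circle.coe_ne_zero _) h2
  · rw [hsrc]
    exact fun t m' h1 i => hφ.map_smul t m' h1.1 i
  · rw [hsrc]
    exact ⟨hmφ, hi⟩
  · rw [hsrc]
    exact fun h => h.2 (h0 i)

/-- Affine charts on a blow-up at a fixed point. -/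
theorem IsBlowUp.exists_charts (hq : IsBlowUp (n := n) x q) :
    ∃ (φ : OpenPartialHomeomorph M (Model n)) (a : Torus n ≃ₜ* Torus n)
      (ψ : Fin n → OpenPartialHomeomorph M' (Model n)) (a' : Fin n → Torus n ≃ₜ* Torus n),
      IsStdChart φ Finset.univ a ∧ x ∈ φ.source ∧ φ x = 0 ∧ φ.target = univ ∧
      (∀ i, IsStdChart (ψ i) Finset.univ (a' i) ∧ (ψ i).target = univ ∧
        ∀ m ∈ (ψ i).source, q m ∈ φ.source ∧ φ (q m) = blowDown i (ψ i m)) ∧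
      ∀ m, q m ∈ φ.source → ∃ i, m ∈ (ψ i).source := by
  obtain ⟨φ, a, u, hφ, hx, hx0, hu, hψ⟩ := hq.local_model
  have htu : φ.target = univ := by
    rw [hφ.target_eq]
    exact eq_univ_of_forall fun z i hi => absurd (Finset.mem_univ i) hi
  choose ψ hψA hs ht hv using hψ
  simp only [htu, mem_univ, ofPred_true] at ht
  have hval : ∀ i, ∀ m ∈ (ψ i).source, q m ∈ φ.source ∧ φ (q m) = blowDown i (ψ i m) := by
    intro i m hm
    have hm' := hm
    rw [hs] at hm'
    obtain ⟨-, b, hb⟩ := hu m hm'.1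
    refine ⟨hm'.1, funext fun j => ?_⟩
    rw [hv i m hm, blowDown]
    by_cases hj : j = i
    · rw [if_pos hj, Function.update_self, hj]
    · rw [if_neg hj, Function.update_self, Function.update_of_ne hj, hb]
      simp only [Pi.smul_apply, smul_eq_mul]
      field_simp [hm'.2]
  have hsource : ∀ i m, q m ∈ φ.source → φ (q m) i ≠ 0 → m ∈ (ψ i).source := by
    intro i m h1 h2
    obtain ⟨-, b, hb⟩ := hu m h1
    rw [hs]
    refine ⟨h1, fun h3 => h2 ?_⟩
    rw [hb, Pi.smul_apply, h3, smul_zero]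
  have hequi : ∀ i (t : Torus n) (w : Model n), t • (ψ i).symm w =
      (ψ i).symm fun j => (a.trans (blowUpAut i) t j : ℂ) * w j := by
    intro i t w
    have hc : Continuous (ψ i).symm := by
      have := (ψ i).continuousOn_symm
      rwa [ht, continuousOn_univ] at this
    refine congrFun (Continuous.ext_on (dense_apply_ne_zero i) ((hq.continuous_smul t).comp hc)
      (hc.comp (continuous_pi fun j => continuous_const.mul (continuous_apply j))) ?_) w
    intro w hw
    have hw' : w ∈ (ψ i).target := by rw [ht]; exact mem_univ w
    obtain ⟨h1, h2⟩ := hval i _ ((ψ i).map_target hw')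
    rw [(ψ i).right_inv hw'] at h2
    have h3 : q (t • (ψ i).symm w) ∈ φ.source := by
      rw [hq.map_smul]
      exact hφ.smul_mem t _ h1
    have h4 : ∀ j, φ (q (t • (ψ i).symm w)) j = (a t j : ℂ) * blowDown i w j := fun j => by
      rw [hq.map_smul, hφ.map_smul t _ h1, h2]
    have hti : (a t i : ℂ) ≠ 0 := Circle.coe_ne_zero _
    have hwi : w i ≠ 0 := hw
    have h5 : blowDown i w i = w i := if_pos rfl
    have h6 : t • (ψ i).symm w ∈ (ψ i).source := hsource i _ h3 (by
      rw [h4, h5]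
      exact mul_ne_zero hti hwi)
    have h7 := (hval i _ h6).2
    refine (ψ i).injOn h6 ((ψ i).map_target (by rw [ht]; exact mem_univ _)) ?_
    change _ = ψ i ((ψ i).symm fun j => (a.trans (blowUpAut i) t j : ℂ) * w j)
    rw [(ψ i).right_inv (by rw [ht]; exact mem_univ _)]
    have h8 : ψ i (t • (ψ i).symm w) i = (a t i : ℂ) * w i := by
      rw [← h5, ← h4, h7]
      exact (if_pos rfl).symm
    funext j
    change _ = (blowUpAut i (a t) j : ℂ) * w j
    rw [blowUpAut_apply]
    by_cases hj : j = i
    · rw [if_pos hj, hj, h8]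
    · rw [if_neg hj, Circle.coe_div]
      have h9 := h4 j
      rw [h7, blowDown, blowDown, if_neg hj, if_neg hj, h8] at h9
      field_simp
      refine mul_left_cancel₀ hwi ?_
      linear_combination h9
  have hequi' : ∀ i (t : Torus n), ∀ m ∈ (ψ i).source, t • m = (ψ i).symm fun j =>
      (a.trans (blowUpAut i) t j : ℂ) * ψ i m j := fun i t m hm => by
    rw [← hequi, (ψ i).left_inv hm]
  refine ⟨φ, a, ψ, fun i => a.trans (blowUpAut i), hφ, hx, hx0, htu, fun i =>
    ⟨⟨hψA i, ?_, fun t m hm => ?_, fun t m hm j => ?_⟩, ht i, hval i⟩, fun m hm => ?_⟩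
  · rw [ht]
    exact (eq_univ_of_forall fun z i hi => absurd (Finset.mem_univ i) hi).symm
  · rw [hequi' i t m hm]
    exact (ψ i).map_target (by rw [ht]; exact mem_univ _)
  · rw [hequi' i t m hm, (ψ i).right_inv (by rw [ht]; exact mem_univ _)]
  · obtain ⟨h1, -⟩ := hu m hm
    obtain ⟨i, hi⟩ : ∃ i, u m i ≠ 0 := by
      by_contra! h2
      exact h1 (funext h2)
    exact ⟨i, by rw [hs]; exact ⟨hm, hi⟩⟩

theorem IsBlowUp.continuous (hq : IsBlowUp (n := n) x q) : Continuous q := by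
  refine continuous_iff_continuousAt.2 fun m => ?_
  by_cases hm : q m = x
  · obtain ⟨φ, a, ψ, a', hφ, hx, -, ht, hψ, hcov⟩ := hq.exists_charts
    obtain ⟨i, hi⟩ := hcov m (by rwa [hm])
    have h1 : ContinuousAt (fun m => φ.symm (blowDown i (ψ i m))) m := by
      refine ContinuousAt.comp (φ.continuousAt_symm (by rw [ht]; exact mem_univ _)) ?_
      exact (contDiff_blowDown i).continuous.continuousAt.comp ((ψ i).continuousAt hi)
    refine h1.congr ?_
    filter_upwards [(ψ i).open_source.mem_nhds hi] with m' hm'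
    obtain ⟨h2, h3⟩ := (hψ i).2.2 m' hm'
    rw [← h3, φ.left_inv h2]
  · exact (hq.localDiffeo ⟨m, hm⟩).contMDiffAt.continuousAt

/-- The blow-down map as a diffeomorphism away from the exceptional divisor. -/
theorem IsBlowUp.exists_diffeo (hq : IsBlowUp (n := n) x q) (m0 : M') :
    ∃ e : OpenPartialHomeomorph M' M, e.source = q ⁻¹' {x}ᶜ ∧ e.target = {x}ᶜ ∧ (∀ m, e m = q m) ∧
      ContMDiffOn 𝓘(ℝ, Model n) 𝓘(ℝ, Model n) ∞ e e.source ∧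
      ContMDiffOn 𝓘(ℝ, Model n) 𝓘(ℝ, Model n) ∞ e.symm e.target := by
  have : Nonempty M' := ⟨m0⟩
  let E := hq.bijOn.toPartialEquiv q _ _
  have h1 : ContMDiffOn 𝓘(ℝ, Model n) 𝓘(ℝ, Model n) ∞ q (q ⁻¹' {x}ᶜ) := hq.localDiffeo.contMDiffOn
  have h2 : ContMDiffOn 𝓘(ℝ, Model n) 𝓘(ℝ, Model n) ∞ E.symm {x}ᶜ := by
    intro y hy
    have hm : E.symm y ∈ q ⁻¹' {x}ᶜ := E.map_target hy
    have hqy : q (E.symm y) = y := E.right_inv hy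
    have hL := hq.localDiffeo ⟨_, hm⟩
    have h3 := hL.localInverse_contMDiffAt
    have h4 := hL.localInverse_eventuallyEq_right
    change ContMDiffAt _ _ _ _ (q (E.symm y)) at h3
    change _ =ᶠ[𝓝 (q (E.symm y))] _ at h4
    rw [hqy] at h3 h4
    refine (h3.congr_of_eventuallyEq ?_).contMDiffWithinAt
    filter_upwards [h4, isOpen_compl_singleton.mem_nhds hy] with y' h5 h6
    have h7 : q (hL.localInverse y') = y' := h5
    refine hq.bijOn.injOn (E.map_target h6) ?_ ((E.right_inv h6).trans h7.symm)
    change q _ ∈ ({x} : Set M)ᶜ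
    rwa [h7]
  exact ⟨⟨⟨E, h1.continuousOn, h2.continuousOn⟩, isOpen_compl_singleton.preimage hq.continuous,
    isOpen_compl_singleton⟩, rfl, rfl, fun _ => rfl, h1, h2⟩

theorem IsBlowUp.exists_chart_notMem (hq : IsBlowUp (n := n) x q) (hM : IsStandard n M)
    (hx : ∀ t : Torus n, t • x = x) {m : M'} (hm : q m ≠ x) :
    ∃ φ' ∈ stdCharts n M', ∃ φ ∈ stdCharts n M, m ∈ φ'.source ∧ q m ∈ φ.source ∧
      ∀ m' ∈ φ'.source, φ' m' = φ (q m') := by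
  obtain ⟨φ, ⟨K, a, hφ⟩, hmφ, hxφ⟩ := hM.exists_chart_notMem hx hm
  obtain ⟨e, he1, he2, he3, he4, he5⟩ := hq.exists_diffeo m
  have hs : ∀ m', m' ∈ (e.trans φ).source ↔ q m' ∈ φ.source := fun m' => by
    rw [e.trans_source, he1, mem_inter_iff, mem_preimage, mem_preimage, he3]
    exact ⟨And.right, fun h => ⟨fun h' => hxφ (h' ▸ h), h⟩⟩
  have ht : (e.trans φ).target = φ.target := by
    rw [e.trans_target, he2]
    exact inter_eq_left.2 fun z hz h' => hxφ (h' ▸ φ.map_target hz)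
  refine ⟨e.trans φ, ⟨K, a, ?_, ht.trans hφ.target_eq, fun t m' hm' => ?_, fun t m' hm' i => ?_⟩,
    φ, ⟨K, a, hφ⟩, (hs m).2 hmφ, hmφ, fun m' _ => congrArg φ (he3 m')⟩
  · refine OpenPartialHomeomorph.mem_maximalAtlas_of_contMDiffOn _ ?_ ?_
    · refine (contMDiffOn_of_mem_maximalAtlas hφ.mem_atlas).comp (he4.mono ?_) fun m' hm' => ?_
      · exact fun m' hm' => hm'.1
      · exact hm'.2
    · refine he5.comp ((contMDiffOn_symm_of_mem_maximalAtlas hφ.mem_atlas).mono ht.le) fun z hz => ?_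
      exact hz.2
  · rw [hs] at hm' ⊢
    rw [hq.map_smul]
    exact hφ.smul_mem t _ hm'
  · rw [hs] at hm'
    change φ (e (t • m')) i = a t i * φ (e m') i
    rw [he3, he3, hq.map_smul, hφ.map_smul t _ hm']

theorem IsBlowUp.isStandard (hq : IsBlowUp (n := n) x q) (hM : IsStandard n M)
    (hx : ∀ t : Torus n, t • x = x) : IsStandard n M' := by
  intro m
  by_cases hm : q m = x
  · obtain ⟨φ, a, ψ, a', hφ, hxφ, -, ht, hψ, hcov⟩ := hq.exists_charts
    obtain ⟨i, hi⟩ := hcov m (by rwa [hm])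
    exact ⟨ψ i, _, _, (hψ i).1, hi⟩
  · obtain ⟨φ', ⟨K, a, hφ'⟩, φ, -, h1, -, -⟩ := hq.exists_chart_notMem hM hx hm
    exact ⟨φ', K, a, hφ', h1⟩

theorem IsBlowUp.ne_of_mem_principal (hq : IsBlowUp (n := n) x q) {m : M'}
    (hm : m ∈ principal n M') : q m ≠ x := by
  intro h
  obtain ⟨φ, a, ψ, a', hφ, hxφ, hx0, ht, hψ, hcov⟩ := hq.exists_charts
  obtain ⟨i, hi⟩ := hcov m (by rwa [h])
  refine ((hψ i).1.mem_principal_iff hi).1 hm i ?_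
  have h1 := congrFun ((hψ i).2.2 m hi).2 i
  rw [h, hx0, blowDown, if_pos rfl] at h1
  exact h1.symm

theorem IsBlowUp.mem_principal (hq : IsBlowUp (n := n) x q) {m : M'} (hm : m ∈ principal n M') :
    q m ∈ principal n M := by
  intro t ht
  have h1 := hq.ne_of_mem_principal hm
  refine hm t (hq.bijOn.injOn ?_ h1 (by rw [hq.map_smul, ht]))
  change q (t • m) ≠ x
  rwa [hq.map_smul, ht]

theorem IsBlowUp.logEtale (hq : IsBlowUp (n := n) x q) (hM : IsStandard n M)
    (hx : ∀ t : Torus n, t • x = x) : LogEtale (Smooth n M') (Smooth n M) (stdCharts n M')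
      (stdCharts n M) (principal n M') q := by
  refine logEtale_of_charts (logCharts (hq.isStandard hM hx)) (logCharts hM) hq.continuous
    (fun m => hq.mem_principal) fun m => ?_
  by_cases hm : q m = x
  · obtain ⟨φ, a, ψ, a', hφ, hxφ, -, ht, hψ, hcov⟩ := hq.exists_charts
    obtain ⟨i, hi⟩ := hcov m (by rwa [hm])
    let J : Matrix (Fin n) (Fin n) ℝ := .of fun j k => if j ≠ i ∧ k = i then 1 else 0
    have hJ : J * J = 0 := by
      ext j k
      rw [Matrix.mul_apply]
      refine Finset.sum_eq_zero fun l _ => ?_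
      by_cases hl : l = i <;> simp [J, hl]
    have hJc : ∀ (c : Fin n → ℂ) j, realMul (1 + J) c j = c j + if j = i then 0 else c i := by
      intro c j
      simp only [realMul_apply, Matrix.add_apply, Complex.ofReal_add, add_mul,
        Finset.sum_add_distrib]
      congr 1
      · exact congrFun (realMul_one c) j
      · by_cases hj : j = i
        · simp [J, hj]
        · rw [if_neg hj, Finset.sum_eq_single i]
          · simp [J, hj]
          · intro k _ hk
            simp [J, hk]
          · simp
    refine ⟨ψ i, φ, 1 + J, 1 - J, blowDown i, ⟨_, _, (hψ i).1⟩, ⟨_, _, hφ⟩, hi,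
      ((hψ i).2.2 m hi).1, ?_, contDiff_blowDown i, ?_, .of_forall fun z c => ?_⟩
    · rw [add_mul, mul_sub, mul_sub, hJ]
      simp
    · filter_upwards [(ψ i).open_source.mem_nhds hi] with m' hm' using ((hψ i).2.2 m' hm').2
    · rw [fderiv_blowDown]
      funext j
      change _ = realMul (1 + J) c j * blowDown i z j
      rw [hJc]
      by_cases hj : j = i
      · simp [hj, blowDown]
      · simp only [hj, if_false, blowDown, Pi.mul_apply]
        ring
  · obtain ⟨φ', hφ', φ, hφ, h1, h2, h3⟩ := hq.exists_chart_notMem hM hx hm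
    refine ⟨φ', φ, 1, 1, id, hφ', hφ, h1, h2, one_mul 1, contDiff_id, ?_, .of_forall fun z c => ?_⟩
    · filter_upwards [φ'.open_source.mem_nhds h1] with m' hm' using (h3 m' hm').symm
    · rw [fderiv_id, realMul_one]
      rfl

end BlowUpCharts

/-! ## The base of the blow-ups -/

section BlowUpBase

variable {n : ℕ} {M N B M' N' : Type*}
  [TopologicalSpace M] [ChartedSpace (Model n) M] [MulAction (Torus n) M] [SmoothManifold n M]
  [TopologicalSpace N] [ChartedSpace (Model n) N] [MulAction (Torus n) N] [SmoothManifold n N]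
  [TopologicalSpace M'] [ChartedSpace (Model n) M'] [MulAction (Torus n) M'] [SmoothManifold n M']
  [TopologicalSpace N'] [ChartedSpace (Model n) N'] [MulAction (Torus n) N'] [SmoothManifold n N']
  [TopologicalSpace B] {π : M → B} {ϖ : N → B} {x : M} {y : N} {q : M' → M} {r : N' → N}

/-- Blow-ups of two standard torus actions over the same base, at fixed points over the same
point. -/
structure BlowUpPair (π : M → B) (ϖ : N → B) (x : M) (y : N) (q : M' → M) (r : N' → N) : Prop where
  base : SameBase (n := n) π ϖ
  std : IsStandard n M
  std' : IsStandard n N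
  fixed : ∀ t : Torus n, t • x = x
  fixed' : ∀ t : Torus n, t • y = y
  eq : π x = ϖ y
  blowUp : IsBlowUp (n := n) x q
  blowUp' : IsBlowUp (n := n) y r

theorem BlowUpPair.symm (b : BlowUpPair (n := n) π ϖ x y q r) :
    BlowUpPair (n := n) ϖ π y x r q :=
  ⟨b.base.symm, b.std', b.std, b.fixed', b.fixed, b.eq.symm, b.blowUp', b.blowUp⟩

theorem BlowUpPair.diag (b : BlowUpPair (n := n) π ϖ x y q r) :
    BlowUpPair (n := n) π π x x q q :=
  ⟨⟨b.base.quot, b.base.quot, b.base.eq_iff, b.base.eq_iff, fun _ _ _ => Iff.rfl⟩, b.std, b.std,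
    b.fixed, b.fixed, rfl, b.blowUp, b.blowUp⟩

theorem BlowUpPair.isStandard (b : BlowUpPair (n := n) π ϖ x y q r) : IsStandard n M' :=
  b.blowUp.isStandard b.std b.fixed

theorem BlowUpPair.dense (b : BlowUpPair (n := n) π ϖ x y q r) : Dense {m : M' | q m ≠ x} :=
  (logCharts b.isStandard).dense.mono fun _ => b.blowUp.ne_of_mem_principal

theorem BlowUpPair.ne (b : BlowUpPair (n := n) π ϖ x y q r) {m : M'} {m' : N'}
    (e : π (q m) = ϖ (r m')) (h : r m' ≠ y) : q m ≠ x := fun h' => by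
  rw [h', b.eq] at e
  obtain ⟨t, ht⟩ := (b.base.eq_iff' _ _).1 e
  exact h (ht.symm.trans (b.fixed' t))

theorem BlowUpPair.orbitMap_eq (b : BlowUpPair (n := n) π ϖ x y q r) {m₁ m₂ : M'}
    (e : π (q m₁) = π (q m₂)) (h : q m₁ ≠ x) : orbitMap n M' m₁ = orbitMap n M' m₂ := by
  obtain ⟨t, ht⟩ := (b.base.eq_iff _ _).1 e
  have h1 : q (t • m₁) ≠ x := fun h1 => h <| by
    rw [b.blowUp.map_smul] at h1
    rw [← inv_smul_smul t (q m₁), h1, b.fixed]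
  refine (sameBase_orbitMap.eq_iff _ _).2 ⟨t, b.blowUp.bijOn.injOn h1 ?_ ?_⟩
  · change q m₂ ≠ x
    rwa [← ht, ← b.blowUp.map_smul]
  · rw [b.blowUp.map_smul, ht]

theorem SameBase.eq_of_modBase (h : SameBase (n := n) π ϖ) {φ : OpenPartialHomeomorph M (Model n)}
    {K : Finset (Fin n)} {a : Torus n ≃ₜ* Torus n} (hφ : IsStdChart φ K a) {m : M} {c : B}
    (hm : m ∈ φ.source) (hc : c ∈ π '' φ.source) (e : ∀ i, modBase π φ i c = ‖φ m i‖ ^ 2) :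
    π m = c := by
  obtain ⟨m', hm', rfl⟩ := hc
  refine (h.eq_iff _ _).2 (hφ.exists_smul_eq hm hm' fun i => ?_)
  rw [← sq_eq_sq₀ (norm_nonneg _) (norm_nonneg _), ← e, h.modBase_eq hφ hm']

/-- Local lifts of the identity of the base to the blow-ups. -/
theorem BlowUpPair.exists_local_lift (b : BlowUpPair (n := n) π ϖ x y q r) (y' : N') :
    ∃ s : N' → M', ContMDiffAt 𝓘(ℝ, Model n) 𝓘(ℝ, Model n) ∞ s y' ∧
      ∀ᶠ z in 𝓝 y', π (q (s z)) = ϖ (r z) := by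
  have h := b.base
  have hr := b.blowUp'.continuous
  by_cases hy' : r y' = y
  · obtain ⟨φ, a, ψ, a', hφ, hx, hx0, ht, hψ, -⟩ := b.blowUp.exists_charts
    obtain ⟨φ₂, a₂, ψ₂, a₂', hφ₂, hy, hy0, -, hψ₂, hcov⟩ := b.blowUp'.exists_charts
    obtain ⟨j, hj⟩ := hcov y' (by rwa [hy'])
    obtain ⟨σ, g, hg, -, hgp, eg⟩ := h.exists_match b.std b.std' hφ hφ₂ hx hy b.eq
    let i := σ.symm j
    let Z : Model n → Model n := fun v l => if l = i then (√(g i (blowDown j v)) : ℂ) * v j else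
      (√(g l (blowDown j v)) : ℂ) * (√(g i (blowDown j v)) : ℂ)⁻¹ * v (σ l)
    have hw : ∀ᶠ z in 𝓝 y', blowDown j (ψ₂ j z) = φ₂ (r z) := by
      filter_upwards [(ψ₂ j).open_source.mem_nhds hj] with z hz using ((hψ₂ j).2.2 z hz).2.symm
    have hry : Tendsto r (𝓝 y') (𝓝 y) := by
      rw [← hy']
      exact hr.continuousAt
    have hpos : ∀ᶠ z in 𝓝 y', ∀ l, 0 < g l (φ₂ (r z)) := eventually_all.2 fun l =>
      (((hg l).continuous.continuousAt.comp (φ₂.continuousAt hy)).tendsto.comp hry).eventually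
        (lt_mem_nhds (hgp l))
    have hs : ∀ l, ContDiffAt ℝ ∞ (fun v => (√(g l (blowDown j v)) : ℂ)) (ψ₂ j y') := fun l => by
      refine Complex.ofRealCLM.contDiff.contDiffAt.comp _
        (((hg l).comp (contDiff_blowDown j)).contDiffAt.sqrt ?_)
      rw [Function.comp_apply, hw.self_of_nhds]
      exact (hpos.self_of_nhds l).ne'
    have hZ : ContDiffAt ℝ ∞ Z (ψ₂ j y') := contDiffAt_pi.2 fun l => by
      by_cases hl : l = i
      · simp only [Z, if_pos hl]
        exact (hs i).mul (contDiff_apply ℝ ℂ j).contDiffAt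
      · simp only [Z, if_neg hl]
        refine ((hs l).mul ((hs i).inv ?_)).mul (contDiff_apply ℝ ℂ (σ l)).contDiffAt
        rw [hw.self_of_nhds]
        exact Complex.ofReal_ne_zero.2 (Real.sqrt_ne_zero'.2 (hpos.self_of_nhds i))
    have htu : ∀ v, v ∈ (ψ i).target := fun v => by
      rw [(hψ i).2.1]
      exact mem_univ v
    refine ⟨fun z => (ψ i).symm (Z (ψ₂ j z)), ?_, ?_⟩
    · refine ContMDiffAt.comp y' ((contMDiffOn_symm_of_mem_maximalAtlas
        (hψ i).1.mem_atlas).contMDiffAt ((ψ i).open_target.mem_nhds (htu _)))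
        (ContMDiffAt.comp y' hZ.contMDiffAt ?_)
      exact (contMDiffOn_of_mem_maximalAtlas (hψ₂ j).1.mem_atlas).contMDiffAt
        ((ψ₂ j).open_source.mem_nhds hj)
    · have hB : ∀ᶠ z in 𝓝 y', ϖ (r z) ∈ π '' φ.source :=
        (h.quot'.continuous.continuousAt.tendsto.comp hry).eventually
          ((h.isOpen_image b.std).mem_nhds ⟨x, hx, b.eq⟩)
      filter_upwards [hw, hpos, hB, hry.eventually eg] with z h1 h2 h3 h4
      obtain ⟨h5, h6⟩ := (hψ i).2.2 _ ((ψ i).map_target (htu (Z (ψ₂ j z))))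
      rw [(ψ i).right_inv (htu _)] at h6
      refine h.eq_of_modBase hφ h5 h3 fun l => ?_
      have h7 : blowDown i (Z (ψ₂ j z)) l = (√(g l (φ₂ (r z))) : ℂ) * φ₂ (r z) (σ l) := by
        have h8 : (√(g i (φ₂ (r z))) : ℂ) ≠ 0 :=
          Complex.ofReal_ne_zero.2 (Real.sqrt_ne_zero'.2 (h2 i))
        by_cases hl : l = i
        · rw [hl, blowDown, if_pos rfl, ← h1]
          simp [Z, blowDown, i]
        · have hl' : σ l ≠ j := fun e => hl ((Equiv.eq_symm_apply σ).2 e)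
          rw [← h1] at h8 ⊢
          rw [blowDown, if_neg hl]
          simp only [Z, if_pos, if_neg hl]
          rw [show blowDown j (ψ₂ j z) (σ l) = ψ₂ j z j * ψ₂ j z (σ l) from if_neg hl']
          field_simp
      rw [h6, h7, h4, norm_mul, Complex.norm_real, Real.norm_eq_abs, mul_pow, sq_abs,
        Real.sq_sqrt (h2 l).le, mul_comm]
  · obtain ⟨s, hs, hs'⟩ := h.exists_local_section b.std b.std' (r y')
    have hne : s (r y') ≠ x := fun h1 => hy' <| by
      have h2 := hs'.self_of_nhds
      rw [h1, b.eq] at h2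
      obtain ⟨t, ht⟩ := (h.eq_iff' _ _).1 h2
      rw [← ht, b.fixed']
    obtain ⟨m0, -, -⟩ := b.blowUp.bijOn.surjOn hne
    obtain ⟨e, he1, he2, he3, -, he5⟩ := b.blowUp.exists_diffeo m0
    have hsr : ContMDiffAt 𝓘(ℝ, Model n) 𝓘(ℝ, Model n) ∞ (fun z => s (r z)) y' :=
      hs.comp y' (b.blowUp'.localDiffeo ⟨y', hy'⟩).contMDiffAt
    refine ⟨fun z => e.symm (s (r z)), ?_, ?_⟩
    · refine ContMDiffAt.comp y' (he5.contMDiffAt (e.open_target.mem_nhds ?_)) hsr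
      rw [he2]
      exact hne
    · filter_upwards [hr.continuousAt.eventually hs', hsr.continuousAt.eventually_ne hne] with z h1 h2
      rw [← he3, e.right_inv (by rw [he2]; exact h2), h1]

/-- A map to the orbit space of the blow-up covers the identity of the base. -/
def Covers (π : M → B) (ϖ : N → B) (q : M' → M) (r : N' → N)
    (F : N' → MulAction.orbitRel.Quotient (Torus n) M') : Prop :=
  ∀ m m', orbitMap n M' m = F m' → π (q m) = ϖ (r m')

theorem BlowUpPair.covers_unique (b : BlowUpPair (n := n) π ϖ x y q r)
    {F F' : N' → MulAction.orbitRel.Quotient (Torus n) M'} (hF : Continuous F)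
    (hF' : Continuous F') (h : Covers π ϖ q r F) (h' : Covers π ϖ q r F') : F = F' := by
  have := (sameBase_orbitMap (n := n) (M := M')).t2Space b.isStandard
  refine Continuous.ext_on b.symm.dense hF hF' fun z hz => ?_
  obtain ⟨m, hm⟩ := Quotient.exists_rep (F z)
  obtain ⟨m', hm'⟩ := Quotient.exists_rep (F' z)
  rw [← hm, ← hm']
  exact b.orbitMap_eq ((h m z hm).trans (h' m' z hm').symm) (b.ne (h m z hm) hz)

theorem BlowUpPair.exists_lift (b : BlowUpPair (n := n) π ϖ x y q r) :
    ∃ F : N' → MulAction.orbitRel.Quotient (Torus n) M', Continuous F ∧ Covers π ϖ q r F ∧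
      (∀ (t : Torus n) z, F (t • z) = F z) ∧
      ∀ z, ∃ s : N' → M', ContMDiffAt 𝓘(ℝ, Model n) 𝓘(ℝ, Model n) ∞ s z ∧
        F =ᶠ[𝓝 z] fun z' => orbitMap n M' (s z') := by
  have := (sameBase_orbitMap (n := n) (M := M')).t2Space b.isStandard
  have hO : Continuous (orbitMap n M') := continuous_quot_mk
  choose s hs hs' using b.exists_local_lift
  have hF : ∀ z, (fun z' => orbitMap n M' (s z' z')) =ᶠ[𝓝 z] fun z' => orbitMap n M' (s z z') := by
    intro z
    have h1 : ∀ᶠ z' in 𝓝 z, ContinuousAt (s z) z' :=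
      ((contMDiffAt_iff_contMDiffAt_nhds (by simp)).1
        ((hs z).of_le (m := 1) (by simp))).mono fun _ h => h.continuousAt
    filter_upwards [h1, (hs' z).eventually_nhds] with z' h2 h3
    have hne : (𝓝[{w | r w ≠ y}] z').NeBot :=
      mem_closure_iff_nhdsWithin_neBot.1 (b.symm.dense z')
    refine tendsto_nhds_unique_of_eventuallyEq (l := 𝓝[{w | r w ≠ y}] z')
      ((hO.continuousAt.comp (hs z').continuousAt).tendsto.mono_left nhdsWithin_le_nhds)
      ((hO.continuousAt.comp h2).tendsto.mono_left nhdsWithin_le_nhds) ?_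
    filter_upwards [nhdsWithin_le_nhds h3, nhdsWithin_le_nhds (hs' z'), self_mem_nhdsWithin]
      with w h4 h5 h6
    exact b.orbitMap_eq (h5.trans h4.symm) (b.ne h5 h6)
  have hc : Continuous fun z' => orbitMap n M' (s z' z') := continuous_iff_continuousAt.2 fun z =>
    (hO.continuousAt.comp (hs z).continuousAt).congr (hF z).symm
  have hcov : Covers π ϖ q r fun z' => orbitMap n M' (s z' z') := fun m z e => by
    obtain ⟨t, ht⟩ := (sameBase_orbitMap.eq_iff _ _).1 e
    rw [← (hs' z).self_of_nhds, ← ht, b.blowUp.map_smul]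
    exact (b.base.eq_iff _ _).2 ⟨t, rfl⟩
  refine ⟨_, hc, hcov, fun t z => ?_, fun z => ⟨s z, hs z, hF z⟩⟩
  refine congrFun (b.covers_unique (hc.comp (b.blowUp'.continuous_smul t)) hc (fun m z e => ?_)
    hcov) z
  rw [hcov m (t • z) e, b.blowUp'.map_smul]
  exact ((b.base.eq_iff' _ _).2 ⟨t, rfl⟩).symm

theorem contMDiffOn_comp_lift {F : N' → MulAction.orbitRel.Quotient (Torus n) M'}
    (hF : ∀ z, ∃ s : N' → M', ContMDiffAt 𝓘(ℝ, Model n) 𝓘(ℝ, Model n) ∞ s z ∧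
        F =ᶠ[𝓝 z] fun z' => orbitMap n M' (s z'))
    {U : Set (MulAction.orbitRel.Quotient (Torus n) M')} (hU : IsOpen U)
    {f : MulAction.orbitRel.Quotient (Torus n) M' → ℝ}
    (hf : ContMDiffOn 𝓘(ℝ, Model n) 𝓘(ℝ, ℝ) ∞ (f ∘ orbitMap n M') (orbitMap n M' ⁻¹' U)) :
    ContMDiffOn 𝓘(ℝ, Model n) 𝓘(ℝ, ℝ) ∞ (f ∘ F) (F ⁻¹' U) := fun z hz => by
  obtain ⟨s, hs, e⟩ := hF z
  have h1 : s z ∈ orbitMap n M' ⁻¹' U := by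
    change orbitMap n M' (s z) ∈ U
    rw [← e.eq_of_nhds]
    exact hz
  refine ContMDiffAt.contMDiffWithinAt (ContMDiffAt.congr_of_eventuallyEq
    ((hf.contMDiffAt ((hU.preimage continuous_quot_mk).mem_nhds h1)).comp z hs) ?_)
  exact e.mono fun z' h => congrArg f h

/-- The blow-ups have the same base, by a unique identification over the base. -/
theorem BlowUpPair.existsUnique_sameBase (b : BlowUpPair (n := n) π ϖ x y q r) :
    ∃! ϖ' : N' → MulAction.orbitRel.Quotient (Torus n) M',
      SameBase (n := n) (orbitMap n M') ϖ' ∧ Covers π ϖ q r ϖ' := by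
  obtain ⟨F, hF, hFc, hFi, hFs⟩ := b.exists_lift
  obtain ⟨G, hG, hGc, hGi, hGs⟩ := b.symm.exists_lift
  have hO : ∀ z₁ z₂ : N', orbitMap n N' z₁ = orbitMap n N' z₂ ↔ ∃ t : Torus n, t • z₁ = z₂ :=
    sameBase_orbitMap.eq_iff
  have hO' : ∀ z₁ z₂ : M', orbitMap n M' z₁ = orbitMap n M' z₂ ↔ ∃ t : Torus n, t • z₁ = z₂ :=
    sameBase_orbitMap.eq_iff
  let F' : MulAction.orbitRel.Quotient (Torus n) N' → MulAction.orbitRel.Quotient (Torus n) M' :=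
    Quotient.lift F fun z₁ z₂ e => by
      obtain ⟨t, rfl⟩ := (hO z₁ z₂).1 (Quotient.sound e)
      exact (hFi t z₁).symm
  let G' : MulAction.orbitRel.Quotient (Torus n) M' → MulAction.orbitRel.Quotient (Torus n) N' :=
    Quotient.lift G fun z₁ z₂ e => by
      obtain ⟨t, rfl⟩ := (hO' z₁ z₂).1 (Quotient.sound e)
      exact (hGi t z₁).symm
  have hF' : Continuous F' := continuous_quot_lift _ hF
  have hG' : Continuous G' := continuous_quot_lift _ hG
  have hcov : ∀ z₁ z₂ : N', orbitMap n N' z₁ = orbitMap n N' z₂ → ϖ (r z₁) = ϖ (r z₂) :=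
    fun z₁ z₂ e => by
      obtain ⟨t, rfl⟩ := (hO z₁ z₂).1 e
      rw [b.blowUp'.map_smul]
      exact (b.base.eq_iff' _ _).2 ⟨t, rfl⟩
  have hcov' : ∀ z₁ z₂ : M', orbitMap n M' z₁ = orbitMap n M' z₂ → π (q z₁) = π (q z₂) :=
    fun z₁ z₂ e => by
      obtain ⟨t, rfl⟩ := (hO' z₁ z₂).1 e
      rw [b.blowUp.map_smul]
      exact (b.base.eq_iff _ _).2 ⟨t, rfl⟩
  have hGF : (fun z => G' (F z)) = orbitMap n N' :=
    b.symm.diag.covers_unique (hG'.comp hF) continuous_quot_mk (fun z₁ z₂ e => by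
      obtain ⟨m, hm⟩ := Quotient.exists_rep (F z₂)
      rw [← hm] at e
      exact (hGc z₁ m e).trans (hFc m z₂ hm)) hcov
  have hFG : (fun m => F' (G m)) = orbitMap n M' :=
    b.diag.covers_unique (hF'.comp hG) continuous_quot_mk (fun z₁ z₂ e => by
      obtain ⟨m, hm⟩ := Quotient.exists_rep (G z₂)
      rw [← hm] at e
      exact (hFc z₁ m e).trans (hGc m z₂ hm)) hcov'
  refine ⟨F, ⟨⟨isQuotientMap_quot_mk, isQuotientMap_iff_isClosed.2 ⟨fun c => ?_, fun U =>
    ⟨fun hU => hU.preimage hF, fun hU => ?_⟩⟩, hO', fun z₁ z₂ => ⟨fun e => ?_, ?_⟩, fun U f hU =>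
    ⟨contMDiffOn_comp_lift hFs hU, fun hf => ?_⟩⟩, hFc⟩, fun F₂ ⟨h1, h2⟩ =>
    b.covers_unique h1.quot'.continuous hF h2 hFc⟩
  · obtain ⟨m, rfl⟩ := Quotient.exists_rep c
    obtain ⟨z, hz⟩ := Quotient.exists_rep (G m)
    exact ⟨z, (congrArg F' hz).trans (congrFun hFG m)⟩
  · have h1 : IsClosed (F' ⁻¹' U) := isQuotientMap_quot_mk.isClosed_preimage.1 hU
    have h2 : IsClosed (orbitMap n M' ⁻¹' U) := by
      rw [← hFG]
      exact h1.preimage hG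
    exact isQuotientMap_quot_mk.isClosed_preimage.1 h2
  · rw [← hO, ← hGF]
    exact congrArg G' e
  · rintro ⟨t, rfl⟩
    exact (hFi t z₁).symm
  · have h1 := contMDiffOn_comp_lift hGs (hU.preimage hF') (f := f ∘ F') hf
    have h2 : (f ∘ F') ∘ G = f ∘ orbitMap n M' := by
      rw [← hFG]
      rfl
    have h3 : G ⁻¹' (F' ⁻¹' U) = orbitMap n M' ⁻¹' U := by
      rw [← hFG]
      rfl
    rwa [h2, h3] at h1

end BlowUpBase

/-! ## Pullbacks of T-dualities -/

section EtalePullback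

variable {P P' R R' : Type*} {S : Subalgebra ℝ (P → ℝ)} {S' : Subalgebra ℝ (P' → ℝ)}
  {SR : Subalgebra ℝ (R → ℝ)} {SR' : Subalgebra ℝ (R' → ℝ)}
  {A : Algebroid S} {A' : Algebroid S'} {AR : Algebroid SR} {AR' : Algebroid SR'}
  [TopologicalSpace P] [TopologicalSpace P'] [TopologicalSpace R] [TopologicalSpace R']
  {W' : Set P'} {WR' : Set R'}

theorem EtaleMap.isPullbackForm_of_equivariant {g : P' → P} {θ : P → P} {θ' : P' → P'} {W : Set P}
    (hS' : LocalAlg S') (hS : LocalAlg S) (hg : EtaleMap A' A W' g) (hθ : EtaleMap A A W θ)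
    (hθ' : EtaleMap A' A' W' θ') (hd : Dense (θ' ⁻¹' W')) (comm : ∀ x, θ (g x) = g (θ' x)) {k : ℕ}
    {α : Form A k} {α' : Form A' k} (h : IsPullbackForm g α α') (hα : IsPullbackForm θ α α) :
    IsPullbackForm θ' α' α' :=
  EtaleSquare.top_of_right (WR' := W') (ψ := θ) (ψ' := θ') (g := g) (G := g)
    ⟨hS', hS', hS, hg, hg, hθ.toPullable, hθ'.toPullable, hd, comm⟩ h hα h

theorem EtaleMap.extD_eq {g : P' → P} (hS' : LocalAlg S') (hg : EtaleMap A' A W' g) {k : ℕ}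
    {α : Form A (k + 1)} {β : Form A (k + 2)} {α' : Form A' (k + 1)} {β' : Form A' (k + 2)}
    (hα : IsPullbackForm g α α') (hβ : IsPullbackForm g β β') (h : ∀ X, extD α X = β X)
    (X' : Fin (k + 2) → A') : extD α' X' = β' X' := by
  refine hS'.ext hg.dense fun p hp => ?_
  choose Y' Y hY hX using fun i => hg.exists_related_near hp (X' i)
  rw [extD_congr hS' α' hX, form_congr β' fun i => hS'.vanishesAt (hX i), hα.extD hY, h,
    hβ _ _ hY, Function.comp_apply]

/-- Nondegeneracy of a pairing with the kernel of a projection is preserved by pullbacks. -/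
theorem FrameMap.nondegenerate_of_related {κ : Type} [Fintype κ] {P₂ P₂' : Type*}
    {S₂ : Subalgebra ℝ (P₂ → ℝ)} {S₂' : Subalgebra ℝ (P₂' → ℝ)} {A₂ : Algebroid S₂}
    {A₂' : Algebroid S₂'} [TopologicalSpace P₂] [TopologicalSpace P₂'] {x : κ → AR} {x' : κ → AR'}
    {W : Set P} {WR : Set R} {W₂' : Set P₂'} {ψ : R → P} {ψ' : R' → P'} {ω₁ : R → P₂}
    {ω₁' : R' → P₂'} {Q : R' → R} {g : P₂' → P₂} (hψ : FrameMap A x WR W ψ)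
    (hψ' : FrameMap A' x' WR' W' ψ') (hWR : Dense WR) (hW' : Dense W') (hS' : LocalAlg S')
    (hs : EtaleSquare AR' AR A₂' A₂ WR' W₂' ω₁ ω₁' g Q)
    (hx : ∀ k, Related Q (x' k).1 (x k).1) {F : Form AR 2} {F' : Form AR' 2}
    (hF : IsPullbackForm Q F F') {c : R'} {Y' : AR'} (hY : Related ψ' Y'.1 (0 : A').1)
    (hz : ∀ Z' : AR', Related ω₁' Z'.1 (0 : A₂').1 → (F' ![Y', Z'] : R' → ℝ) c = 0)
    (nd : ∀ Y : AR, Related ψ Y.1 (0 : A).1 →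
      (∀ Z : AR, Related ω₁ Z.1 (0 : A₂).1 → (F ![Y, Z] : R → ℝ) (Q c) = 0) →
        VanishesAt Y (Q c)) : VanishesAt Y' c := by
  obtain ⟨b, hb⟩ := hψ'.exists_vanishesAt hs.localAlg' hS' hW' hY c (vanishesAt_zero _)
  have hb' := eventually_vanishesAt_sub_cst hb
  let Y : AR := ∑ k, cst SR ((b k : R' → ℝ) c) • x k
  have hrel : Related Q (∑ k, cst SR' ((b k : R' → ℝ) c) • x' k).1 Y.1 :=
    Related.sum fun k => (hx k).smul_cst _
  have hY0 : Related ψ Y.1 (0 : A).1 := by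
    have h1 := Related.sum (s := Finset.univ)
      fun k => (hψ.kernel k).smul_cst ((b k : R' → ℝ) c)
    simpa only [smul_zero, Finset.sum_const_zero] using h1
  have hv : VanishesAt Y (Q c) := nd Y hY0 fun Z hZ => by
    obtain ⟨Z', hZ'⟩ := hs.right.lift Z
    have h1 : Related ω₁' Z'.1 (0 : A₂').1 := related_of_square hs.localAlg hs.localAlg' hs.left
      hs.right.pull hs.bot.pull hs.top.pull hs.top.cont hs.dense hs.comm hZ' hZ Related.zero
    have h2 := congrFun (hF ![_, Z'] ![Y, Z] fun i => by
      refine Fin.cases hrel (fun i => ?_) i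
      rw [Subsingleton.elim i 0]
      exact hZ') c
    rw [Function.comp_apply] at h2
    rw [← h2, ← hz Z' h1]
    refine (form_congr F' fun i => ?_).symm
    refine Fin.cases hb' (fun i => ?_) i
    rw [Subsingleton.elim i 0]
    change VanishesAt (Z' - Z') c
    rw [sub_self]
    exact vanishesAt_zero c
  obtain ⟨ι, _, e', -, he, -, -⟩ := hψ.frames (Q c)
  have h3 := he.coeff_eq_zero hs.localAlg'' hWR
    (f := Sum.elim (fun _ => 0) fun k => cst SR ((b k : R' → ℝ) c)) (by
      rw [Fintype.sum_sum_type]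
      simpa only [Sum.elim_inl, Sum.elim_inr, zero_smul, Finset.sum_const_zero, zero_add] using hv)
  refine hb'.congr_sub (VanishesAt.sum fun k _ => vanishesAt_smul ?_ _)
  exact h3 (.inr k)

end EtalePullback

section TDualPullback

variable {n : ℕ} {M N B M' N' B' : Type*}
  [TopologicalSpace M] [ChartedSpace (Model n) M] [MulAction (Torus n) M] [SmoothManifold n M]
  [TopologicalSpace N] [ChartedSpace (Model n) N] [MulAction (Torus n) N] [SmoothManifold n N]
  [TopologicalSpace M'] [ChartedSpace (Model n) M'] [MulAction (Torus n) M'] [SmoothManifold n M']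
  [TopologicalSpace N'] [ChartedSpace (Model n) N'] [MulAction (Torus n) N'] [SmoothManifold n N']
  [TopologicalSpace B] [TopologicalSpace B'] {π : M → B} {ϖ : N → B} {π' : M' → B'} {ϖ' : N' → B'}
  {q : M' → M} {r : N' → N} {Q : Corr π' ϖ' → Corr π ϖ}

theorem SameBase.pullable_fst (h : SameBase (n := n) π ϖ) (hM : IsStandard n M)
    (hN : IsStandard n N) :
    Pullable (ellipticCorr (n := n) π ϖ) (elliptic n M) (Corr.fst : Corr π ϖ → M) :=
  (h.frameMap_fst hM hN).pullable (h.localAlg hM hN) (logCharts hM).localAlg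
    (h.dense_principal hM hN)

theorem SameBase.pullable_snd (h : SameBase (n := n) π ϖ) (hM : IsStandard n M)
    (hN : IsStandard n N) :
    Pullable (ellipticCorr (n := n) π ϖ) (elliptic n N) (Corr.snd : Corr π ϖ → N) :=
  (h.frameMap_snd hM hN).pullable (h.localAlg hM hN) (logCharts hN).localAlg
    (h.dense_principal hM hN)

theorem SameBase.square_fst (h : SameBase (n := n) π ϖ) (hM : IsStandard n M) (hN : IsStandard n N)
    (h' : SameBase (n := n) π' ϖ') (hM' : IsStandard n M') (hN' : IsStandard n N')
    (hq : EtaleMap (elliptic n M') (elliptic n M) (principal n M') q)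
    (hQ : EtaleMap (ellipticCorr (n := n) π' ϖ') (ellipticCorr (n := n) π ϖ)
      (Corr.principal n π' ϖ') Q) (comm : ∀ c, (Q c).fst = q c.fst) :
    EtaleSquare (ellipticCorr (n := n) π' ϖ') (ellipticCorr (n := n) π ϖ) (elliptic n M')
      (elliptic n M) (Corr.principal n π' ϖ') (principal n M') Corr.fst Corr.fst q Q :=
  ⟨(logCharts hM').localAlg, h'.localAlg hM' hN', h.localAlg hM hN, hq, hQ, h.pullable_fst hM hN,
    h'.pullable_fst hM' hN', (h'.frameMap_fst hM' hN').dense, comm⟩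

theorem SameBase.square_snd (h : SameBase (n := n) π ϖ) (hM : IsStandard n M) (hN : IsStandard n N)
    (h' : SameBase (n := n) π' ϖ') (hM' : IsStandard n M') (hN' : IsStandard n N')
    (hr : EtaleMap (elliptic n N') (elliptic n N) (principal n N') r)
    (hQ : EtaleMap (ellipticCorr (n := n) π' ϖ') (ellipticCorr (n := n) π ϖ)
      (Corr.principal n π' ϖ') Q) (comm : ∀ c, (Q c).snd = r c.snd) :
    EtaleSquare (ellipticCorr (n := n) π' ϖ') (ellipticCorr (n := n) π ϖ) (elliptic n N')
      (elliptic n N) (Corr.principal n π' ϖ') (principal n N') Corr.snd Corr.snd r Q :=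
  ⟨(logCharts hN').localAlg, h'.localAlg hM' hN', h.localAlg hM hN, hr, hQ, h.pullable_snd hM hN,
    h'.pullable_snd hM' hN', (h'.frameMap_snd hM' hN').dense, comm⟩

theorem SameBase.related_gen (h : SameBase (n := n) π ϖ) (hM : IsStandard n M)
    (hN : IsStandard n N) (h' : SameBase (n := n) π' ϖ') (hM' : IsStandard n M')
    (hN' : IsStandard n N') (hQ : ∀ t s c, Q (h'.act t s c) = h.act t s (Q c))
    (i : Fin n ⊕ Fin n) : Related Q (h'.gen hM' hN' i).1 (h.gen hM hN i).1 := fun f f' e =>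
  funext fun c => by
    have h1 := h'.gen_deriv hM' hN' i f c
    simp only [e, Function.comp_apply, hQ] at h1
    exact h1.unique (h.gen_deriv hM hN i f' (Q c))

theorem SameBase.act_act (h : SameBase (n := n) π ϖ) (t s t' s' : Torus n) (c : Corr π ϖ) :
    h.act t s (h.act t' s' c) = h.act t' s' (h.act t s c) :=
  Subtype.ext (Prod.ext (smul_comm t t' c.1.1) (smul_comm s s' c.1.2))

theorem Invariant.pullback (hM : IsStandard n M) (hM' : IsStandard n M')
    (hq : EtaleMap (elliptic n M') (elliptic n M) (principal n M') q)
    (hqe : ∀ (t : Torus n) m, q (t • m) = t • q m) {k : ℕ} {α : Form (elliptic n M) k}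
    {α' : Form (elliptic n M') k} (hα : Invariant α) (h : IsPullbackForm q α α') : Invariant α' :=
  fun t => hq.isPullbackForm_of_equivariant (logCharts hM').localAlg (logCharts hM).localAlg
    (etaleMap_smul hM t) (etaleMap_smul hM' t)
    ((logCharts hM').dense.mono fun m hm => (smul_mem_principal_iff t m).2 hm)
    (fun m => (hqe t m).symm) h (hα t)

/-- T-dualities pull back. -/
theorem IsTDual.pullback {h : SameBase (n := n) π ϖ} {h' : SameBase (n := n) π' ϖ'}
    {H : Form (elliptic n M) 3} {K : Form (elliptic n N) 3} {F : Form (ellipticCorr (n := n) π ϖ) 2}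
    (hF : IsTDual h H K F) (hM : IsStandard n M) (hN : IsStandard n N) (hM' : IsStandard n M')
    (hN' : IsStandard n N') (hq : EtaleMap (elliptic n M') (elliptic n M) (principal n M') q)
    (hr : EtaleMap (elliptic n N') (elliptic n N) (principal n N') r)
    (hQ : EtaleMap (ellipticCorr (n := n) π' ϖ') (ellipticCorr (n := n) π ϖ)
      (Corr.principal n π' ϖ') Q) (hqe : ∀ (t : Torus n) m, q (t • m) = t • q m)
    (hre : ∀ (t : Torus n) m, r (t • m) = t • r m)
    (hQe : ∀ t s c, Q (h'.act t s c) = h.act t s (Q c))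
    (h1 : ∀ c, (Q c).fst = q c.fst) (h2 : ∀ c, (Q c).snd = r c.snd)
    {H' : Form (elliptic n M') 3} {K' : Form (elliptic n N') 3}
    {F' : Form (ellipticCorr (n := n) π' ϖ') 2} (pH : IsPullbackForm q H H')
    (pK : IsPullbackForm r K K') (pF : IsPullbackForm Q F F') : IsTDual h' H' K' F' := by
  have sq1 := h.square_fst hM hN h' hM' hN' hq hQ h1
  have sq2 := h.square_snd hM hN h' hM' hN' hr hQ h2
  have hC := h.localAlg hM hN
  have hC' := h'.localAlg hM' hN'
  have swap : ∀ Y Z, F ![Z, Y] = -F ![Y, Z] := fun Y Z => by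
    rw [← F.map_swap ![Y, Z] (show (0 : Fin 2) ≠ 1 by decide)]
    congr 1
    ext i
    fin_cases i <;> rfl
  have swap' : ∀ Y Z, F' ![Z, Y] = -F' ![Y, Z] := fun Y Z => by
    rw [← F'.map_swap ![Y, Z] (show (0 : Fin 2) ≠ 1 by decide)]
    congr 1
    ext i
    fin_cases i <;> rfl
  refine ⟨?_, ?_, hF.invariant.pullback hM hM' hq hqe pH, hF.invariant'.pullback hN hN' hr hre pK,
    fun t s => ?_, ?_, fun c Y hY hz => ?_, fun c Z hZ hz => ?_⟩
  · exact hq.extD_eq (logCharts hM').localAlg pH IsPullbackForm.zero hF.closed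
  · exact hr.extD_eq (logCharts hN').localAlg pK IsPullbackForm.zero hF.closed'
  · refine hQ.isPullbackForm_of_equivariant hC' hC (h.etaleMap_act hM hN t s)
      (h'.etaleMap_act hM' hN' t s) ((h'.dense_principal hM' hN').mono fun c hc => ?_)
      (fun c => (hQe t s c).symm) pF (hF.invariantF t s)
    exact ⟨(smul_mem_principal_iff t c.1.1).2 hc.1, (smul_mem_principal_iff s c.1.2).2 hc.2⟩
  · obtain ⟨G, G', hG, hG', e⟩ := hF.extD_eq
    obtain ⟨G₁, hG₁, -⟩ := hQ.existsUnique hC' G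
    obtain ⟨G₂, hG₂, -⟩ := hQ.existsUnique hC' G'
    refine ⟨G₁, G₂, sq1.top_of_right pH hG hG₁, sq2.top_of_right pK hG' hG₂, ?_⟩
    refine hQ.extD_eq (β := G - G') (β' := G₁ - G₂) hC' pF (fun X' X hX => ?_) e
    funext c
    exact congrArg₂ (· - ·) (congrFun (hG₁ X' X hX) c) (congrFun (hG₂ X' X hX) c)
  · exact (h.frameMap_fst hM hN).nondegenerate_of_related (h'.frameMap_fst hM' hN')
      (h.dense_principal hM hN) (logCharts hM').dense (logCharts hM').localAlg sq2
      (fun k => h.related_gen hM hN h' hM' hN' hQe (.inr k)) pF hY hz (hF.nondeg (Q c))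
  · refine (h.frameMap_snd hM hN).nondegenerate_of_related (h'.frameMap_snd hM' hN')
      (h.dense_principal hM hN) (logCharts hN').dense (logCharts hN').localAlg sq1
      (fun k => h.related_gen hM hN h' hM' hN' hQe (.inl k)) pF hZ (fun Y hY => ?_)
      fun Z hZ hz => hF.nondeg' (Q c) Z hZ fun Y hY => ?_
    · rw [swap']
      exact neg_eq_zero.2 (hz Y hY)
    · rw [swap]
      exact neg_eq_zero.2 (hz Y hY)

/-- The form whose descent to `N` is `τ(ρ)`. -/
def SameBase.tauForm (h : SameBase (n := n) π ϖ) (hM : IsStandard n M) (hN : IsStandard n N)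
    (F : Form (ellipticCorr (n := n) π ϖ) 2) (R : ∀ k, Form (ellipticCorr (n := n) π ϖ) k) (k : ℕ) :
    Form (ellipticCorr (n := n) π ϖ) k :=
  contract (expWedge F R (n + k)) fun i => h.gen hM hN (.inl i)

theorem SameBase.isTau_iff (h : SameBase (n := n) π ϖ) (hM : IsStandard n M) (hN : IsStandard n N)
    {F : Form (ellipticCorr (n := n) π ϖ) 2} {ρ : ∀ k, Form (elliptic n M) k}
    {R : ∀ k, Form (ellipticCorr (n := n) π ϖ) k} (hR : ∀ k, IsPullbackForm Corr.fst (ρ k) (R k))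
    (σ : ∀ k, Form (elliptic n N) k) :
    IsTau h F ρ σ ↔ ∀ k, IsPullbackForm Corr.snd (σ k) (h.tauForm hM hN F R k) := by
  constructor
  · rintro ⟨R₂, T, X, h1, h2, h3, h4⟩ k
    obtain rfl : R₂ = R := funext fun k =>
      ((h.pullable_fst hM hN).existsUnique (h.localAlg hM hN) (ρ k)).unique (h1 k) (hR k)
    obtain rfl : X = fun i => h.gen hM hN (.inl i) := funext fun i => h.gen_eq hM hN (.inl i) (h3 i)
    have e : T k = h.tauForm hM hN F R₂ k := AlternatingMap.ext (h4 k)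
    rw [← e]
    exact h2 k
  · exact fun hσ => ⟨R, _, _, hR, hσ, fun i f c => (h.gen_deriv hM hN (.inl i) f c).deriv.symm,
      fun _ _ => rfl⟩

theorem IsPullbackForm.tauForm {h : SameBase (n := n) π ϖ} {h' : SameBase (n := n) π' ϖ'}
    (hM : IsStandard n M) (hN : IsStandard n N) (hM' : IsStandard n M') (hN' : IsStandard n N')
    (hQe : ∀ t s c, Q (h'.act t s c) = h.act t s (Q c)) {F : Form (ellipticCorr (n := n) π ϖ) 2}
    {F' : Form (ellipticCorr (n := n) π' ϖ') 2} (pF : IsPullbackForm Q F F')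
    {R : ∀ k, Form (ellipticCorr (n := n) π ϖ) k} {R' : ∀ k, Form (ellipticCorr (n := n) π' ϖ') k}
    (hR : ∀ k, IsPullbackForm Q (R k) (R' k)) (k : ℕ) :
    IsPullbackForm Q (h.tauForm hM hN F R k) (h'.tauForm hM' hN' F' R' k) :=
  (pF.expWedge hR (n + k)).contract fun i => h.related_gen hM hN h' hM' hN' hQe (.inl i)

/-- The map `τ` is defined on invariant forms. -/
theorem SameBase.existsUnique_tau (h : SameBase (n := n) π ϖ) (hM : IsStandard n M)
    (hN : IsStandard n N) {F : Form (ellipticCorr (n := n) π ϖ) 2}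
    (hF : ∀ t s : Torus n, IsPullbackForm (h.act t s) F F) {ρ : ∀ k, Form (elliptic n M) k}
    (hρ : ∀ k, Invariant (ρ k)) :
    ∃! σ : ∀ k, Form (elliptic n N) k, (∀ k, Invariant (σ k)) ∧ IsTau h F ρ σ := by
  have hC := h.localAlg hM hN
  choose R hR _ using fun k => (h.pullable_fst hM hN).existsUnique hC (ρ k)
  have hT : ∀ (t s : Torus n) k,
      IsPullbackForm (h.act t s) (h.tauForm hM hN F R k) (h.tauForm hM hN F R k) := fun t s k =>
    (hF t s).tauForm hM hN hM hN (fun t' s' c => h.act_act t s t' s' c) (fun k =>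
      (h.square_fst hM hN h hM hN (etaleMap_smul hM t) (h.etaleMap_act hM hN t s)
        fun _ => rfl).right_of_top (hρ k t) (hR k) (hR k)) k
  have hdesc : ∀ k, ∃! σ : Form (elliptic n N) k,
      IsPullbackForm Corr.snd σ (h.tauForm hM hN F R k) := fun k => by
    refine (h.frameMap_snd hM hN).existsUnique_descent hC (logCharts hN).localAlg
      (logCharts hN).dense (fun m => ?_) (fun f => h.mem_smooth_of_comp_snd hM hN) _
      (fun v i j e => contract_eq_zero _ _ e) fun c c' e => ?_
    · obtain ⟨m', hm'⟩ := h.quot.surjective (ϖ m)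
      exact ⟨⟨(m', m), hm'⟩, rfl⟩
    · obtain ⟨t, ht⟩ := (h.eq_iff c.1.1 c'.1.1).1
        (c.2.trans ((congrArg ϖ e).trans c'.2.symm))
      exact ⟨h.act t 1, Subtype.ext (Prod.ext ht ((one_smul (Torus n) c.1.2).trans e)),
        fun c => one_smul (Torus n) c.1.2, hT t 1 k, (h.etaleMap_act hM hN t 1).lift⟩
  choose σ hσ hu using hdesc
  refine ⟨σ, ⟨fun k t => ?_, (h.isTau_iff hM hN hR σ).2 hσ⟩, fun σ₂ hσ₂ =>
    funext fun k => hu k _ ((h.isTau_iff hM hN hR σ₂).1 hσ₂.2 k)⟩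
  obtain ⟨σ', hσ', -⟩ := (etaleMap_smul hN t).existsUnique (logCharts hN).localAlg (σ k)
  have h1 := (h.square_snd hM hN h hM hN (etaleMap_smul hN t) (h.etaleMap_act hM hN 1 t)
    fun _ => rfl).top_of_right hσ' (hσ k) (hT 1 t k)
  rwa [hu k _ h1] at hσ'

/-- The maps `τ` are compatible with pullbacks. -/
theorem IsTau.pullback {h : SameBase (n := n) π ϖ} {h' : SameBase (n := n) π' ϖ'}
    {F : Form (ellipticCorr (n := n) π ϖ) 2} {ρ : ∀ k, Form (elliptic n M) k}
    {σ : ∀ k, Form (elliptic n N) k} (hτ : IsTau h F ρ σ) (hM : IsStandard n M)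
    (hN : IsStandard n N) (hM' : IsStandard n M') (hN' : IsStandard n N')
    (hq : EtaleMap (elliptic n M') (elliptic n M) (principal n M') q)
    (hr : EtaleMap (elliptic n N') (elliptic n N) (principal n N') r)
    (hQ : EtaleMap (ellipticCorr (n := n) π' ϖ') (ellipticCorr (n := n) π ϖ)
      (Corr.principal n π' ϖ') Q) (hQe : ∀ t s c, Q (h'.act t s c) = h.act t s (Q c))
    (h1 : ∀ c, (Q c).fst = q c.fst) (h2 : ∀ c, (Q c).snd = r c.snd)
    {F' : Form (ellipticCorr (n := n) π' ϖ') 2} (pF : IsPullbackForm Q F F')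
    {ρ' : ∀ k, Form (elliptic n M') k} {σ' : ∀ k, Form (elliptic n N') k}
    (pρ : ∀ k, IsPullbackForm q (ρ k) (ρ' k)) (pσ : ∀ k, IsPullbackForm r (σ k) (σ' k)) :
    IsTau h' F' ρ' σ' := by
  choose R hR _ using fun k => (h.pullable_fst hM hN).existsUnique (h.localAlg hM hN) (ρ k)
  choose R' hR' _ using fun k => hQ.existsUnique (h'.localAlg hM' hN') (R k)
  have hfst := h.square_fst hM hN h' hM' hN' hq hQ h1
  have hsnd := h.square_snd hM hN h' hM' hN' hr hQ h2
  refine (h'.isTau_iff hM' hN' (fun k => hfst.top_of_right (pρ k) (hR k) (hR' k)) σ').2 fun k => ?_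
  exact hsnd.top_of_right (pσ k) ((h.isTau_iff hM hN hR σ).1 hτ k)
    (pF.tauForm hM hN hM' hN' hQe hR' k)

theorem IsBlowUp.etaleMap {x : M} (hq : IsBlowUp (n := n) x q) (hM : IsStandard n M)
    (hx : ∀ t : Torus n, t • x = x) :
    EtaleMap (elliptic n M') (elliptic n M) (principal n M') q :=
  have hC := logCharts (hq.isStandard hM hx)
  (hq.logEtale hM hx).etaleMap hC (logCharts hM) (hC.dense.mono fun _ => hq.mem_principal)

theorem BlowUpPair.etaleMap_corr {x : M} {y : N} (b : BlowUpPair (n := n) π ϖ x y q r)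
    {ϖ' : N' → MulAction.orbitRel.Quotient (Torus n) M'}
    (h' : SameBase (n := n) (orbitMap n M') ϖ')
    (hQ : ∀ m m', orbitMap n M' m = ϖ' m' → π (q m) = ϖ (r m')) :
    EtaleMap (ellipticCorr (n := n) (orbitMap n M') ϖ') (ellipticCorr (n := n) π ϖ)
      (Corr.principal n (orbitMap n M') ϖ') (Corr.map q r hQ) := by
  have hM' := b.isStandard
  have hN' := b.symm.isStandard
  have hq' : ∀ m ∈ principal n M', q m ∈ principal n M := fun _ => b.blowUp.mem_principal
  have hr' : ∀ m ∈ principal n N', r m ∈ principal n N := fun _ => b.blowUp'.mem_principal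
  refine b.base.etaleMap b.std b.std' h' hM' hN' (LogEtale.prodMap b.std b.std' hM' hN'
    (b.blowUp.logEtale b.std b.fixed) (b.blowUp'.logEtale b.std' b.fixed') hq' hr')
    (fun p hp => ⟨hq' _ hp.1, hr' _ hp.2⟩) (fun _ => rfl) fun c hc => ?_
  have h1 : ∀ᶠ p : M' × N' in 𝓝 c.1, r p.2 ≠ y :=
    (b.blowUp'.continuous.comp continuous_snd).continuousAt.eventually_ne
      (b.blowUp'.ne_of_mem_principal hc.2)
  filter_upwards [h1] with p hp e
  obtain ⟨m, hm⟩ := Quotient.exists_rep (ϖ' p.2)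
  rw [← hm]
  exact b.orbitMap_eq (Eq.trans e (hQ m p.2 hm).symm) (b.ne e hp)

end TDualPullback

end TDual

end

theorem mainTheorem5 {n : ℕ} {M N M' N' B : Type*}
    [TopologicalSpace M] [ChartedSpace (TDual.Model n) M] [TDual.SmoothManifold n M]
    [MulAction (TDual.Torus n) M]
    [TopologicalSpace N] [ChartedSpace (TDual.Model n) N] [TDual.SmoothManifold n N]
    [MulAction (TDual.Torus n) N]
    [TopologicalSpace M'] [ChartedSpace (TDual.Model n) M'] [TDual.SmoothManifold n M']
    [MulAction (TDual.Torus n) M']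
    [TopologicalSpace N'] [ChartedSpace (TDual.Model n) N'] [TDual.SmoothManifold n N']
    [MulAction (TDual.Torus n) N']
    [TopologicalSpace B]
    -- `M` and `N` (in the role of the dual manifold) with standard actions over `B`, T-dual by `F`
    (hM : TDual.IsStandard n M) (hN : TDual.IsStandard n N)
    (π : M → B) (ϖ : N → B) (hB : TDual.SameBase (n := n) π ϖ)
    (H : TDual.Form (TDual.elliptic n M) 3) (K : TDual.Form (TDual.elliptic n N) 3)
    (F : TDual.Form (TDual.ellipticCorr (n := n) π ϖ) 2)
    (hF : TDual.IsTDual hB H K F)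
    -- fixed points over the same point of the base
    (x : M) (y : N) (hx : ∀ t : TDual.Torus n, t • x = x) (hy : ∀ t : TDual.Torus n, t • y = y)
    (hxy : π x = ϖ y)
    -- the blow-ups
    (q : M' → M) (r : N' → N)
    (hq : TDual.IsBlowUp (n := n) x q) (hr : TDual.IsBlowUp (n := n) y r) :
    -- the actions on the blow-ups are standard
    TDual.IsStandard n M' ∧ TDual.IsStandard n N' ∧
    -- elliptic forms have unique pullbacks by the blow-down maps
    (∀ k (α : TDual.Form (TDual.elliptic n M) k),
      ∃! α' : TDual.Form (TDual.elliptic n M') k, TDual.IsPullbackForm q α α') ∧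
    (∀ k (α : TDual.Form (TDual.elliptic n N) k),
      ∃! α' : TDual.Form (TDual.elliptic n N') k, TDual.IsPullbackForm r α α') ∧
    -- the blow-ups have the same base, by a unique identification over `B`
    (∃! ϖ' : N' → MulAction.orbitRel.Quotient (TDual.Torus n) M',
      TDual.SameBase (n := n) (TDual.orbitMap n M') ϖ' ∧
      ∀ m m', TDual.orbitMap n M' m = ϖ' m' → π (q m) = ϖ (r m')) ∧
    ∀ (ϖ' : N' → MulAction.orbitRel.Quotient (TDual.Torus n) M')
      (hB' : TDual.SameBase (n := n) (TDual.orbitMap n M') ϖ')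
      (hQ : ∀ m m', TDual.orbitMap n M' m = ϖ' m' → π (q m) = ϖ (r m')),
      -- forms on the correspondence space have unique pullbacks by the induced map `Q`
      (∀ k (α : TDual.Form (TDual.ellipticCorr (n := n) π ϖ) k),
        ∃! α' : TDual.Form (TDual.ellipticCorr (n := n) (TDual.orbitMap n M') ϖ') k,
          TDual.IsPullbackForm (TDual.Corr.map q r hQ) α α') ∧
      ∀ (H' : TDual.Form (TDual.elliptic n M') 3) (K' : TDual.Form (TDual.elliptic n N') 3)
        (F' : TDual.Form (TDual.ellipticCorr (n := n) (TDual.orbitMap n M') ϖ') 2),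
        TDual.IsPullbackForm q H H' → TDual.IsPullbackForm r K K' →
        TDual.IsPullbackForm (TDual.Corr.map q r hQ) F F' →
        -- `Q^* F` is a T-duality between the blow-ups
        TDual.IsTDual hB' H' K' F' ∧
        -- the maps `τ` and `τ'` of invariant forms are defined
        (∀ ρ : ∀ k, TDual.Form (TDual.elliptic n M) k, (∀ k, TDual.Invariant (ρ k)) →
          ∃! σ : ∀ k, TDual.Form (TDual.elliptic n N) k,
            (∀ k, TDual.Invariant (σ k)) ∧ TDual.IsTau hB F ρ σ) ∧
        (∀ ρ' : ∀ k, TDual.Form (TDual.elliptic n M') k, (∀ k, TDual.Invariant (ρ' k)) →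
          ∃! σ' : ∀ k, TDual.Form (TDual.elliptic n N') k,
            (∀ k, TDual.Invariant (σ' k)) ∧ TDual.IsTau hB' F' ρ' σ') ∧
        -- pullbacks by the blow-down maps preserve invariance, and `τ' ∘ q^* = r^* ∘ τ`
        ∀ (ρ : ∀ k, TDual.Form (TDual.elliptic n M) k)
          (σ : ∀ k, TDual.Form (TDual.elliptic n N) k)
          (ρ' : ∀ k, TDual.Form (TDual.elliptic n M') k)
          (σ' : ∀ k, TDual.Form (TDual.elliptic n N') k),
          (∀ k, TDual.Invariant (ρ k)) → (∀ k, TDual.Invariant (σ k)) →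
          (∀ k, TDual.IsPullbackForm q (ρ k) (ρ' k)) →
          (∀ k, TDual.IsPullbackForm r (σ k) (σ' k)) →
          TDual.IsTau hB F ρ σ →
          (∀ k, TDual.Invariant (ρ' k)) ∧ (∀ k, TDual.Invariant (σ' k)) ∧
            TDual.IsTau hB' F' ρ' σ' := by
  have b : TDual.BlowUpPair (n := n) π ϖ x y q r := ⟨hB, hM, hN, hx, hy, hxy, hq, hr⟩
  have hM' := b.isStandard
  have hN' := b.symm.isStandard
  have eq := hq.etaleMap hM hx
  have er := hr.etaleMap hN hy
  refine ⟨hM', hN', fun k => eq.existsUnique (TDual.logCharts hM').localAlg,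
    fun k => er.existsUnique (TDual.logCharts hN').localAlg, b.existsUnique_sameBase,
    fun ϖ' hB' hQ => ?_⟩
  have hC' := hB'.localAlg hM' hN'
  have eQ := b.etaleMap_corr hB' hQ
  have eQe : ∀ t s c, TDual.Corr.map q r hQ (hB'.act t s c) =
      hB.act t s (TDual.Corr.map q r hQ c) := fun t s c =>
    Subtype.ext (Prod.ext (hq.map_smul t c.1.1) (hr.map_smul s c.1.2))
  refine ⟨fun k => eQ.existsUnique hC', fun H' K' F' pH pK pF => ?_⟩
  have hF' := hF.pullback hM hN hM' hN' eq er eQ hq.map_smul hr.map_smul eQe (fun _ => rfl)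
    (fun _ => rfl) pH pK pF
  exact ⟨hF', fun ρ => hB.existsUnique_tau hM hN hF.invariantF,
    fun ρ' => hB'.existsUnique_tau hM' hN' hF'.invariantF, fun ρ σ ρ' σ' hρ hσ pρ pσ hτ =>
      ⟨fun k => (hρ k).pullback hM hM' eq hq.map_smul (pρ k),
        fun k => (hσ k).pullback hN hN' er hr.map_smul (pσ k),
        hτ.pullback hM hN hM' hN' eq er eQ eQe (fun _ => rfl) (fun _ => rfl) pF pρ pσ⟩⟩
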